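/- **Setting.** Fix integers $d\ge1$, $q\ge 2$, smoothness bounds $0<\underline\beta\le 1$, $\underline\beta<\bar\beta$, and constants $L,C_0>0$, $0<\underline\rho\le\bar\rho$. For $\beta>0$ let $\lfloor\beta\rfloor$ be the largest integer strictly less than $\beta$. A problem $\mathsf P$ consists of a law $\mathbf P_X$ of contexts on $[0,1]^d$ and, for each arm $k\in\{1,2\}$, a conditional law of a $\{0,1\}$-valued reward given the context, with mean $f_k(x)$. The contexts are i.i.d.; an admissible policy chooses the arm as a measurable function of the contexts up to now, the rewards observed before, and an external randomization; $\mathcal R^\pi(\mathsf P;T)=\mathbb E^\pi\sum_{t=1}^T\big(\max_k f_k(X_t)-f_{\pi_t}(X_t)\big)$. $\mathcal P(\beta,\alpha,d)$ is the class of problems such that (i) $f_1,f_2$ are $\lfloor\beta\rfloor$ times continuously differentiable on $[0,1]^d$ and differ at $x'$ from their Taylor polynomial of degree $\lfloor\beta\rfloor$ at $x$ by at most $L\|x-x'\|_\infty^\beta$, for all $x,x'\in[0,1]^d$; (ii) $\mathbf P_X$ has a density on $[0,1]^d$ with values in $[\underline\rho,\bar\rho]$; (iii) $\mathbf P_X\{0<|f_1-f_2|\le\delta\}\le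 C_0\delta^\alpha$ for $0<\delta\le1$. For $b>0$, $l_0\ge0$, $\mathcal P^{ss}(\beta,\alpha,d,b,l_0)$ is the class of those $\mathsf P\in\mathcal P(\beta,\alpha,d)$ such that for all integers $l\ge l_0$, $q'>1$, and $\lfloor\beta\rfloor\le p\le\lfloor\bar\beta\rfloor$, $$\max_{\mathsf B}\max_{k}\sup_{x\in\mathsf B}\big|\Gamma^p f_k(x;\mathsf B)-f_k(x)\big|\ge b\,q'^{-l\beta},$$ where $\mathsf B$ runs over the $q'^{ld}$ closed cubes of side $q'^{-l}$ that partition $[0,1]^d$, and $\Gamma^p f(\cdot\,;\mathsf B)$ is the best $L_2(\mathbf P_X(\cdot\mid\mathsf B))$-approximation of $f$ by polynomials of degree at most $p$. Put $\zeta(\beta,\alpha,d)=1-\frac{\beta(1+\alpha)}{2\beta+d}$. **The SACB policy** with horizon $T\ge2$, tuning parameter $\gamma$ and under-smoothing coefficient $\upsilon=\frac d{\underline\beta}+4$. Let $\Lambda=\log_q\log T$, $l=\big\lceil\frac{(\underline\beta+d-1)\log_qT}{(2\bar\beta+d)^2}\big\rceil$, $\bar r=\lceil 2l\bar\beta+\upsilon\Lambda\rceil$,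 $j_1=l$, $j_2=l+\lceil\Lambda/\underline\beta\rceil$, and $\tilde l=\max\{\lceil(\bar\beta l+\Lambda)/\underline\beta\rceil,\lceil(1+\bar\beta)l+\Lambda\rceil\}$. Partition $[0,1]^d$ into $q^{ld}$ bins of side $q^{-l}$. In each bin proceed in rounds $r=1,2,\dots$, alternating the arms on the contexts that fall into the bin. Round $r\le\bar r$ ends when each arm has $q^r$ samples in it. If the flag of the bin is not yet raised, test then whether $$\max_{k,x}\big|\hat f_k(x;j_1)-\hat f_k(x;j_2)\big|>\gamma(\log T)^{\frac d{2\underline\beta}+\frac12}q^{-r/2},$$ where $x$ runs over the points of the bin with coordinates in $q^{-\tilde l}\{1,\dots,q^{\tilde l}\}$, and where $\hat f_k(x;j)$ is the local polynomial estimator of degree $\lfloor\bar\beta\rfloor$ from the samples of arm $k$ in this round, with kernel $\mathbf 1\{\|\cdot\|_\infty\le1\}$ and bandwidth $q^{-j}$ (the value at $x$ of the least squares polynomial if that is unique, and $0$ otherwise), truncated to $[0,1]$. If so, record $r_{\rm last}=r$ and raise the flag; if this never happens, $r_{\rm last}=\bar r$. Exploration ends when every bin has raised its flag or has passed round $\bar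 r$. Then put $\hat\beta=\frac1{2l}\big(\min_{\mathsf B}r_{\rm last}^{(\mathsf B)}-\upsilon\Lambda\big)$ and run, afresh on the remaining periods, the input policy $\pi_0(\beta_0)$ with $\beta_0=\min\{\max\{\underline\beta,\hat\beta\},\bar\beta\}$. **Theorem.** Let $\{\pi_0(\beta_0)\}_{\beta_0\in[\underline\beta,\bar\beta]}$ be admissible policies (which may be tuned to the horizon $T$) such that for each $\alpha>0$ there is $\bar C_0>0$ with $$\sup_{\mathsf P\in\mathcal P(\beta_0,\alpha,d)}\mathcal R^{\pi_0(\beta_0)}(\mathsf P;T)\le\bar C_0(\log T)^{\iota_0(\beta_0,\alpha,d)}T^{\zeta(\beta_0,\alpha,d)}$$ for all $\beta_0\in[\underline\beta,\bar\beta]$ with $\alpha\le\frac1{\min\{1,\beta_0\}}$ and all $T\ge2$, where $\beta_0\mapsto\iota_0(\beta_0,\alpha,d)$ has a finite left limit at every $\beta\in(\underline\beta,\bar\beta]$ with $\alpha\le\frac1{\min\{1,\beta\}}$ (for example, it is monotone or continuous). Then SACB is an admissible policy, and there is $\gamma_0>0$ such that for all $\beta\in[\underline\beta,\bar\beta]$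 and $0<\alpha\le\frac1{\min\{1,\beta\}}$ with $(\underline\beta,\beta,\alpha)\ne(1,\bar\beta,1)$, all $b>0$, $l_0\ge0$ and $\gamma\ge\gamma_0$, there is $\bar C>0$ such that for all $\mathsf P\in\mathcal P^{ss}(\beta,\alpha,d,b,l_0)$ and all $T\ge2$ the SACB policy $\pi$ satisfies $$\mathcal R^\pi(\mathsf P;T)\le\bar C(\log T)^{\frac{3d(\alpha+1)(2\bar\beta+d)^2}{(2\beta+d)(\beta+d)(\underline\beta+d-1)}+\iota_0(\beta_T,\alpha,d)}\,T^{\zeta(\beta,\alpha,d)},$$ where $\beta_T$ is the point of $[\underline\beta,\bar\beta]$ closest to $\beta-\frac{3(2\bar\beta+d)^2\log_q\log T}{(\underline\beta+d-1)\log_qT}$. If moreover $\iota_0(\cdot,\alpha,d)=0$ (at all $\beta_0\in[\underline\beta,\bar\beta]$ with $\alpha\le\frac1{\min\{1,\beta_0\}}$), then SACB is smoothness-adaptive on $\mathcal P^{ss}(\beta,\alpha,d,b,l_0)$: for some $\bar C>0$ one has $\mathcal R^\pi(\mathsf P;T)\le\bar C(\log T)^{\iota}T^{\zeta(\beta,\alpha,d)}$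 for all these $\mathsf P$ and $T$, with the positive exponent $\iota=\frac{3(\alpha+1)(2\bar\beta+1)^2}{(2\beta+1)(\beta+1)\underline\beta}$, which does not depend on $d$. -/

import Mathlib

open MeasureTheory ProbabilityTheory Filter Topology

namespace SACB

noncomputable section

/-! Contexts, problem instances, policies, regret -/

/-- Contexts are vectors with `d` real coordinates; the norm of this type is the sup norm. -/
abbrev Ctx (d : ℕ) : Type := Fin d → ℝ

/-- The unit hypercube `[0,1]^d`. -/
def cube (d : ℕ) : Set (Ctx d) := Set.Icc 0 1

/-- A two-armed problem instance: the law of the contexts on the unit cube and, for each arm, the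
conditional law of the binary reward given the context. -/
structure Problem (d : ℕ) where
  ctxLaw : Measure (Ctx d)
  isProb : IsProbabilityMeasure ctxLaw
  supp : ctxLaw (cube d)ᶜ = 0
  rew : Fin 2 → Kernel (Ctx d) Bool
  isMarkov : ∀ k, IsMarkovKernel (rew k)

attribute [instance] Problem.isProb Problem.isMarkov

/-- The payoff function `f_k(x) = E[Y_k | X = x]`, the conditional probability of reward `1`. -/
def Problem.payoff {d : ℕ} (P : Problem d) (k : Fin 2) (x : Ctx d) : ℝ :=
  ((P.rew k) x).real {true}

/-- Joint law, in one period, of the context and of the two potential rewards. -/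
def Problem.stepLaw {d : ℕ} (P : Problem d) : Measure (Ctx d × (Bool × Bool)) :=
  P.ctxLaw ⊗ₘ (P.rew 0 ×ₖ P.rew 1)

instance {d : ℕ} (P : Problem d) : IsProbabilityMeasure P.stepLaw := by
  unfold Problem.stepLaw; infer_instance

/-- Law of the i.i.d. sequence of contexts and potential rewards. -/
def Problem.law {d : ℕ} (P : Problem d) : Measure (ℕ → Ctx d × (Bool × Bool)) :=
  Measure.infinitePi (fun _ : ℕ => P.stepLaw)

/-- A decision rule. Periods are numbered from `0`: in period `t` the rule sees the contexts of
the periods `0, …, t`, the rewards observed in the periods `0, …, t - 1`, and the external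
randomization `u`. -/
abbrev Rule (d : ℕ) (U : Type*) : Type _ :=
  (t : ℕ) → (Fin (t + 1) → Ctx d) → (Fin t → Bool) → U → Fin 2

/-- A rule is admissible when all its decisions are measurable functions. -/
def IsAdmissible {d : ℕ} {U : Type*} [MeasurableSpace U] (π : Rule d U) : Prop :=
  ∀ t, Measurable fun z : (Fin (t + 1) → Ctx d) × (Fin t → Bool) × U => π t z.1 z.2.1 z.2.2

/-- Admissible policies. -/
structure Policy (d : ℕ) (U : Type*) [MeasurableSpace U] where
  act : Rule d U
  admissible : IsAdmissible act

/-- The potential reward of arm `k`. -/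
def potential (y : Bool × Bool) (k : Fin 2) : Bool := if k = 0 then y.1 else y.2

/-- The rewards observed in the first `t` periods when the rule `π` is followed. -/
def observed {d : ℕ} {U : Type*} (π : Rule d U) (ω : ℕ → Ctx d × (Bool × Bool)) (u : U) :
    (t : ℕ) → (Fin t → Bool)
  | 0 => Fin.elim0
  | t + 1 => Fin.snoc (observed π ω u t)
      (potential (ω t).2 (π t (fun i => (ω i).1) (observed π ω u t) u))

/-- The arm that the rule `π` pulls in period `t`. -/
def action {d : ℕ} {U : Type*} (π : Rule d U) (ω : ℕ → Ctx d × (Bool × Bool)) (u : U) (t : ℕ) :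
    Fin 2 :=
  π t (fun i => (ω i).1) (observed π ω u t) u

/-- Expected regret over `T` periods; the oracle earns `max (f_1 x) (f_2 x)` at the context `x`. -/
def regret {d : ℕ} {U : Type*} [MeasurableSpace U] (μU : Measure U) (π : Rule d U)
    (P : Problem d) (T : ℕ) : ℝ :=
  ∫ z : (ℕ → Ctx d × (Bool × Bool)) × U,
    ∑ t ∈ Finset.range T,
      (max (P.payoff 0 (z.1 t).1) (P.payoff 1 (z.1 t).1)
        - P.payoff (action π z.1 z.2 t) (z.1 t).1) ∂(P.law.prod μU)

/-! Smoothness, margin, and self-similarity -/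

/-- The largest integer strictly less than `β` (for `β > 0`). -/
def strictFloor (β : ℝ) : ℕ := ⌈β⌉₊ - 1

/-- Taylor polynomial of `f` on the cube, of degree `n`, at `x`, evaluated at `x'`. -/
def taylor {d : ℕ} (n : ℕ) (f : Ctx d → ℝ) (x x' : Ctx d) : ℝ :=
  ∑ k ∈ Finset.range (n + 1),
    (1 / (k.factorial : ℝ)) * iteratedFDerivWithin ℝ k f (cube d) x (fun _ => x' - x)

/-- The Hölder class on the cube with exponent `β` and constant `L`. -/
def IsHolder {d : ℕ} (β L : ℝ) (f : Ctx d → ℝ) : Prop :=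
  ContDiffOn ℝ (strictFloor β) f (cube d) ∧
    ∀ x ∈ cube d, ∀ x' ∈ cube d, |f x' - taylor (strictFloor β) f x x'| ≤ L * ‖x - x'‖ ^ β

/-- The context law has a density on the cube with values in `[ρlo, ρhi]`. -/
def HasBoundedDensity {d : ℕ} (ρlo ρhi : ℝ) (μ : Measure (Ctx d)) : Prop :=
  ∃ p : Ctx d → ℝ, Measurable p ∧ (∀ x ∈ cube d, ρlo ≤ p x ∧ p x ≤ ρhi) ∧
    μ = (volume.restrict (cube d)).withDensity fun x => ENNReal.ofReal (p x)

/-- The margin condition with exponent `α` and constant `C₀`. -/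
def MarginCondition {d : ℕ} (α C₀ : ℝ) (P : Problem d) : Prop :=
  ∀ δ : ℝ, 0 < δ → δ ≤ 1 →
    P.ctxLaw.real {x | 0 < |P.payoff 0 x - P.payoff 1 x| ∧ |P.payoff 0 x - P.payoff 1 x| ≤ δ}
      ≤ C₀ * δ ^ α

/-- The class of problems with smoothness `β` and margin exponent `α`. -/
def problemClass (d : ℕ) (β L α C₀ ρlo ρhi : ℝ) : Set (Problem d) :=
  {P | (∀ k, IsHolder β L (P.payoff k)) ∧ HasBoundedDensity ρlo ρhi P.ctxLaw ∧
    MarginCondition α C₀ P}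

/-- The (rectangular) kernel: the indicator of `‖v‖_∞ ≤ 1`. -/
def boxKernel {d : ℕ} (v : Ctx d) : ℝ := Set.indicator {v : Ctx d | ‖v‖ ≤ 1} (fun _ => 1) v

/-- Multi-indices (numbered from `0`) of the bins of side length `q ^ (-l)`. -/
def binIndices (d q l : ℕ) : Finset (Fin d → ℕ) := Fintype.piFinset fun _ => Finset.range (q ^ l)

/-- The closed bin with multi-index `m`. -/
def bin {d : ℕ} (q l : ℕ) (m : Fin d → ℕ) : Set (Ctx d) :=
  {x | ∀ i, (m i : ℝ) / (q : ℝ) ^ l ≤ x i ∧ x i ≤ ((m i : ℝ) + 1) / (q : ℝ) ^ l}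

/-- `g` is a best polynomial approximation of degree at most `p` of `f` on `U`, in mean square for
the context law conditioned on `U`, localized at `x` with bandwidth `h`. -/
def IsProjection {d : ℕ} (μ : Measure (Ctx d)) (p : ℕ) (h : ℝ) (U : Set (Ctx d)) (f : Ctx d → ℝ)
    (x : Ctx d) (g : MvPolynomial (Fin d) ℝ) : Prop :=
  g.totalDegree ≤ p ∧ ∀ g' : MvPolynomial (Fin d) ℝ, g'.totalDegree ≤ p →
    ∫ u, |f u - MvPolynomial.eval u g| ^ 2 * boxKernel (h⁻¹ • (x - u)) ∂(cond μ U) ≤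
    ∫ u, |f u - MvPolynomial.eval u g'| ^ 2 * boxKernel (h⁻¹ • (x - u)) ∂(cond μ U)

open Classical in
/-- The value at `x` of the projection of `f` onto the polynomials of degree at most `p`. -/
def proj {d : ℕ} (μ : Measure (Ctx d)) (p : ℕ) (h : ℝ) (U : Set (Ctx d)) (f : Ctx d → ℝ)
    (x : Ctx d) : ℝ :=
  if H : ∃ g, IsProjection μ p h U f x g then MvPolynomial.eval x H.choose else 0

/-- Self-similarity of the payoffs. The maximum over bins, arms and points is a supremum in
`[0, ∞]`. -/
def SelfSimilar {d : ℕ} (βhi β b l₀ : ℝ) (P : Problem d) : Prop :=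
  ∀ l q p : ℕ, l₀ ≤ l → 1 < q → strictFloor β ≤ p → p ≤ strictFloor βhi →
    ENNReal.ofReal (b * (q : ℝ) ^ (-(l * β))) ≤
      ⨆ m ∈ binIndices d q l, ⨆ k : Fin 2, ⨆ x ∈ bin q l m,
        ENNReal.ofReal
          |proj P.ctxLaw p (((q : ℝ) ^ l)⁻¹) (bin q l m) (P.payoff k) x - P.payoff k x|

/-- The class of problems with self-similar payoffs. -/
def selfSimilarClass (d : ℕ) (βhi β L α C₀ ρlo ρhi b l₀ : ℝ) : Set (Problem d) :=
  {P | P ∈ problemClass d β L α C₀ ρlo ρhi ∧ SelfSimilar βhi β b l₀ P}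

/-! Local polynomial regression -/

/-- The localized least squares criterion of the polynomial `θ`. -/
def lprLoss {d : ℕ} (D : List (Ctx d × Bool)) (x : Ctx d) (h : ℝ) (θ : MvPolynomial (Fin d) ℝ) :
    ℝ :=
  (D.map fun z => ((if z.2 then 1 else 0) - MvPolynomial.eval (z.1 - x) θ) ^ 2
    * boxKernel (h⁻¹ • (z.1 - x))).sum

/-- `θ` minimizes the criterion among the polynomials of degree at most `p`. -/
def IsLprMin {d : ℕ} (D : List (Ctx d × Bool)) (x : Ctx d) (h : ℝ) (p : ℕ)
    (θ : MvPolynomial (Fin d) ℝ) : Prop :=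
  θ.totalDegree ≤ p ∧
    ∀ θ' : MvPolynomial (Fin d) ℝ, θ'.totalDegree ≤ p → lprLoss D x h θ ≤ lprLoss D x h θ'

open Classical in
/-- The local polynomial estimator at `x`: the constant coefficient of the minimizer if that is
unique and `0` otherwise, truncated to the range `[0,1]` of the payoffs. -/
def lpr {d : ℕ} (D : List (Ctx d × Bool)) (x : Ctx d) (h : ℝ) (p : ℕ) : ℝ :=
  max 0 (min 1 (if H : ∃! θ, IsLprMin D x h p θ then MvPolynomial.eval 0 H.choose else 0))

/-! The policy -/

/-- Inputs of the policy: smoothness range, tuning parameter, under-smoothing coefficient, base of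
the partition and horizon. -/
structure Params where
  βlo : ℝ
  βhi : ℝ
  γ : ℝ
  υ : ℝ
  q : ℕ
  T : ℕ

namespace Params

/-- `log_q log T` -/
def loglog (c : Params) : ℝ := Real.logb c.q (Real.log c.T)

/-- The level `l` of the partition. -/
def level (c : Params) (d : ℕ) : ℕ :=
  ⌈(c.βlo + d - 1) * Real.logb c.q c.T / (2 * c.βhi + d) ^ 2⌉₊

/-- The maximal round index. -/
def maxRound (c : Params) (d : ℕ) : ℤ := ⌈2 * (c.level d : ℝ) * c.βhi + c.υ * c.loglog⌉

/-- The two bandwidth exponents. -/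
def bw₁ (c : Params) (d : ℕ) : ℤ := c.level d

def bw₂ (c : Params) (d : ℕ) : ℤ := c.level d + ⌈1 / c.βlo * c.loglog⌉

/-- The exponent of the mesh. -/
def meshLevel (c : Params) (d : ℕ) : ℤ :=
  max ⌈c.βhi * (c.level d : ℝ) / c.βlo + c.loglog / c.βlo⌉
    ⌈(1 + c.βhi) * (c.level d : ℝ) + c.loglog⌉

/-- The mesh points of the bin `m`. -/
def mesh (c : Params) {d : ℕ} (m : Fin d → ℕ) : Set (Ctx d) :=
  {x | x ∈ bin c.q (c.level d) m ∧ ∃ n : Fin d → ℕ, ∀ i, 1 ≤ n i ∧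
    (n i : ℝ) ≤ (c.q : ℝ) ^ c.meshLevel d ∧ x i = (n i : ℝ) / (c.q : ℝ) ^ c.meshLevel d}

/-- The threshold of the test in round `r`. -/
def threshold (c : Params) (d r : ℕ) : ℝ :=
  c.γ * Real.log c.T ^ ((d : ℝ) / (2 * c.βlo) + 1 / 2) / (c.q : ℝ) ^ ((r : ℝ) / 2)

/-- The multi-index of the bin that contains the context `x` (lower faces belong to the bin). -/
def binOf (c : Params) {d : ℕ} (x : Ctx d) : Fin d → ℕ := fun i =>
  min ⌊x i * (c.q : ℝ) ^ c.level d⌋₊ (c.q ^ c.level d - 1)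

end Params

/-- State of a bin: current round, samples of each arm in the current round, whether the flag is
raised, and the recorded round `r_last`. The counter of an arm is its number of samples. -/
structure BinState (d : ℕ) where
  round : ℕ
  data : Fin 2 → List (Ctx d × Bool)
  flag : Bool
  last : ℤ

/-- The arm that is explored next: the second one if the first one has more samples. -/
def BinState.arm {d : ℕ} (s : BinState d) : Fin 2 :=
  if (s.data 1).length < (s.data 0).length then 1 else 0

/-- Outcome of the hypothesis test in bin `m` at the end of a round. -/
def rejects (c : Params) {d : ℕ} (m : Fin d → ℕ) (s : BinState d) : Prop :=
  ∃ k : Fin 2, ∃ x ∈ c.mesh m,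
    c.threshold d s.round <
      |lpr (s.data k) x ((c.q : ℝ) ^ (-c.bw₁ d)) (strictFloor c.βhi)
        - lpr (s.data k) x ((c.q : ℝ) ^ (-c.bw₂ d)) (strictFloor c.βhi)|

/-- Record a new sample of the explored arm. -/
def BinState.record {d : ℕ} (s : BinState d) (x : Ctx d) (y : Bool) : BinState d :=
  { s with data := Function.update s.data s.arm ((x, y) :: s.data s.arm) }

open Classical in
/-- Conclude the round of bin `m` when enough samples are collected. -/
def BinState.close (c : Params) {d : ℕ} (m : Fin d → ℕ) (s : BinState d) : BinState d :=
  if 2 * c.q ^ s.round ≤ (s.data 0).length + (s.data 1).length ∧ (s.round : ℤ) ≤ c.maxRound d then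
    if s.flag = false ∧ rejects c m s then
      { round := s.round + 1, data := fun _ => [], flag := true, last := s.round }
    else
      { s with round := s.round + 1, data := fun _ => [] }
  else s

/-- State of the exploration phase: states of the bins and, once the phase has ended, the number of
periods that it took. -/
structure State (d : ℕ) where
  bins : (Fin d → ℕ) → BinState d
  endTime : Option ℕ

/-- The initial state; `r_last` equals the maximal round unless some test rejects. -/
def initState (c : Params) (d : ℕ) : State d where
  bins := fun _ => { round := 1, data := fun _ => [], flag := false, last := c.maxRound d }
  endTime := none

open Classical in
/-- One period of exploration, in which the state `s` is updated by the context `x` and the reward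
`y` of the explored arm; `t` is the number of earlier periods. -/
def step (c : Params) {d : ℕ} (t : ℕ) (x : Ctx d) (y : Bool) (s : State d) : State d :=
  let m := c.binOf x
  let bins' := Function.update s.bins m (((s.bins m).record x y).close c m)
  { bins := bins'
    endTime := if ∀ m' ∈ binIndices d c.q (c.level d),
        (bins' m').flag = true ∨ c.maxRound d < ((bins' m').round : ℤ) then some (t + 1) else none }

/-- The state after `t` periods, frozen when the exploration phase has ended. -/
def stateAt (c : Params) {d : ℕ} (xs : ℕ → Ctx d) (ys : ℕ → Bool) : ℕ → State d
  | 0 => initState c d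
  | t + 1 =>
    let s := stateAt c xs ys t
    if s.endTime = none then step c t (xs t) (ys t) s else s

/-- The smoothness estimate. -/
def estimate (c : Params) {d : ℕ} (s : State d) : ℝ :=
  1 / (2 * (c.level d : ℝ)) *
    (((sInf ((fun m => (s.bins m).last) '' (binIndices d c.q (c.level d) : Set (Fin d → ℕ))) : ℤ) : ℝ)
      - c.υ * c.loglog)

/-- Restriction to the interval `[lo, hi]`. -/
def clamp (lo hi v : ℝ) : ℝ := min (max lo v) hi

/-- The smoothness-adaptive policy: it explores, estimates the smoothness, and then starts the input
policy `π₀ β₀ T` for the estimated smoothness `β₀` afresh, on the periods after the exploration. -/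
def sacb {d : ℕ} {U : Type*} [MeasurableSpace U] (c : Params) (π₀ : ℝ → ℕ → Policy d U) :
    Rule d U := fun t X Y u =>
  let xs : ℕ → Ctx d := fun i => if h : i < t + 1 then X ⟨i, h⟩ else 0
  let ys : ℕ → Bool := fun i => if h : i < t then Y ⟨i, h⟩ else false
  let s := stateAt c xs ys t
  match s.endTime with
  | none => (s.bins (c.binOf (xs t))).arm
  | some τ => (π₀ (clamp c.βlo c.βhi (estimate c s)) c.T).act (t - τ)
      (fun i => xs (τ + i)) (fun i => ys (τ + i)) u

/-! Exponents -/

/-- The exponent of the minimax regret rate. -/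
def zeta (d : ℕ) (β α : ℝ) : ℝ := 1 - β * (1 + α) / (2 * β + d)

/-- The exponent of the logarithmic cost of adaptation. -/
def adaptCost (d : ℕ) (βlo βhi β α : ℝ) : ℝ :=
  3 * d * (α + 1) * (2 * βhi + d) ^ 2 / ((2 * β + d) * (β + d) * (βlo + d - 1))

/-- The accuracy of the smoothness estimate at horizon `T`. -/
def estError (d q : ℕ) (βlo βhi : ℝ) (T : ℕ) : ℝ :=
  3 * (2 * βhi + d) ^ 2 * Real.logb q (Real.log T) / ((βlo + d - 1) * Real.logb q T)

/-- A bound of the adaptation cost that does not depend on the dimension. -/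
def uniformCost (βlo βhi β α : ℝ) : ℝ :=
  3 * (α + 1) * (2 * βhi + 1) ^ 2 / ((2 * β + 1) * (β + 1) * βlo)

end

end SACB

/-!
# Smoothness-adaptive regret of the SACB policy

The policy spends a short exploration phase on estimating the smoothness `β` of the payoffs, and
then runs a policy that is tuned to the estimate. Three facts make this work: the exploration is
polynomially shorter than the minimax regret, the estimate falls below `β` by a term of order
`log log T / log T` at most, and running the input policy at too small a smoothness
`β - O (log log T / log T)` multiplies `T ^ zeta` by a power of `log T` only.

*The estimator.* The local polynomial estimator is the solution of its normal equations (`lpr_eq`),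
so that its error is controlled by the errors of finitely many empirical means
(`abs_lpr_sub_le`). The matrix of the limiting equations is coercive because every window contains
a corner of a cube whose size is comparable to that of the window (`exists_coercive_corner`,
`GoodWindow`). A Bernstein bound (`law_lpr_error_le`) then shows that, up to a quarter of the
threshold, the estimator at a mesh point equals its population version `popVal`. For the bandwidth
`q ^ (-l)` the window covers the whole bin, and `popVal` is the projection onto polynomials in the
self-similarity condition (`proj_eq_popVal`).

*The estimate.* On the event that these bounds hold for all bins, rounds and mesh points, the
recorded rounds are determined by the biases (`minLast_spec`). A bias never exceeds a constant times
`q ^ (-l β)`, so no test rejects before round `2 l β + (d / βlo - 2) Λ`. By self-similarity, some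
bin has a bias of the order `q ^ (-l β)`, which survives the truncation to `[0, 1]`
(`exists_trunc_error`) and is seen by the mesh (`BoxSetting.le_trunc_error_of_near`); that bin
rejects by round `2 l β + (d / βlo + 2) Λ + 1`. The under-smoothing coefficient `d / βlo + 4` is what
places the resulting estimate in the interval from `β - 3 Λ / l` to `β` (`betaOfLast_mem`,
`stopsWell_of_typical`, `exists_exploration`).

*The regret.* The rounds of a bin are described through the number of visits to it alone
(`BinInv`, `binInv_freeBins`, `explore_spec`), so the end of the exploration is decided by the
past. The periods after it are again an independent sequence (`measurePreserving_glue`), whence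
the regret is at most the length of the exploration, plus the regret of the input policy at an
estimate in the good interval, plus `T` times the probability of the atypical event
(`regret_sacb_le`). Admissibility (`isAdmissible_sacb`) holds because the decisions of the
exploration depend on the past through countably many measurable events.

*The rates.* The exploration has length `T ^ ((βlo + d - 1) / (2 βhi + d))` up to logarithms, and this
exponent is smaller than `zeta` save in the excluded case (`explorationRate_lt_zeta`). Replacing `β`
by the smaller estimate costs a power of `log T` strictly smaller than `adaptCost`; what is left over
absorbs the oscillation of `ι₀` near its left limit at `β` (`eventually_rate_le`). Horizons that are
too small for these asymptotics are absorbed in the constant (`exists_const_of_eventually`).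
-/


namespace SACB

noncomputable section

/-! ### Quadratic least squares -/

open Matrix in
/-- The quadratic form of the matrix `G`. -/
def quadForm {ι : Type*} [Fintype ι] (G : Matrix ι ι ℝ) (δ : ι → ℝ) : ℝ := δ ⬝ᵥ (G *ᵥ δ)

section LeastSquares

open Matrix

variable {ι : Type*} [Fintype ι] {G : Matrix ι ι ℝ} {B θ θs θ0 : ι → ℝ}

/-- Completing the square around a solution of the normal equations. -/
lemma quadLoss_eq_add_quadForm (hG : G.IsSymm) (h : G *ᵥ θs = B) (c : ℝ) (θ : ι → ℝ) :
    c - 2 * (θ ⬝ᵥ B) + quadForm G θ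
      = (c - 2 * (θs ⬝ᵥ B) + quadForm G θs) + quadForm G (θ - θs) := by
  have hsym : θs ⬝ᵥ (G *ᵥ θ) = θ ⬝ᵥ (G *ᵥ θs) := by
    rw [dotProduct_mulVec, ← mulVec_transpose, hG.eq, dotProduct_comm]
  subst h
  simp only [quadForm, mulVec_sub, dotProduct_sub, sub_dotProduct]
  rw [hsym]
  ring

lemma det_ne_zero_of_coercive [DecidableEq ι] {Λ : ℝ} (hΛ : 0 < Λ)
    (hco : ∀ δ, Λ * ∑ s, δ s ^ 2 ≤ quadForm G δ) : G.det ≠ 0 := by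
  intro h0
  obtain ⟨v, hv, hv0⟩ := Matrix.exists_mulVec_eq_zero_iff.mpr h0
  have h1 := hco v
  simp only [quadForm, hv0, dotProduct_zero] at h1
  have h2 : ∑ s, v s ^ 2 ≤ 0 := by
    by_contra hlt
    push Not at hlt
    nlinarith [mul_pos hΛ hlt]
  have h3 : ∑ s, v s ^ 2 = 0 := le_antisymm h2 (Finset.sum_nonneg fun _ _ => sq_nonneg _)
  rw [Finset.sum_eq_zero_iff_of_nonneg (fun _ _ => sq_nonneg _)] at h3
  apply hv
  ext s
  simpa using h3 s (Finset.mem_univ s)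

/-- Stability of coercive normal equations: a small residual means a small error. -/
lemma abs_sub_le_of_coercive {Λ ε : ℝ} (hΛ : 0 < Λ)
    (hco : ∀ δ, Λ * ∑ s, δ s ^ 2 ≤ quadForm G δ) (hG : G *ᵥ θ = B)
    (hε : ∀ s, |B s - (G *ᵥ θ0) s| ≤ ε) (s : ι) :
    |θ s - θ0 s| ≤ Fintype.card ι * ε / Λ := by
  classical
  obtain ⟨s0, -, hs0⟩ := Finset.exists_max_image Finset.univ (fun s => |θ s - θ0 s|)
    ⟨s, Finset.mem_univ s⟩
  refine (hs0 s (Finset.mem_univ s)).trans ?_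
  set M := |θ s0 - θ0 s0| with hM
  have hM0 : 0 ≤ M := abs_nonneg _
  have h1 : Λ * M ^ 2 ≤ Fintype.card ι * (M * ε) := by
    calc Λ * M ^ 2 ≤ Λ * ∑ s, (θ - θ0) s ^ 2 := by
          gcongr
          rw [hM, sq_abs]
          exact Finset.single_le_sum (f := fun s => (θ - θ0) s ^ 2)
            (fun _ _ => sq_nonneg _) (Finset.mem_univ s0)
      _ ≤ quadForm G (θ - θ0) := hco _
      _ = ∑ s, (θ - θ0) s * (B s - (G *ᵥ θ0) s) := by
          rw [quadForm, mulVec_sub, hG]; rfl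
      _ ≤ ∑ _s : ι, M * ε := by
          refine Finset.sum_le_sum fun t _ => ?_
          refine (le_abs_self _).trans ?_
          rw [abs_mul]
          exact mul_le_mul (hs0 t (Finset.mem_univ t)) (hε t) (abs_nonneg _) hM0
      _ = Fintype.card ι * (M * ε) := by simp
  rw [le_div_iff₀ hΛ]
  rcases hM0.eq_or_lt with h0 | hpos
  · rw [← h0]
    have : 0 ≤ ε := (abs_nonneg _).trans (hε s0)
    simp; positivity
  · nlinarith

lemma mulVec_eq_zero_of_quadForm_eq_zero (hG : G.IsSymm) (hpos : ∀ δ, 0 ≤ quadForm G δ)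
    {δ : ι → ℝ} (h : quadForm G δ = 0) : G *ᵥ δ = 0 := by
  have hp : G.PosSemidef := by
    refine Matrix.PosSemidef.of_dotProduct_mulVec_nonneg ?_ ?_
    · rw [Matrix.IsHermitian, conjTranspose_eq_transpose_of_trivial]; exact hG
    · intro x; simpa [quadForm] using hpos x
  have := (hp.dotProduct_mulVec_zero_iff δ).1
  simp only [star_trivial] at this
  exact this h

end LeastSquares

/-! ### Polynomials of bounded degree in coordinates -/

/-- Multi-indices of total degree at most `p`. -/
abbrev Idx (d p : ℕ) : Type := {s : Fin d → Fin (p + 1) // ∑ i, ((s i : Fin (p + 1)) : ℕ) ≤ p}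

/-- The index of the constant monomial. -/
def idxZero (d p : ℕ) : Idx d p := ⟨fun _ => 0, by simp⟩

/-- The monomial with exponent `s`. -/
def mono {d p : ℕ} (s : Idx d p) (v : Ctx d) : ℝ := ∏ i, v i ^ ((s.1 i : Fin (p + 1)) : ℕ)

/-- The value at `v` of the polynomial with coefficients `θ`. -/
def polyVal {d p : ℕ} (θ : Idx d p → ℝ) (v : Ctx d) : ℝ := ∑ s, θ s * mono s v

section Poly

variable {d p : ℕ}

lemma mono_zero_right (s : Idx d p) : mono s (0 : Ctx d) = if s = idxZero d p then 1 else 0 := by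
  unfold mono
  split_ifs with h
  · subst h; simp [idxZero]
  · have : ∃ i, s.1 i ≠ 0 := by
      by_contra hcon
      push Not at hcon
      exact h (Subtype.ext (funext hcon))
    obtain ⟨i, hi⟩ := this
    refine Finset.prod_eq_zero (Finset.mem_univ i) ?_
    have : ((s.1 i : Fin (p + 1)) : ℕ) ≠ 0 := fun h0 => hi (Fin.ext h0)
    simp [this]

lemma mono_idxZero (v : Ctx d) : mono (idxZero d p) v = 1 := by simp [mono, idxZero]

lemma polyVal_zero_right (θ : Idx d p → ℝ) : polyVal θ 0 = θ (idxZero d p) := by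
  simp [polyVal, mono_zero_right]

lemma polyVal_sub (θ η : Idx d p → ℝ) (v : Ctx d) :
    polyVal (θ - η) v = polyVal θ v - polyVal η v := by
  simp [polyVal, sub_mul, Finset.sum_sub_distrib]

lemma polyVal_zero_left (v : Ctx d) : polyVal (0 : Idx d p → ℝ) v = 0 := by simp [polyVal]

lemma polyVal_single (v : Ctx d) (c : ℝ) :
    polyVal (Pi.single (idxZero d p) c) v = c := by
  simp [polyVal, Pi.single_apply, mono_idxZero]

lemma abs_mono_le_one (s : Idx d p) {v : Ctx d} (hv : ‖v‖ ≤ 1) : |mono s v| ≤ 1 := by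
  unfold mono
  rw [Finset.abs_prod]
  refine Finset.prod_le_one (fun _ _ => abs_nonneg _) fun i _ => ?_
  rw [abs_pow]
  exact pow_le_one₀ (abs_nonneg _) ((norm_le_pi_norm v i).trans hv)

lemma abs_mono_le_norm {s : Idx d p} (hs : s ≠ idxZero d p) {v : Ctx d} (hv : ‖v‖ ≤ 1) :
    |mono s v| ≤ ‖v‖ := by
  unfold mono
  have : ∃ i, s.1 i ≠ 0 := by
    by_contra hcon
    push Not at hcon
    exact hs (Subtype.ext (funext hcon))
  obtain ⟨i, hi⟩ := this
  rw [Finset.abs_prod, ← Finset.mul_prod_erase _ _ (Finset.mem_univ i)]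
  have hi' : ((s.1 i : Fin (p + 1)) : ℕ) ≠ 0 := fun h0 => hi (Fin.ext h0)
  have h1 : |v i ^ ((s.1 i : Fin (p + 1)) : ℕ)| ≤ ‖v‖ := by
    rw [abs_pow]
    exact (pow_le_of_le_one (abs_nonneg _) ((norm_le_pi_norm v i).trans hv) hi').trans
      (norm_le_pi_norm v i)
  have h2 : ∏ j ∈ Finset.univ.erase i, |v j ^ ((s.1 j : Fin (p + 1)) : ℕ)| ≤ 1 := by
    refine Finset.prod_le_one (fun _ _ => abs_nonneg _) fun j _ => ?_
    rw [abs_pow]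
    exact pow_le_one₀ (abs_nonneg _) ((norm_le_pi_norm v j).trans hv)
  calc _ ≤ ‖v‖ * 1 := mul_le_mul h1 h2 (Finset.prod_nonneg fun _ _ => abs_nonneg _) (norm_nonneg _)
    _ = ‖v‖ := mul_one _

lemma abs_polyVal_le {θ : Idx d p → ℝ} {M : ℝ} (hθ : ∀ s, |θ s| ≤ M) {v : Ctx d} (hv : ‖v‖ ≤ 1) :
    |polyVal θ v| ≤ Fintype.card (Idx d p) * M := by
  unfold polyVal
  refine (Finset.abs_sum_le_sum_abs _ _).trans ?_
  calc ∑ s, |θ s * mono s v| ≤ ∑ _s : Idx d p, M := by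
        refine Finset.sum_le_sum fun s _ => ?_
        rw [abs_mul]
        calc _ ≤ M * 1 := mul_le_mul (hθ s) (abs_mono_le_one s hv) (abs_nonneg _)
              ((abs_nonneg _).trans (hθ s))
          _ = M := mul_one _
    _ = _ := by simp

lemma abs_polyVal_sub_le {θ : Idx d p → ℝ} {M : ℝ} (hθ : ∀ s, |θ s| ≤ M) {v : Ctx d}
    (hv : ‖v‖ ≤ 1) : |polyVal θ v - polyVal θ 0| ≤ Fintype.card (Idx d p) * M * ‖v‖ := by
  have hM : 0 ≤ M := (abs_nonneg _).trans (hθ (idxZero d p))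
  unfold polyVal
  rw [← Finset.sum_sub_distrib]
  refine (Finset.abs_sum_le_sum_abs _ _).trans ?_
  calc ∑ s, |θ s * mono s v - θ s * mono s 0| ≤ ∑ _s : Idx d p, M * ‖v‖ := by
        refine Finset.sum_le_sum fun s _ => ?_
        rw [← mul_sub, abs_mul]
        refine mul_le_mul (hθ s) ?_ (abs_nonneg _) hM
        by_cases hs : s = idxZero d p
        · subst hs; simp [mono_idxZero]
        · rw [mono_zero_right, if_neg hs, sub_zero]; exact abs_mono_le_norm hs hv
    _ = _ := by simp [mul_assoc]

lemma continuous_mono (s : Idx d p) : Continuous (mono s : Ctx d → ℝ) := by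
  unfold mono; fun_prop

lemma continuous_polyVal (θ : Idx d p → ℝ) : Continuous (polyVal θ : Ctx d → ℝ) := by
  unfold polyVal
  exact continuous_finsetSum _ fun s _ => continuous_const.mul (continuous_mono s)

/-- The exponent of a monomial as a finitely supported function. -/
def idxExp (s : Idx d p) : Fin d →₀ ℕ :=
  Finsupp.equivFunOnFinite.symm fun i => ((s.1 i : Fin (p + 1)) : ℕ)

lemma idxExp_injective : Function.Injective (idxExp : Idx d p → _) := by
  intro s t h
  apply Subtype.ext
  funext i
  apply Fin.ext
  have := DFunLike.congr_fun h i
  simpa [idxExp] using this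

/-- A polynomial that vanishes on a box with infinite sides has zero coefficients. -/
lemma eq_zero_of_polyVal_eq_zero {θ : Idx d p → ℝ} (S : Fin d → Set ℝ) (hS : ∀ i, (S i).Infinite)
    (h : ∀ v : Ctx d, (∀ i, v i ∈ S i) → polyVal θ v = 0) : θ = 0 := by
  set g : MvPolynomial (Fin d) ℝ := ∑ s, MvPolynomial.monomial (idxExp s) (θ s) with hg
  have hev : ∀ v, MvPolynomial.eval v g = polyVal θ v := by
    intro v
    simp only [hg, map_sum, MvPolynomial.eval_monomial, polyVal, mono]
    refine Finset.sum_congr rfl fun s _ => ?_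
    congr 1
    rw [Finsupp.prod_fintype _ _ (by simp)]
    rfl
  have hg0 : g = 0 := by
    apply MvPolynomial.funext_set S hS
    intro v hv
    rw [hev, map_zero]
    exact h v fun i => hv i trivial
  ext s
  have : MvPolynomial.coeff (idxExp s) g = θ s := by
    simp only [hg, MvPolynomial.coeff_sum, MvPolynomial.coeff_monomial]
    rw [Finset.sum_eq_single s]
    · simp
    · intro t _ hts
      rw [if_neg fun hc => hts (idxExp_injective hc)]
    · simp
  rw [← this, hg0]; simp

open MvPolynomial in
/-- The polynomial `u ↦ polyVal θ (h⁻¹ • (u - x))`. -/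
def toMv (x : Ctx d) (h : ℝ) (θ : Idx d p → ℝ) : MvPolynomial (Fin d) ℝ :=
  ∑ s, C (θ s) * ∏ i, (C h⁻¹ * (X i - C (x i))) ^ ((s.1 i : Fin (p + 1)) : ℕ)

lemma eval_toMv (x : Ctx d) (h : ℝ) (θ : Idx d p → ℝ) (u : Ctx d) :
    MvPolynomial.eval u (toMv x h θ) = polyVal θ (h⁻¹ • (u - x)) := by
  simp [toMv, polyVal, mono]

open MvPolynomial in
lemma totalDegree_affine_monomial_le (a b : Fin d → ℝ) (c : ℝ) (s : Fin d → ℕ) :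
    (C c * ∏ i, (C (a i) * X i + C (b i)) ^ s i : MvPolynomial (Fin d) ℝ).totalDegree
      ≤ ∑ i, s i := by
  refine (totalDegree_mul _ _).trans ?_
  rw [totalDegree_C, zero_add]
  refine (totalDegree_finsetProd _ _).trans (Finset.sum_le_sum fun i _ => ?_)
  refine (totalDegree_pow _ _).trans ?_
  have h1 : (C (a i) * X i + C (b i) : MvPolynomial (Fin d) ℝ).totalDegree ≤ 1 := by
    refine (totalDegree_add _ _).trans (max_le ?_ (by simp))
    refine (totalDegree_mul _ _).trans ?_
    simp [totalDegree_X]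
  calc s i * _ ≤ s i * 1 := Nat.mul_le_mul_left _ h1
    _ = s i := mul_one _

open MvPolynomial in
lemma totalDegree_toMv_le (x : Ctx d) (h : ℝ) (θ : Idx d p → ℝ) :
    (toMv x h θ).totalDegree ≤ p := by
  unfold toMv
  refine totalDegree_finsetSum_le fun s _ => ?_
  have h2 : ∀ i, (C h⁻¹ * (X i - C (x i)) : MvPolynomial (Fin d) ℝ)
      = C h⁻¹ * X i + C (- (h⁻¹ * x i)) := by
    intro i; simp only [map_neg, map_mul]; ring
  simp_rw [h2]
  exact (totalDegree_affine_monomial_le (fun _ => h⁻¹) _ _ _).trans s.2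

open MvPolynomial in
/-- Every polynomial of degree at most `p` has coordinates around each point, at each scale. -/
lemma exists_polyVal_eq_eval {g : MvPolynomial (Fin d) ℝ} (hg : g.totalDegree ≤ p) (x : Ctx d)
    {h : ℝ} (hh : h ≠ 0) :
    ∃ θ : Idx d p → ℝ, ∀ u, eval u g = polyVal θ (h⁻¹ • (u - x)) := by
  set g' : MvPolynomial (Fin d) ℝ :=
    ∑ s ∈ g.support, C (coeff s g) * ∏ i, (C h * X i + C (x i)) ^ s i with hg'
  have hev' : ∀ v, eval v g' = eval (x + h • v) g := by
    intro v
    rw [eval_eq' (x + h • v) g, hg', map_sum]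
    simp only [map_mul, eval_C, map_prod, map_pow, map_add, eval_X]
    refine Finset.sum_congr rfl fun s _ => ?_
    congr 1
    refine Finset.prod_congr rfl fun i _ => ?_
    simp [add_comm]
  have hdeg : g'.totalDegree ≤ p := by
    rw [hg']
    refine totalDegree_finsetSum_le fun s hs => ?_
    refine (totalDegree_affine_monomial_le (fun _ => h) _ _ s).trans ?_
    refine le_trans ?_ hg
    have := le_totalDegree hs
    rwa [Finsupp.sum_fintype _ _ (by simp)] at this
  refine ⟨fun s => coeff (idxExp s) g', fun u => ?_⟩
  have h1 : eval u g = eval (h⁻¹ • (u - x)) g' := by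
    rw [hev']; congr 1; rw [smul_smul, mul_inv_cancel₀ hh, one_smul]; simp
  rw [h1, eval_eq', polyVal]
  symm
  have hterm : ∀ s : Idx d p, coeff (idxExp s) g' * mono s (h⁻¹ • (u - x))
      = coeff (idxExp s) g' * ∏ i, (h⁻¹ • (u - x)) i ^ (idxExp s) i := fun s => rfl
  simp_rw [hterm]
  rw [← Finset.sum_image (s := Finset.univ) (g := idxExp)
    (f := fun e => coeff e g' * ∏ i, (h⁻¹ • (u - x)) i ^ e i) (idxExp_injective.injOn)]
  symm
  refine Finset.sum_subset (fun e he => ?_) (fun e _ he => ?_)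
  · have hle : ∑ i, e i ≤ p := by
      have := (le_totalDegree he).trans hdeg
      rwa [Finsupp.sum_fintype _ _ (by simp)] at this
    have hi : ∀ i, e i < p + 1 := fun i =>
      Nat.lt_succ_of_le ((Finset.single_le_sum (f := fun i => e i) (fun _ _ => Nat.zero_le _)
        (Finset.mem_univ i)).trans hle)
    rw [Finset.mem_image]
    refine ⟨⟨fun i => ⟨e i, hi i⟩, by simpa using hle⟩, Finset.mem_univ _, ?_⟩
    ext i; simp [idxExp]
  · rw [notMem_support_iff] at he
    rw [he, zero_mul]

end Poly

/-! ### Local polynomial regression through the normal equations -/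

/-- The weight of the context `u` in the window of bandwidth `h` around `x`. -/
def weight {d : ℕ} (x : Ctx d) (h : ℝ) (u : Ctx d) : ℝ := boxKernel (h⁻¹ • (u - x))

/-- The monomial `s` in the coordinates centred at `x` with unit `h`. -/
def feat {d p : ℕ} (x : Ctx d) (h : ℝ) (s : Idx d p) (u : Ctx d) : ℝ := mono s (h⁻¹ • (u - x))

/-- The number `0` or `1` that encodes a reward. -/
def val (y : Bool) : ℝ := if y then 1 else 0

/-- The Gram matrix of the samples `D`. -/
def gram {d : ℕ} (D : List (Ctx d × Bool)) (x : Ctx d) (h : ℝ) (p : ℕ) :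
    Matrix (Idx d p) (Idx d p) ℝ :=
  fun s t => (D.map fun z => weight x h z.1 * feat x h s z.1 * feat x h t z.1).sum

/-- The right-hand side of the normal equations of the samples `D`. -/
def moments {d : ℕ} (D : List (Ctx d × Bool)) (x : Ctx d) (h : ℝ) (p : ℕ) : Idx d p → ℝ :=
  fun s => (D.map fun z => weight x h z.1 * feat x h s z.1 * val z.2).sum

/-- Truncation to the unit interval. -/
def trunc (a : ℝ) : ℝ := max 0 (min 1 a)

lemma abs_trunc_sub_le (a b : ℝ) : |trunc a - trunc b| ≤ |a - b| := by
  unfold trunc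
  have h1 : |max 0 (min 1 a) - max 0 (min 1 b)| ≤ |min 1 a - min 1 b| := by
    simpa using abs_max_sub_max_le_max 0 (min 1 a) 0 (min 1 b)
  have h2 : |min 1 a - min 1 b| ≤ |a - b| := by
    simpa using abs_min_sub_min_le_max 1 a 1 b
  exact h1.trans h2

lemma trunc_of_mem {a : ℝ} (h0 : 0 ≤ a) (h1 : a ≤ 1) : trunc a = a := by
  rw [trunc, min_eq_right h1, max_eq_right h0]

lemma trunc_nonneg (a : ℝ) : 0 ≤ trunc a := le_max_left _ _

lemma trunc_le_one (a : ℝ) : trunc a ≤ 1 := max_le zero_le_one (min_le_left _ _)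

section Lpr

open Matrix

variable {d p : ℕ}

lemma weight_eq_ite (x : Ctx d) (h : ℝ) (u : Ctx d) :
    weight x h u = if ‖h⁻¹ • (u - x)‖ ≤ 1 then 1 else 0 := by
  simp [weight, boxKernel, Set.indicator_apply]

lemma weight_nonneg (x : Ctx d) (h : ℝ) (u : Ctx d) : 0 ≤ weight x h u := by
  rw [weight_eq_ite]; split_ifs <;> norm_num

lemma weight_le_one (x : Ctx d) (h : ℝ) (u : Ctx d) : weight x h u ≤ 1 := by
  rw [weight_eq_ite]; split_ifs <;> norm_num

lemma weight_sq (x : Ctx d) (h : ℝ) (u : Ctx d) : weight x h u ^ 2 = weight x h u := by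
  rw [weight_eq_ite]; split_ifs <;> norm_num

lemma abs_weight_mul_le {x : Ctx d} {h : ℝ} {u : Ctx d} {a M : ℝ}
    (ha : ‖h⁻¹ • (u - x)‖ ≤ 1 → |a| ≤ M) : |weight x h u * a| ≤ M * weight x h u := by
  rw [weight_eq_ite]; split_ifs with h1
  · simpa using ha h1
  · simp

lemma val_nonneg (y : Bool) : 0 ≤ val y := by unfold val; split_ifs <;> norm_num
lemma val_le_one (y : Bool) : val y ≤ 1 := by unfold val; split_ifs <;> norm_num

lemma boxKernel_sub_eq_weight (x : Ctx d) (h : ℝ) (u : Ctx d) :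
    boxKernel (h⁻¹ • (x - u)) = weight x h u := by
  have hn : ‖h⁻¹ • (x - u)‖ = ‖h⁻¹ • (u - x)‖ := by rw [← neg_sub u x, smul_neg, norm_neg]
  have hb : ∀ v : Ctx d, boxKernel v = if ‖v‖ ≤ 1 then 1 else 0 := fun v => by
    simp [boxKernel, Set.indicator_apply]
  rw [weight, hb, hb]
  simp only [hn]

lemma gram_isSymm (D : List (Ctx d × Bool)) (x : Ctx d) (h : ℝ) : (gram D x h p).IsSymm := by
  ext s t
  simp only [gram, Matrix.transpose_apply]
  congr 2
  funext z; ring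

lemma polyVal_sq (θ : Idx d p → ℝ) (v : Ctx d) :
    polyVal θ v ^ 2 = ∑ s, ∑ t, θ s * θ t * (mono s v * mono t v) := by
  rw [sq, polyVal, Finset.sum_mul_sum]
  refine Finset.sum_congr rfl fun s _ => Finset.sum_congr rfl fun t _ => by ring

lemma quadForm_eq_sum {ι : Type*} [Fintype ι] (G : Matrix ι ι ℝ) (θ : ι → ℝ) :
    quadForm G θ = ∑ s, ∑ t, θ s * θ t * G s t := by
  simp only [quadForm, dotProduct, Matrix.mulVec, Finset.mul_sum]
  refine Finset.sum_congr rfl fun s _ => Finset.sum_congr rfl fun t _ => by ring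

lemma quadForm_gram (D : List (Ctx d × Bool)) (x : Ctx d) (h : ℝ) (θ : Idx d p → ℝ) :
    quadForm (gram D x h p) θ
      = (D.map fun z => weight x h z.1 * polyVal θ (h⁻¹ • (z.1 - x)) ^ 2).sum := by
  rw [quadForm_eq_sum]
  induction D with
  | nil => simp [gram]
  | cons z D ih =>
    simp only [gram, List.map_cons, List.sum_cons, mul_add, Finset.sum_add_distrib] at ih ⊢
    rw [ih, polyVal_sq, Finset.mul_sum]
    congr 1
    refine Finset.sum_congr rfl fun s _ => ?_
    rw [Finset.mul_sum]
    refine Finset.sum_congr rfl fun t _ => ?_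
    simp only [feat]; ring

lemma quadForm_gram_nonneg (D : List (Ctx d × Bool)) (x : Ctx d) (h : ℝ) (θ : Idx d p → ℝ) :
    0 ≤ quadForm (gram D x h p) θ := by
  rw [quadForm_gram]
  apply List.sum_nonneg
  intro a ha
  obtain ⟨z, -, rfl⟩ := List.mem_map.1 ha
  exact mul_nonneg (weight_nonneg _ _ _) (sq_nonneg _)

/-- The criterion is a quadratic function of the coefficients. -/
lemma lprLoss_eq (D : List (Ctx d × Bool)) (x : Ctx d) (h : ℝ) (g : MvPolynomial (Fin d) ℝ)
    (θ : Idx d p → ℝ) (hg : ∀ w, MvPolynomial.eval w g = polyVal θ (h⁻¹ • w)) :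
    lprLoss D x h g = (D.map fun z => weight x h z.1 * val z.2 ^ 2).sum
      - 2 * (θ ⬝ᵥ moments D x h p) + quadForm (gram D x h p) θ := by
  rw [quadForm_gram]
  unfold lprLoss
  induction D with
  | nil => simp [moments, dotProduct]
  | cons z D ih =>
    have hm : θ ⬝ᵥ moments (z :: D) x h p
        = weight x h z.1 * val z.2 * polyVal θ (h⁻¹ • (z.1 - x)) + θ ⬝ᵥ moments D x h p := by
      simp only [dotProduct, moments, List.map_cons, List.sum_cons, mul_add,
        Finset.sum_add_distrib, polyVal, Finset.mul_sum, feat]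
      congr 1
      refine Finset.sum_congr rfl fun s _ => by ring
    simp only [List.map_cons, List.sum_cons]
    rw [ih, hm, hg]
    change (val z.2 - _) ^ 2 * weight x h z.1 + _ = _
    ring

/-- The estimator in closed form. The least squares polynomial is unique if and only if the Gram
matrix is invertible. -/
theorem lpr_eq (D : List (Ctx d × Bool)) (x : Ctx d) {h : ℝ} (hh : h ≠ 0) (p : ℕ) :
    lpr D x h p = max 0 (min 1 (if (gram D x h p).det ≠ 0 then
      ((gram D x h p)⁻¹ *ᵥ moments D x h p) (idxZero d p) else 0)) := by
  have hco : ∀ g : MvPolynomial (Fin d) ℝ, g.totalDegree ≤ p →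
      ∃ θ : Idx d p → ℝ, ∀ w, MvPolynomial.eval w g = polyVal θ (h⁻¹ • w) := by
    intro g hg
    obtain ⟨θ, hθ⟩ := exists_polyVal_eq_eval hg 0 hh
    exact ⟨θ, fun w => by simpa using hθ w⟩
  have hto : ∀ (θ : Idx d p → ℝ) w,
      MvPolynomial.eval w (toMv 0 h θ) = polyVal θ (h⁻¹ • w) := by
    intro θ w; simpa using eval_toMv 0 h θ w
  unfold lpr
  congr 2
  by_cases hdet : (gram D x h p).det ≠ 0
  · rw [if_pos hdet]
    set θs := (gram D x h p)⁻¹ *ᵥ moments D x h p with hθs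
    have hne : gram D x h p *ᵥ θs = moments D x h p := by
      rw [hθs, mulVec_mulVec, Matrix.mul_nonsing_inv _ (Ne.isUnit hdet), one_mulVec]
    have hloss : ∀ (g : MvPolynomial (Fin d) ℝ) (θ : Idx d p → ℝ),
        (∀ w, MvPolynomial.eval w g = polyVal θ (h⁻¹ • w)) →
        lprLoss D x h g = lprLoss D x h (toMv 0 h θs) + quadForm (gram D x h p) (θ - θs) := by
      intro g θ hg
      rw [lprLoss_eq D x h g θ hg, lprLoss_eq D x h _ θs (hto θs)]
      exact quadLoss_eq_add_quadForm (gram_isSymm _ _ _) hne _ _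
    have hmin : IsLprMin D x h p (toMv 0 h θs) := by
      refine ⟨totalDegree_toMv_le _ _ _, fun g hg => ?_⟩
      obtain ⟨θ, hθ⟩ := hco g hg
      rw [hloss g θ hθ]
      linarith [quadForm_gram_nonneg D x h (θ - θs)]
    have huniq : ∀ g, IsLprMin D x h p g → g = toMv 0 h θs := by
      intro g hg
      obtain ⟨θ, hθ⟩ := hco g hg.1
      have h1 := hg.2 _ hmin.1
      rw [hloss g θ hθ] at h1
      have h0 : quadForm (gram D x h p) (θ - θs) = 0 :=
        le_antisymm (by linarith) (quadForm_gram_nonneg D x h _)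
      have h2 := mulVec_eq_zero_of_quadForm_eq_zero (gram_isSymm _ _ _)
        (quadForm_gram_nonneg D x h) h0
      have h3 : θ - θs = 0 := by
        by_contra hne0
        exact hdet (Matrix.exists_mulVec_eq_zero_iff.1 ⟨_, hne0, h2⟩)
      have h4 : θ = θs := sub_eq_zero.1 h3
      apply MvPolynomial.funext
      intro w
      rw [hθ, hto, h4]
    have H : ∃! θ, IsLprMin D x h p θ := ⟨_, hmin, huniq⟩
    rw [dif_pos H, huniq _ H.choose_spec.1, hto, smul_zero, polyVal_zero_right]
  · rw [if_neg hdet, dif_neg]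
    rintro ⟨g, hg, hu⟩
    push Not at hdet
    obtain ⟨v, hv, hv0⟩ := Matrix.exists_mulVec_eq_zero_iff.2 hdet
    obtain ⟨θ, hθ⟩ := hco g hg.1
    have hev : ∀ w, MvPolynomial.eval w (toMv 0 h (θ + v)) = polyVal (θ + v) (h⁻¹ • w) := hto _
    have hB : v ⬝ᵥ moments D x h p = 0 := by
      -- the data in the window are annihilated by `polyVal v`
      have hq : (D.map fun z => weight x h z.1 * polyVal v (h⁻¹ • (z.1 - x)) ^ 2).sum = 0 := by
        rw [← quadForm_gram, quadForm, hv0, dotProduct_zero]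
      have hz : ∀ z ∈ D, weight x h z.1 * polyVal v (h⁻¹ • (z.1 - x)) ^ 2 = 0 := by
        clear hv0 hv hu hg hdet
        induction D with
        | nil => simp
        | cons z D ih =>
          simp only [List.map_cons, List.sum_cons] at hq
          have ha : 0 ≤ weight x h z.1 * polyVal v (h⁻¹ • (z.1 - x)) ^ 2 :=
            mul_nonneg (weight_nonneg _ _ _) (sq_nonneg _)
          have hb : 0 ≤ (D.map fun z => weight x h z.1 * polyVal v (h⁻¹ • (z.1 - x)) ^ 2).sum := by
            rw [← quadForm_gram]; exact quadForm_gram_nonneg D x h v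
          intro z' hz'
          rcases List.mem_cons.1 hz' with rfl | hz'
          · linarith
          · exact ih (by linarith) z' hz'
      have : v ⬝ᵥ moments D x h p
          = (D.map fun z => weight x h z.1 * val z.2 * polyVal v (h⁻¹ • (z.1 - x))).sum := by
        clear hv0 hv hu hg hdet hq hz
        induction D with
        | nil => simp [moments, dotProduct]
        | cons z D ih =>
          simp only [List.map_cons, List.sum_cons]
          rw [← ih]
          simp only [dotProduct, moments, List.map_cons, List.sum_cons, mul_add,
            Finset.sum_add_distrib, polyVal, Finset.mul_sum, feat]
          congr 1
          refine Finset.sum_congr rfl fun s _ => by ring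
      rw [this]
      apply List.sum_eq_zero
      intro a ha
      obtain ⟨z, hzD, rfl⟩ := List.mem_map.1 ha
      rcases mul_eq_zero.1 (hz z hzD) with h1 | h1
      · rw [h1]; ring
      · rw [pow_eq_zero_iff (two_ne_zero)] at h1
        rw [h1]; ring
    have heq : lprLoss D x h (toMv 0 h (θ + v)) = lprLoss D x h g := by
      rw [lprLoss_eq D x h _ _ hev, lprLoss_eq D x h g θ hθ, add_dotProduct, hB]
      have : quadForm (gram D x h p) (θ + v) = quadForm (gram D x h p) θ := by
        have hs : v ⬝ᵥ (gram D x h p *ᵥ θ) = 0 := by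
          rw [dotProduct_mulVec, ← mulVec_transpose, (gram_isSymm D x h).eq, hv0, zero_dotProduct]
        simp only [quadForm, mulVec_add, dotProduct_add, add_dotProduct, hv0, hs, dotProduct_zero]
        ring
      rw [this]; ring
    have hmin' : IsLprMin D x h p (toMv 0 h (θ + v)) :=
      ⟨totalDegree_toMv_le _ _ _, fun g' hg' => heq ▸ hg.2 g' hg'⟩
    have := hu _ hmin'
    have hv' : v = 0 := by
      apply eq_zero_of_polyVal_eq_zero (fun _ => Set.univ) (fun _ => Set.infinite_univ)
      intro w _
      have h1 := hev (h • w)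
      rw [this, hθ, smul_smul, inv_mul_cancel₀ hh, one_smul] at h1
      have h2 : polyVal (θ + v) w = polyVal θ w + polyVal v w := by
        simp [polyVal, add_mul, Finset.sum_add_distrib]
      linarith
    exact hv hv'

/-- Deterministic error bound of the estimator: when the Gram matrix is coercive, the estimator is
as close to any reference value as the normal equations of the reference polynomial are balanced. -/
lemma abs_lpr_sub_le {D : List (Ctx d × Bool)} {x : Ctx d} {h : ℝ} (hh : h ≠ 0) {Λ ε : ℝ}
    (hΛ : 0 < Λ) (hco : ∀ δ, Λ * ∑ s, δ s ^ 2 ≤ quadForm (gram D x h p) δ) {θ0 : Idx d p → ℝ}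
    (hε : ∀ s : Idx d p, |(D.map fun z => weight x h z.1 * feat x h s z.1 *
      (val z.2 - polyVal θ0 (h⁻¹ • (z.1 - x)))).sum| ≤ ε) :
    |lpr D x h p - trunc (θ0 (idxZero d p))| ≤ Fintype.card (Idx d p) * ε / Λ := by
  have hdet := det_ne_zero_of_coercive hΛ hco
  rw [lpr_eq D x hh, if_pos hdet]
  refine (abs_trunc_sub_le _ _).trans ?_
  refine abs_sub_le_of_coercive hΛ hco (B := moments D x h p) ?_ ?_ _
  · rw [mulVec_mulVec, Matrix.mul_nonsing_inv _ (Ne.isUnit hdet), one_mulVec]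
  · intro s
    have : moments D x h p s - (gram D x h p *ᵥ θ0) s = (D.map fun z => weight x h z.1 *
        feat x h s z.1 * (val z.2 - polyVal θ0 (h⁻¹ • (z.1 - x)))).sum := by
      clear hε hdet hco
      induction D with
      | nil => simp [moments, gram, mulVec, dotProduct]
      | cons z D ih =>
        simp only [List.map_cons, List.sum_cons]
        rw [← ih]
        simp only [moments, gram, mulVec, dotProduct, List.map_cons, List.sum_cons, add_mul,
          Finset.sum_add_distrib, polyVal, mul_sub, Finset.mul_sum, feat]
        have : ∀ s' : Idx d p, weight x h z.1 * mono s (h⁻¹ • (z.1 - x)) *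
            (θ0 s' * mono s' (h⁻¹ • (z.1 - x))) = weight x h z.1 * mono s (h⁻¹ • (z.1 - x)) *
            mono s' (h⁻¹ • (z.1 - x)) * θ0 s' := fun s' => by ring
        simp_rw [this]
        ring
    rw [this]
    exact hε s

end Lpr

/-! ### Population least squares -/

section Population

open Matrix

variable {d p : ℕ}

/-- The Gram matrix of the window of bandwidth `h` around `x` under the law `ν`. -/
def popGram (p : ℕ) (ν : Measure (Ctx d)) (x : Ctx d) (h : ℝ) : Matrix (Idx d p) (Idx d p) ℝ :=
  fun s t => ∫ u, weight x h u * feat x h s u * feat x h t u ∂ν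

/-- The right-hand side of the normal equations for the target `f` under the law `ν`. -/
def popMoments (p : ℕ) (ν : Measure (Ctx d)) (f : Ctx d → ℝ) (x : Ctx d) (h : ℝ) : Idx d p → ℝ :=
  fun s => ∫ u, weight x h u * feat x h s u * f u ∂ν

/-- The coefficients of the least squares polynomial of `f` under the law `ν`. -/
def popCoef (p : ℕ) (ν : Measure (Ctx d)) (f : Ctx d → ℝ) (x : Ctx d) (h : ℝ) : Idx d p → ℝ :=
  (popGram p ν x h)⁻¹ *ᵥ popMoments p ν f x h

/-- The value at `x` of the least squares polynomial of `f` in the window around `x`. -/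
def popVal (p : ℕ) (ν : Measure (Ctx d)) (f : Ctx d → ℝ) (x : Ctx d) (h : ℝ) : ℝ :=
  popCoef p ν f x h (idxZero d p)

lemma measurable_weight (x : Ctx d) (h : ℝ) : Measurable (weight x h) := by
  have : weight x h = fun u => if ‖h⁻¹ • (u - x)‖ ≤ 1 then (1 : ℝ) else 0 := by
    funext u; exact weight_eq_ite x h u
  rw [this]
  refine Measurable.ite ?_ measurable_const measurable_const
  exact measurableSet_le (by fun_prop) measurable_const

lemma measurable_feat (x : Ctx d) (h : ℝ) (s : Idx d p) : Measurable (feat x h s) := by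
  unfold feat
  exact (continuous_mono s).measurable.comp (by fun_prop)

lemma measurable_polyVal_comp (x : Ctx d) (h : ℝ) (θ : Idx d p → ℝ) :
    Measurable fun u => polyVal θ (h⁻¹ • (u - x)) :=
  (continuous_polyVal θ).measurable.comp (by fun_prop)

lemma abs_weight_mul_feat_mul_le (x : Ctx d) (h : ℝ) (s : Idx d p) (u : Ctx d) {a M : ℝ}
    (ha : ‖h⁻¹ • (u - x)‖ ≤ 1 → |a| ≤ M) : |weight x h u * feat x h s u * a| ≤ M * weight x h u := by
  rw [mul_assoc]
  refine abs_weight_mul_le fun hv => ?_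
  rw [abs_mul]
  calc _ ≤ 1 * M := mul_le_mul (abs_mono_le_one s hv) (ha hv) (abs_nonneg _) zero_le_one
    _ = M := one_mul M

/-- The window of bandwidth `h` around `x` has mass of order `σ` under `ν`, and its Gram matrix is
coercive at the same order. -/
structure GoodWindow (p : ℕ) (ν : Measure (Ctx d)) (x : Ctx d) (h K₁ K₂ σ : ℝ) : Prop where
  h_pos : 0 < h
  K₁_pos : 0 < K₁
  σ_pos : 0 < σ
  coercive : ∀ δ : Idx d p → ℝ, K₁ * σ * ∑ s, δ s ^ 2 ≤ quadForm (popGram p ν x h) δ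
  mass : ∫ u, weight x h u ∂ν ≤ K₂ * σ

variable {ν : Measure (Ctx d)} {f : Ctx d → ℝ} {x : Ctx d} {h K₁ K₂ σ : ℝ}

lemma popGram_isSymm : (popGram p ν x h).IsSymm := by
  ext s t
  simp only [popGram, Matrix.transpose_apply]
  congr 1
  funext z; ring

lemma GoodWindow.det_ne_zero (W : GoodWindow p ν x h K₁ K₂ σ) : (popGram p ν x h).det ≠ 0 :=
  det_ne_zero_of_coercive (mul_pos W.K₁_pos W.σ_pos) W.coercive

lemma GoodWindow.normal_eq (W : GoodWindow p ν x h K₁ K₂ σ) :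
    popGram p ν x h *ᵥ popCoef p ν f x h = popMoments p ν f x h := by
  rw [popCoef, mulVec_mulVec, Matrix.mul_nonsing_inv _ (Ne.isUnit W.det_ne_zero), one_mulVec]

variable [IsProbabilityMeasure ν]

lemma integrable_weight (x : Ctx d) (h : ℝ) : Integrable (weight x h) ν :=
  Integrable.of_bound (measurable_weight x h).aestronglyMeasurable 1
    (ae_of_all _ fun u => by
      rw [Real.norm_eq_abs, abs_of_nonneg (weight_nonneg _ _ _)]; exact weight_le_one _ _ _)

lemma integrable_weight_feat_mul (x : Ctx d) (h : ℝ) (s : Idx d p) {g : Ctx d → ℝ} {M : ℝ}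
    (hg : Measurable g) (hM : ∀ u, ‖h⁻¹ • (u - x)‖ ≤ 1 → |g u| ≤ M) :
    Integrable (fun u => weight x h u * feat x h s u * g u) ν := by
  refine Integrable.mono' ((integrable_weight x h).const_mul M)
    (((measurable_weight x h).mul (measurable_feat x h s)).mul hg).aestronglyMeasurable
    (ae_of_all _ fun u => ?_)
  exact abs_weight_mul_feat_mul_le x h s u (hM u)

lemma integrable_gram (x : Ctx d) (h : ℝ) (s t : Idx d p) :
    Integrable (fun u => weight x h u * feat x h s u * feat x h t u) ν :=
  integrable_weight_feat_mul x h s (measurable_feat x h t) fun _ hv => abs_mono_le_one t hv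

lemma quadForm_popGram (δ : Idx d p → ℝ) :
    quadForm (popGram p ν x h) δ = ∫ u, weight x h u * polyVal δ (h⁻¹ • (u - x)) ^ 2 ∂ν := by
  rw [quadForm_eq_sum]
  have : ∀ u, weight x h u * polyVal δ (h⁻¹ • (u - x)) ^ 2
      = ∑ s, ∑ t, δ s * δ t * (weight x h u * feat x h s u * feat x h t u) := by
    intro u
    rw [polyVal_sq, Finset.mul_sum]
    refine Finset.sum_congr rfl fun s _ => ?_
    rw [Finset.mul_sum]
    refine Finset.sum_congr rfl fun t _ => ?_
    simp only [feat]; ring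
  simp_rw [this]
  rw [integral_finsetSum _ fun s _ => integrable_finsetSum _ fun t _ =>
    (integrable_gram x h s t).const_mul _]
  refine Finset.sum_congr rfl fun s _ => ?_
  rw [integral_finsetSum _ fun t _ => (integrable_gram x h s t).const_mul _]
  refine Finset.sum_congr rfl fun t _ => ?_
  rw [integral_const_mul]
  rfl

lemma quadForm_popGram_nonneg (δ : Idx d p → ℝ) : 0 ≤ quadForm (popGram p ν x h) δ := by
  rw [quadForm_popGram]
  exact integral_nonneg fun u => mul_nonneg (weight_nonneg _ _ _) (sq_nonneg _)

lemma popMoments_sub (hf : Measurable f) (hf1 : ∀ u, |f u| ≤ 1) (θ : Idx d p → ℝ) (s : Idx d p) :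
    popMoments p ν f x h s - (popGram p ν x h *ᵥ θ) s
      = ∫ u, weight x h u * feat x h s u * (f u - polyVal θ (h⁻¹ • (u - x))) ∂ν := by
  have hi := integrable_weight_feat_mul (ν := ν) x h s hf (fun u _ => hf1 u)
  have hi2 : ∀ t, Integrable (fun u => weight x h u * feat x h s u * feat x h t u * θ t) ν :=
    fun t => (integrable_gram x h s t).mul_const _
  have : ∀ u, weight x h u * feat x h s u * (f u - polyVal θ (h⁻¹ • (u - x)))
      = weight x h u * feat x h s u * f u
        - ∑ t, weight x h u * feat x h s u * feat x h t u * θ t := by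
    intro u
    rw [mul_sub, polyVal, Finset.mul_sum]
    congr 1
    refine Finset.sum_congr rfl fun t _ => ?_
    simp only [feat]; ring
  simp_rw [this]
  rw [integral_sub hi (integrable_finsetSum _ fun t _ => hi2 t),
    integral_finsetSum _ fun t _ => hi2 t]
  simp_rw [integral_mul_const]
  rfl

namespace GoodWindow

variable (W : GoodWindow p ν x h K₁ K₂ σ)
include W

/-- The residual of the least squares polynomial is orthogonal to the monomials. -/
lemma integral_residual_eq_zero (hf : Measurable f) (hf1 : ∀ u, |f u| ≤ 1) (s : Idx d p) :
    ∫ u, weight x h u * feat x h s u *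
      (f u - polyVal (popCoef p ν f x h) (h⁻¹ • (u - x))) ∂ν = 0 := by
  rw [← popMoments_sub hf hf1, W.normal_eq, sub_self]

/-- Least squares approximation is as good, up to a constant factor, as uniform approximation. -/
lemma abs_popCoef_sub_le (hf : Measurable f) (hf1 : ∀ u, |f u| ≤ 1) {η : ℝ} {θ : Idx d p → ℝ}
    (hη : ∀ᵐ u ∂ν, ‖h⁻¹ • (u - x)‖ ≤ 1 → |f u - polyVal θ (h⁻¹ • (u - x))| ≤ η) (hη0 : 0 ≤ η)
    (s : Idx d p) :
    |popCoef p ν f x h s - θ s| ≤ Fintype.card (Idx d p) * (K₂ / K₁) * η := by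
  have := abs_sub_le_of_coercive (ε := η * (K₂ * σ)) (mul_pos W.K₁_pos W.σ_pos) W.coercive
    (θ0 := θ) (W.normal_eq (f := f)) (fun t => ?_) s
  · refine this.trans (le_of_eq ?_)
    have h1 := W.σ_pos.ne'
    have h2 := W.K₁_pos.ne'
    field_simp
  · rw [popMoments_sub hf hf1]
    calc |∫ u, weight x h u * feat x h t u * (f u - polyVal θ (h⁻¹ • (u - x))) ∂ν|
        ≤ ∫ u, η * weight x h u ∂ν := by
          rw [← Real.norm_eq_abs]
          refine norm_integral_le_of_norm_le ((integrable_weight x h).const_mul η) ?_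
          filter_upwards [hη] with u hu
          exact abs_weight_mul_feat_mul_le x h t u hu
      _ = η * ∫ u, weight x h u ∂ν := integral_const_mul _ _
      _ ≤ η * (K₂ * σ) := mul_le_mul_of_nonneg_left W.mass hη0

lemma abs_popCoef_le (hf : Measurable f) (hf1 : ∀ u, |f u| ≤ 1) (s : Idx d p) :
    |popCoef p ν f x h s| ≤ Fintype.card (Idx d p) * (K₂ / K₁) := by
  have := W.abs_popCoef_sub_le hf hf1 (η := 1) (θ := 0)
    (ae_of_all _ fun u _ => by simpa [polyVal_zero_left] using hf1 u) zero_le_one s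
  simpa using this

/-- The least squares polynomial is the unique minimizer of the mean square error. -/
lemma minimizer_iff (hf : Measurable f) (hf1 : ∀ u, |f u| ≤ 1) (g : MvPolynomial (Fin d) ℝ) :
    (g.totalDegree ≤ p ∧ ∀ g' : MvPolynomial (Fin d) ℝ, g'.totalDegree ≤ p →
      ∫ u, |f u - MvPolynomial.eval u g| ^ 2 * boxKernel (h⁻¹ • (x - u)) ∂ν ≤
      ∫ u, |f u - MvPolynomial.eval u g'| ^ 2 * boxKernel (h⁻¹ • (x - u)) ∂ν) ↔
    g = toMv x h (popCoef p ν f x h) := by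
  set θs := popCoef p ν f x h with hθs
  have hi := fun s => integrable_weight_feat_mul (ν := ν) (p := p) x h s hf (fun u _ => hf1 u)
  have hexp : ∀ (g : MvPolynomial (Fin d) ℝ) (θ : Idx d p → ℝ),
      (∀ u, MvPolynomial.eval u g = polyVal θ (h⁻¹ • (u - x))) →
      ∫ u, |f u - MvPolynomial.eval u g| ^ 2 * boxKernel (h⁻¹ • (x - u)) ∂ν
        = ∫ u, weight x h u * f u ^ 2 ∂ν - 2 * (θ ⬝ᵥ popMoments p ν f x h)
          + quadForm (popGram p ν x h) θ := by
    intro g θ hg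
    rw [quadForm_popGram]
    have hI1 : Integrable (fun u => weight x h u * f u ^ 2) ν := by
      refine Integrable.mono' (integrable_weight x h)
        ((measurable_weight x h).mul (hf.pow_const 2)).aestronglyMeasurable (ae_of_all _ fun u => ?_)
      rw [Real.norm_eq_abs]
      refine (abs_weight_mul_le (M := 1) fun _ => ?_).trans (by simp)
      rw [abs_pow]; exact pow_le_one₀ (abs_nonneg _) (hf1 u)
    have hI2 : Integrable (fun u => 2 * ∑ s, θ s * (weight x h u * feat x h s u * f u)) ν :=
      (integrable_finsetSum _ fun s _ => (hi s).const_mul _).const_mul _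
    have hI3 : Integrable (fun u => weight x h u * polyVal θ (h⁻¹ • (u - x)) ^ 2) ν := by
      have : (fun u => weight x h u * polyVal θ (h⁻¹ • (u - x)) ^ 2)
          = fun u => ∑ s, ∑ t, θ s * θ t * (weight x h u * feat x h s u * feat x h t u) := by
        funext u
        rw [polyVal_sq, Finset.mul_sum]
        refine Finset.sum_congr rfl fun s _ => ?_
        rw [Finset.mul_sum]
        refine Finset.sum_congr rfl fun t _ => ?_
        simp only [feat]; ring
      rw [this]
      exact integrable_finsetSum _ fun s _ => integrable_finsetSum _ fun t _ =>
        (integrable_gram x h s t).const_mul _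
    have hpt : ∀ u, |f u - MvPolynomial.eval u g| ^ 2 * boxKernel (h⁻¹ • (x - u))
        = weight x h u * f u ^ 2 - 2 * ∑ s, θ s * (weight x h u * feat x h s u * f u)
          + weight x h u * polyVal θ (h⁻¹ • (u - x)) ^ 2 := by
      intro u
      rw [sq_abs, hg, boxKernel_sub_eq_weight]
      have : ∑ s, θ s * (weight x h u * feat x h s u * f u)
          = weight x h u * f u * polyVal θ (h⁻¹ • (u - x)) := by
        rw [polyVal, Finset.mul_sum]
        refine Finset.sum_congr rfl fun s _ => ?_
        simp only [feat]; ring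
      rw [this]; ring
    simp_rw [hpt]
    have e1 := integral_add (hI1.sub hI2) hI3
    simp only [Pi.sub_apply] at e1
    rw [e1, integral_sub hI1 hI2, integral_const_mul,
      integral_finsetSum _ fun s _ => (hi s).const_mul _]
    simp_rw [integral_const_mul]
    rfl
  have hloss : ∀ (g : MvPolynomial (Fin d) ℝ) (θ : Idx d p → ℝ),
      (∀ u, MvPolynomial.eval u g = polyVal θ (h⁻¹ • (u - x))) →
      ∫ u, |f u - MvPolynomial.eval u g| ^ 2 * boxKernel (h⁻¹ • (x - u)) ∂ν =
      ∫ u, |f u - MvPolynomial.eval u (toMv x h θs)| ^ 2 * boxKernel (h⁻¹ • (x - u)) ∂ν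
        + quadForm (popGram p ν x h) (θ - θs) := by
    intro g θ hg
    rw [hexp g θ hg, hexp _ θs (eval_toMv x h θs)]
    exact quadLoss_eq_add_quadForm popGram_isSymm W.normal_eq _ _
  constructor
  · rintro ⟨hdeg, hmin⟩
    obtain ⟨θ, hθ⟩ := exists_polyVal_eq_eval hdeg x W.h_pos.ne'
    have h1 := hmin _ (totalDegree_toMv_le x h θs)
    rw [hloss g θ hθ] at h1
    have h2 := W.coercive (θ - θs)
    have h3 : ∑ s, (θ - θs) s ^ 2 = 0 := by
      refine le_antisymm ?_ (Finset.sum_nonneg fun _ _ => sq_nonneg _)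
      by_contra hlt
      push Not at hlt
      have := mul_pos (mul_pos W.K₁_pos W.σ_pos) hlt
      linarith
    rw [Finset.sum_eq_zero_iff_of_nonneg (fun _ _ => sq_nonneg _)] at h3
    have h4 : θ = θs := by
      ext s
      have := h3 s (Finset.mem_univ s)
      rw [pow_eq_zero_iff two_ne_zero] at this
      exact sub_eq_zero.1 this
    apply MvPolynomial.funext
    intro u
    rw [hθ, h4, eval_toMv]
  · rintro rfl
    refine ⟨totalDegree_toMv_le _ _ _, fun g' hg' => ?_⟩
    obtain ⟨θ, hθ⟩ := exists_polyVal_eq_eval hg' x W.h_pos.ne'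
    rw [hloss g' θ hθ]
    linarith [quadForm_popGram_nonneg (ν := ν) (x := x) (h := h) (θ - θs)]

end GoodWindow

end Population

/-- When the window covers the bin, the projection in the self-similarity condition is the
population version of the estimator. -/
lemma proj_eq_popVal {d p : ℕ} {μ : Measure (Ctx d)} {U : Set (Ctx d)}
    [IsProbabilityMeasure (cond μ U)] {f : Ctx d → ℝ} {x : Ctx d} {h K₁ K₂ σ : ℝ}
    (W : GoodWindow p (cond μ U) x h K₁ K₂ σ) (hf : Measurable f) (hf1 : ∀ u, |f u| ≤ 1) :
    proj μ p h U f x = popVal p (cond μ U) f x h := by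
  have hiff : ∀ g, IsProjection μ p h U f x g ↔ g = toMv x h (popCoef p (cond μ U) f x h) :=
    fun g => W.minimizer_iff hf hf1 g
  have H : ∃ g, IsProjection μ p h U f x g := ⟨_, (hiff _).2 rfl⟩
  unfold proj
  rw [dif_pos H, (hiff _).1 H.choose_spec, eval_toMv, sub_self, smul_zero, polyVal_zero_right,
    popVal]

/-! ### Taylor polynomials -/

section Taylor

variable {d p : ℕ}

open MvPolynomial in
/-- The Taylor polynomial at `x`, in coordinates centred at `x` with unit `h`. -/
lemma exists_polyVal_eq_taylor {n : ℕ} (hn : n ≤ p) (f : Ctx d → ℝ) (x : Ctx d) {h : ℝ}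
    (hh : h ≠ 0) :
    ∃ θ : Idx d p → ℝ, ∀ u, taylor n f x u = polyVal θ (h⁻¹ • (u - x)) := by
  set M : (k : ℕ) → ContinuousMultilinearMap ℝ (fun _ : Fin k => Ctx d) ℝ :=
    fun k => iteratedFDerivWithin ℝ k f (cube d) x with hM
  set g : MvPolynomial (Fin d) ℝ := ∑ k ∈ Finset.range (n + 1),
    C (1 / (k.factorial : ℝ)) * ∑ r : Fin k → Fin d,
      C (M k fun i => Pi.single (r i) 1) * ∏ i, (X (r i) - C (x (r i))) with hg
  have hdeg : g.totalDegree ≤ p := by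
    rw [hg]
    refine totalDegree_finsetSum_le fun k hk => ?_
    refine (totalDegree_mul _ _).trans ?_
    rw [totalDegree_C, zero_add]
    refine totalDegree_finsetSum_le fun r _ => ?_
    refine (totalDegree_mul _ _).trans ?_
    rw [totalDegree_C, zero_add]
    refine (totalDegree_finsetProd _ _).trans ?_
    calc ∑ i : Fin k, (X (r i) - C (x (r i)) : MvPolynomial (Fin d) ℝ).totalDegree
        ≤ ∑ _i : Fin k, 1 := by
          refine Finset.sum_le_sum fun i _ => ?_
          rw [sub_eq_add_neg, ← map_neg C]
          exact (totalDegree_add _ _).trans (max_le (by simp [totalDegree_X]) (by simp))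
      _ = k := by simp
      _ ≤ p := by have := Finset.mem_range.1 hk; omega
  obtain ⟨θ, hθ⟩ := exists_polyVal_eq_eval hdeg x hh
  refine ⟨θ, fun u => ?_⟩
  rw [← hθ, hg, taylor, map_sum]
  refine Finset.sum_congr rfl fun k _ => ?_
  rw [map_mul, eval_C]
  congr 1
  have hdec : u - x = ∑ j, (u j - x j) • (Pi.single j (1 : ℝ) : Ctx d) := by
    ext i; simp [Finset.sum_apply, Pi.single_apply]
  change M k (fun _ => u - x) = _
  rw [hdec]
  rw [ContinuousMultilinearMap.map_sum, map_sum]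
  refine Finset.sum_congr rfl fun r _ => ?_
  rw [ContinuousMultilinearMap.map_smul_univ]
  simp [mul_comm]

lemma taylor_self (n : ℕ) (f : Ctx d → ℝ) (x : Ctx d) : taylor n f x x = f x := by
  unfold taylor
  rw [Finset.sum_eq_single 0]
  · simp
  · intro k _ hk
    have : Nonempty (Fin k) := ⟨⟨0, Nat.pos_of_ne_zero hk⟩⟩
    have h0 : (fun _ : Fin k => x - x) = 0 := by funext i; simp
    rw [h0, ContinuousMultilinearMap.map_zero, mul_zero]
  · simp

/-- A Hölder function has, around each point of the cube, an approximating polynomial with the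
right value at that point. -/
lemma IsHolder.exists_approx {β L : ℝ} {f : Ctx d → ℝ} (hf : IsHolder β L f)
    (hp : strictFloor β ≤ p) {x : Ctx d} (hx : x ∈ cube d) {h : ℝ} (hh : h ≠ 0) :
    ∃ θ : Idx d p → ℝ, θ (idxZero d p) = f x ∧
      ∀ u ∈ cube d, |f u - polyVal θ (h⁻¹ • (u - x))| ≤ L * ‖u - x‖ ^ β := by
  obtain ⟨θ, hθ⟩ := exists_polyVal_eq_taylor hp f x hh
  refine ⟨θ, ?_, fun u hu => ?_⟩
  · have := hθ x
    rw [taylor_self, sub_self, smul_zero, polyVal_zero_right] at this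
    exact this.symm
  · rw [← hθ, ← norm_sub_rev x u]
    exact hf.2 x hx u hu

end Taylor

/-! ### Windows inside boxes -/

section Windows

variable {d p : ℕ}

/-- The cube of side `1/2` that has a vertex at the origin and lies in the orthant `σ`. -/
def corner (σ : Fin d → Bool) : Set (Ctx d) :=
  Set.Icc (fun i => if σ i then 0 else -(1 / 2)) (fun i => if σ i then 1 / 2 else 0)

lemma norm_le_of_mem_corner {σ : Fin d → Bool} {v : Ctx d} (hv : v ∈ corner σ) : ‖v‖ ≤ 1 / 2 := by
  rw [pi_norm_le_iff_of_nonneg (by norm_num)]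
  intro i
  have h1 := hv.1 i
  have h2 := hv.2 i
  simp only at h1 h2
  rw [Real.norm_eq_abs, abs_le]
  split_ifs at h1 h2 <;> constructor <;> linarith

lemma quadForm_smul {ι : Type*} [Fintype ι] (G : Matrix ι ι ℝ) (c : ℝ) (δ : ι → ℝ) :
    quadForm G (c • δ) = c ^ 2 * quadForm G δ := by
  simp only [quadForm, Matrix.mulVec_smul, dotProduct_smul, smul_dotProduct, smul_eq_mul]
  ring

/-- A positive quadratic form in finitely many variables is coercive. -/
lemma exists_coercive_of_pos {ι : Type*} [Fintype ι] [Nonempty ι] {G : Matrix ι ι ℝ}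
    (hG : ∀ δ, δ ≠ 0 → 0 < quadForm G δ) :
    ∃ c : ℝ, 0 < c ∧ ∀ δ, c * ∑ s, δ s ^ 2 ≤ quadForm G δ := by
  have hcont : Continuous (quadForm G) := by
    have : quadForm G = fun θ => ∑ s, ∑ t, θ s * θ t * G s t := by
      funext θ; exact quadForm_eq_sum G θ
    rw [this]; fun_prop
  obtain ⟨e, he, hmin⟩ := (isCompact_sphere (0 : ι → ℝ) 1).exists_isMinOn
    (NormedSpace.sphere_nonempty.2 zero_le_one) hcont.continuousOn
  have he0 : e ≠ 0 := by
    rintro rfl; simp at he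
  have hcard : (0 : ℝ) < Fintype.card ι := by exact_mod_cast Fintype.card_pos
  refine ⟨quadForm G e / Fintype.card ι, div_pos (hG e he0) hcard, fun δ => ?_⟩
  rcases eq_or_ne δ 0 with rfl | hδ
  · simp [quadForm]
  have hn : 0 < ‖δ‖ := norm_pos_iff.2 hδ
  have h1 : quadForm G e ≤ quadForm G (‖δ‖⁻¹ • δ) := by
    apply hmin
    rw [mem_sphere_zero_iff_norm, norm_smul, norm_inv, norm_norm, inv_mul_cancel₀ hn.ne']
  rw [quadForm_smul] at h1
  have h2 : quadForm G e * ‖δ‖ ^ 2 ≤ quadForm G δ := by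
    have := mul_le_mul_of_nonneg_right h1 (sq_nonneg ‖δ‖)
    refine this.trans (le_of_eq ?_)
    field_simp
  have h3 : ∑ s, δ s ^ 2 ≤ Fintype.card ι * ‖δ‖ ^ 2 := by
    calc ∑ s, δ s ^ 2 ≤ ∑ _s : ι, ‖δ‖ ^ 2 := by
          refine Finset.sum_le_sum fun s _ => ?_
          rw [← sq_abs]
          exact pow_le_pow_left₀ (abs_nonneg _) (norm_le_pi_norm δ s) 2
      _ = _ := by simp
  calc quadForm G e / Fintype.card ι * ∑ s, δ s ^ 2
      ≤ quadForm G e / Fintype.card ι * (Fintype.card ι * ‖δ‖ ^ 2) := by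
        exact mul_le_mul_of_nonneg_left h3 (div_pos (hG e he0) hcard).le
    _ = quadForm G e * ‖δ‖ ^ 2 := by field_simp
    _ ≤ _ := h2

lemma integrableOn_corner (σ : Fin d → Bool) {g : Ctx d → ℝ} (hg : Continuous g) :
    IntegrableOn g (corner σ) := hg.continuousOn.integrableOn_compact isCompact_Icc

/-- The mean square of a polynomial over a cube controls its coefficients. -/
lemma exists_coercive_corner (d p : ℕ) :
    ∃ c : ℝ, 0 < c ∧ ∀ (σ : Fin d → Bool) (δ : Idx d p → ℝ),
      c * ∑ s, δ s ^ 2 ≤ ∫ v in corner σ, polyVal δ v ^ 2 := by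
  have hne : Nonempty (Idx d p) := ⟨idxZero d p⟩
  have key : ∀ σ : Fin d → Bool, ∃ c : ℝ, 0 < c ∧ ∀ δ : Idx d p → ℝ,
      c * ∑ s, δ s ^ 2 ≤ ∫ v in corner σ, polyVal δ v ^ 2 := by
    intro σ
    set G : Matrix (Idx d p) (Idx d p) ℝ := fun s t => ∫ v in corner σ, mono s v * mono t v with hGd
    have hq : ∀ δ : Idx d p → ℝ, quadForm G δ = ∫ v in corner σ, polyVal δ v ^ 2 := by
      intro δ
      rw [quadForm_eq_sum]
      simp_rw [polyVal_sq]
      have hi : ∀ s t, IntegrableOn (fun v : Ctx d => δ s * δ t * (mono s v * mono t v))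
          (corner σ) := fun s t => integrableOn_corner σ
        (continuous_const.mul ((continuous_mono s).mul (continuous_mono t)))
      rw [integral_finsetSum _ fun s _ => integrable_finsetSum _ fun t _ => hi s t]
      refine Finset.sum_congr rfl fun s _ => ?_
      rw [integral_finsetSum _ fun t _ => hi s t]
      refine Finset.sum_congr rfl fun t _ => ?_
      rw [integral_const_mul]
    have hpos : ∀ δ : Idx d p → ℝ, δ ≠ 0 → 0 < quadForm G δ := by
      intro δ hδ
      rw [hq]
      have hnn : 0 ≤ ∫ v in corner σ, polyVal δ v ^ 2 := integral_nonneg fun v => sq_nonneg _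
      refine lt_of_le_of_ne hnn fun h0 => hδ ?_
      have hcont : Continuous fun v : Ctx d => polyVal δ v ^ 2 := (continuous_polyVal δ).pow 2
      rw [eq_comm, setIntegral_eq_zero_iff_of_nonneg_ae (ae_of_all _ fun v => sq_nonneg _)
        (integrableOn_corner σ hcont)] at h0
      set S : Fin d → Set ℝ := fun i =>
        Set.Ioo (if σ i then 0 else -(1 / 2)) (if σ i then 1 / 2 else 0) with hS
      have hsub : Set.pi Set.univ S ⊆ corner σ := by
        intro v hv
        exact ⟨fun i => (hv i trivial).1.le, fun i => (hv i trivial).2.le⟩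
      have hopen : IsOpen (Set.pi Set.univ S) :=
        isOpen_set_pi Set.finite_univ fun i _ => isOpen_Ioo
      have h1 : (fun v : Ctx d => polyVal δ v ^ 2) =ᵐ[volume.restrict (Set.pi Set.univ S)] 0 :=
        ae_restrict_of_ae_restrict_of_subset hsub h0
      have h2 := Measure.eqOn_open_of_ae_eq h1 hopen hcont.continuousOn continuousOn_const
      refine eq_zero_of_polyVal_eq_zero S (fun i => Set.Ioo_infinite ?_) fun v hv => ?_
      · split_ifs <;> norm_num
      · have := h2 (show v ∈ Set.pi Set.univ S from fun i _ => hv i)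
        simpa using this
    obtain ⟨c, hc, hle⟩ := exists_coercive_of_pos hpos
    exact ⟨c, hc, fun δ => (hle δ).trans (le_of_eq (hq δ))⟩
  choose c hc hle using key
  obtain ⟨σ0, hσ0⟩ := Finite.exists_min c
  refine ⟨c σ0, hc σ0, fun σ δ => le_trans ?_ (hle σ δ)⟩
  exact mul_le_mul_of_nonneg_right (hσ0 σ) (Finset.sum_nonneg fun _ _ => sq_nonneg _)

/-- The closed box with lowest vertex `a` and side `h`. -/
def box (a : Ctx d) (h : ℝ) : Set (Ctx d) := Set.Icc a fun i => a i + h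

lemma measurableSet_box (a : Ctx d) (h : ℝ) : MeasurableSet (box a h) := measurableSet_Icc

lemma volume_box (a : Ctx d) {h : ℝ} (hh : 0 ≤ h) :
    volume (box a h) = ENNReal.ofReal (h ^ d) := by
  rw [box, Real.volume_Icc_pi]
  simp [ENNReal.ofReal_pow hh]

lemma norm_sub_le_of_mem_box {a : Ctx d} {h : ℝ} (hh : 0 ≤ h) {x u : Ctx d} (hx : x ∈ box a h)
    (hu : u ∈ box a h) : ‖u - x‖ ≤ h := by
  rw [pi_norm_le_iff_of_nonneg hh]
  intro i
  have h1 := hx.1 i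
  have h2 : x i ≤ a i + h := hx.2 i
  have h3 := hu.1 i
  have h4 : u i ≤ a i + h := hu.2 i
  rw [Real.norm_eq_abs, Pi.sub_apply, abs_le]
  constructor <;> linarith

variable {ρlo ρhi : ℝ} {μ : Measure (Ctx d)}

lemma HasBoundedDensity.le_measure (hμ : HasBoundedDensity ρlo ρhi μ) :
    ENNReal.ofReal ρlo • volume.restrict (cube d) ≤ μ := by
  obtain ⟨g, hg, hb, rfl⟩ := hμ
  rw [← withDensity_const]
  apply withDensity_mono
  filter_upwards [ae_restrict_mem (measurableSet_Icc : MeasurableSet (cube d))] with x hx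
  exact ENNReal.ofReal_le_ofReal (hb x hx).1

lemma HasBoundedDensity.measure_le (hμ : HasBoundedDensity ρlo ρhi μ) :
    μ ≤ ENNReal.ofReal ρhi • volume.restrict (cube d) := by
  obtain ⟨g, hg, hb, rfl⟩ := hμ
  rw [← withDensity_const]
  apply withDensity_mono
  filter_upwards [ae_restrict_mem (measurableSet_Icc : MeasurableSet (cube d))] with x hx
  exact ENNReal.ofReal_le_ofReal (hb x hx).2

section Cond

variable (hμ : HasBoundedDensity ρlo ρhi μ) (hlo : 0 < ρlo) (hhi : ρlo ≤ ρhi) {a : Ctx d}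
  {h : ℝ} (hh : 0 < h) (hB : box a h ⊆ cube d)
include hμ hlo hh hB

lemma le_measure_box : ENNReal.ofReal (ρlo * h ^ d) ≤ μ (box a h) := by
  have := hμ.le_measure (box a h)
  rw [Measure.smul_apply, Measure.restrict_apply (measurableSet_box a h),
    Set.inter_eq_left.2 hB, volume_box a hh.le, smul_eq_mul,
    ← ENNReal.ofReal_mul hlo.le] at this
  exact this

lemma measure_box_ne_zero : μ (box a h) ≠ 0 := by
  have h1 := le_measure_box hμ hlo hh hB
  have h2 : 0 < ENNReal.ofReal (ρlo * h ^ d) := ENNReal.ofReal_pos.2 (by positivity)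
  exact (h2.trans_le h1).ne'

include hhi in
lemma measure_box_le : μ (box a h) ≤ ENNReal.ofReal (ρhi * h ^ d) := by
  have := hμ.measure_le (box a h)
  rw [Measure.smul_apply, Measure.restrict_apply (measurableSet_box a h),
    Set.inter_eq_left.2 hB, volume_box a hh.le, smul_eq_mul,
    ← ENNReal.ofReal_mul (hlo.le.trans hhi)] at this
  exact this

include hhi in
lemma le_cond_box : ENNReal.ofReal (ρlo / (ρhi * h ^ d)) • volume.restrict (box a h)
    ≤ cond μ (box a h) := by
  have hhi0 : 0 < ρhi := hlo.trans_le hhi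
  have h1 : ENNReal.ofReal ρlo • volume.restrict (box a h) ≤ μ.restrict (box a h) := by
    have := Measure.restrict_mono_measure hμ.le_measure (box a h)
    rwa [Measure.restrict_smul, Measure.restrict_restrict (measurableSet_box a h),
      Set.inter_eq_left.2 hB] at this
  have h2 : ENNReal.ofReal (1 / (ρhi * h ^ d)) ≤ (μ (box a h))⁻¹ := by
    rw [one_div, ENNReal.ofReal_inv_of_pos (by positivity)]
    exact ENNReal.inv_le_inv.2 (measure_box_le hμ hlo hhi hh hB)
  unfold ProbabilityTheory.cond
  intro s
  have h3 := h1 s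
  simp only [Measure.smul_apply, smul_eq_mul] at h3 ⊢
  calc ENNReal.ofReal (ρlo / (ρhi * h ^ d)) * volume.restrict (box a h) s
      = ENNReal.ofReal (1 / (ρhi * h ^ d)) * (ENNReal.ofReal ρlo * volume.restrict (box a h) s) := by
        rw [← mul_assoc, ← ENNReal.ofReal_mul (by positivity)]
        congr 2; ring
    _ ≤ _ := mul_le_mul' h2 h3

include hhi in
lemma cond_box_le : cond μ (box a h)
    ≤ ENNReal.ofReal (ρhi / (ρlo * h ^ d)) • volume.restrict (box a h) := by
  have hhi0 : 0 < ρhi := hlo.trans_le hhi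
  have h1 : μ.restrict (box a h) ≤ ENNReal.ofReal ρhi • volume.restrict (box a h) := by
    have := Measure.restrict_mono_measure hμ.measure_le (box a h)
    rwa [Measure.restrict_smul, Measure.restrict_restrict (measurableSet_box a h),
      Set.inter_eq_left.2 hB] at this
  have h2 : (μ (box a h))⁻¹ ≤ ENNReal.ofReal (1 / (ρlo * h ^ d)) := by
    rw [one_div, ENNReal.ofReal_inv_of_pos (by positivity)]
    exact ENNReal.inv_le_inv.2 (le_measure_box hμ hlo hh hB)
  unfold ProbabilityTheory.cond
  intro s
  have h3 := h1 s
  simp only [Measure.smul_apply, smul_eq_mul] at h3 ⊢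
  calc _ ≤ ENNReal.ofReal (1 / (ρlo * h ^ d)) * (ENNReal.ofReal ρhi * volume.restrict (box a h) s) :=
        mul_le_mul' h2 h3
    _ = _ := by
        rw [← mul_assoc, ← ENNReal.ofReal_mul (by positivity)]
        congr 2; ring

include hhi in
/-- Windows in boxes are good: `c` is the constant of `exists_coercive_corner`. -/
lemma goodWindow_box [IsProbabilityMeasure (cond μ (box a h))] {c : ℝ} (hc : 0 < c)
    (hco : ∀ (σ : Fin d → Bool) (δ : Idx d p → ℝ),
      c * ∑ s, δ s ^ 2 ≤ ∫ v in corner σ, polyVal δ v ^ 2)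
    {x : Ctx d} (hx : x ∈ box a h) {h' : ℝ} (hh' : 0 < h') (hle : h' ≤ h) :
    GoodWindow p (cond μ (box a h)) x h' (ρlo / ρhi * c) (ρhi / ρlo * 2 ^ d) ((h' / h) ^ d) where
  h_pos := hh'
  K₁_pos := by have : 0 < ρhi := hlo.trans_le hhi; positivity
  σ_pos := by positivity
  coercive := by
    intro δ
    have hhi0 : 0 < ρhi := hlo.trans_le hhi
    -- the orthant in which the box extends at least by half of the bandwidth
    set σ : Fin d → Bool := fun i => decide (x i + h' / 2 ≤ a i + h) with hσ
    have hcorner : ∀ v ∈ corner σ, x + h' • v ∈ box a h := by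
      intro v hv
      refine ⟨fun i => ?_, fun i => ?_⟩ <;>
      · have h1 := hv.1 i
        have h2 := hv.2 i
        have h3 := hx.1 i
        have h4 : x i ≤ a i + h := hx.2 i
        simp only [hσ, decide_eq_true_eq] at h1 h2
        simp only [Pi.add_apply, Pi.smul_apply, smul_eq_mul]
        split_ifs at h1 h2 <;> nlinarith
    rw [quadForm_popGram]
    set F : Ctx d → ℝ := fun u => weight x h' u * polyVal δ (h'⁻¹ • (u - x)) ^ 2 with hF
    have hFm : Measurable F := (measurable_weight x h').mul
      ((measurable_polyVal_comp x h' δ).pow_const 2)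
    have hFb : ∀ u, |F u| ≤ (Fintype.card (Idx d p) * ‖δ‖) ^ 2 := by
      intro u
      refine (abs_weight_mul_le (M := (Fintype.card (Idx d p) * ‖δ‖) ^ 2) fun hv => ?_).trans ?_
      · rw [abs_pow]
        exact pow_le_pow_left₀ (abs_nonneg _) (abs_polyVal_le (fun s => norm_le_pi_norm δ s) hv) 2
      · exact mul_le_of_le_one_right (by positivity) (weight_le_one _ _ _)
    have hF0 : ∀ u, 0 ≤ F u := fun u => mul_nonneg (weight_nonneg _ _ _) (sq_nonneg _)
    have h1 : ∫ u, F u ∂(ENNReal.ofReal (ρlo / (ρhi * h ^ d)) • volume.restrict (box a h))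
        ≤ ∫ u, F u ∂(cond μ (box a h)) :=
      integral_mono_measure (le_cond_box hμ hlo hhi hh hB) (ae_of_all _ hF0)
        (Integrable.of_bound hFm.aestronglyMeasurable _ (ae_of_all _ hFb))
    rw [integral_smul_measure, ENNReal.toReal_ofReal (by positivity), smul_eq_mul] at h1
    have hFi : Integrable F (volume.restrict (box a h)) := by
      have : IsFiniteMeasure (volume.restrict (box a h)) := ⟨by
        rw [Measure.restrict_apply_univ, volume_box a hh.le]; exact ENNReal.ofReal_lt_top⟩
      exact Integrable.of_bound hFm.aestronglyMeasurable _ (ae_of_all _ hFb)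
    have h2 : h' ^ d * ∫ v in corner σ, polyVal δ v ^ 2 ≤ ∫ u in box a h, F u := by
      have e1 : h' ^ d * ∫ v in corner σ, polyVal δ v ^ 2
          = ∫ u, (corner σ).indicator (fun v => polyVal δ v ^ 2) (h'⁻¹ • (u - x)) := by
        rw [integral_sub_right_eq_self
          (fun u => (corner σ).indicator (fun v => polyVal δ v ^ 2) (h'⁻¹ • u)) x,
          Measure.integral_comp_inv_smul volume
          ((corner σ).indicator (fun v => polyVal δ v ^ 2)) h',
          integral_indicator (show MeasurableSet (corner σ) from measurableSet_Icc)]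
        simp [abs_of_pos hh']
      rw [e1, ← integral_indicator (measurableSet_box a h)]
      refine integral_mono_of_nonneg (ae_of_all _ fun u => ?_)
        ((integrable_indicator_iff (measurableSet_box a h)).2 hFi) (ae_of_all _ fun u => ?_)
      · exact Set.indicator_nonneg (fun _ _ => sq_nonneg _) _
      · by_cases hv : h'⁻¹ • (u - x) ∈ corner σ
        · have hu : u ∈ box a h := by
            have := hcorner _ hv
            rwa [smul_smul, mul_inv_cancel₀ hh'.ne', one_smul, add_sub_cancel] at this
          simp only [Set.indicator_of_mem hv, Set.indicator_of_mem hu, hF]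
          rw [weight_eq_ite, if_pos ((norm_le_of_mem_corner hv).trans (by norm_num)), one_mul]
        · simp only [Set.indicator_of_notMem hv]
          exact Set.indicator_nonneg (fun u _ => hF0 u) _
    calc ρlo / ρhi * c * (h' / h) ^ d * ∑ s, δ s ^ 2
        = ρlo / (ρhi * h ^ d) * (h' ^ d * (c * ∑ s, δ s ^ 2)) := by
          rw [div_pow]; field_simp
      _ ≤ ρlo / (ρhi * h ^ d) * ∫ u in box a h, F u := by
          refine mul_le_mul_of_nonneg_left (le_trans ?_ h2) (by positivity)
          exact mul_le_mul_of_nonneg_left (hco σ δ) (by positivity)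
      _ ≤ _ := h1
  mass := by
    have hhi0 : 0 < ρhi := hlo.trans_le hhi
    have h1 : ∫ u, weight x h' u ∂(cond μ (box a h))
        ≤ ∫ u, weight x h' u ∂(ENNReal.ofReal (ρhi / (ρlo * h ^ d)) • volume.restrict (box a h)) := by
      have : IsFiniteMeasure (volume.restrict (box a h)) := ⟨by
        rw [Measure.restrict_apply_univ, volume_box a hh.le]; exact ENNReal.ofReal_lt_top⟩
      have : IsFiniteMeasure (ENNReal.ofReal (ρhi / (ρlo * h ^ d)) • volume.restrict (box a h)) :=
        Measure.smul_finite _ ENNReal.ofReal_ne_top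
      refine integral_mono_measure (cond_box_le hμ hlo hhi hh hB)
        (ae_of_all _ fun u => weight_nonneg _ _ _) ?_
      refine Integrable.of_bound (measurable_weight x h').aestronglyMeasurable 1
        (ae_of_all _ fun u => ?_)
      rw [Real.norm_eq_abs, abs_of_nonneg (weight_nonneg _ _ _)]; exact weight_le_one _ _ _
    rw [integral_smul_measure, ENNReal.toReal_ofReal (by positivity), smul_eq_mul] at h1
    have h2 : ∫ u in box a h, weight x h' u ≤ (2 * h') ^ d := by
      have e1 : weight x h' = (Metric.closedBall x h').indicator fun _ => (1 : ℝ) := by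
        funext u
        classical
        rw [weight_eq_ite, Set.indicator_apply]
        have : ‖h'⁻¹ • (u - x)‖ ≤ 1 ↔ u ∈ Metric.closedBall x h' := by
          rw [norm_smul, norm_inv, Real.norm_of_nonneg hh'.le, inv_mul_le_iff₀ hh', mul_one,
            mem_closedBall_iff_norm]
        simp only [this]
      have hfin : volume (Metric.closedBall x h') ≠ ⊤ := by
        rw [Real.volume_pi_closedBall x hh'.le]; exact ENNReal.ofReal_ne_top
      rw [e1, integral_indicator Metric.isClosed_closedBall.measurableSet]
      rw [integral_const, smul_eq_mul, mul_one, measureReal_def, Measure.restrict_apply_univ]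
      refine (ENNReal.toReal_mono hfin (Measure.restrict_apply_le _ _)).trans (le_of_eq ?_)
      rw [Real.volume_pi_closedBall x hh'.le, ENNReal.toReal_ofReal (by positivity),
        Fintype.card_fin]
    refine h1.trans ?_
    calc ρhi / (ρlo * h ^ d) * ∫ u in box a h, weight x h' u
        ≤ ρhi / (ρlo * h ^ d) * (2 * h') ^ d :=
          mul_le_mul_of_nonneg_left h2 (by positivity)
      _ = _ := by rw [mul_pow, div_pow]; field_simp

end Cond

end Windows

/-! ### Approximation error of the population estimator on a box -/

/-- A box in the cube, a context law with bounded density, and the constant `c` of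
`exists_coercive_corner`. -/
structure BoxSetting (d p : ℕ) (ρlo ρhi c : ℝ) (μ : Measure (Ctx d)) (a : Ctx d) (h : ℝ) :
    Prop where
  density : HasBoundedDensity ρlo ρhi μ
  finite : IsFiniteMeasure μ
  ρlo_pos : 0 < ρlo
  ρlo_le : ρlo ≤ ρhi
  c_pos : 0 < c
  coercive : ∀ (σ : Fin d → Bool) (δ : Idx d p → ℝ),
      c * ∑ s, δ s ^ 2 ≤ ∫ v in corner σ, polyVal δ v ^ 2
  h_pos : 0 < h
  subset : box a h ⊆ cube d

/-- The bound of the coefficients of a least squares polynomial. -/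
def coefBound (d p : ℕ) (ρlo ρhi c : ℝ) : ℝ :=
  Fintype.card (Idx d p) * ((ρhi / ρlo * 2 ^ d) / (ρlo / ρhi * c))

lemma ae_mem_cond_box {d : ℕ} (μ : Measure (Ctx d)) (a : Ctx d) (h : ℝ) : ∀ᵐ u ∂(cond μ (box a h)), u ∈ box a h := by
  unfold ProbabilityTheory.cond
  exact (Measure.smul_absolutelyContinuous).ae_le (ae_restrict_mem (measurableSet_box a h))

namespace BoxSetting

variable {d p : ℕ} {ρlo ρhi c : ℝ} {μ : Measure (Ctx d)} {a : Ctx d} {h : ℝ}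
  (S : BoxSetting d p ρlo ρhi c μ a h)
include S

lemma ρhi_pos : 0 < ρhi := S.ρlo_pos.trans_le S.ρlo_le

lemma coefBound_nonneg : 0 ≤ coefBound d p ρlo ρhi c := by
  have h1 := S.ρlo_pos
  have h2 := S.ρhi_pos
  have h3 := S.c_pos
  unfold coefBound; positivity

lemma isProbabilityMeasure : IsProbabilityMeasure (cond μ (box a h)) := by
  have := S.finite
  exact cond_isProbabilityMeasure (measure_box_ne_zero S.density S.ρlo_pos S.h_pos S.subset)

lemma window {x : Ctx d} (hx : x ∈ box a h) {h' : ℝ} (hh' : 0 < h') (hle : h' ≤ h) :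
    GoodWindow p (cond μ (box a h)) x h' (ρlo / ρhi * c) (ρhi / ρlo * 2 ^ d) ((h' / h) ^ d) := by
  have := S.isProbabilityMeasure
  exact goodWindow_box S.density S.ρlo_pos S.ρlo_le S.h_pos S.subset S.c_pos S.coercive hx hh' hle

lemma window_self {x : Ctx d} (hx : x ∈ box a h) :
    GoodWindow p (cond μ (box a h)) x h (ρlo / ρhi * c) (ρhi / ρlo * 2 ^ d) 1 := by
  have := S.window hx S.h_pos le_rfl
  rwa [div_self S.h_pos.ne', one_pow] at this

variable {f : Ctx d → ℝ} {β L : ℝ}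

/-- The bias of the population estimator with bandwidth `h'` is of order `h' ^ β`. -/
lemma abs_popVal_sub_le (hf : Measurable f) (hf1 : ∀ u, |f u| ≤ 1) (hβ : 0 < β) (hL : 0 ≤ L)
    (hH : IsHolder β L f) (hp : strictFloor β ≤ p) {x : Ctx d} (hx : x ∈ box a h) {h' : ℝ}
    (hh' : 0 < h') (hle : h' ≤ h) :
    |popVal p (cond μ (box a h)) f x h' - f x| ≤ coefBound d p ρlo ρhi c * (L * h' ^ β) := by
  have := S.isProbabilityMeasure
  obtain ⟨θ, hθ0, hθ⟩ := hH.exists_approx hp (S.subset hx) hh'.ne'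
  rw [← hθ0]
  refine (S.window hx hh' hle).abs_popCoef_sub_le hf hf1 ?_ (by positivity) _
  filter_upwards [ae_mem_cond_box μ a h] with u hu hv
  refine (hθ u (S.subset hu)).trans (mul_le_mul_of_nonneg_left ?_ hL)
  refine Real.rpow_le_rpow (norm_nonneg _) ?_ hβ.le
  rwa [norm_smul, norm_inv, Real.norm_of_nonneg hh'.le, inv_mul_le_iff₀ hh', mul_one] at hv

lemma norm_inv_smul_le {x u : Ctx d} (hx : x ∈ box a h) (hu : u ∈ box a h) :
    ‖h⁻¹ • (u - x)‖ ≤ 1 := by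
  rw [norm_smul, norm_inv, Real.norm_of_nonneg S.h_pos.le, inv_mul_le_iff₀ S.h_pos, mul_one]
  exact norm_sub_le_of_mem_box S.h_pos.le hx hu

lemma norm_inv_smul_eq (x u : Ctx d) : ‖h⁻¹ • (u - x)‖ = ‖u - x‖ / h := by
  rw [norm_smul, norm_inv, Real.norm_of_nonneg S.h_pos.le, div_eq_inv_mul]

/-- With the bandwidth of the box, all windows of the box have the same least squares polynomial. -/
lemma popVal_eq_polyVal (hf : Measurable f) (hf1 : ∀ u, |f u| ≤ 1) {x x0 : Ctx d}
    (hx : x ∈ box a h) (hx0 : x0 ∈ box a h) :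
    popVal p (cond μ (box a h)) f x h
      = polyVal (popCoef p (cond μ (box a h)) f x0 h) (h⁻¹ • (x - x0)) := by
  have := S.isProbabilityMeasure
  have hint : ∀ y ∈ box a h, ∀ g : MvPolynomial (Fin d) ℝ,
      ∫ u, |f u - MvPolynomial.eval u g| ^ 2 * boxKernel (h⁻¹ • (y - u)) ∂(cond μ (box a h))
        = ∫ u, |f u - MvPolynomial.eval u g| ^ 2 ∂(cond μ (box a h)) := by
    intro y hy g
    refine integral_congr_ae ?_
    filter_upwards [ae_mem_cond_box μ a h] with u hu
    rw [boxKernel_sub_eq_weight, weight_eq_ite, if_pos (S.norm_inv_smul_le hy hu), mul_one]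
  have h1 := ((S.window_self hx0).minimizer_iff hf hf1
    (toMv x0 h (popCoef p (cond μ (box a h)) f x0 h))).2 rfl
  simp only [hint x0 hx0] at h1
  have h2 := (S.window_self hx).minimizer_iff hf hf1
    (toMv x0 h (popCoef p (cond μ (box a h)) f x0 h))
  simp only [hint x hx] at h2
  have h3 := h2.1 h1
  have h4 := congrArg (MvPolynomial.eval x) h3
  rw [eval_toMv, eval_toMv, sub_self, smul_zero, polyVal_zero_right] at h4
  rw [h4, popVal]

lemma abs_popVal_le (hf : Measurable f) (hf1 : ∀ u, |f u| ≤ 1) {x : Ctx d} (hx : x ∈ box a h) :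
    |popVal p (cond μ (box a h)) f x h| ≤ coefBound d p ρlo ρhi c := by
  have := S.isProbabilityMeasure
  exact (S.window_self hx).abs_popCoef_le hf hf1 _

lemma abs_popVal_sub_popVal_le (hf : Measurable f) (hf1 : ∀ u, |f u| ≤ 1) {x x' : Ctx d}
    (hx : x ∈ box a h) (hx' : x' ∈ box a h) :
    |popVal p (cond μ (box a h)) f x' h - popVal p (cond μ (box a h)) f x h|
      ≤ Fintype.card (Idx d p) * coefBound d p ρlo ρhi c * (‖x' - x‖ / h) := by
  have := S.isProbabilityMeasure
  have h1 := abs_polyVal_sub_le (fun s => (S.window_self hx).abs_popCoef_le hf hf1 s)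
    (S.norm_inv_smul_le hx hx')
  rw [S.norm_inv_smul_eq, ← S.popVal_eq_polyVal hf hf1 hx' hx, polyVal_zero_right] at h1
  exact h1

/-- The approximation error of the least squares polynomial of the box varies at the scale `h ^ β`,
even though the payoff itself may vary faster. -/
lemma abs_error_sub_le (hf : Measurable f) (hf1 : ∀ u, |f u| ≤ 1) (hβ : 0 < β) (hL : 0 ≤ L)
    (hH : IsHolder β L f) (hp : strictFloor β ≤ p) {x x' : Ctx d} (hx : x ∈ box a h)
    (hx' : x' ∈ box a h) :
    |(f x' - popVal p (cond μ (box a h)) f x' h) - (f x - popVal p (cond μ (box a h)) f x h)|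
      ≤ (L * (‖x' - x‖ / h) ^ β +
        Fintype.card (Idx d p) * (coefBound d p ρlo ρhi c * L) * (‖x' - x‖ / h)) * h ^ β := by
  have := S.isProbabilityMeasure
  have hh := S.h_pos
  obtain ⟨θ, hθ0, hθ⟩ := hH.exists_approx hp (S.subset hx) hh.ne'
  set η := popCoef p (cond μ (box a h)) f x h with hη
  have h1 : ∀ s, |(η - θ) s| ≤ coefBound d p ρlo ρhi c * (L * h ^ β) := by
    intro s
    refine (S.window_self hx).abs_popCoef_sub_le hf hf1 ?_ (by positivity) s
    filter_upwards [ae_mem_cond_box μ a h] with u hu hv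
    refine (hθ u (S.subset hu)).trans (mul_le_mul_of_nonneg_left ?_ hL)
    exact Real.rpow_le_rpow (norm_nonneg _) (norm_sub_le_of_mem_box hh.le hx hu) hβ.le
  have h2 := abs_polyVal_sub_le h1 (S.norm_inv_smul_le hx hx')
  rw [S.norm_inv_smul_eq, polyVal_sub, polyVal_sub, ← S.popVal_eq_polyVal hf hf1 hx' hx,
    polyVal_zero_right, polyVal_zero_right, hθ0] at h2
  have h3 := hθ x' (S.subset hx')
  have h4 : L * ‖x' - x‖ ^ β = L * (‖x' - x‖ / h) ^ β * h ^ β := by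
    rw [Real.div_rpow (norm_nonneg _) hh.le]
    field_simp
  rw [h4] at h3
  have h5 : (f x' - popVal p (cond μ (box a h)) f x' h) - (f x - popVal p (cond μ (box a h)) f x h)
      = (f x' - polyVal θ (h⁻¹ • (x' - x)))
        - ((popVal p (cond μ (box a h)) f x' h - polyVal θ (h⁻¹ • (x' - x)))
          - (η (idxZero d p) - f x)) := by
    simp only [popVal, hη]; ring
  rw [h5]
  refine (abs_sub _ _).trans ?_
  calc _ ≤ _ := add_le_add h3 h2
    _ = _ := by ring

end BoxSetting

/-- Truncation does not hide the approximation error. The estimator is truncated to `[0,1]`, and so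
the test compares truncated polynomials, while self-similarity concerns the polynomials themselves.
If the truncated least squares polynomial `g` were close to `f` everywhere, then `f - g` would be
nearly `trunc g - g`, which has a negative inner product with `g - 1/2`; but the residual is
orthogonal to polynomials. -/
lemma exists_trunc_error (d p : ℕ) {ρlo ρhi c β L b : ℝ} (hlo : 0 < ρlo) (hhi : ρlo ≤ ρhi)
    (hc : 0 < c) (hβ : 0 < β) (hL : 0 < L) (hb : 0 < b) (hp : strictFloor β ≤ p) :
    ∃ ε : ℝ, 0 < ε ∧ ∀ (μ : Measure (Ctx d)) (a : Ctx d) (h : ℝ) (f : Ctx d → ℝ),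
      BoxSetting d p ρlo ρhi c μ a h → Measurable f → (∀ u, 0 ≤ f u ∧ f u ≤ 1) →
      IsHolder β L f → (∃ x ∈ box a h, b * h ^ β ≤ |popVal p (cond μ (box a h)) f x h - f x|) →
      ∃ x ∈ box a h, ε * h ^ β ≤ |trunc (popVal p (cond μ (box a h)) f x h) - f x| := by
  set M := coefBound d p ρlo ρhi c with hM
  have hhi0 : 0 < ρhi := hlo.trans_le hhi
  have hM0 : 0 ≤ M := by rw [hM, coefBound]; positivity
  set N : ℝ := (Fintype.card (Idx d p) : ℝ) with hN
  have hN0 : 0 ≤ N := by positivity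
  obtain ⟨κ, hκ0, hκ1, hκ⟩ : ∃ κ : ℝ, 0 < κ ∧ κ ≤ 1 ∧
      L * κ ^ β + N * (M * L) * κ ≤ b / 2 := by
    have hcont : Tendsto (fun κ : ℝ => L * κ ^ β + N * (M * L) * κ) (𝓝[>] 0) (𝓝 0) := by
      have h1 : Tendsto (fun κ : ℝ => κ ^ β) (𝓝[>] 0) (𝓝 0) := by
        have := (Real.continuousAt_rpow_const 0 β (Or.inr hβ.le)).tendsto
        rw [Real.zero_rpow hβ.ne'] at this
        exact this.mono_left nhdsWithin_le_nhds
      have h2 : Tendsto (fun κ : ℝ => κ) (𝓝[>] 0) (𝓝 0) := nhdsWithin_le_nhds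
      simpa using (h1.const_mul L).add (h2.const_mul (N * (M * L)))
    have h1 := hcont.eventually (gt_mem_nhds (show (0 : ℝ) < b / 2 by positivity))
    have h2 : ∀ᶠ κ : ℝ in 𝓝[>] 0, κ ∈ Set.Ioc (0 : ℝ) 1 := Ioc_mem_nhdsGT one_pos
    obtain ⟨κ, h3, h4⟩ := (h1.and h2).exists
    exact ⟨κ, h4.1, h4.2, h3.le⟩
  have hK : 0 < ρlo / ρhi * c * κ ^ d := by positivity
  -- `K` bounds from below the mass of a window of relative size `κ`, on which the error of `g` is
  -- still at least half of its value at `x0`.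
  set K := ρlo / ρhi * c * κ ^ d with hKd
  refine ⟨min (b / 4) (K * b / (16 * (M + 1))), by positivity, ?_⟩
  intro μ a h f S hf hf01 hH ⟨x0, hx0, hbx⟩
  have := S.isProbabilityMeasure
  have hf1 : ∀ u, |f u| ≤ 1 := fun u => abs_le.2 ⟨by linarith [(hf01 u).1], (hf01 u).2⟩
  by_contra hcon
  push Not at hcon
  set ε := min (b / 4) (K * b / (16 * (M + 1))) with hε
  set ν := cond μ (box a h) with hν
  set θ := popCoef p ν f x0 h with hθ
  set g : Ctx d → ℝ := fun u => polyVal θ (h⁻¹ • (u - x0)) with hg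
  have hgu : ∀ u ∈ box a h, popVal p ν f u h = g u := fun u hu => S.popVal_eq_polyVal hf hf1 hu hx0
  have hgm : Measurable g := measurable_polyVal_comp x0 h θ
  have hgb : ∀ u ∈ box a h, |g u| ≤ M := fun u hu => by
    rw [← hgu u hu]; exact S.abs_popVal_le hf hf1 hu
  have hδ : 0 < h ^ β := Real.rpow_pos_of_pos S.h_pos _
  -- the residual is orthogonal to `g - 1/2`
  have horth : ∫ u, (f u - g u) * (g u - 1 / 2) ∂ν = 0 := by
    set η : Idx d p → ℝ := θ - Pi.single (idxZero d p) (1 / 2) with hη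
    have h1 : ∀ᵐ u ∂ν, (f u - g u) * (g u - 1 / 2)
        = ∑ s, η s * (weight x0 h u * feat x0 h s u * (f u - g u)) := by
      filter_upwards [ae_mem_cond_box μ a h] with u hu
      have hw : weight x0 h u = 1 := by
        rw [weight_eq_ite, if_pos (S.norm_inv_smul_le hx0 hu)]
      have h2 : g u - 1 / 2 = polyVal η (h⁻¹ • (u - x0)) := by
        rw [hη, polyVal_sub, polyVal_single]
      rw [h2, polyVal, Finset.mul_sum]
      refine Finset.sum_congr rfl fun s _ => ?_
      rw [hw]; simp only [feat]; ring
    rw [integral_congr_ae h1, integral_finsetSum]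
    · refine Finset.sum_eq_zero fun s _ => ?_
      rw [integral_const_mul, (S.window_self hx0).integral_residual_eq_zero hf hf1, mul_zero]
    · intro s _
      refine (integrable_weight_feat_mul x0 h s (hf.sub hgm)
        (M := 1 + Fintype.card (Idx d p) * M) fun u hu => ?_).const_mul _
      refine (abs_sub _ _).trans (add_le_add (hf1 u) ?_)
      exact abs_polyVal_le (fun s => (S.window_self hx0).abs_popCoef_le hf hf1 s) hu
  have htm : Measurable fun u => trunc (g u) := by
    unfold trunc
    exact measurable_const.max (measurable_const.min hgm)
  have hbound : ∀ {F : Ctx d → ℝ} (C : ℝ), Measurable F → (∀ u ∈ box a h, |F u| ≤ C) →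
      Integrable F ν := by
    intro F C hF hC
    refine Integrable.of_bound hF.aestronglyMeasurable C ?_
    filter_upwards [ae_mem_cond_box μ a h] with u hu
    exact hC u hu
  have htb : ∀ u, |trunc (g u)| ≤ 1 := fun u =>
    abs_le.2 ⟨by linarith [trunc_nonneg (g u)], trunc_le_one _⟩
  have hI1 : Integrable (fun u => (f u - trunc (g u)) * (g u - 1 / 2)) ν := by
    refine hbound ((1 + 1) * (M + 1 / 2)) ((hf.sub htm).mul (hgm.sub_const _)) fun u hu => ?_
    rw [abs_mul]
    refine mul_le_mul ((abs_sub _ _).trans (add_le_add (hf1 u) (htb u)))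
      ((abs_sub _ _).trans (add_le_add (hgb u hu) (by norm_num [abs_of_pos]))) (abs_nonneg _)
      (by norm_num)
  have hI2 : Integrable (fun u => (g u - trunc (g u)) * (g u - 1 / 2)) ν := by
    refine hbound ((M + 1) * (M + 1 / 2)) ((hgm.sub htm).mul (hgm.sub_const _)) fun u hu => ?_
    rw [abs_mul]
    refine mul_le_mul ((abs_sub _ _).trans (add_le_add (hgb u hu) (htb u)))
      ((abs_sub _ _).trans (add_le_add (hgb u hu) (by norm_num [abs_of_pos]))) (abs_nonneg _)
      (by positivity)
  have heq : ∫ u, (g u - trunc (g u)) * (g u - 1 / 2) ∂ν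
      = ∫ u, (f u - trunc (g u)) * (g u - 1 / 2) ∂ν := by
    have h1 := integral_sub hI1 hI2
    have h2 : ∀ u, (f u - trunc (g u)) * (g u - 1 / 2) - (g u - trunc (g u)) * (g u - 1 / 2)
        = (f u - g u) * (g u - 1 / 2) := fun u => by ring
    simp_rw [h2] at h1
    rw [horth] at h1
    linarith
  have hup : ∫ u, (f u - trunc (g u)) * (g u - 1 / 2) ∂ν ≤ ε * h ^ β * (M + 1) := by
    calc ∫ u, (f u - trunc (g u)) * (g u - 1 / 2) ∂ν ≤ ∫ _u, ε * h ^ β * (M + 1) ∂ν := by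
          refine integral_mono_ae hI1 (integrable_const _) ?_
          filter_upwards [ae_mem_cond_box μ a h] with u hu
          refine (le_abs_self _).trans ?_
          rw [abs_mul]
          have h1 := hcon u hu
          rw [hgu u hu, abs_sub_comm] at h1
          refine mul_le_mul h1.le ((abs_sub _ _).trans (add_le_add (hgb u hu) ?_)) (abs_nonneg _)
            (by positivity)
          norm_num [abs_of_pos]
      _ = _ := by simp
  have hdown : (b / 8) * h ^ β * K ≤ ∫ u, (g u - trunc (g u)) * (g u - 1 / 2) ∂ν := by
    have W := S.window hx0 (mul_pos hκ0 S.h_pos)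
      (by nlinarith [S.h_pos] : κ * h ≤ h)
    have h1 := W.coercive (Pi.single (idxZero d p) 1)
    rw [quadForm_popGram] at h1
    simp only [polyVal_single, one_pow, mul_one] at h1
    have h2 : ∑ s, (Pi.single (idxZero d p) (1 : ℝ) : Idx d p → ℝ) s ^ 2 = 1 := by
      rw [Finset.sum_eq_single (idxZero d p)] <;> simp +contextual
    rw [h2, mul_one, mul_div_assoc, div_self S.h_pos.ne', mul_one, ← hKd] at h1
    calc (b / 8) * h ^ β * K ≤ (b / 8) * h ^ β * ∫ u, weight x0 (κ * h) u ∂ν :=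
          mul_le_mul_of_nonneg_left h1 (by positivity)
      _ = ∫ u, (b / 8) * h ^ β * weight x0 (κ * h) u ∂ν := (integral_const_mul _ _).symm
      _ ≤ _ := by
          refine integral_mono_ae ((integrable_weight _ _).const_mul _) hI2 ?_
          filter_upwards [ae_mem_cond_box μ a h] with u hu
          have hsign : |g u - trunc (g u)| / 2 ≤ (g u - trunc (g u)) * (g u - 1 / 2) := by
            unfold trunc
            rcases le_total (g u) 0 with h0 | h0
            · rw [min_eq_right (h0.trans zero_le_one), max_eq_left h0, sub_zero, abs_of_nonpos h0]
              nlinarith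
            · rcases le_total (g u) 1 with h1 | h1
              · rw [min_eq_right h1, max_eq_right h0]; simp
              · rw [min_eq_left h1, max_eq_right zero_le_one, abs_of_nonneg (by linarith)]
                nlinarith
          refine le_trans ?_ hsign
          rw [weight_eq_ite]
          split_ifs with hw
          · rw [norm_smul, norm_inv, Real.norm_of_nonneg (by have := S.h_pos; positivity),
              inv_mul_le_iff₀ (mul_pos hκ0 S.h_pos), mul_one] at hw
            have hv : ‖u - x0‖ / h ≤ κ := by rwa [div_le_iff₀ S.h_pos]
            have he := S.abs_error_sub_le hf hf1 hβ hL.le hH hp hx0 hu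
            have he2 : (L * (‖u - x0‖ / h) ^ β +
                Fintype.card (Idx d p) * (coefBound d p ρlo ρhi c * L) * (‖u - x0‖ / h)) * h ^ β
                ≤ b / 2 * h ^ β := by
              refine mul_le_mul_of_nonneg_right (le_trans ?_ hκ) hδ.le
              refine add_le_add (mul_le_mul_of_nonneg_left ?_ hL.le)
                (mul_le_mul_of_nonneg_left hv (by positivity))
              exact Real.rpow_le_rpow (div_nonneg (norm_nonneg _) S.h_pos.le) hv hβ.le
            have he3 := he.trans he2
            have h3 := hcon u hu
            rw [hgu u hu] at h3 he3
            have h4 : ε * h ^ β ≤ b / 4 * h ^ β :=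
              mul_le_mul_of_nonneg_right (min_le_left _ _) hδ.le
            rw [abs_sub_comm] at hbx
            have h5 : b / 4 * h ^ β ≤ |g u - trunc (g u)| := by
              have e1 : |f x0 - popVal p ν f x0 h| ≤ |(f u - g u) - (f x0 - popVal p ν f x0 h)|
                  + |trunc (g u) - f u| + |g u - trunc (g u)| := by
                have : f x0 - popVal p ν f x0 h = -((f u - g u) - (f x0 - popVal p ν f x0 h))
                  - (trunc (g u) - f u) - (g u - trunc (g u)) := by ring
                calc |f x0 - popVal p ν f x0 h| = _ := congrArg abs this
                  _ ≤ |-((f u - g u) - (f x0 - popVal p ν f x0 h)) - (trunc (g u) - f u)|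
                      + |g u - trunc (g u)| := abs_sub _ _
                  _ ≤ _ := by
                    gcongr
                    refine (abs_sub _ _).trans ?_
                    rw [abs_neg]
              linarith
            linarith
          · rw [mul_zero]; positivity
  have hfin : (b / 8) * h ^ β * K ≤ ε * h ^ β * (M + 1) := by
    rw [heq] at hdown; exact hdown.trans hup
  have h1 : ε ≤ K * b / (16 * (M + 1)) := min_le_right _ _
  have h2 : ε * (M + 1) ≤ K * b / 16 := by
    calc ε * (M + 1) ≤ K * b / (16 * (M + 1)) * (M + 1) :=
          mul_le_mul_of_nonneg_right h1 (by positivity)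
      _ = _ := by field_simp
  have h3 : 0 < K * b * h ^ β := by positivity
  nlinarith

/-- The truncated approximation error persists nearby. -/
lemma BoxSetting.le_trunc_error_of_near {d p : ℕ} {ρlo ρhi c β L ε κ : ℝ} {μ : Measure (Ctx d)}
    {a : Ctx d} {h : ℝ} {f : Ctx d → ℝ} (S : BoxSetting d p ρlo ρhi c μ a h) (hf : Measurable f)
    (hf01 : ∀ u, 0 ≤ f u ∧ f u ≤ 1) (hβ : 0 < β) (hL : 0 ≤ L) (hH : IsHolder β L f)
    (hp : strictFloor β ≤ p) {x x' : Ctx d} (hx : x ∈ box a h) (hx' : x' ∈ box a h)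
    (hε : ε * h ^ β ≤ |trunc (popVal p (cond μ (box a h)) f x h) - f x|)
    (hκ : ‖x' - x‖ / h ≤ κ)
    (hκ1 : L * κ ^ β + Fintype.card (Idx d p) * (coefBound d p ρlo ρhi c * L) * κ ≤ ε / 4)
    (hκ2 : 2 * (Fintype.card (Idx d p) * coefBound d p ρlo ρhi c * (‖x' - x‖ / h)) ≤ ε / 4 * h ^ β) :
    ε / 2 * h ^ β ≤ |trunc (popVal p (cond μ (box a h)) f x' h) - f x'| := by
  have hf1 : ∀ u, |f u| ≤ 1 := fun u => abs_le.2 ⟨by linarith [(hf01 u).1], (hf01 u).2⟩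
  set g := fun u => popVal p (cond μ (box a h)) f u h with hg
  have h1 := S.abs_popVal_sub_popVal_le hf hf1 hx hx'
  have h2 := S.abs_error_sub_le hf hf1 hβ hL hH hp hx hx'
  have hδ : 0 < h ^ β := Real.rpow_pos_of_pos S.h_pos _
  have hM := S.coefBound_nonneg
  have h3 : (L * (‖x' - x‖ / h) ^ β +
      Fintype.card (Idx d p) * (coefBound d p ρlo ρhi c * L) * (‖x' - x‖ / h)) * h ^ β
      ≤ ε / 4 * h ^ β := by
    refine mul_le_mul_of_nonneg_right (le_trans ?_ hκ1) hδ.le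
    refine add_le_add (mul_le_mul_of_nonneg_left ?_ hL)
      (mul_le_mul_of_nonneg_left hκ (by positivity))
    exact Real.rpow_le_rpow (div_nonneg (norm_nonneg _) S.h_pos.le) hκ hβ.le
  have h4 := abs_trunc_sub_le (g x') (g x)
  change |g x' - g x| ≤ _ at h1
  change |(f x' - g x') - (f x - g x)| ≤ _ at h2
  change ε * h ^ β ≤ |trunc (g x) - f x| at hε
  change ε / 2 * h ^ β ≤ |trunc (g x') - f x'|
  have e : trunc (g x) - f x = (trunc (g x') - f x') - (trunc (g x') - trunc (g x))
      + ((f x' - g x') - (f x - g x)) + (g x' - g x) := by ring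
  have h5 : |trunc (g x) - f x| ≤ |trunc (g x') - f x'| + |trunc (g x') - trunc (g x)|
      + |(f x' - g x') - (f x - g x)| + |g x' - g x| := by
    rw [e]
    refine (abs_add_le _ _).trans (add_le_add ?_ le_rfl)
    refine (abs_add_le _ _).trans (add_le_add ?_ le_rfl)
    exact abs_sub _ _
  linarith

/-! ### Independent sequences -/

section Sequences

variable {S : Type*}

/-- The sequence that follows `ω` for `τ` periods and then starts `ω'` afresh. -/
def glue (τ : ℕ) (ω ω' : ℕ → S) : ℕ → S := fun i => if i < τ then ω i else ω' (i - τ)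

lemma glue_of_lt {τ i : ℕ} (h : i < τ) (ω ω' : ℕ → S) : glue τ ω ω' i = ω i := if_pos h

lemma glue_add (τ i : ℕ) (ω ω' : ℕ → S) : glue τ ω ω' (τ + i) = ω' i := by
  simp [glue]

variable [MeasurableSpace S]

lemma measurable_glue (τ : ℕ) :
    Measurable fun z : (ℕ → S) × (ℕ → S) => glue τ z.1 z.2 := by
  refine measurable_pi_iff.2 fun i => ?_
  unfold glue
  split_ifs
  · exact (measurable_pi_apply i).comp measurable_fst
  · exact (measurable_pi_apply (i - τ)).comp measurable_snd

/-- An i.i.d. sequence starts afresh, independently of the past, at each deterministic time. -/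
lemma measurePreserving_glue (μ : Measure S) [IsProbabilityMeasure μ] (τ : ℕ) :
    MeasurePreserving (fun z : (ℕ → S) × (ℕ → S) => glue τ z.1 z.2)
      ((Measure.infinitePi fun _ : ℕ => μ).prod (Measure.infinitePi fun _ : ℕ => μ))
      (Measure.infinitePi fun _ : ℕ => μ) := by
  refine ⟨measurable_glue τ, ?_⟩
  refine Measure.eq_infinitePi (fun _ : ℕ => μ) fun s t ht => ?_
  have hms : MeasurableSet (Set.pi (s : Set ℕ) t) :=
    MeasurableSet.pi s.countable_toSet fun i _ => ht i
  rw [Measure.map_apply (measurable_glue τ) hms]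
  have hpre : (fun z : (ℕ → S) × (ℕ → S) => glue τ z.1 z.2) ⁻¹' (Set.pi (s : Set ℕ) t)
      = (Set.pi ((s.filter (· < τ) : Finset ℕ) : Set ℕ) t) ×ˢ
        (Set.pi (((s.filter (¬ · < τ)).image (· - τ) : Finset ℕ) : Set ℕ) fun j => t (j + τ)) := by
    ext ⟨ω, ω'⟩
    simp only [Set.mem_preimage, Set.mem_pi, Set.mem_prod, Finset.mem_coe, Finset.mem_filter,
      Finset.mem_image]
    constructor
    · intro h
      refine ⟨fun i hi => ?_, ?_⟩
      · have := h i hi.1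
        rwa [glue_of_lt hi.2] at this
      · rintro j ⟨i, ⟨hi, hiτ⟩, rfl⟩
        have h1 := h i hi
        have h2 : i = τ + (i - τ) := by omega
        rw [h2, glue_add] at h1
        rwa [show i - τ + τ = τ + (i - τ) by omega]
    · rintro ⟨h1, h2⟩ i hi
      by_cases hiτ : i < τ
      · rw [glue_of_lt hiτ]; exact h1 i ⟨hi, hiτ⟩
      · have h3 := h2 (i - τ) ⟨i, ⟨hi, hiτ⟩, rfl⟩
        have h4 : i = τ + (i - τ) := by omega
        rw [show i - τ + τ = i by omega] at h3
        rw [h4, glue_add, ← h4]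
        exact h3
  rw [hpre, Measure.prod_prod, Measure.infinitePi_pi, Measure.infinitePi_pi]
  · rw [Finset.prod_image, ← Finset.prod_filter_mul_prod_filter_not s (· < τ)]
    · congr 1
      refine Finset.prod_congr rfl fun i hi => ?_
      have := (Finset.mem_filter.1 hi).2
      rw [show i - τ + τ = i by omega]
    · intro i hi j hj hij
      have h1 := (Finset.mem_filter.1 hi).2
      have h2 := (Finset.mem_filter.1 hj).2
      simp only at hij
      omega
  · intro i _; exact ht _
  · intro i _; exact ht _

lemma lintegral_head_tail (μ : Measure S) [IsProbabilityMeasure μ]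
    {K : S → (ℕ → S) → ENNReal} (hK : Measurable (Function.uncurry K)) :
    ∫⁻ ω, K (ω 0) (fun i => ω (i + 1)) ∂(Measure.infinitePi fun _ : ℕ => μ)
      = ∫⁻ s, ∫⁻ ω, K s ω ∂(Measure.infinitePi fun _ : ℕ => μ) ∂μ := by
  have hm : Measurable fun ω : ℕ → S => K (ω 0) (fun i => ω (i + 1)) := by
    refine hK.comp (Measurable.prodMk (measurable_pi_apply 0) ?_)
    exact measurable_pi_iff.2 fun i => measurable_pi_apply (i + 1)
  rw [← (measurePreserving_glue μ 1).lintegral_comp hm, lintegral_prod]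
  · have h1 : ∀ ω ω' : ℕ → S, K (glue 1 ω ω' 0) (fun i => glue 1 ω ω' (i + 1)) = K (ω 0) ω' := by
      intro ω ω'
      congr 1
    simp_rw [h1]
    have h2 : Measurable fun s => ∫⁻ ω, K s ω ∂(Measure.infinitePi fun _ : ℕ => μ) :=
      hK.lintegral_prod_right'
    rw [← lintegral_map h2 (measurable_pi_apply 0), Measure.infinitePi_map_eval]
  · exact (hm.comp (measurable_glue 1)).aemeasurable

end Sequences

section Counting

variable {d : ℕ}

/-- One period: the context and the two potential rewards. -/
abbrev Period (d : ℕ) : Type := Ctx d × (Bool × Bool)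

open Classical in
/-- The number of the first `t` contexts that lie in `V`. -/
def count (V : Set (Ctx d)) (ω : ℕ → Period d) (t : ℕ) : ℕ :=
  ∑ i ∈ Finset.range t, if (ω i).1 ∈ V then 1 else 0

open Classical in
lemma count_succ (V : Set (Ctx d)) (ω : ℕ → Period d) (t : ℕ) :
    count V ω (t + 1) = count V ω t + if (ω t).1 ∈ V then 1 else 0 := Finset.sum_range_succ _ _

open Classical in
lemma count_succ' (V : Set (Ctx d)) (ω : ℕ → Period d) (t : ℕ) :
    count V ω (t + 1) = (if (ω 0).1 ∈ V then 1 else 0) + count V (fun i => ω (i + 1)) t := by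
  unfold count
  rw [Finset.sum_range_succ', add_comm]

lemma measurable_count {V : Set (Ctx d)} (hV : MeasurableSet V) (t : ℕ) :
    Measurable fun ω : ℕ → Period d => count V ω t := by
  unfold count
  refine Finset.measurable_sum _ fun i _ => Measurable.ite ?_ measurable_const measurable_const
  exact (measurable_fst.comp (measurable_pi_apply i)) hV

/-- A product of factors with conditional mean at most `1` has mean at most `1`; each factor may
depend on the current period and on the number of earlier visits to `V`. -/
lemma lintegral_prod_count_le_one (P : Problem d) {V : Set (Ctx d)} (hV : MeasurableSet V)
    {F : ℕ → Period d → ENNReal} (hF : ∀ c, Measurable (F c))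
    (hle : ∀ c, ∫⁻ s, F c s ∂P.stepLaw ≤ 1) (n : ℕ) :
    ∀ k, ∫⁻ ω, ∏ t ∈ Finset.range n, F (k + count V ω t) (ω t) ∂P.law ≤ 1 := by
  classical
  have hFu : Measurable (Function.uncurry F) := measurable_from_prod_countable_right hF
  induction n with
  | zero => intro k; simp [Problem.law]
  | succ n ih =>
    intro k
    set K : Period d → (ℕ → Period d) → ENNReal := fun s ω =>
      (∏ t ∈ Finset.range n, F (k + ((if s.1 ∈ V then 1 else 0) + count V ω t)) (ω t)) * F k s
      with hK
    have h1 : ∀ ω : ℕ → Period d, ∏ t ∈ Finset.range (n + 1), F (k + count V ω t) (ω t)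
        = K (ω 0) (fun i => ω (i + 1)) := by
      intro ω
      rw [Finset.prod_range_succ']
      simp only [hK, count_succ']
      simp [count]
    have hKm : Measurable (Function.uncurry K) := by
      refine Measurable.mul ?_ ((hF k).comp measurable_fst)
      refine Finset.measurable_prod _ fun t _ => ?_
      refine hFu.comp (Measurable.prodMk ?_ ((measurable_pi_apply t).comp measurable_snd))
      refine Measurable.const_add (Measurable.add ?_ ((measurable_count hV t).comp measurable_snd)) k
      exact Measurable.ite ((measurable_fst.comp measurable_fst) hV) measurable_const
        measurable_const
    simp_rw [h1]
    unfold Problem.law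
    rw [lintegral_head_tail _ hKm]
    refine le_trans (lintegral_mono fun s => ?_) (hle k)
    simp only [hK]
    rw [lintegral_mul_const'']
    · calc _ ≤ 1 * F k s := by
            refine mul_le_mul_left ?_ _
            have := ih (k + if s.1 ∈ V then 1 else 0)
            simp_rw [add_assoc] at this
            exact this
        _ = F k s := one_mul _
    · refine (Finset.measurable_prod _ fun t _ => ?_).aemeasurable
      exact hFu.comp (Measurable.prodMk (((measurable_count hV t).const_add _).const_add _)
        (measurable_pi_apply t))

open Classical in
/-- The samples of arm `k` at the contexts that lie in `V`, restricted to those visits of `V` whose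
number satisfies `ph`; the latest sample comes first. -/
def samples (V : Set (Ctx d)) (ph : ℕ → Prop) (k : Fin 2) (ω : ℕ → Period d) :
    ℕ → List (Ctx d × Bool)
  | 0 => []
  | t + 1 => if (ω t).1 ∈ V ∧ ph (count V ω t) then
      ((ω t).1, potential (ω t).2 k) :: samples V ph k ω t else samples V ph k ω t

lemma measurable_potential (k : Fin 2) : Measurable fun y : Bool × Bool => potential y k :=
  measurable_of_countable _

lemma exp_le_one_add_add_sq {x : ℝ} (hx : |x| ≤ 1) : Real.exp x ≤ 1 + x + x ^ 2 := by
  have := abs_le.1 (Real.abs_exp_sub_one_sub_id_le hx)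
  linarith [this.2]

/-- Markov's inequality on the exponential scale. -/
lemma measure_exp_le_of_lintegral_le_one {Ω : Type*} [MeasurableSpace Ω] {μ : Measure Ω}
    {W : Ω → ENNReal} (hW : Measurable W) (h : ∫⁻ ω, W ω ∂μ ≤ 1) (e : ℝ) :
    μ {ω | ENNReal.ofReal (Real.exp e) ≤ W ω} ≤ ENNReal.ofReal (Real.exp (-e)) := by
  have he0 : ENNReal.ofReal (Real.exp e) ≠ 0 := (ENNReal.ofReal_pos.2 (Real.exp_pos _)).ne'
  refine (meas_ge_le_lintegral_div hW.aemeasurable he0 ENNReal.ofReal_ne_top).trans ?_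
  rw [Real.exp_neg, ENNReal.ofReal_inv_of_pos (Real.exp_pos _), ← one_div]
  exact ENNReal.div_le_div_right h _

/-- Bernstein's inequality for the samples of a phase. -/
lemma law_samples_sum_ge_le (P : Problem d) {V : Set (Ctx d)} (hV : MeasurableSet V)
    (ph : ℕ → Prop) (k : Fin 2) {Z : Ctx d × Bool → ℝ} (hZ : Measurable Z) {M v lam : ℝ}
    (hM : ∀ z, |Z z| ≤ M)
    (hmean : ∫ s in {s : Period d | s.1 ∈ V}, Z (s.1, potential s.2 k) ∂P.stepLaw = 0)
    (hvar : ∫ s in {s : Period d | s.1 ∈ V}, Z (s.1, potential s.2 k) ^ 2 ∂P.stepLaw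
      ≤ v * P.stepLaw.real {s : Period d | s.1 ∈ V})
    (hlam : 0 ≤ lam) (hlamM : lam * M ≤ 1) (n N : ℕ) (a : ℝ) :
    P.law {ω | (samples V ph k ω n).length = N ∧ a ≤ ((samples V ph k ω n).map Z).sum}
      ≤ ENNReal.ofReal (Real.exp (-lam * a + lam ^ 2 * v * N)) := by
  classical
  set Vs : Set (Period d) := {s | s.1 ∈ V} with hVs
  have hVsm : MeasurableSet Vs := measurable_fst hV
  set Y : Period d → ℝ := fun s => Z (s.1, potential s.2 k) with hY
  have hYm : Measurable Y :=
    hZ.comp (measurable_fst.prodMk ((measurable_potential k).comp measurable_snd))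
  have hYM : ∀ s, |lam * Y s| ≤ 1 := fun s => by
    rw [abs_mul, abs_of_nonneg hlam]
    exact (mul_le_mul_of_nonneg_left (hM _) hlam).trans hlamM
  set F : ℕ → Period d → ENNReal := fun c s =>
    if ph c ∧ s ∈ Vs then ENNReal.ofReal (Real.exp (lam * Y s - lam ^ 2 * v)) else 1 with hF
  have hFm : ∀ c, Measurable (F c) := by
    intro c
    refine Measurable.ite ?_ ?_ measurable_const
    · by_cases hc : ph c
      · simpa [hc] using hVsm
      · simp [hc]
    · exact ENNReal.measurable_ofReal.comp
        (Real.measurable_exp.comp ((hYm.const_mul lam).sub_const _))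
  have hFle : ∀ c, ∫⁻ s, F c s ∂P.stepLaw ≤ 1 := by
    intro c
    by_cases hc : ph c
    · have hb : ∀ s, F c s ≤ ENNReal.ofReal (1 + Vs.indicator (fun s =>
          Real.exp (-(lam ^ 2 * v)) * (1 + lam * Y s + (lam * Y s) ^ 2) - 1) s) := by
        intro s
        simp only [hF, hc, true_and]
        split_ifs with hs
        · rw [Set.indicator_of_mem hs]
          refine ENNReal.ofReal_le_ofReal ?_
          rw [sub_eq_add_neg, add_comm, Real.exp_add]
          have := mul_le_mul_of_nonneg_left (exp_le_one_add_add_sq (hYM s))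
            (Real.exp_pos (-(lam ^ 2 * v))).le
          linarith
        · rw [Set.indicator_of_notMem hs]; simp
      have hYi : Integrable Y P.stepLaw := Integrable.of_bound hYm.aestronglyMeasurable M
        (ae_of_all _ fun s => hM _)
      have hY2i : Integrable (fun s => Y s ^ 2) P.stepLaw :=
        Integrable.of_bound (hYm.pow_const 2).aestronglyMeasurable (M ^ 2)
        (ae_of_all _ fun s => by
          rw [Real.norm_eq_abs, abs_pow]; exact pow_le_pow_left₀ (abs_nonneg _) (hM _) 2)
      have hQi : Integrable (fun s => Real.exp (-(lam ^ 2 * v)) *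
          (1 + lam * Y s + (lam * Y s) ^ 2) - 1) P.stepLaw := by
        have : (fun s => Real.exp (-(lam ^ 2 * v)) * (1 + lam * Y s + (lam * Y s) ^ 2) - 1)
            = fun s => Real.exp (-(lam ^ 2 * v)) * (1 + lam * Y s + lam ^ 2 * Y s ^ 2) - 1 := by
          funext s; ring
        rw [this]
        exact ((((integrable_const _).add (hYi.const_mul _)).add (hY2i.const_mul _)).const_mul
          _).sub (integrable_const _)
      have hint : ∫ s, (1 + Vs.indicator (fun s =>
          Real.exp (-(lam ^ 2 * v)) * (1 + lam * Y s + (lam * Y s) ^ 2) - 1) s) ∂P.stepLaw ≤ 1 := by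
        rw [integral_add (integrable_const _) (hQi.indicator hVsm), integral_indicator hVsm]
        have e1 : ∫ s in Vs, (Real.exp (-(lam ^ 2 * v)) * (1 + lam * Y s + (lam * Y s) ^ 2) - 1)
            ∂P.stepLaw = Real.exp (-(lam ^ 2 * v)) * (P.stepLaw.real Vs +
              lam * ∫ s in Vs, Y s ∂P.stepLaw + lam ^ 2 * ∫ s in Vs, Y s ^ 2 ∂P.stepLaw)
              - P.stepLaw.real Vs := by
          have h1 : Integrable (fun s => lam * Y s) (P.stepLaw.restrict Vs) :=
            hYi.integrableOn.const_mul lam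
          have h2 : Integrable (fun s => (lam * Y s) ^ 2) (P.stepLaw.restrict Vs) := by
            simp_rw [mul_pow]
            exact hY2i.integrableOn.const_mul _
          have h3 : Integrable (fun s => 1 + lam * Y s) (P.stepLaw.restrict Vs) :=
            (integrable_const _).add h1
          have h4 : Integrable (fun s => 1 + lam * Y s + (lam * Y s) ^ 2)
              (P.stepLaw.restrict Vs) := h3.add h2
          rw [integral_sub (h4.const_mul _) (integrable_const _), integral_const_mul,
            integral_add h3 h2, integral_add (integrable_const _) h1, integral_const_mul]
          simp_rw [mul_pow]
          rw [integral_const_mul]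
          simp
        rw [e1, hmean]
        simp only [integral_const, probReal_univ, smul_eq_mul, mul_one, mul_zero, add_zero]
        have hp : 0 ≤ P.stepLaw.real Vs := measureReal_nonneg
        have h4 : Real.exp (-(lam ^ 2 * v)) * (1 + lam ^ 2 * v) ≤ 1 := by
          have := Real.add_one_le_exp (lam ^ 2 * v)
          calc _ ≤ Real.exp (-(lam ^ 2 * v)) * Real.exp (lam ^ 2 * v) :=
                mul_le_mul_of_nonneg_left (by linarith) (Real.exp_pos _).le
            _ = 1 := by rw [← Real.exp_add]; simp
        have h5 : lam ^ 2 * ∫ s in Vs, Y s ^ 2 ∂P.stepLaw ≤ lam ^ 2 * (v * P.stepLaw.real Vs) :=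
          mul_le_mul_of_nonneg_left hvar (sq_nonneg _)
        have h6 := mul_le_mul_of_nonneg_left h5 (Real.exp_pos (-(lam ^ 2 * v))).le
        have h7 := mul_le_mul_of_nonneg_right h4 hp
        nlinarith
      calc ∫⁻ s, F c s ∂P.stepLaw ≤ ∫⁻ s, ENNReal.ofReal (1 + Vs.indicator (fun s =>
          Real.exp (-(lam ^ 2 * v)) * (1 + lam * Y s + (lam * Y s) ^ 2) - 1) s) ∂P.stepLaw :=
            lintegral_mono hb
        _ = ENNReal.ofReal (∫ s, (1 + Vs.indicator (fun s =>
          Real.exp (-(lam ^ 2 * v)) * (1 + lam * Y s + (lam * Y s) ^ 2) - 1) s) ∂P.stepLaw) := by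
            refine (ofReal_integral_eq_lintegral_ofReal
              ((integrable_const _).add (hQi.indicator hVsm)) (ae_of_all _ fun s => ?_)).symm
            by_cases hs : s ∈ Vs
            · simp only [Pi.zero_apply, Pi.add_apply]
              rw [Set.indicator_of_mem hs]
              have h8 := exp_le_one_add_add_sq (hYM s)
              have h9 := mul_nonneg (Real.exp_pos (-(lam ^ 2 * v))).le
                ((Real.exp_pos (lam * Y s)).le.trans h8)
              linarith
            · simp only [Pi.zero_apply, Pi.add_apply]
              rw [Set.indicator_of_notMem hs]; norm_num
        _ ≤ 1 := by rw [ENNReal.ofReal_le_one]; exact hint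
    · simp only [hF, hc, false_and, if_false]
      simp
  have hprod : ∀ ω n, ∏ t ∈ Finset.range n, F (0 + count V ω t) (ω t)
      = ENNReal.ofReal (Real.exp (lam * ((samples V ph k ω n).map Z).sum
        - lam ^ 2 * v * (samples V ph k ω n).length)) := by
    intro ω n
    induction n with
    | zero => simp [samples]
    | succ n ih =>
      rw [Finset.prod_range_succ, ih]
      simp only [samples, hF, zero_add]
      by_cases hc : (ω n).1 ∈ V ∧ ph (count V ω n)
      · rw [if_pos (show ph (count V ω n) ∧ ω n ∈ Vs from ⟨hc.2, hc.1⟩), if_pos hc,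
          ← ENNReal.ofReal_mul (Real.exp_pos _).le, ← Real.exp_add]
        congr 2
        simp only [List.map_cons, List.sum_cons, List.length_cons, hY]
        push_cast
        ring
      · rw [if_neg (show ¬ (ph (count V ω n) ∧ ω n ∈ Vs) from fun h => hc ⟨h.2, h.1⟩), if_neg hc,
          mul_one]
  have hmain := lintegral_prod_count_le_one P hV hFm hFle n 0
  have hFu : Measurable (Function.uncurry F) := measurable_from_prod_countable_right hFm
  have hWm : Measurable fun ω : ℕ → Period d =>
      ∏ t ∈ Finset.range n, F (0 + count V ω t) (ω t) := by
    refine Finset.measurable_prod _ fun t _ => ?_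
    exact hFu.comp (Measurable.prodMk ((measurable_count hV t).const_add _) (measurable_pi_apply t))
  refine (measure_mono ?_).trans ((measure_exp_le_of_lintegral_le_one hWm hmain
    (lam * a - lam ^ 2 * v * N)).trans (le_of_eq ?_))
  · rintro ω ⟨h1, h2⟩
    simp only [Set.mem_ofPred_eq]
    rw [hprod, h1]
    refine ENNReal.ofReal_le_ofReal (Real.exp_le_exp.2 ?_)
    have := mul_le_mul_of_nonneg_left h2 hlam
    linarith
  · congr 2; ring

/-- Lower tail of the number of visits. -/
lemma law_count_lt_le (P : Problem d) {V : Set (Ctx d)} (hV : MeasurableSet V) (n N : ℕ) {π : ℝ}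
    (hπ : π ≤ P.stepLaw.real {s : Period d | s.1 ∈ V}) :
    P.law {ω | count V ω n < N} ≤ ENNReal.ofReal (Real.exp (N - n * π / 2)) := by
  classical
  set Vs : Set (Period d) := {s | s.1 ∈ V} with hVs
  have hVsm : MeasurableSet Vs := measurable_fst hV
  set Fr : Period d → ℝ := fun s => Real.exp (π / 2) * (1 - Vs.indicator (fun _ => 1 / 2) s) with hFr
  have hFr0 : ∀ s, 0 ≤ Fr s := by
    intro s
    refine mul_nonneg (Real.exp_pos _).le ?_
    rw [Set.indicator_apply]; split_ifs <;> norm_num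
  set F : ℕ → Period d → ENNReal := fun _ s => ENNReal.ofReal (Fr s) with hF
  have hFrm : Measurable Fr :=
    (measurable_const.sub (measurable_const.indicator hVsm)).const_mul _
  have hFm : ∀ c, Measurable (F c) := fun _ => ENNReal.measurable_ofReal.comp hFrm
  have hFle : ∀ c, ∫⁻ s, F c s ∂P.stepLaw ≤ 1 := by
    intro c
    have hi : Integrable (Vs.indicator fun _ => (1 / 2 : ℝ)) P.stepLaw :=
      (integrable_const _).indicator hVsm
    have hFri : Integrable Fr P.stepLaw :=
      ((integrable_const (1 : ℝ)).sub hi).const_mul (Real.exp (π / 2))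
    simp only [hF]
    rw [← ofReal_integral_eq_lintegral_ofReal hFri (ae_of_all _ hFr0), ENNReal.ofReal_le_one]
    simp only [hFr]
    rw [integral_const_mul, integral_sub (integrable_const _) hi, integral_indicator hVsm]
    simp only [integral_const, smul_eq_mul, measureReal_def, Measure.restrict_apply_univ,
      measure_univ, ENNReal.toReal_one, one_mul] at hπ ⊢
    calc _ ≤ Real.exp (π / 2) * Real.exp (-(π / 2)) := by
          refine mul_le_mul_of_nonneg_left ?_ (Real.exp_pos _).le
          have := Real.add_one_le_exp (-(π / 2))
          linarith
      _ = 1 := by rw [← Real.exp_add]; simp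
  have hprod : ∀ ω n, ENNReal.ofReal (Real.exp (n * π / 2 - count V ω n))
      ≤ ∏ t ∈ Finset.range n, F (0 + count V ω t) (ω t) := by
    intro ω n
    induction n with
    | zero => simp [count]
    | succ n ih =>
      rw [Finset.prod_range_succ]
      refine le_trans ?_ (mul_le_mul' ih le_rfl)
      simp only [hF]
      rw [← ENNReal.ofReal_mul (Real.exp_pos _).le]
      refine ENNReal.ofReal_le_ofReal ?_
      rw [count_succ]
      simp only [hFr]
      by_cases hc : (ω n).1 ∈ V
      · have hc' : ω n ∈ Vs := hc
        rw [if_pos hc, Set.indicator_of_mem hc', ← mul_assoc, ← Real.exp_add]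
        have he : Real.exp (-1) ≤ 1 - 1 / 2 := by
          have h1 := Real.add_one_le_exp (1 : ℝ)
          rw [Real.exp_neg, show (1 : ℝ) - 1 / 2 = 2⁻¹ by norm_num]
          exact inv_anti₀ two_pos (by linarith)
        calc _ = Real.exp (n * π / 2 - count V ω n + π / 2) * Real.exp (-1) := by
              rw [← Real.exp_add]; congr 1; push_cast; ring
          _ ≤ _ := mul_le_mul_of_nonneg_left he (Real.exp_pos _).le
      · have hc' : ω n ∉ Vs := hc
        rw [if_neg hc, Set.indicator_of_notMem hc', sub_zero, mul_one, ← Real.exp_add]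
        apply le_of_eq
        congr 1; push_cast; ring
  have hmain := lintegral_prod_count_le_one P hV hFm hFle n 0
  have hWm : Measurable fun ω : ℕ → Period d =>
      ∏ t ∈ Finset.range n, F (0 + count V ω t) (ω t) := by
    refine Finset.measurable_prod _ fun t _ => ?_
    exact (hFm 0).comp (measurable_pi_apply t)
  refine (measure_mono ?_).trans ((measure_exp_le_of_lintegral_le_one hWm hmain
    (n * π / 2 - N)).trans (le_of_eq ?_))
  · intro ω h1
    refine le_trans (ENNReal.ofReal_le_ofReal (Real.exp_le_exp.2 ?_)) (hprod ω n)
    have : (count V ω n : ℝ) ≤ N := by exact_mod_cast (show count V ω n < N from h1).le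
    linarith
  · congr 2; ring

end Counting

/-! ### Moments of one period -/

section Moments

variable {d : ℕ} (P : Problem d)

lemma payoff_nonneg (k : Fin 2) (x : Ctx d) : 0 ≤ P.payoff k x := measureReal_nonneg

lemma payoff_le_one (k : Fin 2) (x : Ctx d) : P.payoff k x ≤ 1 := measureReal_le_one

lemma measurable_payoff (k : Fin 2) : Measurable (P.payoff k) := by
  unfold Problem.payoff
  exact (Kernel.measurable_coe (P.rew k) (MeasurableSet.singleton true)).ennreal_toReal

lemma stepLaw_fst_mem {V : Set (Ctx d)} (hV : MeasurableSet V) :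
    P.stepLaw {s : Period d | s.1 ∈ V} = P.ctxLaw V := by
  have h : P.stepLaw.map Prod.fst = P.ctxLaw := by
    have := Measure.fst_compProd P.ctxLaw (P.rew 0 ×ₖ P.rew 1)
    exact this
  rw [← h, Measure.map_apply measurable_fst hV]
  rfl

lemma integral_rew (k : Fin 2) (x : Ctx d) (g : Bool → ℝ) :
    ∫ y, g y ∂(P.rew k x) = P.payoff k x * g true + (1 - P.payoff k x) * g false := by
  have h1 : (P.rew k x).real {false} = 1 - P.payoff k x := by
    have h2 : ({false} : Set Bool) = {true}ᶜ := by ext b; cases b <;> simp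
    rw [h2, probReal_compl_eq_one_sub (MeasurableSet.singleton true)]
    rfl
  rw [integral_fintype (Integrable.of_finite), Fintype.sum_bool, h1]
  rfl

lemma integral_potential (k : Fin 2) (x : Ctx d) (g : Bool → ℝ) :
    ∫ y, g (potential y k) ∂((P.rew 0 ×ₖ P.rew 1) x)
      = P.payoff k x * g true + (1 - P.payoff k x) * g false := by
  rw [Kernel.prod_apply]
  fin_cases k
  · simp only [potential]
    have := integral_fun_fst (μ := P.rew 0 x) (ν := P.rew 1 x) g
    simp only [probReal_univ, one_smul] at this
    exact this.trans (integral_rew P 0 x g)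
  · simp only [potential]
    have := integral_fun_snd (μ := P.rew 0 x) (ν := P.rew 1 x) g
    simp only [probReal_univ, one_smul] at this
    exact this.trans (integral_rew P 1 x g)

lemma setIntegral_stepLaw {V : Set (Ctx d)} (hV : MeasurableSet V) (k : Fin 2)
    {Z : Ctx d × Bool → ℝ} (hZ : Measurable Z) {M : ℝ} (hM : ∀ z, |Z z| ≤ M) :
    ∫ s in {s : Period d | s.1 ∈ V}, Z (s.1, potential s.2 k) ∂P.stepLaw
      = ∫ u in V, (P.payoff k u * Z (u, true) + (1 - P.payoff k u) * Z (u, false)) ∂P.ctxLaw := by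
  have hVs : MeasurableSet {s : Period d | s.1 ∈ V} := measurable_fst hV
  have hYm : Measurable fun s : Period d => Z (s.1, potential s.2 k) :=
    hZ.comp (measurable_fst.prodMk ((measurable_potential k).comp measurable_snd))
  have hYi : Integrable (fun s : Period d => Z (s.1, potential s.2 k)) P.stepLaw :=
    Integrable.of_bound hYm.aestronglyMeasurable M (ae_of_all _ fun s => hM _)
  rw [← integral_indicator hVs, ← integral_indicator hV]
  unfold Problem.stepLaw
  rw [Measure.integral_compProd (hYi.indicator hVs)]
  refine integral_congr_ae (ae_of_all _ fun u => ?_)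
  by_cases hu : u ∈ V
  · simp only [Set.indicator_of_mem hu]
    rw [← integral_potential P k u fun y => Z (u, y)]
    refine integral_congr_ae (ae_of_all _ fun y => ?_)
    exact Set.indicator_of_mem (show (u, y) ∈ {s : Period d | s.1 ∈ V} from hu) _
  · simp only [Set.indicator_of_notMem hu]
    refine integral_eq_zero_of_ae (ae_of_all _ fun y => ?_)
    exact Set.indicator_of_notMem (show (u, y) ∉ {s : Period d | s.1 ∈ V} from hu) _

/-- Bernstein's inequality for the samples of a phase, in terms of the conditional context law. The
scale `σ` is the mass of the window on which `Z` lives. -/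
lemma law_samples_sum_ge_le_exp {V B : Set (Ctx d)} (hV : MeasurableSet V)
    (hVB : V =ᵐ[P.ctxLaw] B) (ph : ℕ → Prop) (k : Fin 2) {Z : Ctx d × Bool → ℝ}
    (hZ : Measurable Z) {M K σ ε : ℝ} (hM : ∀ z, |Z z| ≤ M)
    (hmean : ∫ u, (P.payoff k u * Z (u, true) + (1 - P.payoff k u) * Z (u, false))
      ∂(cond P.ctxLaw B) = 0)
    (hvar : ∫ u, (P.payoff k u * Z (u, true) ^ 2 + (1 - P.payoff k u) * Z (u, false) ^ 2)
      ∂(cond P.ctxLaw B) ≤ K * σ)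
    (hK : 0 < K) (hε : 0 ≤ ε) (hεM : ε * M ≤ 2 * K) (n N : ℕ) :
    P.law {ω | (samples V ph k ω n).length = N ∧
      ε * (σ * N) ≤ ((samples V ph k ω n).map Z).sum}
      ≤ ENNReal.ofReal (Real.exp (-(ε ^ 2 * (σ * N) / (4 * K)))) := by
  have hcond : ∀ F : Ctx d → ℝ,
      ∫ u in V, F u ∂P.ctxLaw = P.ctxLaw.real V * ∫ u, F u ∂(cond P.ctxLaw B) := by
    intro F
    have hreal : P.ctxLaw.real V = P.ctxLaw.real B := measureReal_congr hVB
    rw [setIntegral_congr_set hVB, hreal, ProbabilityTheory.cond, integral_smul_measure, smul_eq_mul,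
      ← mul_assoc, ENNReal.toReal_inv, measureReal_def]
    by_cases h0 : P.ctxLaw B = 0
    · rw [Measure.restrict_eq_zero.2 h0]; simp
    · rw [mul_inv_cancel₀, one_mul]
      exact ENNReal.toReal_ne_zero.2 ⟨h0, measure_ne_top _ _⟩
  have hstep : P.stepLaw.real {s : Period d | s.1 ∈ V} = P.ctxLaw.real V := by
    rw [measureReal_def, stepLaw_fst_mem P hV, measureReal_def]
  have h1 := law_samples_sum_ge_le P hV ph k hZ hM (v := K * σ) (lam := ε / (2 * K)) ?_ ?_
    (by positivity) ?_ n N (ε * (σ * N))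
  · refine h1.trans (le_of_eq ?_)
    congr 2
    field_simp
    ring
  · rw [setIntegral_stepLaw P hV k hZ hM, hcond, hmean, mul_zero]
  · have hM2 : ∀ z, |Z z ^ 2| ≤ M ^ 2 := fun z => by
      rw [abs_pow]; exact pow_le_pow_left₀ (abs_nonneg _) (hM z) 2
    rw [setIntegral_stepLaw P hV k (Z := fun z => Z z ^ 2) (hZ.pow_const 2) hM2, hcond, hstep,
      mul_comm]
    exact mul_le_mul_of_nonneg_right hvar measureReal_nonneg
  · rw [div_mul_eq_mul_div, div_le_one (by positivity)]; exact hεM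

/-- Two-sided form of `law_samples_sum_ge_le_exp`. -/
lemma law_samples_abs_sum_gt_le {V B : Set (Ctx d)} (hV : MeasurableSet V)
    (hVB : V =ᵐ[P.ctxLaw] B) (ph : ℕ → Prop) (k : Fin 2) {Z : Ctx d × Bool → ℝ}
    (hZ : Measurable Z) {M K σ ε : ℝ} (hM : ∀ z, |Z z| ≤ M)
    (hmean : ∫ u, (P.payoff k u * Z (u, true) + (1 - P.payoff k u) * Z (u, false))
      ∂(cond P.ctxLaw B) = 0)
    (hvar : ∫ u, (P.payoff k u * Z (u, true) ^ 2 + (1 - P.payoff k u) * Z (u, false) ^ 2)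
      ∂(cond P.ctxLaw B) ≤ K * σ)
    (hK : 0 < K) (hε : 0 ≤ ε) (hεM : ε * M ≤ 2 * K) (n N : ℕ) :
    P.law {ω | (samples V ph k ω n).length = N ∧
      ε * (σ * N) < |((samples V ph k ω n).map Z).sum|}
      ≤ ENNReal.ofReal (2 * Real.exp (-(ε ^ 2 * (σ * N) / (4 * K)))) := by
  have h1 := law_samples_sum_ge_le_exp P hV hVB ph k hZ hM hmean hvar hK hε hεM n N
  have h2 := law_samples_sum_ge_le_exp P hV hVB ph k (Z := fun z => -Z z) (σ := σ) (K := K)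
    (ε := ε) (M := M) hZ.neg
    (fun z => by rw [abs_neg]; exact hM z) (by
      have : ∀ u, P.payoff k u * -Z (u, true) + (1 - P.payoff k u) * -Z (u, false)
        = -(P.payoff k u * Z (u, true) + (1 - P.payoff k u) * Z (u, false)) := fun u => by ring
      simp_rw [this]
      rw [integral_neg, hmean, neg_zero]) (by simpa using hvar) hK hε hεM n N
  rw [two_mul, ENNReal.ofReal_add (Real.exp_pos _).le (Real.exp_pos _).le]
  refine le_trans (measure_mono ?_) ((measure_union_le _ _).trans (add_le_add h1 h2))
  rintro ω ⟨hlen, hlt⟩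
  rcases lt_abs.1 hlt with h | h
  · exact Or.inl ⟨hlen, h.le⟩
  · refine Or.inr ⟨hlen, ?_⟩
    have hneg : ∀ D : List (Ctx d × Bool), (D.map fun z => -Z z).sum = -(D.map Z).sum := by
      intro D
      induction D with
      | nil => simp
      | cons z D ih => simp only [List.map_cons, List.sum_cons, ih]; ring
    rw [hneg]; exact h.le

end Moments

/-! ### Concentration of the local polynomial estimator -/

section Concentration

variable {d p : ℕ}

lemma quadForm_ge_of_close {ι : Type*} [Fintype ι] {G H : Matrix ι ι ℝ} {Λ e : ℝ}
    (hH : ∀ δ, Λ * ∑ s, δ s ^ 2 ≤ quadForm H δ) (he : ∀ s t, |G s t - H s t| ≤ e) (he0 : 0 ≤ e)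
    (δ : ι → ℝ) : (Λ - Fintype.card ι * e) * ∑ s, δ s ^ 2 ≤ quadForm G δ := by
  have h1 : quadForm H δ - quadForm G δ ≤ e * (∑ s, |δ s|) ^ 2 := by
    rw [quadForm_eq_sum, quadForm_eq_sum, ← Finset.sum_sub_distrib, sq, Finset.sum_mul_sum,
      Finset.mul_sum]
    refine Finset.sum_le_sum fun s _ => ?_
    rw [← Finset.sum_sub_distrib, Finset.mul_sum]
    refine Finset.sum_le_sum fun t _ => ?_
    rw [← mul_sub]
    refine (le_abs_self _).trans ?_
    rw [abs_mul, abs_mul, abs_sub_comm, mul_comm e]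
    exact mul_le_mul_of_nonneg_left (he s t) (by positivity)
  have h2 : (∑ s, |δ s|) ^ 2 ≤ Fintype.card ι * ∑ s, δ s ^ 2 := by
    have := sq_sum_le_card_mul_sum_sq (s := (Finset.univ : Finset ι)) (f := fun s => |δ s|)
    simpa using this
  have h3 := mul_le_mul_of_nonneg_left h2 he0
  have h4 := hH δ
  nlinarith

lemma GoodWindow.K₁_le_K₂ {ν : Measure (Ctx d)} [IsProbabilityMeasure ν] {x : Ctx d}
    {h K₁ K₂ σ : ℝ} (W : GoodWindow p ν x h K₁ K₂ σ) : K₁ ≤ K₂ := by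
  have h1 := W.coercive (Pi.single (idxZero d p) 1)
  rw [quadForm_popGram] at h1
  simp only [polyVal_single, one_pow, mul_one] at h1
  have h2 : ∑ s, (Pi.single (idxZero d p) (1 : ℝ) : Idx d p → ℝ) s ^ 2 = 1 := by
    rw [Finset.sum_eq_single (idxZero d p)] <;> simp +contextual
  rw [h2, mul_one] at h1
  exact le_of_mul_le_mul_right (h1.trans W.mass) W.σ_pos

/-- The bound of the noise terms. -/
def noiseBound (d p : ℕ) (K₁ K₂ : ℝ) : ℝ :=
  1 + Fintype.card (Idx d p) * (Fintype.card (Idx d p) * (K₂ / K₁))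

/-- The constant in the exponent of the concentration inequality. -/
def concRate (d p : ℕ) (K₁ K₂ : ℝ) : ℝ :=
  (K₁ / (8 * Fintype.card (Idx d p))) ^ 2 / (4 * (noiseBound d p K₁ K₂ ^ 2 * K₂))

/-- The estimator is close to its population version: the empirical Gram matrix stays coercive and
the empirical normal equations of the population polynomial are nearly balanced, both by
Bernstein's inequality. -/
lemma law_lpr_error_le (P : Problem d) {V B : Set (Ctx d)} (hV : MeasurableSet V)
    (hVB : V =ᵐ[P.ctxLaw] B) [IsProbabilityMeasure (cond P.ctxLaw B)] (ph : ℕ → Prop) (k : Fin 2)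
    {x : Ctx d} {h K₁ K₂ σ : ℝ} (W : GoodWindow p (cond P.ctxLaw B) x h K₁ K₂ σ) {thr : ℝ}
    (hthr0 : 0 ≤ thr) (hthr1 : thr ≤ 1) (n : ℕ) {N : ℕ} (hN : 0 < N) :
    P.law {ω | (samples V ph k ω n).length = N ∧ thr / 4 <
      |lpr (samples V ph k ω n) x h p - trunc (popVal p (cond P.ctxLaw B) (P.payoff k) x h)|}
      ≤ ENNReal.ofReal (2 * (Fintype.card (Idx d p) ^ 2 + Fintype.card (Idx d p)) *
        Real.exp (-(concRate d p K₁ K₂ * thr ^ 2 * (σ * N)))) := by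
  set ν := cond P.ctxLaw B with hν
  set f := P.payoff k with hf
  have hfm : Measurable f := measurable_payoff P k
  have hf0 : ∀ u, 0 ≤ f u := payoff_nonneg P k
  have hf1' : ∀ u, f u ≤ 1 := payoff_le_one P k
  have hf1 : ∀ u, |f u| ≤ 1 := fun u => abs_le.2 ⟨by linarith [hf0 u], hf1' u⟩
  set θ := popCoef p ν f x h with hθ
  set Dn : ℝ := (Fintype.card (Idx d p) : ℝ) with hDn
  have hne : Nonempty (Idx d p) := ⟨idxZero d p⟩
  have hDn1 : 1 ≤ Dn := by
    rw [hDn]; exact_mod_cast Fintype.card_pos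
  have hK₁ := W.K₁_pos
  have hK₁₂ := W.K₁_le_K₂
  have hK₂ : 0 < K₂ := hK₁.trans_le hK₁₂
  have hσ := W.σ_pos
  set M := noiseBound d p K₁ K₂ with hM
  have hM1 : 1 ≤ M := by
    rw [hM, noiseBound]
    have : 0 ≤ Dn * (Dn * (K₂ / K₁)) := by positivity
    linarith
  have hNr : (0 : ℝ) < N := by exact_mod_cast hN
  -- the two families of deviations
  set Zg : Idx d p → Idx d p → Ctx d × Bool → ℝ := fun s t z =>
    weight x h z.1 * feat x h s z.1 * feat x h t z.1 - popGram p ν x h s t with hZg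
  set Zn : Idx d p → Ctx d × Bool → ℝ := fun s z =>
    weight x h z.1 * feat x h s z.1 * (val z.2 - polyVal θ (h⁻¹ • (z.1 - x))) with hZn
  -- With `Dn` features, entrywise deviations of `K₁ / (2 Dn)` halve the coercivity constant of the
  -- Gram matrix at most; the moments then have to be balanced up to a quarter of that times `thr`.
  set εg : ℝ := K₁ / (2 * Dn) with hεg
  set εn : ℝ := K₁ / (8 * Dn) * thr with hεn
  have hεgK : εg ≤ K₁ := by
    rw [hεg, div_le_iff₀ (by positivity)]; nlinarith
  have hκ : K₁ / (8 * Dn) ≤ K₁ := by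
    rw [div_le_iff₀ (by positivity)]; nlinarith
  have hκ0 : 0 < K₁ / (8 * Dn) := by positivity
  have hvalm : Measurable val := measurable_of_countable _
  -- deviations of the Gram matrix
  have hG : ∀ s t, P.law {ω | (samples V ph k ω n).length = N ∧
      εg * (σ * N) < |((samples V ph k ω n).map (Zg s t)).sum|}
      ≤ ENNReal.ofReal (2 * Real.exp (-(concRate d p K₁ K₂ * thr ^ 2 * (σ * N)))) := by
    intro s t
    have hwm : Measurable fun u => weight x h u * feat x h s u * feat x h t u :=
      ((measurable_weight x h).mul (measurable_feat x h s)).mul (measurable_feat x h t)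
    have hwb : ∀ u, |weight x h u * feat x h s u * feat x h t u| ≤ weight x h u := fun u => by
      have := abs_weight_mul_feat_mul_le x h s u (a := feat x h t u) (M := 1)
        fun hv => abs_mono_le_one t hv
      rwa [one_mul] at this
    have hgb : |popGram p ν x h s t| ≤ 1 := by
      have h1 : |popGram p ν x h s t| ≤ ∫ u, (1 : ℝ) ∂ν := by
        rw [← Real.norm_eq_abs]
        exact norm_integral_le_of_norm_le (integrable_const _)
          (ae_of_all _ fun u => (hwb u).trans (weight_le_one _ _ _))
      simpa using h1
    have hint := integrable_gram (ν := ν) x h s t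
    refine (law_samples_abs_sum_gt_le P hV hVB ph k (Z := Zg s t) (M := 2) (K := K₂) (σ := σ)
      (ε := εg) ?_ ?_ ?_ ?_ hK₂ (by positivity) (by linarith) n N).trans ?_
    · exact (hwm.comp measurable_fst).sub_const _
    · intro z
      refine (abs_sub _ _).trans ?_
      have := (hwb z.1).trans (weight_le_one _ _ _)
      linarith
    · have : ∀ u, f u * Zg s t (u, true) + (1 - f u) * Zg s t (u, false)
          = weight x h u * feat x h s u * feat x h t u - popGram p ν x h s t := fun u => by
        simp only [hZg]; ring
      refine (integral_congr_ae (ae_of_all _ this)).trans ?_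
      rw [integral_sub hint (integrable_const _)]
      simp [popGram]
    · have : ∀ u, f u * Zg s t (u, true) ^ 2 + (1 - f u) * Zg s t (u, false) ^ 2
          = (weight x h u * feat x h s u * feat x h t u - popGram p ν x h s t) ^ 2 := fun u => by
        simp only [hZg]; ring
      refine (integral_congr_ae (ae_of_all _ this)).trans_le ?_
      have hsq : Integrable (fun u => (weight x h u * feat x h s u * feat x h t u) ^ 2) ν := by
        refine Integrable.of_bound (hwm.pow_const 2).aestronglyMeasurable 1 (ae_of_all _ fun u => ?_)
        rw [Real.norm_eq_abs, abs_pow]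
        exact pow_le_one₀ (abs_nonneg _) ((hwb u).trans (weight_le_one _ _ _))
      have e1 : ∀ u, (weight x h u * feat x h s u * feat x h t u - popGram p ν x h s t) ^ 2
          = (weight x h u * feat x h s u * feat x h t u) ^ 2
            - 2 * popGram p ν x h s t * (weight x h u * feat x h s u * feat x h t u)
            + popGram p ν x h s t ^ 2 := fun u => by ring
      simp_rw [e1]
      have e2 : Integrable (fun u => (weight x h u * feat x h s u * feat x h t u) ^ 2
            - 2 * popGram p ν x h s t * (weight x h u * feat x h s u * feat x h t u)) ν :=
        hsq.sub (hint.const_mul _)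
      rw [integral_add e2 (integrable_const _), integral_sub hsq (hint.const_mul _),
        integral_const_mul]
      have e3 : ∫ u, weight x h u * feat x h s u * feat x h t u ∂ν = popGram p ν x h s t := rfl
      rw [e3]
      simp only [integral_const, probReal_univ, smul_eq_mul, one_mul]
      have e4 : ∫ u, (weight x h u * feat x h s u * feat x h t u) ^ 2 ∂ν ≤ K₂ * σ := by
        refine (integral_mono hsq (integrable_weight x h) fun u => ?_).trans W.mass
        have h1 := hwb u
        have h2 := weight_sq x h u
        simp only
        rw [← sq_abs]
        exact (pow_le_pow_left₀ (abs_nonneg _) h1 2).trans_eq h2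
      nlinarith [sq_nonneg (popGram p ν x h s t)]
    · refine ENNReal.ofReal_le_ofReal (mul_le_mul_of_nonneg_left (Real.exp_le_exp.2 ?_) two_pos.le)
      rw [neg_le_neg_iff]
      -- The rate is that of the normal equations; `thr ≤ 1` makes it valid for the Gram matrix too.
      have e1 : concRate d p K₁ K₂ * thr ^ 2 ≤ εg ^ 2 / (4 * K₂) := by
        rw [concRate, ← hDn, ← hM]
        have h1 : (K₁ / (8 * Dn)) ^ 2 ≤ εg ^ 2 := by
          refine pow_le_pow_left₀ hκ0.le ?_ 2
          rw [hεg]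
          exact div_le_div_of_nonneg_left hK₁.le (by positivity) (by linarith)
        calc (K₁ / (8 * Dn)) ^ 2 / (4 * (M ^ 2 * K₂)) * thr ^ 2
            ≤ (K₁ / (8 * Dn)) ^ 2 / (4 * (M ^ 2 * K₂)) * 1 := by
              refine mul_le_mul_of_nonneg_left (pow_le_one₀ hthr0 hthr1) (by positivity)
          _ ≤ εg ^ 2 / (4 * K₂) := by
              rw [mul_one]
              refine div_le_div₀ (sq_nonneg _) h1 (by positivity) ?_
              have : K₂ ≤ M ^ 2 * K₂ := le_mul_of_one_le_left hK₂.le (one_le_pow₀ hM1)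
              linarith
      calc _ ≤ εg ^ 2 / (4 * K₂) * (σ * N) := mul_le_mul_of_nonneg_right e1 (by positivity)
        _ = _ := by ring
  -- deviations of the normal equations
  have hNs : ∀ s, P.law {ω | (samples V ph k ω n).length = N ∧
      εn * (σ * N) < |((samples V ph k ω n).map (Zn s)).sum|}
      ≤ ENNReal.ofReal (2 * Real.exp (-(concRate d p K₁ K₂ * thr ^ 2 * (σ * N)))) := by
    intro s
    have hpm : Measurable fun u => polyVal θ (h⁻¹ • (u - x)) := measurable_polyVal_comp x h θ
    have hb : ∀ z : Ctx d × Bool, |Zn s z| ≤ M * weight x h z.1 := fun z => by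
      refine abs_weight_mul_feat_mul_le x h s z.1 fun hv => ?_
      refine (abs_sub _ _).trans (add_le_add ?_ ?_)
      · rw [abs_of_nonneg (val_nonneg _)]; exact val_le_one _
      · exact abs_polyVal_le (fun s => W.abs_popCoef_le hfm hf1 s) hv
    refine (law_samples_abs_sum_gt_le P hV hVB ph k (Z := Zn s) (M := M) (K := M ^ 2 * K₂) (σ := σ)
      (ε := εn) ?_ ?_ ?_ ?_ (by positivity) (by positivity) ?_ n N).trans ?_
    · refine Measurable.mul (((measurable_weight x h).mul (measurable_feat x h s)).comp
        measurable_fst) ?_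
      exact (hvalm.comp measurable_snd).sub (hpm.comp measurable_fst)
    · intro z
      exact (hb z).trans (mul_le_of_le_one_right (by positivity) (weight_le_one _ _ _))
    · have : ∀ u, f u * Zn s (u, true) + (1 - f u) * Zn s (u, false)
          = weight x h u * feat x h s u * (f u - polyVal θ (h⁻¹ • (u - x))) := fun u => by
        simp only [hZn, val]
        simp
        ring
      refine (integral_congr_ae (ae_of_all _ this)).trans ?_
      exact W.integral_residual_eq_zero hfm hf1 s
    · have hwi : Integrable (fun u => M ^ 2 * weight x h u) ν := (integrable_weight x h).const_mul _
      calc ∫ u, (f u * Zn s (u, true) ^ 2 + (1 - f u) * Zn s (u, false) ^ 2) ∂ν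
          ≤ ∫ u, M ^ 2 * weight x h u ∂ν := by
            refine integral_mono_of_nonneg (ae_of_all _ fun u => ?_) hwi (ae_of_all _ fun u => ?_)
            · exact add_nonneg (mul_nonneg (hf0 u) (sq_nonneg _))
                (mul_nonneg (by linarith [hf1' u]) (sq_nonneg _))
            · have hz : ∀ y, Zn s (u, y) ^ 2 ≤ M ^ 2 * weight x h u := fun y => by
                rw [← sq_abs, ← weight_sq, ← mul_pow]
                exact pow_le_pow_left₀ (abs_nonneg _) (hb (u, y)) 2
              have h1 := mul_le_mul_of_nonneg_left (hz true) (hf0 u)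
              have h2 := mul_le_mul_of_nonneg_left (hz false) (by linarith [hf1' u] : 0 ≤ 1 - f u)
              simp only
              linarith
        _ = M ^ 2 * ∫ u, weight x h u ∂ν := integral_const_mul _ _
        _ ≤ M ^ 2 * (K₂ * σ) := mul_le_mul_of_nonneg_left W.mass (sq_nonneg _)
        _ = M ^ 2 * K₂ * σ := by ring
    · have h1 : εn ≤ K₂ := by
        calc εn ≤ K₁ / (8 * Dn) * 1 := mul_le_mul_of_nonneg_left hthr1 hκ0.le
          _ ≤ K₂ := by rw [mul_one]; exact hκ.trans hK₁₂
      nlinarith [mul_le_mul_of_nonneg_right h1 (zero_le_one.trans hM1),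
        mul_pos hK₂ (one_pos.trans_le hM1)]
    · refine ENNReal.ofReal_le_ofReal (mul_le_mul_of_nonneg_left (Real.exp_le_exp.2 ?_) two_pos.le)
      rw [neg_le_neg_iff]
      apply le_of_eq
      rw [concRate, ← hDn, ← hM, hεn]
      ring
  have hdet : {ω | (samples V ph k ω n).length = N ∧ thr / 4 <
      |lpr (samples V ph k ω n) x h p - trunc (popVal p ν f x h)|}
      ⊆ (⋃ st ∈ (Finset.univ : Finset (Idx d p × Idx d p)), {ω | (samples V ph k ω n).length = N ∧
          εg * (σ * N) < |((samples V ph k ω n).map (Zg st.1 st.2)).sum|}) ∪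
        (⋃ s ∈ (Finset.univ : Finset (Idx d p)), {ω | (samples V ph k ω n).length = N ∧
          εn * (σ * N) < |((samples V ph k ω n).map (Zn s)).sum|}) := by
    rintro ω ⟨hlen, hlt⟩
    by_contra hcon
    simp only [Set.mem_union, Set.mem_iUnion, Finset.mem_univ, exists_prop, true_and,
      not_or, not_exists, Set.mem_ofPred_eq, not_and, not_lt, Prod.forall] at hcon
    obtain ⟨hg, hn⟩ := hcon
    set D := samples V ph k ω n with hD
    have hgram : ∀ s t, |gram D x h p s t - ((N : ℝ) • popGram p ν x h) s t| ≤ εg * (σ * N) := by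
      intro s t
      refine le_trans (le_of_eq ?_) (hg s t hlen)
      congr 1
      rw [← hlen]
      simp only [hZg, gram, Matrix.smul_apply, smul_eq_mul]
      clear_value D
      clear hlen hlt hg hn hD
      induction D with
      | nil => simp
      | cons z D ih =>
        simp only [List.map_cons, List.sum_cons, List.length_cons] at ih ⊢
        rw [← ih]; push_cast; ring
    have hco : ∀ δ : Idx d p → ℝ, (K₁ * σ * N) * ∑ s, δ s ^ 2
        ≤ quadForm ((N : ℝ) • popGram p ν x h) δ := by
      intro δ
      have h1 : quadForm ((N : ℝ) • popGram p ν x h) δ = N * quadForm (popGram p ν x h) δ := by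
        simp only [quadForm, Matrix.smul_mulVec, dotProduct_smul, smul_eq_mul]
      rw [h1]
      have := mul_le_mul_of_nonneg_left (W.coercive δ) hNr.le
      linarith
    have hco2 : ∀ δ : Idx d p → ℝ, (K₁ / 2 * (σ * N)) * ∑ s, δ s ^ 2 ≤ quadForm (gram D x h p) δ := by
      intro δ
      have := quadForm_ge_of_close hco hgram (by positivity) δ
      have e1 : K₁ * σ * N - Fintype.card (Idx d p) * (εg * (σ * N)) = K₁ / 2 * (σ * N) := by
        rw [hεg, ← hDn]; field_simp; ring
      rwa [e1] at this
    have herr := abs_lpr_sub_le W.h_pos.ne' (Λ := K₁ / 2 * (σ * N)) (by positivity) hco2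
      (θ0 := θ) (fun s => hn s hlen)
    have e2 : (Fintype.card (Idx d p) : ℝ) * (εn * (σ * N)) / (K₁ / 2 * (σ * N)) = thr / 4 := by
      rw [hεn, ← hDn]; field_simp; ring
    rw [e2] at herr
    exact absurd herr (not_le.2 hlt)
  refine (measure_mono hdet).trans ((measure_union_le _ _).trans ?_)
  refine (add_le_add ((measure_biUnion_finset_le _ _).trans
    (Finset.sum_le_sum fun st _ => hG st.1 st.2)) ((measure_biUnion_finset_le _ _).trans
    (Finset.sum_le_sum fun s _ => hNs s))).trans (le_of_eq ?_)
  simp only [Finset.sum_const, Finset.card_univ, Fintype.card_prod, nsmul_eq_mul]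
  rw [← ENNReal.ofReal_natCast, ← ENNReal.ofReal_natCast, ← ENNReal.ofReal_mul (by positivity),
    ← ENNReal.ofReal_mul (by positivity), ← ENNReal.ofReal_add (by positivity) (by positivity)]
  congr 1
  push_cast
  ring

end Concentration

/-! ### The exploration phase -/

section Exploration

variable {d : ℕ}

/-- The number of visits of a bin before its round `r`. -/
def roundStart (q r : ℕ) : ℕ := 2 * ∑ i ∈ Finset.Ico 1 r, q ^ i

lemma roundStart_one (q : ℕ) : roundStart q 1 = 0 := by simp [roundStart]

lemma roundStart_succ (q : ℕ) {r : ℕ} (hr : 1 ≤ r) :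
    roundStart q (r + 1) = roundStart q r + 2 * q ^ r := by
  unfold roundStart
  rw [Finset.sum_Ico_succ_top hr, mul_add]

lemma roundStart_mono (q : ℕ) {r r' : ℕ} (h : r ≤ r') : roundStart q r ≤ roundStart q r' := by
  unfold roundStart
  exact Nat.mul_le_mul_left _ (Finset.sum_le_sum_of_subset (Finset.Ico_subset_Ico_right h))

/-- The visits of a bin in which arm `k` is sampled in round `r`. -/
def phase (q r : ℕ) (k : Fin 2) (n : ℕ) : Prop :=
  roundStart q r ≤ n ∧ n < roundStart q (r + 1) ∧ n % 2 = (k : ℕ)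

variable (c : Params)

/-- The contexts that belong to the bin `m`. -/
def binSet (m : Fin d → ℕ) : Set (Ctx d) := {x | c.binOf x = m}

/-- The samples of arm `k` in round `r` of bin `m`, up to time `t`. -/
def roundSamples (m : Fin d → ℕ) (r : ℕ) (k : Fin 2) (ω : ℕ → Period d) (t : ℕ) :
    List (Ctx d × Bool) := samples (binSet c m) (phase c.q r k) k ω t

/-- The test of round `r` of bin `m` rejects, on the basis of the samples up to time `t`. -/
def RoundRejects (m : Fin d → ℕ) (r : ℕ) (ω : ℕ → Period d) (t : ℕ) : Prop :=
  rejects c m { round := r, data := fun k => roundSamples c m r k ω t, flag := false, last := 0 }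

/-- The states of the bins when the exploration is never stopped. -/
def freeBins (ω : ℕ → Period d) : ℕ → (Fin d → ℕ) → BinState d
  | 0 => (initState c d).bins
  | t + 1 => Function.update (freeBins ω t) (c.binOf (ω t).1)
      (((freeBins ω t (c.binOf (ω t).1)).record (ω t).1
        (potential (ω t).2 (freeBins ω t (c.binOf (ω t).1)).arm)).close c (c.binOf (ω t).1))

/-- The state of the exploration phase after `t` periods. -/
def explore (ω : ℕ → Period d) : ℕ → State d
  | 0 => initState c d
  | t + 1 =>
    open Classical in
    if (explore ω t).endTime = none then
      step c t (ω t).1 (potential (ω t).2 ((explore ω t).bins (c.binOf (ω t).1)).arm) (explore ω t)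
    else explore ω t

/-- Each bin has raised its flag or has passed the last round. -/
def AllDone (ω : ℕ → Period d) (t : ℕ) : Prop :=
  ∀ m ∈ binIndices d c.q (c.level d), (freeBins c ω t m).flag = true ∨
    c.maxRound d < ((freeBins c ω t m).round : ℤ)

/-- Description of the state `s` of the bin `m` at time `t` in terms of the visits of the bin. -/
structure BinInv (m : Fin d → ℕ) (ω : ℕ → Period d) (t : ℕ) (s : BinState d) : Prop where
  round_pos : 1 ≤ s.round
  round_le : (s.round : ℤ) ≤ c.maxRound d + 1
  start_le : roundStart c.q s.round ≤ count (binSet c m) ω t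
  data : (s.round : ℤ) ≤ c.maxRound d → ∀ k, s.data k = roundSamples c m s.round k ω t
  count_eq : (s.round : ℤ) ≤ c.maxRound d →
    count (binSet c m) ω t = roundStart c.q s.round + ((s.data 0).length + (s.data 1).length)
  lt : (s.round : ℤ) ≤ c.maxRound d → (s.data 0).length + (s.data 1).length < 2 * c.q ^ s.round
  balance : (s.round : ℤ) ≤ c.maxRound d →
    (s.data 1).length ≤ (s.data 0).length ∧ (s.data 0).length ≤ (s.data 1).length + 1
  length : ∀ r, 1 ≤ r → r < s.round → ∀ k, (roundSamples c m r k ω t).length = c.q ^ r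
  no_flag : s.flag = false → s.last = c.maxRound d ∧
    ∀ r, 1 ≤ r → r < s.round → ¬ RoundRejects c m r ω t
  flag : s.flag = true → ∃ r₀ : ℕ, s.last = r₀ ∧ 1 ≤ r₀ ∧ r₀ < s.round ∧ RoundRejects c m r₀ ω t ∧
    ∀ r, 1 ≤ r → r < r₀ → ¬ RoundRejects c m r ω t

variable {c}

lemma rejects_congr {m : Fin d → ℕ} {s s' : BinState d} (hr : s.round = s'.round)
    (hd : s.data = s'.data) : rejects c m s ↔ rejects c m s' := by
  unfold rejects; rw [hr, hd]

lemma roundSamples_succ_of_notMem {m : Fin d → ℕ} {ω : ℕ → Period d} {t : ℕ}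
    (h : c.binOf (ω t).1 ≠ m) (r : ℕ) (k : Fin 2) :
    roundSamples c m r k ω (t + 1) = roundSamples c m r k ω t := by
  unfold roundSamples
  rw [samples, if_neg]
  rintro ⟨h1, -⟩
  exact h h1

lemma roundSamples_succ_of_passed {m : Fin d → ℕ} {ω : ℕ → Period d} {t r : ℕ}
    (h : roundStart c.q (r + 1) ≤ count (binSet c m) ω t) (k : Fin 2) :
    roundSamples c m r k ω (t + 1) = roundSamples c m r k ω t := by
  unfold roundSamples
  rw [samples, if_neg]
  rintro ⟨-, h1⟩
  exact absurd h1.2.1 (not_lt.2 h)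

lemma roundRejects_congr {m : Fin d → ℕ} {ω : ℕ → Period d} {t t' r : ℕ}
    (h : ∀ k, roundSamples c m r k ω t' = roundSamples c m r k ω t) :
    RoundRejects c m r ω t' ↔ RoundRejects c m r ω t :=
  rejects_congr rfl (funext h)

lemma count_binSet_succ_of_ne {m : Fin d → ℕ} {ω : ℕ → Period d} {t : ℕ}
    (h : c.binOf (ω t).1 ≠ m) : count (binSet c m) ω (t + 1) = count (binSet c m) ω t := by
  rw [count_succ, if_neg (show (ω t).1 ∉ binSet c m from h), add_zero]

lemma count_binSet_succ_of_eq {m : Fin d → ℕ} {ω : ℕ → Period d} {t : ℕ}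
    (h : c.binOf (ω t).1 = m) : count (binSet c m) ω (t + 1) = count (binSet c m) ω t + 1 := by
  rw [count_succ, if_pos (show (ω t).1 ∈ binSet c m from h)]

lemma BinInv.of_same {m : Fin d → ℕ} {ω : ℕ → Period d} {t t' : ℕ} {s : BinState d}
    (I : BinInv c m ω t s) (hc : count (binSet c m) ω t' = count (binSet c m) ω t)
    (hs : ∀ r k, roundSamples c m r k ω t' = roundSamples c m r k ω t) : BinInv c m ω t' s where
  round_pos := I.round_pos
  round_le := I.round_le
  start_le := by rw [hc]; exact I.start_le
  data h k := by rw [hs]; exact I.data h k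
  count_eq h := by rw [hc]; exact I.count_eq h
  lt := I.lt
  balance := I.balance
  length r h1 h2 k := by rw [hs]; exact I.length r h1 h2 k
  no_flag h := ⟨(I.no_flag h).1, fun r h1 h2 => by
    rw [roundRejects_congr (hs r)]; exact (I.no_flag h).2 r h1 h2⟩
  flag h := by
    obtain ⟨r₀, h1, h2, h3, h4, h5⟩ := I.flag h
    exact ⟨r₀, h1, h2, h3, (roundRejects_congr (hs r₀)).2 h4, fun r h6 h7 => by
      rw [roundRejects_congr (hs r)]; exact h5 r h6 h7⟩

lemma roundStart_even (q r : ℕ) : roundStart q r % 2 = 0 := by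
  unfold roundStart; omega

/-- The invariant survives a visit of the bin. -/
lemma BinInv.visit {m : Fin d → ℕ} {ω : ℕ → Period d} {t : ℕ} {s : BinState d}
    (I : BinInv c m ω t s) (hm : c.binOf (ω t).1 = m) :
    BinInv c m ω (t + 1)
      ((s.record (ω t).1 (potential (ω t).2 s.arm)).close c m) := by
  set n := count (binSet c m) ω t with hn
  have hcount : count (binSet c m) ω (t + 1) = n + 1 := count_binSet_succ_of_eq hm
  have hpassed : ∀ r, r < s.round → ∀ k,
      roundSamples c m r k ω (t + 1) = roundSamples c m r k ω t := fun r hr k =>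
    roundSamples_succ_of_passed ((roundStart_mono c.q hr).trans I.start_le) k
  have hlen' : ∀ r, 1 ≤ r → r < s.round → ∀ k,
      (roundSamples c m r k ω (t + 1)).length = c.q ^ r := fun r h1 h2 k => by
    rw [hpassed r h2]; exact I.length r h1 h2 k
  have hnf : s.flag = false → s.last = c.maxRound d ∧
      ∀ r, 1 ≤ r → r < s.round → ¬ RoundRejects c m r ω (t + 1) := fun h =>
    ⟨(I.no_flag h).1, fun r h1 h2 => by
      rw [roundRejects_congr (hpassed r h2)]; exact (I.no_flag h).2 r h1 h2⟩
  have hfl : s.flag = true → ∃ r₀ : ℕ, s.last = r₀ ∧ 1 ≤ r₀ ∧ r₀ < s.round ∧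
      RoundRejects c m r₀ ω (t + 1) ∧
      ∀ r, 1 ≤ r → r < r₀ → ¬ RoundRejects c m r ω (t + 1) := fun h => by
    obtain ⟨r₀, h1, h2, h3, h4, h5⟩ := I.flag h
    exact ⟨r₀, h1, h2, h3, (roundRejects_congr (hpassed r₀ h3)).2 h4, fun r h6 h7 => by
      rw [roundRejects_congr (hpassed r (h7.trans h3))]; exact h5 r h6 h7⟩
  set s' := s.record (ω t).1 (potential (ω t).2 s.arm) with hs'
  have hs'r : s'.round = s.round := rfl
  have hs'f : s'.flag = s.flag := rfl
  have hs'l : s'.last = s.last := rfl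
  by_cases hR : (s.round : ℤ) ≤ c.maxRound d
  · -- the visit belongs to an active round
    have hcnt := I.count_eq hR
    have hlt := I.lt hR
    have hbal := I.balance hR
    have harm : n % 2 = ((s.arm : Fin 2) : ℕ) := by
      have := roundStart_even c.q s.round
      unfold BinState.arm
      split_ifs with h
      · simp only [Fin.val_one]; omega
      · simp only [Fin.val_zero]; omega
    have hin : roundStart c.q s.round ≤ n ∧ n < roundStart c.q (s.round + 1) := by
      rw [roundStart_succ _ I.round_pos]; omega
    have hdata : ∀ k, s'.data k = roundSamples c m s.round k ω (t + 1) := by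
      intro k
      unfold roundSamples
      rw [samples]
      by_cases hk : k = s.arm
      · subst hk
        rw [if_pos ⟨hm, hin.1, hin.2, harm⟩]
        simp only [hs', BinState.record, Function.update_self]
        rw [I.data hR]; rfl
      · rw [if_neg]
        · simp only [hs', BinState.record, Function.update_of_ne hk]
          rw [I.data hR]; rfl
        · rintro ⟨-, -, -, h⟩
          exact hk (Fin.ext (h.symm.trans harm))
    have hlen : (s'.data 0).length + (s'.data 1).length
        = (s.data 0).length + (s.data 1).length + 1 ∧
        (s'.data 1).length ≤ (s'.data 0).length ∧ (s'.data 0).length ≤ (s'.data 1).length + 1 := by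
      simp only [hs', BinState.record]
      unfold BinState.arm
      split_ifs with h
      · simp; omega
      · simp; omega
    have hcnt' : count (binSet c m) ω (t + 1)
        = roundStart c.q s'.round + ((s'.data 0).length + (s'.data 1).length) := by
      rw [hcount, hs'r]; omega
    unfold BinState.close
    by_cases hcl : 2 * c.q ^ s'.round ≤ (s'.data 0).length + (s'.data 1).length
    · -- the round is concluded
      rw [if_pos ⟨hcl, hR⟩]
      have hfull : (s'.data 0).length + (s'.data 1).length = 2 * c.q ^ s.round := by
        rw [hs'r] at hcl; omega
      have hpass' : roundStart c.q (s.round + 1) = count (binSet c m) ω (t + 1) := by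
        rw [roundStart_succ _ I.round_pos, hcnt', hfull, hs'r]
      have hRej : rejects c m s' ↔ RoundRejects c m s.round ω (t + 1) :=
        rejects_congr rfl (funext hdata)
      have hpow : 0 < 2 * c.q ^ (s.round + 1) := by
        have h1 : 0 < c.q ^ s.round := by omega
        have h2 : 0 < c.q := by
          rcases Nat.eq_zero_or_pos c.q with h0 | h0
          · rw [h0, zero_pow (by have := I.round_pos; omega)] at h1; omega
          · exact h0
        positivity
      have hlenr : ∀ r, 1 ≤ r → r < s.round + 1 → ∀ k,
          (roundSamples c m r k ω (t + 1)).length = c.q ^ r := by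
        intro r h1 h2 k
        rcases Nat.lt_succ_iff_lt_or_eq.1 h2 with h3 | h3
        · exact hlen' r h1 h3 k
        · subst h3
          rw [← hdata]
          have h4 : (s'.data 0).length = c.q ^ s.round ∧ (s'.data 1).length = c.q ^ s.round := by
            omega
          fin_cases k
          · exact h4.1
          · exact h4.2
      have hempty : ∀ k, ([] : List (Ctx d × Bool)) = roundSamples c m (s.round + 1) k ω (t + 1) := by
        -- no visit has reached the new round yet
        have hgen : ∀ t', count (binSet c m) ω t' ≤ roundStart c.q (s.round + 1) → ∀ k,
            [] = roundSamples c m (s.round + 1) k ω t' := by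
          intro t'
          induction t' with
          | zero => intro _ k; rfl
          | succ t' ih =>
            intro h k
            by_cases hm' : c.binOf (ω t').1 = m
            · have h1 := count_binSet_succ_of_eq hm'
              unfold roundSamples
              rw [samples, if_neg]
              · exact ih (by omega) k
              · rintro ⟨-, h2, -⟩; omega
            · rw [roundSamples_succ_of_notMem hm']
              exact ih (by rw [← count_binSet_succ_of_ne hm']; exact h) k
        exact hgen (t + 1) hpass'.ge
      by_cases hrej : s'.flag = false ∧ rejects c m s'
      · rw [if_pos hrej]
        refine ⟨by simp, by simp; omega, hpass'.le, fun _ k => hempty k, ?_, ?_, ?_, ?_, ?_, ?_⟩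
        · intro _; simp; exact hpass'.symm
        · intro _; exact hpow
        · intro _; simp
        · exact hlenr
        · intro h; simp at h
        · intro _
          refine ⟨s.round, rfl, I.round_pos, Nat.lt_succ_self _, hRej.1 hrej.2, ?_⟩
          exact (hnf hrej.1).2
      · rw [if_neg hrej]
        refine ⟨by simp, by simp; omega, hpass'.le, fun _ k => hempty k, ?_, ?_, ?_, ?_, ?_, ?_⟩
        · intro _; simp; exact hpass'.symm
        · intro _; exact hpow
        · intro _; simp
        · exact hlenr
        · intro h
          refine ⟨(hnf h).1, fun r h1 h2 => ?_⟩
          rcases Nat.lt_succ_iff_lt_or_eq.1 h2 with h3 | h3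
          · exact (hnf h).2 r h1 h3
          · have h3' : r = s.round := h3
            rw [h3', ← hRej]
            exact fun h4 => hrej ⟨h, h4⟩
        · intro h
          obtain ⟨r₀, h1, h2, h3, h4⟩ := hfl h
          exact ⟨r₀, h1, h2, Nat.lt_succ_of_lt h3, h4⟩
    · rw [if_neg (fun h => hcl h.1)]
      refine ⟨I.round_pos, I.round_le, ?_, fun _ => hdata, fun _ => hcnt', ?_, fun _ => hlen.2,
        hlen', hnf, hfl⟩
      · rw [hcount]; exact (I.start_le).trans (Nat.le_succ _)
      · intro _; exact not_le.1 hcl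
  · unfold BinState.close
    rw [if_neg (fun h => hR h.2)]
    refine ⟨I.round_pos, I.round_le, ?_, fun h => absurd h hR, fun h => absurd h hR,
      fun h => absurd h hR, fun h => absurd h hR, hlen', hnf, hfl⟩
    rw [hcount]; exact (I.start_le).trans (Nat.le_succ _)

/-- The state of a bin, which is defined by recursion over time, is a function of its visits. -/
lemma binInv_freeBins (hq : 0 < c.q) (hR : 1 ≤ c.maxRound d) (ω : ℕ → Period d) (m : Fin d → ℕ) :
    ∀ t, BinInv c m ω t (freeBins c ω t m) := by
  intro t
  induction t with
  | zero =>
    refine ⟨le_rfl, by simp [freeBins, initState]; omega, by simp [freeBins, initState,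
      roundStart_one], fun _ k => rfl, fun _ => ?_, fun _ => ?_, fun _ => ?_, ?_, ?_, ?_⟩
    · simp [freeBins, initState, roundStart_one, count]
    · simp only [freeBins, initState, List.length_nil]; positivity
    · simp [freeBins, initState]
    · intro r h1 h2; simp [freeBins, initState] at h2; omega
    · intro _
      refine ⟨rfl, fun r h1 h2 => ?_⟩
      simp [freeBins, initState] at h2; omega
    · intro h; simp [freeBins, initState] at h
  | succ t ih =>
    rw [freeBins]
    by_cases hm : c.binOf (ω t).1 = m
    · subst hm
      rw [Function.update_self]
      exact ih.visit rfl
    · rw [Function.update_of_ne (Ne.symm hm)]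
      exact ih.of_same (count_binSet_succ_of_ne hm) fun r k => roundSamples_succ_of_notMem hm r k

/-- A bin with enough visits has passed the last round. -/
lemma maxRound_lt_of_count {m : Fin d → ℕ} {ω : ℕ → Period d} {t : ℕ} {s : BinState d}
    (I : BinInv c m ω t s) {N : ℕ} (hN : ∀ r : ℕ, (r : ℤ) ≤ c.maxRound d → roundStart c.q (r + 1) ≤ N)
    (h : N ≤ count (binSet c m) ω t) : c.maxRound d < (s.round : ℤ) := by
  by_contra hle
  push Not at hle
  have h1 := I.count_eq hle
  have h2 := I.lt hle
  have h3 := hN _ hle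
  rw [roundStart_succ _ I.round_pos] at h3
  omega

/-! ### Stopping of the exploration phase -/

/-- Before the exploration ends its state is the unstopped one, and from then on it is frozen at the
first time at which all bins are done. -/
lemma explore_spec (ω : ℕ → Period d) (t : ℕ) :
    ((explore c ω t).endTime = none ∧ (explore c ω t).bins = freeBins c ω t ∧
      ∀ t', 1 ≤ t' → t' ≤ t → ¬ AllDone c ω t') ∨
    ∃ τ, 1 ≤ τ ∧ τ ≤ t ∧ (explore c ω t).endTime = some τ ∧
      (explore c ω t).bins = freeBins c ω τ ∧ AllDone c ω τ ∧ explore c ω τ = explore c ω t := by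
  classical
  induction t with
  | zero => exact Or.inl ⟨rfl, rfl, fun t' h1 h2 => by omega⟩
  | succ t ih =>
    rcases ih with ⟨h1, h2, h3⟩ | ⟨τ, h1, h2, h3, h4, h5, h6⟩
    · have hb : (explore c ω (t + 1)).bins = freeBins c ω (t + 1) := by
        rw [explore, if_pos h1, freeBins]
        simp only [step, h2]
      have he : (explore c ω (t + 1)).endTime
          = if AllDone c ω (t + 1) then some (t + 1) else none := by
        have hb' := hb
        rw [explore, if_pos h1] at hb' ⊢
        unfold AllDone
        rw [← hb']
        simp only [step]
        congr
      by_cases hd : AllDone c ω (t + 1)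
      · rw [if_pos hd] at he
        exact Or.inr ⟨t + 1, by omega, le_rfl, he, hb, hd, rfl⟩
      · rw [if_neg hd] at he
        refine Or.inl ⟨he, hb, fun t' h4 h5 => ?_⟩
        rcases Nat.le_succ_iff.1 h5 with h6 | h6
        · exact h3 t' h4 h6
        · subst h6; exact hd
    · have : explore c ω (t + 1) = explore c ω t := by
        rw [explore, if_neg (by rw [h3]; simp)]
      rw [this]
      exact Or.inr ⟨τ, h1, by omega, h3, h4, h5, h6⟩

lemma explore_eq_of_endTime {ω : ℕ → Period d} {t τ : ℕ} (h : (explore c ω t).endTime = some τ) :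
    ∀ t', t ≤ t' → explore c ω t' = explore c ω t := by
  intro t' ht'
  induction t', ht' using Nat.le_induction with
  | base => rfl
  | succ t' _ ih => rw [explore, ih, if_neg (by rw [h]; simp)]

lemma endTime_le_of_allDone {ω : ℕ → Period d} {n : ℕ} (hn : 1 ≤ n) (h : AllDone c ω n) :
    ∃ τ, 1 ≤ τ ∧ τ ≤ n ∧ (explore c ω τ).endTime = some τ := by
  rcases explore_spec (c := c) ω n with ⟨-, -, h3⟩ | ⟨τ, h1, h2, h3, -, -, h6⟩
  · exact absurd h (h3 n hn le_rfl)
  · exact ⟨τ, h1, h2, by rw [h6]; exact h3⟩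

lemma explore_congr {ω ω' : ℕ → Period d} {t : ℕ} (h : ∀ i < t, ω i = ω' i) :
    explore c ω t = explore c ω' t := by
  induction t with
  | zero => rfl
  | succ t ih =>
    rw [explore, explore, ih fun i hi => h i (by omega), h t (by omega)]

end Exploration

/-! ### The policy along a trajectory -/

section Trajectory

variable {d : ℕ} {U : Type*}

lemma observed_apply (π : Rule d U) (ω : ℕ → Period d) (u : U) {t i : ℕ} (hi : i < t) :
    observed π ω u t ⟨i, hi⟩ = potential (ω i).2 (action π ω u i) := by
  induction t with
  | zero => omega
  | succ t ih =>
    rw [observed]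
    rcases Nat.lt_succ_iff_lt_or_eq.1 hi with h | h
    · have : (⟨i, hi⟩ : Fin (t + 1)) = Fin.castSucc ⟨i, h⟩ := rfl
      rw [this, Fin.snoc_castSucc, ih h]
    · subst h
      have : (⟨i, hi⟩ : Fin (i + 1)) = Fin.last i := rfl
      rw [this, Fin.snoc_last]
      rfl

lemma stateAt_congr (c : Params) {xs xs' : ℕ → Ctx d} {ys ys' : ℕ → Bool} {t : ℕ}
    (hx : ∀ i < t, xs i = xs' i) (hy : ∀ i < t, ys i = ys' i) :
    stateAt c xs ys t = stateAt c xs' ys' t := by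
  induction t with
  | zero => rfl
  | succ t ih =>
    rw [stateAt, stateAt, ih (fun i hi => hx i (by omega)) (fun i hi => hy i (by omega)),
      hx t (by omega), hy t (by omega)]

variable [MeasurableSpace U] (c : Params) (π₀ : ℝ → ℕ → Policy d U)

/-- The smoothness that the policy passes to the input policy. -/
def chosenBeta (s : State d) : ℝ := clamp c.βlo c.βhi (estimate c s)

lemma action_sacb_eq (ω : ℕ → Period d) (u : U) (t : ℕ) :
    action (sacb c π₀) ω u t =
      match (stateAt c (fun i => (ω i).1)
        (fun i => potential (ω i).2 (action (sacb c π₀) ω u i)) t).endTime with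
      | none => ((stateAt c (fun i => (ω i).1)
        (fun i => potential (ω i).2 (action (sacb c π₀) ω u i)) t).bins (c.binOf (ω t).1)).arm
      | some τ => (π₀ (chosenBeta c (stateAt c (fun i => (ω i).1)
        (fun i => potential (ω i).2 (action (sacb c π₀) ω u i)) t)) c.T).act (t - τ)
          (fun i => if τ + i < t + 1 then (ω (τ + i)).1 else 0)
          (fun i => if τ + i < t then potential (ω (τ + i)).2 (action (sacb c π₀) ω u (τ + i))
            else false) u := by
  have hst : stateAt c (fun i => if h : i < t + 1 then (ω i).1 else 0)
      (fun i => if h : i < t then observed (sacb c π₀) ω u t ⟨i, h⟩ else false) t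
      = stateAt c (fun i => (ω i).1)
        (fun i => potential (ω i).2 (action (sacb c π₀) ω u i)) t := by
    refine stateAt_congr c (fun i hi => ?_) (fun i hi => ?_)
    · rw [dif_pos (by omega)]
    · rw [dif_pos hi, observed_apply]
  conv_lhs => rw [action, sacb]
  simp only
  rw [hst]
  generalize stateAt c (fun i => (ω i).1)
        (fun i => potential (ω i).2 (action (sacb c π₀) ω u i)) t = s
  cases s.endTime with
  | none => simp
  | some τ =>
    simp only [chosenBeta]
    congr 1
    funext i
    split_ifs with h
    · rw [observed_apply]
    · rfl

lemma stateAt_eq_explore (ω : ℕ → Period d) (u : U) (t : ℕ) :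
    stateAt c (fun i => (ω i).1) (fun i => potential (ω i).2 (action (sacb c π₀) ω u i)) t
      = explore c ω t := by
  classical
  induction t with
  | zero => rfl
  | succ t ih =>
    have hact := action_sacb_eq c π₀ ω u t
    rw [ih] at hact
    rw [stateAt, explore, ih]
    by_cases h : (explore c ω t).endTime = none
    · rw [if_pos h, if_pos h]
      rw [h] at hact
      simp only at hact
      rw [hact]
    · rw [if_neg h, if_neg h]

/-- After the exploration, the policy acts as the input policy does on the later periods. -/
lemma action_sacb_of_endTime (ω : ℕ → Period d) (u : U) {τ : ℕ}
    (h : (explore c ω τ).endTime = some τ) (j : ℕ) :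
    action (sacb c π₀) ω u (τ + j)
      = action (π₀ (chosenBeta c (explore c ω τ)) c.T).act (fun i => ω (τ + i)) u j := by
  induction j using Nat.strong_induction_on with
  | _ j ih =>
    have hact := action_sacb_eq c π₀ ω u (τ + j)
    rw [stateAt_eq_explore, explore_eq_of_endTime h (τ + j) (by omega), h] at hact
    simp only at hact
    rw [hact, action]
    have hj : τ + j - τ = j := by omega
    have gen : ∀ (n : ℕ), n = j → (π₀ (chosenBeta c (explore c ω τ)) c.T).act n
          (fun i : Fin (n + 1) => if τ + (i : ℕ) < τ + j + 1 then (ω (τ + i)).1 else 0)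
          (fun i : Fin n => if τ + (i : ℕ) < τ + j then
            potential (ω (τ + i)).2 (action (sacb c π₀) ω u (τ + i)) else false) u
        = (π₀ (chosenBeta c (explore c ω τ)) c.T).act j (fun i => (ω (τ + i)).1)
          (observed (π₀ (chosenBeta c (explore c ω τ)) c.T).act (fun i => ω (τ + i)) u j) u := by
      rintro n rfl
      congr 1
      · funext i
        rw [if_pos (by have := i.2; omega)]
      · funext i
        rw [if_pos (by have := i.2; omega), ih i i.2]
        exact (observed_apply _ _ _ i.2).symm
    exact gen _ hj

end Trajectory

/-! ### Admissibility -/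

section Measurability

variable {d : ℕ}

/-- A measurable choice among countably many measurable functions is measurable. -/
lemma measurable_choice {Ω A Γ : Type*} [MeasurableSpace Ω] [MeasurableSpace A] [MeasurableSpace Γ]
    [Countable A] [MeasurableSingletonClass A] {g : Ω → A} (hg : Measurable g) {F : A → Ω → Γ}
    (hF : ∀ a, Measurable (F a)) : Measurable fun ω => F (g ω) ω := by
  have h : Measurable (Function.uncurry F) := measurable_from_prod_countable_right hF
  exact h.comp (hg.prodMk measurable_id)

lemma measurable_list_sum_map {Ω ι : Type*} [MeasurableSpace Ω] (l : List ι) {f : ι → Ω → ℝ}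
    (hf : ∀ i, Measurable (f i)) : Measurable fun ω => (l.map fun i => f i ω).sum := by
  induction l with
  | nil => simp
  | cons a l ih =>
    simp only [List.map_cons, List.sum_cons]
    exact (hf a).add ih

/-- The samples with the time indices `l`. -/
def samplesAt (l : List ℕ) (k : Fin 2) (ω : ℕ → Period d) : List (Ctx d × Bool) :=
  l.map fun i => ((ω i).1, potential (ω i).2 k)

lemma measurable_lpr_samplesAt (l : List ℕ) (k : Fin 2) (x : Ctx d) {h : ℝ} (hh : h ≠ 0) (p : ℕ) :
    Measurable fun ω : ℕ → Period d => lpr (samplesAt l k ω) x h p := by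
  have hω : ∀ i, Measurable fun ω : ℕ → Period d => (ω i).1 := fun i =>
    measurable_fst.comp (measurable_pi_apply i)
  have hG : ∀ s t : Idx d p, Measurable fun ω : ℕ → Period d =>
      gram (samplesAt l k ω) x h p s t := fun s t => by
    simp only [gram, samplesAt, List.map_map]
    exact measurable_list_sum_map l fun i =>
      (((measurable_weight x h).comp (hω i)).mul ((measurable_feat x h s).comp (hω i))).mul
        ((measurable_feat x h t).comp (hω i))
  have hM : ∀ s : Idx d p, Measurable fun ω : ℕ → Period d =>
      moments (samplesAt l k ω) x h p s := fun s => by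
    simp only [moments, samplesAt, List.map_map]
    refine measurable_list_sum_map l fun i =>
      (((measurable_weight x h).comp (hω i)).mul ((measurable_feat x h s).comp (hω i))).mul ?_
    exact (measurable_of_countable (fun y : Bool × Bool => val (potential y k))).comp
      (measurable_snd.comp (measurable_pi_apply i))
  have hdet : ∀ A : (ℕ → Period d) → Matrix (Idx d p) (Idx d p) ℝ,
      (∀ s t, Measurable fun ω => A ω s t) → Measurable fun ω => (A ω).det := fun A hA => by
    simp only [Matrix.det_apply]
    refine Finset.measurable_sum _ fun σ _ => ?_
    exact (Finset.measurable_prod _ fun i _ => hA _ _).const_smul _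
  simp_rw [lpr_eq _ x hh]
  refine measurable_const.max (measurable_const.min ?_)
  refine Measurable.ite ?_ ?_ measurable_const
  · exact (hdet _ hG) (measurableSet_singleton (0 : ℝ)).compl
  · simp only [Matrix.mulVec, dotProduct, Matrix.inv_def, Matrix.smul_apply, Ring.inverse_eq_inv',
      smul_eq_mul]
    refine Finset.measurable_sum _ fun s _ => ((hdet _ hG).inv.mul ?_).mul (hM s)
    simp only [Matrix.adjugate_apply]
    refine hdet _ fun a b => ?_
    simp only [Matrix.updateRow_apply]
    split_ifs
    · exact measurable_const
    · exact hG a b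

end Measurability

section Skeleton

variable {d : ℕ} (c : Params)

/-- The state of a bin, with each sample represented by the period in which it was taken. -/
structure Skeleton where
  round : ℕ
  idx : Fin 2 → List ℕ
  flag : Bool
  last : ℤ

instance : MeasurableSpace Skeleton := ⊤

instance : DiscreteMeasurableSpace Skeleton := ⟨fun _ => trivial⟩

instance : Countable Skeleton :=
  Function.Injective.countable (f := fun s : Skeleton => (s.round, s.idx, s.flag, s.last))
    fun s s' h => by
      cases s; cases s'; simpa using h

/-- The state of a bin that a skeleton stands for. -/
def Skeleton.toBin (s : Skeleton) (ω : ℕ → Period d) : BinState d where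
  round := s.round
  data := fun k => samplesAt (s.idx k) k ω
  flag := s.flag
  last := s.last

/-- The arm that is explored next. -/
def Skeleton.arm (s : Skeleton) : Fin 2 :=
  if (s.idx 1).length < (s.idx 0).length then 1 else 0

/-- Record a sample taken in period `t`. -/
def Skeleton.record (s : Skeleton) (t : ℕ) : Skeleton :=
  { s with idx := Function.update s.idx s.arm (t :: s.idx s.arm) }

open Classical in
/-- Conclude the round when enough samples are collected. -/
def Skeleton.close (m : Fin d → ℕ) (s : Skeleton) (ω : ℕ → Period d) : Skeleton :=
  if 2 * c.q ^ s.round ≤ (s.idx 0).length + (s.idx 1).length ∧ (s.round : ℤ) ≤ c.maxRound d then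
    if s.flag = false ∧ rejects c m (s.toBin ω) then
      { round := s.round + 1, idx := fun _ => [], flag := true, last := s.round }
    else
      { s with round := s.round + 1, idx := fun _ => [] }
  else s

open Classical in
/-- The skeletons of the states `freeBins`. -/
def skeleton (ω : ℕ → Period d) : ℕ → (Fin d → ℕ) → Skeleton
  | 0, _ => { round := 1, idx := fun _ => [], flag := false, last := c.maxRound d }
  | t + 1, m => if c.binOf (ω t).1 = m then ((skeleton ω t m).record t).close c m ω
      else skeleton ω t m

variable {c}

lemma Skeleton.toBin_arm (s : Skeleton) (ω : ℕ → Period d) : (s.toBin ω).arm = s.arm := by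
  simp [BinState.arm, Skeleton.arm, Skeleton.toBin, samplesAt]

lemma Skeleton.toBin_record (s : Skeleton) (ω : ℕ → Period d) (t : ℕ) :
    (s.record t).toBin ω = (s.toBin ω).record (ω t).1 (potential (ω t).2 (s.toBin ω).arm) := by
  unfold BinState.record
  rw [Skeleton.toBin_arm]
  unfold Skeleton.toBin Skeleton.record
  simp only [BinState.mk.injEq, true_and, and_true]
  funext k
  by_cases hk : k = s.arm
  · subst hk; simp [samplesAt]
  · simp [Function.update_of_ne hk]

lemma Skeleton.toBin_close (s : Skeleton) (ω : ℕ → Period d) (m : Fin d → ℕ) :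
    (s.close c m ω).toBin ω = (s.toBin ω).close c m := by
  have h0 : ∀ k, ((s.toBin ω).data k).length = (s.idx k).length := fun k => by
    simp [Skeleton.toBin, samplesAt]
  unfold BinState.close Skeleton.close
  rw [h0, h0]
  have h1 : (s.toBin ω).round = s.round := rfl
  have h2 : (s.toBin ω).flag = s.flag := rfl
  rw [h1, h2]
  split_ifs <;> simp [Skeleton.toBin, samplesAt]

lemma freeBins_eq_toBin (ω : ℕ → Period d) (t : ℕ) (m : Fin d → ℕ) :
    freeBins c ω t m = (skeleton c ω t m).toBin ω := by
  induction t with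
  | zero => rfl
  | succ t ih =>
    rw [freeBins, skeleton]
    by_cases hm : c.binOf (ω t).1 = m
    · subst hm
      rw [Function.update_self, if_pos rfl, ih, Skeleton.toBin_close, Skeleton.toBin_record]
    · rw [Function.update_of_ne (Ne.symm hm), if_neg hm, ih]

lemma measurable_binOf : Measurable fun x : Ctx d => c.binOf x := by
  refine measurable_pi_iff.2 fun i => ?_
  exact (Nat.measurable_floor.comp ((measurable_pi_apply i).mul_const _)).min measurable_const

lemma measurableSet_binSet (m : Fin d → ℕ) : MeasurableSet (binSet c m : Set (Ctx d)) :=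
  measurable_binOf (measurableSet_singleton m)

lemma countable_mesh (m : Fin d → ℕ) : (c.mesh m).Countable := by
  refine (Set.countable_range fun n : Fin d → ℕ =>
    fun i => (n i : ℝ) / (c.q : ℝ) ^ c.meshLevel d).mono ?_
  rintro x ⟨-, n, hn⟩
  exact ⟨n, funext fun i => (hn i).2.2.symm⟩

lemma measurableSet_rejects (hq : 0 < c.q) (m : Fin d → ℕ) (s : Skeleton) :
    MeasurableSet {ω : ℕ → Period d | rejects c m (s.toBin ω)} := by
  have hq' : (c.q : ℝ) ≠ 0 := by exact_mod_cast hq.ne'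
  have : {ω : ℕ → Period d | rejects c m (s.toBin ω)} = ⋃ k : Fin 2, ⋃ x ∈ c.mesh m,
      {ω | c.threshold d s.round < |lpr (samplesAt (s.idx k) k ω) x
        ((c.q : ℝ) ^ (-c.bw₁ d)) (strictFloor c.βhi)
        - lpr (samplesAt (s.idx k) k ω) x ((c.q : ℝ) ^ (-c.bw₂ d)) (strictFloor c.βhi)|} := by
    ext ω
    simp only [Set.mem_iUnion, exists_prop]
    rfl
  rw [this]
  refine MeasurableSet.iUnion fun k => MeasurableSet.biUnion (countable_mesh m) fun x _ => ?_
  refine measurableSet_lt measurable_const ?_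
  have h1 := measurable_lpr_samplesAt (d := d) (s.idx k) k x
    (zpow_ne_zero (-c.bw₁ d) hq') (strictFloor c.βhi)
  have h2 := measurable_lpr_samplesAt (d := d) (s.idx k) k x
    (zpow_ne_zero (-c.bw₂ d) hq') (strictFloor c.βhi)
  exact (h1.sub h2).norm

lemma measurable_skeleton (hq : 0 < c.q) (t : ℕ) (m : Fin d → ℕ) :
    Measurable fun ω : ℕ → Period d => skeleton c ω t m := by
  classical
  induction t with
  | zero => exact measurable_const
  | succ t ih =>
    simp only [skeleton]
    refine Measurable.ite ?_ ?_ ih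
    · exact (measurable_binOf.comp (measurable_fst.comp (measurable_pi_apply t)))
        (measurableSet_singleton m)
    · refine measurable_choice (g := fun ω => (skeleton c ω t m).record t)
        (F := fun s ω => s.close c m ω) ?_ fun s => ?_
      · exact (Measurable.of_discrete (f := fun s : Skeleton => s.record t)).comp ih
      · unfold Skeleton.close
        by_cases h1 : 2 * c.q ^ s.round ≤ (s.idx 0).length + (s.idx 1).length ∧
          (s.round : ℤ) ≤ c.maxRound d
        · simp only [if_pos h1]
          by_cases h2 : s.flag = false
          · simp only [h2, true_and]
            exact Measurable.ite (measurableSet_rejects hq m s) measurable_const measurable_const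
          · simp only [h2]
            exact measurable_const
        · simp only [if_neg h1]
          exact measurable_const

lemma measurableSet_allDone (hq : 0 < c.q) (t : ℕ) :
    MeasurableSet {ω : ℕ → Period d | AllDone c ω t} := by
  have : {ω : ℕ → Period d | AllDone c ω t} = ⋂ m ∈ binIndices d c.q (c.level d),
      (fun ω => skeleton c ω t m) ⁻¹' {s | s.flag = true ∨ c.maxRound d < (s.round : ℤ)} := by
    ext ω
    simp only [AllDone, freeBins_eq_toBin, Set.mem_iInter]
    rfl
  rw [this]
  exact Finset.measurableSet_biInter _ fun m _ => measurable_skeleton hq t m trivial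

variable (c)

/-- The least recorded round, when the exploration is never stopped. -/
def minLast (ω : ℕ → Period d) (t : ℕ) : ℤ :=
  sInf ((fun m => (freeBins c ω t m).last) '' (binIndices d c.q (c.level d) : Set (Fin d → ℕ)))

/-- The smoothness that the policy derives from the least recorded round. -/
def betaOfLast (d : ℕ) (z : ℤ) : ℝ :=
  clamp c.βlo c.βhi (1 / (2 * (c.level d : ℝ)) * ((z : ℝ) - c.υ * c.loglog))

/-- The number of periods of exploration, if it ends by time `t`. -/
def stopTime (ω : ℕ → Period d) (t : ℕ) : Option ℕ := (explore c ω t).endTime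

variable {c}

lemma measurable_minLast (hq : 0 < c.q) (t : ℕ) :
    Measurable fun ω : ℕ → Period d => minLast c ω t := by
  have h1 : Measurable fun ω : ℕ → Period d =>
      fun m : binIndices d c.q (c.level d) => (skeleton c ω t m).last :=
    measurable_pi_iff.2 fun m =>
      (Measurable.of_discrete (f := fun s : Skeleton => s.last)).comp (measurable_skeleton hq t (m : Fin d → ℕ))
  have h2 := (measurable_of_countable
    (fun v : binIndices d c.q (c.level d) → ℤ => sInf (Set.range v))).comp h1
  convert h2 using 2 with ω
  simp only [minLast, freeBins_eq_toBin, Function.comp]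
  congr 1
  ext z
  simp [Skeleton.toBin]

instance : MeasurableSpace (Option ℕ) := ⊤

lemma stopTime_eq_some_iff {ω : ℕ → Period d} {t τ : ℕ} : stopTime c ω t = some τ ↔
    (1 ≤ τ ∧ τ ≤ t) ∧ AllDone c ω τ ∧ ∀ t', 1 ≤ t' → t' < τ → ¬ AllDone c ω t' := by
  have key : ∀ s, stopTime c ω t = some s → (1 ≤ s ∧ s ≤ t) ∧ AllDone c ω s ∧
      ∀ t', 1 ≤ t' → t' < s → ¬ AllDone c ω t' := by
    intro s hs
    rcases explore_spec (c := c) ω t with ⟨h1, -⟩ | ⟨s', h1, h2, h3, -, h5, h6⟩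
    · rw [stopTime, h1] at hs; cases hs
    · have : s' = s := by rw [stopTime, h3] at hs; exact Option.some.inj hs
      subst this
      refine ⟨⟨h1, h2⟩, h5, fun t' h7 h8 h9 => ?_⟩
      obtain ⟨s'', h10, h11, h12⟩ := endTime_le_of_allDone h7 h9
      have h13 := explore_eq_of_endTime h12 t (by omega)
      rw [h13, h12] at h3
      have := Option.some.inj h3
      omega
  refine ⟨key τ, fun ⟨⟨h1, h2⟩, h3, h4⟩ => ?_⟩
  obtain ⟨s, h5, h6, h7⟩ := endTime_le_of_allDone h1 h3
  have h8 : stopTime c ω t = some s := by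
    rw [stopTime, explore_eq_of_endTime h7 t (by omega), h7]
  have h9 := key s h8
  have : s = τ := by
    by_contra hne
    exact h4 s h5 (by omega) h9.2.1
  rw [h8, this]

lemma measurable_stopTime (hq : 0 < c.q) (t : ℕ) :
    Measurable fun ω : ℕ → Period d => stopTime c ω t := by
  have hs : ∀ τ, MeasurableSet ((fun ω : ℕ → Period d => stopTime c ω t) ⁻¹' {some τ}) := by
    intro τ
    have : (fun ω : ℕ → Period d => stopTime c ω t) ⁻¹' {some τ} = {ω | (1 ≤ τ ∧ τ ≤ t) ∧
        AllDone c ω τ ∧ ∀ t', 1 ≤ t' → t' < τ → ¬ AllDone c ω t'} := by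
      ext ω
      exact stopTime_eq_some_iff
    rw [this]
    refine (MeasurableSet.const _).inter ((measurableSet_allDone hq τ).inter ?_)
    have : {ω : ℕ → Period d | ∀ t', 1 ≤ t' → t' < τ → ¬ AllDone c ω t'}
        = ⋂ t', {ω | 1 ≤ t' → t' < τ → ¬ AllDone c ω t'} := by
      ext ω; simp
    change MeasurableSet {ω : ℕ → Period d | ∀ t', 1 ≤ t' → t' < τ → ¬ AllDone c ω t'}
    rw [this]
    refine MeasurableSet.iInter fun t' => ?_
    by_cases h1 : 1 ≤ t' ∧ t' < τ
    · simp only [h1.1, h1.2, true_imp_iff]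
      exact (measurableSet_allDone hq t').compl
    · have : {ω : ℕ → Period d | 1 ≤ t' → t' < τ → ¬ AllDone c ω t'} = Set.univ := by
        ext ω
        simp only [Set.mem_univ, iff_true, Set.mem_ofPred_eq]
        exact fun h2 h3 => absurd ⟨h2, h3⟩ h1
      rw [this]
      exact MeasurableSet.univ
  refine measurable_to_countable' fun o => ?_
  cases o with
  | some τ => exact hs τ
  | none =>
    have : (fun ω : ℕ → Period d => stopTime c ω t) ⁻¹' {none}
        = (⋃ τ, (fun ω : ℕ → Period d => stopTime c ω t) ⁻¹' {some τ})ᶜ := by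
      ext ω
      simp only [Set.mem_preimage, Set.mem_singleton_iff, Set.mem_compl_iff, Set.mem_iUnion]
      cases stopTime c ω t <;> simp
    rw [this]
    exact (MeasurableSet.iUnion hs).compl

lemma bins_explore_of_none {ω : ℕ → Period d} {t : ℕ} (h : stopTime c ω t = none) :
    (explore c ω t).bins = freeBins c ω t := by
  rcases explore_spec (c := c) ω t with ⟨-, h2, -⟩ | ⟨τ, -, -, h3, -⟩
  · exact h2
  · rw [stopTime, h3] at h; cases h

lemma bins_explore_of_some {ω : ℕ → Period d} {t τ : ℕ} (h : stopTime c ω t = some τ) :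
    (explore c ω t).bins = freeBins c ω τ := by
  rcases explore_spec (c := c) ω t with ⟨h1, -⟩ | ⟨s, -, -, h3, h4, -⟩
  · rw [stopTime, h1] at h; cases h
  · rw [stopTime, h3] at h
    rw [h4, Option.some.inj h]

lemma chosenBeta_explore {ω : ℕ → Period d} {t τ : ℕ} (h : stopTime c ω t = some τ) :
    chosenBeta c (explore c ω t) = betaOfLast c d (minLast c ω τ) := by
  unfold chosenBeta estimate betaOfLast minLast
  rw [bins_explore_of_some h]

lemma stateAt_eq_explore_diag (xs : ℕ → Ctx d) (ys : ℕ → Bool) (t : ℕ) :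
    stateAt c xs ys t = explore c (fun i => (xs i, (ys i, ys i))) t := by
  induction t with
  | zero => rfl
  | succ t ih =>
    rw [stateAt, explore, ih]
    simp [potential]

/-- The policy is admissible: its decisions depend on the past through countably many events. -/
theorem isAdmissible_sacb {U : Type*} [MeasurableSpace U] (hq : 0 < c.q)
    (π₀ : ℝ → ℕ → Policy d U) : IsAdmissible (sacb c π₀) := by
  intro t
  set Z := (Fin (t + 1) → Ctx d) × (Fin t → Bool) × U
  let xs : Z → ℕ → Ctx d := fun z i => if h : i < t + 1 then z.1 ⟨i, h⟩ else 0
  let ys : Z → ℕ → Bool := fun z i => if h : i < t then z.2.1 ⟨i, h⟩ else false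
  let W : Z → ℕ → Period d := fun z i => (xs z i, (ys z i, ys z i))
  have hxs : ∀ i, Measurable fun z => xs z i := fun i => by
    by_cases h : i < t + 1
    · simp only [xs, dif_pos h]
      exact (measurable_pi_apply _).comp measurable_fst
    · simp only [xs, dif_neg h]; exact measurable_const
  have hys : ∀ i, Measurable fun z => ys z i := fun i => by
    by_cases h : i < t
    · simp only [ys, dif_pos h]
      exact (measurable_pi_apply _).comp (measurable_fst.comp measurable_snd)
    · simp only [ys, dif_neg h]; exact measurable_const
  have hW : Measurable W := measurable_pi_iff.2 fun i =>
    (hxs i).prodMk ((hys i).prodMk (hys i))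
  let F : Option ℕ → Z → Fin 2 := fun o z => match o with
    | none => (freeBins c (W z) t (c.binOf (xs z t))).arm
    | some τ => (π₀ (betaOfLast c d (minLast c (W z) τ)) c.T).act (t - τ)
      (fun i => xs z (τ + i)) (fun i => ys z (τ + i)) z.2.2
  have hF : ∀ o, Measurable (F o) := by
    intro o
    cases o with
    | none =>
      refine measurable_choice (g := fun z => c.binOf (xs z t))
        (F := fun m z => (freeBins c (W z) t m).arm) (measurable_binOf.comp (hxs t)) fun m => ?_
      simp only [freeBins_eq_toBin, Skeleton.toBin_arm]
      exact (Measurable.of_discrete (f := fun s : Skeleton => s.arm)).comp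
        ((measurable_skeleton hq t m).comp hW)
    | some τ =>
      refine measurable_choice (g := fun z => minLast c (W z) τ)
        (F := fun ν z => (π₀ (betaOfLast c d ν) c.T).act (t - τ)
          (fun i => xs z (τ + i)) (fun i => ys z (τ + i)) z.2.2)
        ((measurable_minLast hq τ).comp hW) fun ν => ?_
      exact ((π₀ (betaOfLast c d ν) c.T).admissible (t - τ)).comp
        ((measurable_pi_iff.2 fun i => hxs _).prodMk
          ((measurable_pi_iff.2 fun i => hys _).prodMk (measurable_snd.comp measurable_snd)))
  have hmain := measurable_choice ((measurable_stopTime hq t).comp hW) hF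
  convert hmain using 2 with z
  have hs : stateAt c (xs z) (ys z) t = explore c (W z) t := stateAt_eq_explore_diag _ _ _
  change (match (stateAt c (xs z) (ys z) t).endTime with
    | none => ((stateAt c (xs z) (ys z) t).bins (c.binOf (xs z t))).arm
    | some τ => (π₀ (clamp c.βlo c.βhi (estimate c (stateAt c (xs z) (ys z) t))) c.T).act (t - τ)
      (fun i => xs z (τ + i)) (fun i => ys z (τ + i)) z.2.2) = F (stopTime c (W z) t) z
  rw [hs]
  rcases ho : stopTime c (W z) t with _ | τ
  · have h1 : (explore c (W z) t).endTime = none := ho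
    rw [h1]
    simp only [F, bins_explore_of_none ho]
  · have h1 : (explore c (W z) t).endTime = some τ := ho
    rw [h1]
    simp only [F, ← chosenBeta_explore ho]
    rfl

end Skeleton

/-! ### Measurability of the actions -/

section Actions

variable {d : ℕ} {U : Type*} [MeasurableSpace U]

lemma measurable_observed {π : Rule d U} (hπ : IsAdmissible π) (t : ℕ) :
    Measurable fun z : (ℕ → Period d) × U => observed π z.1 z.2 t := by
  induction t with
  | zero => exact measurable_pi_iff.2 fun i => i.elim0
  | succ t ih =>
    have hact : Measurable fun z : (ℕ → Period d) × U => action π z.1 z.2 t := by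
      refine (hπ t).comp (Measurable.prodMk ?_ (ih.prodMk measurable_snd))
      exact measurable_pi_iff.2 fun i =>
        measurable_fst.comp ((measurable_pi_apply _).comp measurable_fst)
    refine measurable_pi_iff.2 fun i => ?_
    refine Fin.lastCases ?_ (fun j => ?_) i
    · simp only [observed, Fin.snoc_last]
      refine measurable_choice (g := fun z : (ℕ → Period d) × U => action π z.1 z.2 t)
        (F := fun k z => potential (z.1 t).2 k) hact fun k => ?_
      exact (measurable_potential k).comp
        (measurable_snd.comp ((measurable_pi_apply t).comp measurable_fst))
    · simp only [observed, Fin.snoc_castSucc]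
      exact (measurable_pi_apply j).comp ih

lemma measurable_action {π : Rule d U} (hπ : IsAdmissible π) (t : ℕ) :
    Measurable fun z : (ℕ → Period d) × U => action π z.1 z.2 t := by
  refine (hπ t).comp (Measurable.prodMk ?_ ((measurable_observed hπ t).prodMk measurable_snd))
  exact measurable_pi_iff.2 fun i =>
    measurable_fst.comp ((measurable_pi_apply _).comp measurable_fst)

end Actions

/-! ### Decomposition of the regret -/

section Regret

variable {d : ℕ} {U : Type*} [MeasurableSpace U]

instance isProbabilityMeasure_law (P : Problem d) : IsProbabilityMeasure P.law := by
  unfold Problem.law; infer_instance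

/-- The regret of arm `k` at the context `x`. -/
def gap (P : Problem d) (x : Ctx d) (k : Fin 2) : ℝ :=
  max (P.payoff 0 x) (P.payoff 1 x) - P.payoff k x

lemma gap_nonneg (P : Problem d) (x : Ctx d) (k : Fin 2) : 0 ≤ gap P x k := by
  unfold gap
  fin_cases k
  · exact sub_nonneg.2 (le_max_left _ _)
  · exact sub_nonneg.2 (le_max_right _ _)

lemma gap_le_one (P : Problem d) (x : Ctx d) (k : Fin 2) : gap P x k ≤ 1 := by
  have := payoff_nonneg P k x
  have h := max_le (payoff_le_one P 0 x) (payoff_le_one P 1 x)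
  unfold gap
  linarith

lemma measurable_gap (P : Problem d) (k : Fin 2) : Measurable fun x => gap P x k :=
  ((measurable_payoff P 0).max (measurable_payoff P 1)).sub (measurable_payoff P k)

/-- The realized regret in the first `T` periods. -/
def loss (P : Problem d) (π : Rule d U) (T : ℕ) (ω : ℕ → Period d) (u : U) : ENNReal :=
  ∑ t ∈ Finset.range T, ENNReal.ofReal (gap P (ω t).1 (action π ω u t))

lemma measurable_gap_action (P : Problem d) {π : Rule d U} (hπ : IsAdmissible π) (t : ℕ) :
    Measurable fun z : (ℕ → Period d) × U => gap P (z.1 t).1 (action π z.1 z.2 t) :=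
  measurable_choice (g := fun z : (ℕ → Period d) × U => action π z.1 z.2 t)
    (F := fun k z => gap P (z.1 t).1 k) (measurable_action hπ t) fun k =>
      (measurable_gap P k).comp
        (measurable_fst.comp ((measurable_pi_apply t).comp measurable_fst))

lemma measurable_loss (P : Problem d) {π : Rule d U} (hπ : IsAdmissible π) (T : ℕ) :
    Measurable fun z : (ℕ → Period d) × U => loss P π T z.1 z.2 :=
  Finset.measurable_sum _ fun t _ => (measurable_gap_action P hπ t).ennreal_ofReal

variable (μU : Measure U) [IsProbabilityMeasure μU]

lemma lintegral_loss (P : Problem d) {π : Rule d U} (hπ : IsAdmissible π) (T : ℕ) :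
    ∫⁻ z, loss P π T z.1 z.2 ∂(P.law.prod μU) = ENNReal.ofReal (regret μU π P T) := by
  have hsum : ∀ z : (ℕ → Period d) × U, loss P π T z.1 z.2 = ENNReal.ofReal
      (∑ t ∈ Finset.range T, gap P (z.1 t).1 (action π z.1 z.2 t)) := fun z => by
    rw [ENNReal.ofReal_sum_of_nonneg fun t _ => gap_nonneg _ _ _]
    rfl
  simp_rw [hsum]
  rw [← ofReal_integral_eq_lintegral_ofReal]
  · rfl
  · refine integrable_finsetSum _ fun t _ => Integrable.of_bound
      (measurable_gap_action P hπ t).aestronglyMeasurable 1 (ae_of_all _ fun z => ?_)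
    rw [Real.norm_eq_abs, abs_of_nonneg (gap_nonneg _ _ _)]
    exact gap_le_one _ _ _
  · exact ae_of_all _ fun z => Finset.sum_nonneg fun t _ => gap_nonneg _ _ _

variable (c : Params) (π₀ : ℝ → ℕ → Policy d U)

/-- The exploration ends at time `τ`, with a smoothness estimate in `G`. -/
def StopsWell (G : Set ℝ) (τ : ℕ) (ω : ℕ → Period d) : Prop :=
  stopTime c ω τ = some τ ∧ betaOfLast c d (minLast c ω τ) ∈ G

variable {c}

lemma measurableSet_stopsWell (hq : 0 < c.q) (G : Set ℝ) (τ : ℕ) :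
    MeasurableSet {ω : ℕ → Period d | StopsWell c G τ ω} := by
  refine MeasurableSet.inter ?_ ?_
  · exact measurable_stopTime hq τ (measurableSet_singleton (some τ))
  · exact measurable_minLast hq τ (MeasurableSpace.measurableSet_top (s := betaOfLast c d ⁻¹' G))

lemma freeBins_congr {ω ω' : ℕ → Period d} {t : ℕ} (h : ∀ i < t, ω i = ω' i) :
    freeBins c ω t = freeBins c ω' t := by
  induction t with
  | zero => rfl
  | succ t ih =>
    rw [freeBins, freeBins, ih fun i hi => h i (by omega), h t (by omega)]

lemma minLast_congr {ω ω' : ℕ → Period d} {t : ℕ} (h : ∀ i < t, ω i = ω' i) :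
    minLast c ω t = minLast c ω' t := by
  unfold minLast
  rw [freeBins_congr h]

lemma stopsWell_congr {G : Set ℝ} {ω ω' : ℕ → Period d} {t : ℕ} (h : ∀ i < t, ω i = ω' i) :
    StopsWell c G t ω ↔ StopsWell c G t ω' := by
  unfold StopsWell stopTime
  rw [minLast_congr h, explore_congr h]

lemma StopsWell.unique {G : Set ℝ} {ω : ℕ → Period d} {τ τ' : ℕ} (h : StopsWell c G τ ω)
    (h' : StopsWell c G τ' ω) : τ = τ' := by
  have h1 := (stopTime_eq_some_iff.1 h.1)
  have h2 := (stopTime_eq_some_iff.1 h'.1)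
  by_contra hne
  rcases Nat.lt_or_gt_of_ne hne with h3 | h3
  · exact h2.2.2 τ h1.1.1 h3 h1.2.1
  · exact h1.2.2 τ' h2.1.1 h3 h2.2.1

omit [MeasurableSpace U] in
lemma loss_le_card (P : Problem d) (π : Rule d U) (T : ℕ) (ω : ℕ → Period d) (u : U) :
    loss P π T ω u ≤ T := by
  unfold loss
  refine (Finset.sum_le_sum fun t _ => ENNReal.ofReal_le_one.2 (gap_le_one P _ _)).trans ?_
  simp

lemma loss_sacb_le (P : Problem d) {G : Set ℝ} {τ T : ℕ} {ω : ℕ → Period d}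
    (h : StopsWell c G τ ω) (u : U) : loss P (sacb c π₀) T ω u ≤
      τ + loss P (π₀ (betaOfLast c d (minLast c ω τ)) c.T).act T (fun i => ω (τ + i)) u := by
  have hle : loss P (sacb c π₀) T ω u ≤ loss P (sacb c π₀) (τ + T) ω u :=
    Finset.sum_le_sum_of_subset (Finset.range_subset_range.2 (by omega))
  refine hle.trans ?_
  unfold loss
  rw [Finset.sum_range_add]
  refine add_le_add ?_ (le_of_eq ?_)
  · refine (Finset.sum_le_sum fun t _ => ENNReal.ofReal_le_one.2 (gap_le_one P _ _)).trans ?_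
    simp
  · refine Finset.sum_congr rfl fun j _ => ?_
    rw [action_sacb_of_endTime c π₀ ω u h.1 j, chosenBeta_explore h.1]

/-- An i.i.d. sequence starts afresh at time `τ`. -/
lemma lintegral_law_glue (P : Problem d) (τ : ℕ) {H : (ℕ → Period d) → ENNReal}
    (hH : Measurable H) :
    ∫⁻ ω, H ω ∂P.law = ∫⁻ ω, ∫⁻ ω', H (glue τ ω ω') ∂P.law ∂P.law := by
  have h := (measurePreserving_glue P.stepLaw τ).lintegral_comp hH
  have hm2 := hH.comp (measurable_glue (S := Period d) τ)
  exact (h.symm.trans (lintegral_prod _ hm2.aemeasurable))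

variable (c) in
/-- The loss of the input policy when it is started at time `τ`, if the exploration ends there with
an estimate in `G`, and zero otherwise. -/
def restartLoss (P : Problem d) (G : Set ℝ) (T τ : ℕ) (ω : ℕ → Period d) (u : U) : ENNReal :=
  open Classical in
  if StopsWell c G τ ω then
    loss P (π₀ (betaOfLast c d (minLast c ω τ)) c.T).act T (fun i => ω (τ + i)) u
  else 0

lemma measurable_restartLoss (hq : 0 < c.q) (P : Problem d) (G : Set ℝ) (T τ : ℕ) :
    Measurable fun z : (ℕ → Period d) × U => restartLoss c π₀ P G T τ z.1 z.2 := by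
  have hshift : Measurable fun z : (ℕ → Period d) × U =>
      (((fun i => z.1 (τ + i)), z.2) : (ℕ → Period d) × U) := by
    refine Measurable.prodMk (measurable_pi_iff.2 fun i => ?_) measurable_snd
    exact (measurable_pi_apply (τ + i)).comp measurable_fst
  have hE : MeasurableSet {z : (ℕ → Period d) × U | StopsWell c G τ z.1} :=
    measurable_fst (measurableSet_stopsWell hq G τ)
  have hloss : Measurable fun z : (ℕ → Period d) × U =>
      loss P (π₀ (betaOfLast c d (minLast c z.1 τ)) c.T).act T (fun i => z.1 (τ + i)) z.2 :=
    by
    have hF : ∀ ν : ℤ, Measurable fun z : (ℕ → Period d) × U =>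
        loss P (π₀ (betaOfLast c d ν) c.T).act T (fun i => z.1 (τ + i)) z.2 := fun ν => by
      have h := (measurable_loss P (π₀ (betaOfLast c d ν) c.T).admissible T).comp hshift
      simp only [Function.comp_def] at h
      exact h
    have hg : Measurable fun z : (ℕ → Period d) × U => minLast c z.1 τ :=
      (measurable_minLast hq τ).comp measurable_fst
    exact measurable_choice hg hF
  have heq : (fun z : (ℕ → Period d) × U => restartLoss c π₀ P G T τ z.1 z.2)
      = Set.indicator {z | StopsWell c G τ z.1} (fun z =>
        loss P (π₀ (betaOfLast c d (minLast c z.1 τ)) c.T).act T (fun i => z.1 (τ + i)) z.2) := by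
    funext z
    unfold restartLoss
    split_ifs with h
    · rw [Set.indicator_of_mem (show z ∈ {z : (ℕ → Period d) × U | StopsWell c G τ z.1} from h)]
    · rw [Set.indicator_of_notMem
        (show z ∉ {z : (ℕ → Period d) × U | StopsWell c G τ z.1} from h)]
  rw [heq]
  exact hloss.indicator hE

/-- After a stopping time that depends on the past only, the input policy faces a fresh problem. -/
lemma lintegral_restartLoss_le (hq : 0 < c.q) (P : Problem d) (G : Set ℝ) (T τ : ℕ) {B : ENNReal}
    (hB : ∀ β₀ ∈ G, ENNReal.ofReal (regret μU (π₀ β₀ c.T).act P T) ≤ B) :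
    ∫⁻ z : (ℕ → Period d) × U, restartLoss c π₀ P G T τ z.1 z.2 ∂(P.law.prod μU)
      ≤ B * P.law {ω | StopsWell c G τ ω} := by
  have hE := measurableSet_stopsWell (d := d) hq G τ
  have hm := measurable_restartLoss π₀ hq P G T τ
  rw [lintegral_prod _ hm.aemeasurable]
  have hm' : Measurable fun ω : ℕ → Period d => ∫⁻ u, restartLoss c π₀ P G T τ ω u ∂μU :=
    hm.lintegral_prod_right'
  rw [lintegral_law_glue P τ hm']
  have hB' : ∀ ω : ℕ → Period d,
      ∫⁻ ω', ∫⁻ u, restartLoss c π₀ P G T τ (glue τ ω ω') u ∂μU ∂P.law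
      ≤ Set.indicator {ω | StopsWell c G τ ω} (fun _ => B) ω := by
    intro ω
    have hglue : ∀ ω', ∀ i < τ, glue τ ω ω' i = ω i := fun ω' i hi => glue_of_lt hi ω ω'
    by_cases h : StopsWell c G τ ω
    · rw [Set.indicator_of_mem (show ω ∈ {ω | StopsWell c G τ ω} from h)]
      have h1 : ∀ ω' u, restartLoss c π₀ P G T τ (glue τ ω ω') u
          = loss P (π₀ (betaOfLast c d (minLast c ω τ)) c.T).act T ω' u := fun ω' u => by
        unfold restartLoss
        rw [if_pos ((stopsWell_congr (hglue ω')).2 h), minLast_congr (hglue ω')]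
        congr 1
        funext i
        exact glue_add τ i ω ω'
      simp_rw [h1]
      refine le_trans (le_of_eq ?_) (hB _ h.2)
      have hl := (measurable_loss P (π₀ (betaOfLast c d (minLast c ω τ)) c.T).admissible T)
      rw [← lintegral_loss μU P (π₀ _ c.T).admissible T, lintegral_prod _ hl.aemeasurable]
    · rw [Set.indicator_of_notMem (show ω ∉ {ω | StopsWell c G τ ω} from h)]
      have h1 : ∀ ω' u, restartLoss c π₀ P G T τ (glue τ ω ω') u = 0 := fun ω' u =>
        if_neg (fun h2 => h ((stopsWell_congr (hglue ω')).1 h2))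
      simp_rw [h1]
      simp
  refine (lintegral_mono hB').trans ?_
  rw [lintegral_indicator hE, setLIntegral_const]

/-- The regret of the policy is at most the length of the exploration, plus the worst regret of the
input policies with a good estimate, plus the horizon times the probability of a bad outcome. -/
theorem regret_sacb_le (hq : 0 < c.q) (P : Problem d) (G : Set ℝ) (T N : ℕ) {B δ : ℝ} (hB0 : 0 ≤ B)
    (hδ0 : 0 ≤ δ) (hB : ∀ β₀ ∈ G, regret μU (π₀ β₀ c.T).act P T ≤ B)
    (hδ : P.law {ω | ¬ ∃ τ ≤ N, StopsWell c G τ ω} ≤ ENNReal.ofReal δ) :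
    regret μU (sacb c π₀) P T ≤ N + B + T * δ := by
  have hadm := isAdmissible_sacb hq π₀
  set bad : Set (ℕ → Period d) := {ω | ¬ ∃ τ ≤ N, StopsWell c G τ ω} with hbad
  have hbadm : MeasurableSet bad := by
    have : bad = (⋃ τ ∈ Finset.range (N + 1), {ω | StopsWell c G τ ω})ᶜ := by
      ext ω; simp [hbad]
    rw [this]
    exact (Finset.measurableSet_biUnion _ fun τ _ => measurableSet_stopsWell hq G τ).compl
  have hpt : ∀ z : (ℕ → Period d) × U, loss P (sacb c π₀) T z.1 z.2 ≤
      (N : ENNReal) + Set.indicator {z : (ℕ → Period d) × U | z.1 ∈ bad} (fun _ => (T : ENNReal)) z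
        + ∑ τ ∈ Finset.range (N + 1), restartLoss c π₀ P G T τ z.1 z.2 := by
    intro z
    by_cases hz : z.1 ∈ bad
    · rw [Set.indicator_of_mem (show z ∈ {z : (ℕ → Period d) × U | z.1 ∈ bad} from hz)]
      refine (loss_le_card P _ T z.1 z.2).trans ?_
      rw [add_comm (N : ENNReal), add_assoc]
      exact le_self_add
    · have hz' : ∃ τ ≤ N, StopsWell c G τ z.1 := not_not.1 hz
      obtain ⟨τ, hτ, hs⟩ := hz'
      refine (loss_sacb_le π₀ P hs z.2).trans ?_
      refine add_le_add ?_ ?_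
      · refine le_trans ?_ le_self_add
        exact_mod_cast hτ
      · refine le_trans (le_of_eq ?_) (Finset.single_le_sum
          (f := fun τ => restartLoss c π₀ P G T τ z.1 z.2)
          (fun _ _ => zero_le) (Finset.mem_range.2 (Nat.lt_succ_of_le hτ)))
        exact (if_pos hs).symm
  have hB' : ∀ β₀ ∈ G, ENNReal.ofReal (regret μU (π₀ β₀ c.T).act P T) ≤ ENNReal.ofReal B :=
    fun β₀ h => ENNReal.ofReal_le_ofReal (hB β₀ h)
  -- The end of the exploration is unique, so summing over its possible values costs nothing.
  have hsum : ∑ τ ∈ Finset.range (N + 1), P.law {ω | StopsWell c G τ ω} ≤ 1 := by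
    rw [← measure_biUnion_finset]
    · exact prob_le_one
    · intro τ _ τ' _ hne
      exact Set.disjoint_left.2 fun ω h h' => hne (StopsWell.unique h h')
    · exact fun τ _ => measurableSet_stopsWell hq G τ
  have hmain : ENNReal.ofReal (regret μU (sacb c π₀) P T) ≤ ENNReal.ofReal (N + B + T * δ) := by
    rw [← lintegral_loss μU P hadm T]
    calc ∫⁻ z, loss P (sacb c π₀) T z.1 z.2 ∂(P.law.prod μU)
        ≤ ∫⁻ z, (N : ENNReal) + Set.indicator {z : (ℕ → Period d) × U | z.1 ∈ bad}
            (fun _ => (T : ENNReal)) z + ∑ τ ∈ Finset.range (N + 1), restartLoss c π₀ P G T τ z.1 z.2 ∂(P.law.prod μU) :=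
          lintegral_mono hpt
      _ = N + T * P.law bad + ∑ τ ∈ Finset.range (N + 1), ∫⁻ z, restartLoss c π₀ P G T τ z.1 z.2 ∂(P.law.prod μU) := by
          have hbm : MeasurableSet {z : (ℕ → Period d) × U | z.1 ∈ bad} := measurable_fst hbadm
          have hbi : Measurable (Set.indicator {z : (ℕ → Period d) × U | z.1 ∈ bad}
              (fun _ => (T : ENNReal))) := measurable_const.indicator hbm
          rw [lintegral_add_left (f := fun z => (N : ENNReal) + Set.indicator
            {z : (ℕ → Period d) × U | z.1 ∈ bad} (fun _ => (T : ENNReal)) z)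
            (measurable_const.add hbi), lintegral_add_left measurable_const,
            lintegral_finsetSum _ fun τ _ => measurable_restartLoss π₀ hq P G T τ]
          rw [lintegral_const, measure_univ, mul_one, lintegral_indicator hbm, setLIntegral_const]
          have : {z : (ℕ → Period d) × U | z.1 ∈ bad} = bad ×ˢ Set.univ := by ext z; simp
          rw [this, Measure.prod_prod, measure_univ, mul_one]
      _ ≤ N + T * ENNReal.ofReal δ + ∑ τ ∈ Finset.range (N + 1),
            ENNReal.ofReal B * P.law {ω | StopsWell c G τ ω} := by
          gcongr with τ _
          exact lintegral_restartLoss_le μU π₀ hq P G T τ hB'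
      _ ≤ N + T * ENNReal.ofReal δ + ENNReal.ofReal B * 1 := by
          rw [← Finset.mul_sum]; gcongr
      _ = ENNReal.ofReal (N + B + T * δ) := by
          rw [ENNReal.ofReal_add (by positivity) (by positivity), ENNReal.ofReal_add (by positivity)
            hB0, ENNReal.ofReal_mul (by positivity), ENNReal.ofReal_natCast, ENNReal.ofReal_natCast]
          ring
  exact (ENNReal.ofReal_le_ofReal_iff (by positivity)).1 hmain

lemma regret_le_horizon {π : Rule d U} (hπ : IsAdmissible π) (P : Problem d) (T : ℕ) :
    regret μU π P T ≤ T := by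
  have h := lintegral_loss μU P hπ T
  have h1 : ∫⁻ z, loss P π T z.1 z.2 ∂(P.law.prod μU) ≤ (T : ENNReal) := by
    have h2 : ∫⁻ z, loss P π T z.1 z.2 ∂(P.law.prod μU) ≤ ∫⁻ _, (T : ENNReal) ∂(P.law.prod μU) :=
      lintegral_mono fun z => loss_le_card P π T z.1 z.2
    rwa [lintegral_const, measure_univ, mul_one] at h2
  rw [h, ← ENNReal.ofReal_natCast T] at h1
  exact (ENNReal.ofReal_le_ofReal_iff (Nat.cast_nonneg T)).1 h1

end Regret

/-! ### Bins and mesh points -/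

section Bins

variable {d : ℕ}

/-- The corner of a bin with the least coordinates. -/
def binCorner (q l : ℕ) (m : Fin d → ℕ) : Ctx d := fun i => (m i : ℝ) / (q : ℝ) ^ l

lemma bin_eq_box (q l : ℕ) (m : Fin d → ℕ) :
    bin q l m = box (binCorner q l m) (((q : ℝ) ^ l)⁻¹) := by
  ext x
  simp only [bin, box, binCorner, Set.mem_Icc, Pi.le_def, Set.mem_ofPred_eq]
  rw [← forall_and]
  refine forall_congr' fun i => ?_
  rw [add_div, one_div]

lemma mem_binIndices {q l : ℕ} {m : Fin d → ℕ} : m ∈ binIndices d q l ↔ ∀ i, m i < q ^ l := by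
  simp [binIndices]

lemma card_binIndices (d q l : ℕ) : (binIndices d q l).card = (q ^ l) ^ d := by
  simp [binIndices]

lemma bin_subset_cube {q l : ℕ} {m : Fin d → ℕ} (hm : m ∈ binIndices d q l) :
    bin q l m ⊆ cube d := by
  intro x hx
  refine ⟨fun i => ?_, fun i => ?_⟩
  · exact le_trans (by positivity) (hx i).1
  · refine (hx i).2.trans ?_
    have h1 := mem_binIndices.1 hm i
    have h2 : (m i : ℝ) + 1 ≤ (q : ℝ) ^ l := by exact_mod_cast h1
    exact div_le_one_of_le₀ h2 (by positivity)

variable {c : Params}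

lemma mem_bin_of_binOf {x : Ctx d} (hq : 0 < c.q) (hx : x ∈ cube d) {m : Fin d → ℕ}
    (h : c.binOf x = m) : x ∈ bin c.q (c.level d) m := by
  intro i
  have hs : (0 : ℝ) < (c.q : ℝ) ^ c.level d := by positivity
  have hsn : 0 < c.q ^ c.level d := by positivity
  have hx0 : 0 ≤ x i := hx.1 i
  have hx1 : x i ≤ 1 := hx.2 i
  have hm : min ⌊x i * (c.q : ℝ) ^ c.level d⌋₊ (c.q ^ c.level d - 1) = m i := congrFun h i
  have hy : 0 ≤ x i * (c.q : ℝ) ^ c.level d := by positivity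
  have hy1 : x i * (c.q : ℝ) ^ c.level d ≤ (c.q : ℝ) ^ c.level d :=
    mul_le_of_le_one_left hs.le hx1
  have h1 := Nat.floor_le hy
  rw [div_le_iff₀ hs, le_div_iff₀ hs]
  have hle : (m i : ℝ) ≤ ⌊x i * (c.q : ℝ) ^ c.level d⌋₊ := by
    exact_mod_cast hm ▸ min_le_left _ _
  refine ⟨hle.trans h1, ?_⟩
  rcases min_choice ⌊x i * (c.q : ℝ) ^ c.level d⌋₊ (c.q ^ c.level d - 1) with h2 | h2
  · rw [h2] at hm
    rw [← hm]
    exact (Nat.lt_floor_add_one _).le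
  · rw [h2] at hm
    rw [← hm]
    push_cast [Nat.cast_sub (show 1 ≤ c.q ^ c.level d from hsn)]
    linarith

lemma binOf_eq_of_mem_bin {x : Ctx d} (hq : 0 < c.q) {m : Fin d → ℕ}
    (hm : m ∈ binIndices d c.q (c.level d)) (hx : x ∈ bin c.q (c.level d) m)
    (hne : ∀ i, x i ≠ ((m i : ℝ) + 1) / (c.q : ℝ) ^ c.level d) : c.binOf x = m := by
  funext i
  have hs : (0 : ℝ) < (c.q : ℝ) ^ c.level d := by positivity
  have hmi := mem_binIndices.1 hm i
  have h1 := (div_le_iff₀ hs).1 (hx i).1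
  have h2 := (lt_div_iff₀ hs).1 (lt_of_le_of_ne (hx i).2 (hne i))
  have h3 : ⌊x i * (c.q : ℝ) ^ c.level d⌋₊ = m i :=
    (Nat.floor_eq_iff ((Nat.cast_nonneg _).trans h1)).2 ⟨h1, h2⟩
  show min ⌊x i * (c.q : ℝ) ^ c.level d⌋₊ (c.q ^ c.level d - 1) = m i
  rw [h3]
  omega

/-- Up to the faces, the contexts that belong to a bin are those in the closed bin. -/
lemma binSet_ae_eq {P : Problem d} {ρlo ρhi : ℝ} (hP : HasBoundedDensity ρlo ρhi P.ctxLaw)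
    (hq : 0 < c.q) {m : Fin d → ℕ} (hm : m ∈ binIndices d c.q (c.level d)) :
    (binSet c m : Set (Ctx d)) =ᵐ[P.ctxLaw] bin c.q (c.level d) m := by
  have hcube : ∀ᵐ x ∂P.ctxLaw, x ∈ cube d := by
    rw [ae_iff]; exact P.supp
  have hface : ∀ i : Fin d, ∀ᵐ x ∂P.ctxLaw, x i ≠ ((m i : ℝ) + 1) / (c.q : ℝ) ^ c.level d := by
    intro i
    rw [ae_iff]
    simp only [ne_eq, not_not]
    refine le_antisymm ((hP.measure_le _).trans ?_) zero_le
    rw [Measure.smul_apply, smul_eq_mul]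
    have : volume {x : Ctx d | x i = ((m i : ℝ) + 1) / (c.q : ℝ) ^ c.level d} = 0 :=
      Measure.pi_hyperplane (fun _ : Fin d => (volume : Measure ℝ)) i _
    rw [le_antisymm ((Measure.restrict_apply_le _ _).trans this.le) zero_le, mul_zero]
  filter_upwards [hcube, ae_all_iff.2 hface] with x hx hxf
  exact propext ⟨fun h => mem_bin_of_binOf hq hx h, fun h => binOf_eq_of_mem_bin hq hm h hxf⟩

lemma le_stepLaw_binSet {P : Problem d} {ρlo ρhi : ℝ} (hP : HasBoundedDensity ρlo ρhi P.ctxLaw)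
    (hlo : 0 < ρlo) (hq : 0 < c.q) {m : Fin d → ℕ} (hm : m ∈ binIndices d c.q (c.level d)) :
    ρlo * (((c.q : ℝ) ^ c.level d)⁻¹) ^ d ≤
      P.stepLaw.real {s : Period d | s.1 ∈ (binSet c m : Set (Ctx d))} := by
  have hs : (0 : ℝ) < ((c.q : ℝ) ^ c.level d)⁻¹ := by positivity
  rw [Measure.real, stepLaw_fst_mem P (measurableSet_binSet m),
    measure_congr (binSet_ae_eq hP hq hm), bin_eq_box]
  have hsub := bin_subset_cube hm
  rw [bin_eq_box] at hsub
  have := le_measure_box hP hlo hs hsub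
  rw [← ENNReal.ofReal_le_iff_le_toReal (measure_ne_top _ _)]
  exact this

lemma mesh_subset (m : Fin d → ℕ) : c.mesh m ⊆ bin c.q (c.level d) m := fun _ hx => hx.1

/-- The mesh points have at most `N ^ d` values, where `N` bounds the mesh width from below. -/
lemma exists_mesh_finset {M : ℕ} (hM : c.meshLevel d = M) :
    ∃ F : Finset (Ctx d), F.card ≤ (c.q ^ M) ^ d ∧
      ∀ m : Fin d → ℕ, c.mesh m ⊆ F := by
  classical
  refine ⟨(Fintype.piFinset fun _ : Fin d => Finset.Icc 1 (c.q ^ M)).image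
    fun n i => (n i : ℝ) / (c.q : ℝ) ^ M, ?_, ?_⟩
  · refine Finset.card_image_le.trans ?_
    simp
  · rintro m x ⟨-, n, hn⟩
    rw [hM] at hn
    simp only [zpow_natCast] at hn
    refine Finset.mem_coe.2 (Finset.mem_image.2 ⟨n, ?_, ?_⟩)
    · simp only [Fintype.mem_piFinset, Finset.mem_Icc]
      exact fun i => ⟨(hn i).1, by exact_mod_cast (hn i).2.1⟩
    · funext i; exact (hn i).2.2.symm

/-- Each point of a bin is close to a mesh point of the bin. -/
lemma exists_mesh_near (hq : 0 < c.q) {M : ℕ} (hM : c.meshLevel d = M) (hlM : c.level d ≤ M)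
    {m : Fin d → ℕ} (hm : m ∈ binIndices d c.q (c.level d)) {x : Ctx d}
    (hx : x ∈ bin c.q (c.level d) m) :
    ∃ x' ∈ c.mesh m, ‖x' - x‖ ≤ ((c.q : ℝ) ^ M)⁻¹ := by
  set s : ℝ := (c.q : ℝ) ^ M with hs
  have hs0 : 0 < s := by positivity
  have hl0 : (0 : ℝ) < (c.q : ℝ) ^ c.level d := by positivity
  obtain ⟨e, he⟩ := Nat.exists_eq_add_of_le hlM
  have hse : s = (c.q : ℝ) ^ c.level d * (c.q : ℝ) ^ e := by rw [hs, he, pow_add]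
  have he1 : (1 : ℝ) ≤ (c.q : ℝ) ^ e := one_le_pow₀ (by exact_mod_cast hq)
  set n : Fin d → ℕ := fun i => max 1 ⌈x i * s⌉₊ with hn
  have hx0 : ∀ i, 0 ≤ x i := fun i => le_trans (by positivity) (hx i).1
  have hup : ∀ i, (n i : ℝ) ≤ ((m i : ℝ) + 1) * (c.q : ℝ) ^ e := by
    intro i
    have h1 : ((max 1 ⌈x i * s⌉₊ : ℕ) : ℝ) ≤ (((m i + 1) * c.q ^ e : ℕ) : ℝ) := by
      rw [Nat.cast_le]
      refine max_le (Nat.succ_le_of_lt (by positivity)) (Nat.ceil_le.2 ?_)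
      have := (le_div_iff₀ hl0).1 (hx i).2
      push_cast
      rw [hse, ← mul_assoc]
      exact mul_le_mul_of_nonneg_right this (by positivity)
    push_cast at h1 ⊢
    simpa [hn] using h1
  have hlow : ∀ i, x i * s ≤ n i := fun i =>
    (Nat.le_ceil _).trans (by exact_mod_cast le_max_right _ _)
  have hnear : ∀ i, (n i : ℝ) ≤ x i * s + 1 := by
    intro i
    have h1 := (Nat.ceil_lt_add_one (mul_nonneg (hx0 i) hs0.le)).le
    simp only [hn, Nat.cast_max, Nat.cast_one]
    exact max_le (by have := mul_nonneg (hx0 i) hs0.le; linarith) h1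
  refine ⟨fun i => (n i : ℝ) / s, ⟨fun i => ⟨?_, ?_⟩, n, fun i => ⟨le_max_left _ _, ?_, ?_⟩⟩, ?_⟩
  · refine (hx i).1.trans ?_
    rw [le_div_iff₀ hs0]
    exact hlow i
  · rw [div_le_div_iff₀ hs0 hl0, hse]
    have := mul_le_mul_of_nonneg_right (hup i) hl0.le
    linarith
  · rw [hM, zpow_natCast, ← hs, hse]
    refine (hup i).trans (mul_le_mul_of_nonneg_right ?_ (by positivity))
    exact_mod_cast mem_binIndices.1 hm i
  · rw [hM, zpow_natCast]
  · rw [pi_norm_le_iff_of_nonneg (by positivity)]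
    intro i
    rw [Pi.sub_apply, Real.norm_eq_abs, abs_le]
    have h1 : x i ≤ n i / s := by rw [le_div_iff₀ hs0]; exact hlow i
    have h2 : n i / s ≤ x i + s⁻¹ := by
      rw [div_le_iff₀ hs0, add_mul, inv_mul_cancel₀ hs0.ne']; exact hnear i
    have h3 : 0 < s⁻¹ := by positivity
    constructor <;> linarith

/-- The setting of the regression lemmas holds on each bin. -/
lemma boxSetting_bin {P : Problem d} {ρlo ρhi c₁ : ℝ} {p : ℕ}
    (hP : HasBoundedDensity ρlo ρhi P.ctxLaw)
    (hlo : 0 < ρlo) (hhi : ρlo ≤ ρhi) (hc₁ : 0 < c₁)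
    (hco : ∀ (σ : Fin d → Bool) (δ : Idx d p → ℝ),
      c₁ * ∑ s, δ s ^ 2 ≤ ∫ v in corner σ, polyVal δ v ^ 2)
    {q l : ℕ} (hq : 0 < q) {m : Fin d → ℕ} (hm : m ∈ binIndices d q l) :
    BoxSetting d p ρlo ρhi c₁ P.ctxLaw (binCorner q l m) (((q : ℝ) ^ l)⁻¹) where
  density := hP
  finite := inferInstance
  ρlo_pos := hlo
  ρlo_le := hhi
  c_pos := hc₁
  coercive := hco
  h_pos := by positivity
  subset := by rw [← bin_eq_box]; exact bin_subset_cube hm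

end Bins

/-! ### The typical event -/

section Typical

variable {d : ℕ} (c : Params)

/-- The bandwidth `q ^ (-j₁)`, if `i` is false, or `q ^ (-j₂)`. -/
def bandwidth (d : ℕ) (i : Bool) : ℝ := if i then (c.q : ℝ) ^ (-c.bw₂ d) else (c.q : ℝ) ^ (-c.bw₁ d)

/-- The population version of the estimator of arm `k` on the bin `m`. -/
def target (P : Problem d) (m : Fin d → ℕ) (k : Fin 2) (x : Ctx d) (h : ℝ) : ℝ :=
  popVal (strictFloor c.βhi) (cond P.ctxLaw (bin c.q (c.level d) m)) (P.payoff k) x h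

/-- Up to time `N`, in all bins and in all finished rounds whose threshold is not trivial, the
estimators are close to their population versions at the mesh points. -/
def Concentrated (P : Problem d) (N : ℕ) (ω : ℕ → Period d) : Prop :=
  ∀ n ≤ N, ∀ m ∈ binIndices d c.q (c.level d), ∀ r : ℕ, (r : ℤ) ≤ c.maxRound d →
    c.threshold d r ≤ 1 → ∀ k, ∀ x ∈ c.mesh m, ∀ i : Bool,
    (roundSamples c m r k ω n).length = c.q ^ r →
    |lpr (roundSamples c m r k ω n) x (bandwidth c d i) (strictFloor c.βhi)
      - trunc (target c P m k x (bandwidth c d i))| ≤ c.threshold d r / 4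

/-- By time `N`, each bin has been visited at least `n` times. -/
def Visited (N n : ℕ) (ω : ℕ → Period d) : Prop :=
  ∀ m ∈ binIndices d c.q (c.level d), n ≤ count (binSet c m) ω N

variable {c}

lemma bandwidth_false : bandwidth c d false = ((c.q : ℝ) ^ c.level d)⁻¹ := by
  simp [bandwidth, Params.bw₁]

lemma law_not_visited_le {P : Problem d} {ρlo ρhi : ℝ} (hP : HasBoundedDensity ρlo ρhi P.ctxLaw)
    (hlo : 0 < ρlo) (hq : 0 < c.q) (N n : ℕ) :
    P.law {ω | ¬ Visited c N n ω} ≤ ENNReal.ofReal ((((c.q : ℝ) ^ c.level d) ^ d) *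
      Real.exp (n - N * (ρlo * (((c.q : ℝ) ^ c.level d)⁻¹) ^ d) / 2)) := by
  have hsub : {ω : ℕ → Period d | ¬ Visited c N n ω} ⊆ ⋃ m ∈ binIndices d c.q (c.level d),
      {ω | count (binSet c m) ω N < n} := by
    intro ω hω
    simp only [Visited, Set.mem_ofPred_eq, not_forall, not_le] at hω
    obtain ⟨m, hm, h⟩ := hω
    exact Set.mem_biUnion hm h
  refine (measure_mono hsub).trans ((measure_biUnion_finset_le _ _).trans ?_)
  refine (Finset.sum_le_card_nsmul _ _ _ fun m hm =>
    law_count_lt_le P (measurableSet_binSet m) N n (le_stepLaw_binSet hP hlo hq hm)).trans ?_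
  rw [card_binIndices, nsmul_eq_mul, ENNReal.ofReal_mul (by positivity)]
  gcongr
  rw [← ENNReal.ofReal_natCast]
  push_cast
  exact le_rfl

lemma law_not_concentrated_le {P : Problem d} {ρlo ρhi c₁ γ₁ : ℝ}
    (hP : HasBoundedDensity ρlo ρhi P.ctxLaw) (hlo : 0 < ρlo) (hhi : ρlo ≤ ρhi) (hc₁ : 0 < c₁)
    (hco : ∀ (σ : Fin d → Bool) (δ : Idx d (strictFloor c.βhi) → ℝ),
      c₁ * ∑ s, δ s ^ 2 ≤ ∫ v in corner σ, polyVal δ v ^ 2) (hq : 0 < c.q)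
    (hthr : ∀ r, 0 ≤ c.threshold d r) {M R : ℕ} (hM : c.meshLevel d = M) (hR : c.maxRound d = R)
    (hbw : bandwidth c d true ≤ bandwidth c d false)
    (hγ₁ : ∀ r : ℕ, γ₁ ≤ concRate d (strictFloor c.βhi) (ρlo / ρhi * c₁) (ρhi / ρlo * 2 ^ d)
      * c.threshold d r ^ 2 * ((bandwidth c d true / bandwidth c d false) ^ d * (c.q : ℝ) ^ r))
    (N : ℕ) :
    P.law {ω | ¬ Concentrated c P N ω} ≤ ENNReal.ofReal
      (((N + 1) * (((c.q : ℝ) ^ c.level d) ^ d * ((R + 1) * (2 * (((c.q : ℝ) ^ M) ^ d * 2))))) *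
      (2 * (Fintype.card (Idx d (strictFloor c.βhi)) ^ 2 +
        Fintype.card (Idx d (strictFloor c.βhi))) * Real.exp (-γ₁))) := by
  classical
  set p := strictFloor c.βhi with hp
  have hq' : (0 : ℝ) < c.q := by exact_mod_cast hq
  have hbpos : ∀ i, 0 < bandwidth c d i := fun i => by
    unfold bandwidth; split_ifs <;> exact zpow_pos hq' _
  have hble : ∀ i, bandwidth c d i ≤ ((c.q : ℝ) ^ c.level d)⁻¹ := fun i => by
    rw [← bandwidth_false]
    cases i
    · exact le_rfl
    · exact hbw
  have hconc : 0 ≤ concRate d p (ρlo / ρhi * c₁) (ρhi / ρlo * 2 ^ d) := by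
    have : 0 < ρhi := hlo.trans_le hhi
    unfold concRate; positivity
  obtain ⟨F, hF, hmesh⟩ := exists_mesh_finset (c := c) (d := d) hM
  set B : ℕ × (Fin d → ℕ) × ℕ × Fin 2 × Ctx d × Bool → Set (ℕ → Period d) :=
    fun ⟨n, m, r, k, x, i⟩ => {ω | (c.threshold d r ≤ 1 ∧ x ∈ c.mesh m) ∧
      (roundSamples c m r k ω n).length = c.q ^ r ∧ c.threshold d r / 4 <
      |lpr (roundSamples c m r k ω n) x (bandwidth c d i) p
        - trunc (target c P m k x (bandwidth c d i))|} with hB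
  set I : Finset (ℕ × (Fin d → ℕ) × ℕ × Fin 2 × Ctx d × Bool) :=
    Finset.range (N + 1) ×ˢ binIndices d c.q (c.level d) ×ˢ Finset.range (R + 1) ×ˢ
      Finset.univ ×ˢ F ×ˢ Finset.univ with hI
  have hsub : {ω : ℕ → Period d | ¬ Concentrated c P N ω} ⊆ ⋃ z ∈ I, B z := by
    intro ω hω
    simp only [Concentrated, Set.mem_ofPred_eq, not_forall, not_le] at hω
    obtain ⟨n, hn, m, hm, r, hr, ht, k, x, hx, i, hlen, h⟩ := hω
    refine Set.mem_biUnion (x := (n, m, r, k, x, i)) ?_ ⟨⟨ht, hx⟩, hlen, h⟩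
    simp only [hI, Finset.coe_product, Set.mem_prod, Finset.mem_coe, Finset.mem_range,
      Finset.mem_univ, and_true, true_and]
    refine ⟨by omega, hm, ?_, hmesh m hx⟩
    rw [hR] at hr
    omega
  have hbound : ∀ z ∈ I, P.law (B z) ≤ ENNReal.ofReal (2 * (Fintype.card (Idx d p) ^ 2 +
        Fintype.card (Idx d p)) * Real.exp (-γ₁)) := by
    rintro ⟨n, m, r, k, x, i⟩ hz
    simp only [hI, Finset.mem_product, Finset.mem_univ, and_true, true_and] at hz
    have hm := hz.2.1
    by_cases hv : c.threshold d r ≤ 1 ∧ x ∈ c.mesh m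
    · have S := boxSetting_bin hP hlo hhi hc₁ hco hq hm (l := c.level d)
      have hprob := S.isProbabilityMeasure
      have hxb := mesh_subset m hv.2
      rw [bin_eq_box] at hxb
      have W := S.window hxb (hbpos i) (hble i)
      have hae := binSet_ae_eq hP hq hm
      rw [bin_eq_box] at hae
      have hmain := law_lpr_error_le P (measurableSet_binSet m) hae (phase c.q r k) k W (hthr r) hv.1
        n (N := c.q ^ r) (by positivity)
      refine (measure_mono ?_).trans (hmain.trans (ENNReal.ofReal_le_ofReal ?_))
      · rintro ω ⟨-, h1, h2⟩
        refine ⟨h1, ?_⟩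
        rw [← bin_eq_box]
        exact h2
      · refine mul_le_mul_of_nonneg_left (Real.exp_le_exp.2 (neg_le_neg ((hγ₁ r).trans ?_)))
          (by positivity)
        push_cast
        refine mul_le_mul_of_nonneg_left (mul_le_mul_of_nonneg_right ?_ (by positivity))
          (mul_nonneg hconc (sq_nonneg _))
        rw [← bandwidth_false]
        refine pow_le_pow_left₀ (div_nonneg (hbpos _).le (hbpos _).le) ?_ _
        refine div_le_div_of_nonneg_right ?_ (hbpos _).le
        cases i
        · exact hbw
        · exact le_rfl
    · have : B (n, m, r, k, x, i) = ∅ := by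
        ext ω
        simp only [hB, Set.mem_empty_iff_false, iff_false]
        exact fun h => hv h.1
      rw [this, measure_empty]
      exact zero_le
  refine (measure_mono hsub).trans ((measure_biUnion_finset_le _ _).trans ?_)
  refine (Finset.sum_le_card_nsmul _ _ _ hbound).trans ?_
  rw [nsmul_eq_mul, ← ENNReal.ofReal_natCast, ← ENNReal.ofReal_mul (by positivity)]
  refine ENNReal.ofReal_le_ofReal (mul_le_mul_of_nonneg_right ?_ (by positivity))
  simp only [hI, Finset.card_product, Finset.card_range, card_binIndices, Finset.card_univ,
    Fintype.card_fin, Fintype.card_bool]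
  push_cast
  have hF' : (F.card : ℝ) ≤ ((c.q : ℝ) ^ M) ^ d := by exact_mod_cast hF
  gcongr

end Typical

/-! ### The recorded rounds on the typical event -/

section Recorded

variable {d : ℕ} {c : Params}

lemma exists_stopTime {ω : ℕ → Period d} {N n : ℕ} (hq : 0 < c.q) (hR : 1 ≤ c.maxRound d)
    (hN : 1 ≤ N) (hn : ∀ r : ℕ, (r : ℤ) ≤ c.maxRound d → roundStart c.q (r + 1) ≤ n)
    (hv : Visited c N n ω) : ∃ τ, 1 ≤ τ ∧ τ ≤ N ∧ stopTime c ω τ = some τ ∧ AllDone c ω τ := by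
  have hall : AllDone c ω N := fun m hm =>
    Or.inr (maxRound_lt_of_count (binInv_freeBins hq hR ω m N) hn (hv m hm))
  obtain ⟨τ, h1, h2, h3⟩ := endTime_le_of_allDone hN hall
  have h4 : stopTime c ω τ = some τ := h3
  exact ⟨τ, h1, h2, h4, (stopTime_eq_some_iff.1 h4).2.1⟩

variable {P : Problem d} {ρlo ρhi c₁ β L : ℝ} (hP : HasBoundedDensity ρlo ρhi P.ctxLaw)
  (hlo : 0 < ρlo) (hhi : ρlo ≤ ρhi) (hc₁ : 0 < c₁)
  (hco : ∀ (σ : Fin d → Bool) (δ : Idx d (strictFloor c.βhi) → ℝ),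
    c₁ * ∑ s, δ s ^ 2 ≤ ∫ v in corner σ, polyVal δ v ^ 2) (hq : 0 < c.q)
  (hbw : bandwidth c d true ≤ bandwidth c d false) (hβ : 0 < β) (hL : 0 ≤ L)
  (hH : ∀ k, IsHolder β L (P.payoff k)) (hp : strictFloor β ≤ strictFloor c.βhi)

include hP hlo hhi hc₁ hco hq hbw hβ hL hH hp in
lemma abs_target_sub_le {m : Fin d → ℕ} (hm : m ∈ binIndices d c.q (c.level d)) (k : Fin 2)
    {x : Ctx d} (hx : x ∈ bin c.q (c.level d) m) (i : Bool) :
    |trunc (target c P m k x (bandwidth c d i)) - P.payoff k x|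
      ≤ coefBound d (strictFloor c.βhi) ρlo ρhi c₁ * (L * bandwidth c d i ^ β) := by
  have S := boxSetting_bin hP hlo hhi hc₁ hco hq hm (l := c.level d)
  have hq' : (0 : ℝ) < c.q := by exact_mod_cast hq
  have hbpos : 0 < bandwidth c d i := by
    unfold bandwidth; split_ifs <;> exact zpow_pos hq' _
  have hble : bandwidth c d i ≤ ((c.q : ℝ) ^ c.level d)⁻¹ := by
    rw [← bandwidth_false]
    cases i
    · exact le_rfl
    · exact hbw
  have hf1 : ∀ u, |P.payoff k u| ≤ 1 := fun u =>
    abs_le.2 ⟨by linarith [payoff_nonneg P k u], payoff_le_one P k u⟩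
  have h := S.abs_popVal_sub_le (measurable_payoff P k) hf1 hβ hL (hH k) hp
    (by rw [← bin_eq_box]; exact hx) hbpos hble
  rw [← bin_eq_box] at h
  have h1 := abs_trunc_sub_le (target c P m k x (bandwidth c d i)) (P.payoff k x)
  rw [trunc_of_mem (payoff_nonneg P k x) (payoff_le_one P k x)] at h1
  exact h1.trans h

include hP hlo hhi hc₁ hco hq hbw hβ hL hH hp in
/-- On the typical event, a test rejects only if its threshold is of the order of the bias. -/
lemma threshold_lt_of_rejects {N t : ℕ} (ht : t ≤ N) {ω : ℕ → Period d}
    (hc : Concentrated c P N ω) {m : Fin d → ℕ} (hm : m ∈ binIndices d c.q (c.level d)) {r : ℕ}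
    (hr : (r : ℤ) ≤ c.maxRound d) (hlen : ∀ k, (roundSamples c m r k ω t).length = c.q ^ r)
    (hrej : RoundRejects c m r ω t) :
    c.threshold d r < 4 * coefBound d (strictFloor c.βhi) ρlo ρhi c₁ * L *
      bandwidth c d false ^ β := by
  obtain ⟨k, x, hx, hlt⟩ := hrej
  have hlt' : c.threshold d r < |lpr (roundSamples c m r k ω t) x (bandwidth c d false)
      (strictFloor c.βhi) - lpr (roundSamples c m r k ω t) x (bandwidth c d true)
      (strictFloor c.βhi)| := hlt
  have hthr1 : c.threshold d r ≤ 1 := by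
    refine hlt'.le.trans (abs_le.2 ⟨?_, ?_⟩)
    · have h1 : lpr (roundSamples c m r k ω t) x (bandwidth c d true) (strictFloor c.βhi) ≤ 1 :=
        max_le zero_le_one (min_le_left _ _)
      have h2 : 0 ≤ lpr (roundSamples c m r k ω t) x (bandwidth c d false) (strictFloor c.βhi) :=
        le_max_left _ _
      linarith
    · have h1 : lpr (roundSamples c m r k ω t) x (bandwidth c d false) (strictFloor c.βhi) ≤ 1 :=
        max_le zero_le_one (min_le_left _ _)
      have h2 : 0 ≤ lpr (roundSamples c m r k ω t) x (bandwidth c d true) (strictFloor c.βhi) :=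
        le_max_left _ _
      linarith
  have hxb := mesh_subset m hx
  have h1 := abs_le.1 (hc t ht m hm r hr hthr1 k x hx false (hlen k))
  have h2 := abs_le.1 (hc t ht m hm r hr hthr1 k x hx true (hlen k))
  have h3 := abs_le.1 (abs_target_sub_le hP hlo hhi hc₁ hco hq hbw hβ hL hH hp hm k hxb false)
  have h4 := abs_le.1 (abs_target_sub_le hP hlo hhi hc₁ hco hq hbw hβ hL hH hp hm k hxb true)
  have S := boxSetting_bin hP hlo hhi hc₁ hco hq hm (l := c.level d)
  have hq' : (0 : ℝ) < c.q := by exact_mod_cast hq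
  have h5 : coefBound d (strictFloor c.βhi) ρlo ρhi c₁ * (L * bandwidth c d true ^ β)
      ≤ coefBound d (strictFloor c.βhi) ρlo ρhi c₁ * (L * bandwidth c d false ^ β) := by
    refine mul_le_mul_of_nonneg_left (mul_le_mul_of_nonneg_left
      (Real.rpow_le_rpow ?_ hbw hβ.le) hL) S.coefBound_nonneg
    exact (zpow_pos hq' _).le
  rcases lt_abs.1 hlt' with h | h <;> linarith [h1.1, h1.2, h2.1, h2.2, h3.1, h3.2, h4.1, h4.2]

include hP hlo hhi hc₁ hco hq hbw hβ hL hH hp in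
/-- On the typical event, a test rejects if its threshold and the bias of the small bandwidth are
small relative to the bias of the large bandwidth. -/
lemma roundRejects_of_error {N t : ℕ} (ht : t ≤ N) {ω : ℕ → Period d}
    (hc : Concentrated c P N ω) {m : Fin d → ℕ} (hm : m ∈ binIndices d c.q (c.level d)) {r : ℕ}
    (hr : (r : ℤ) ≤ c.maxRound d) (hlen : ∀ k, (roundSamples c m r k ω t).length = c.q ^ r)
    (hthr1 : c.threshold d r ≤ 1) {k : Fin 2} {x : Ctx d} (hx : x ∈ c.mesh m)
    (herr : 3 / 2 * c.threshold d r +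
      coefBound d (strictFloor c.βhi) ρlo ρhi c₁ * (L * bandwidth c d true ^ β)
      < |trunc (target c P m k x (bandwidth c d false)) - P.payoff k x|) :
    RoundRejects c m r ω t := by
  refine ⟨k, x, hx, ?_⟩
  show c.threshold d r < |lpr (roundSamples c m r k ω t) x (bandwidth c d false)
      (strictFloor c.βhi) - lpr (roundSamples c m r k ω t) x (bandwidth c d true)
      (strictFloor c.βhi)|
  have hxb := mesh_subset m hx
  have h1 := abs_le.1 (hc t ht m hm r hr hthr1 k x hx false (hlen k))
  have h2 := abs_le.1 (hc t ht m hm r hr hthr1 k x hx true (hlen k))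
  have h4 := abs_le.1 (abs_target_sub_le hP hlo hhi hc₁ hco hq hbw hβ hL hH hp hm k hxb true)
  rw [lt_abs] at herr ⊢
  rcases herr with h | h
  · left; linarith [h1.1, h1.2, h2.1, h2.2, h4.1, h4.2]
  · right; linarith [h1.1, h1.2, h2.1, h2.2, h4.1, h4.2]

include hP hlo hhi hc₁ hco hq hbw hβ hL hH hp in
/-- On the typical event, the least recorded round is the last one or has a threshold of the order
of the bias, and it does not exceed a round in which a biased bin must reject. -/
lemma minLast_spec (hR : 1 ≤ c.maxRound d) {N τ : ℕ} (hτ : τ ≤ N) {ω : ℕ → Period d}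
    (hc : Concentrated c P N ω) (hdone : AllDone c ω τ) {r₁ : ℕ} (hr₁ : 1 ≤ r₁)
    (hr₁R : (r₁ : ℤ) ≤ c.maxRound d) (hthr1 : c.threshold d r₁ ≤ 1)
    (hbias : ∃ m ∈ binIndices d c.q (c.level d), ∃ k : Fin 2, ∃ x ∈ c.mesh m,
      3 / 2 * c.threshold d r₁ +
      coefBound d (strictFloor c.βhi) ρlo ρhi c₁ * (L * bandwidth c d true ^ β)
      < |trunc (target c P m k x (bandwidth c d false)) - P.payoff k x|) :
    minLast c ω τ ≤ r₁ ∧ (minLast c ω τ = c.maxRound d ∨ ∃ r : ℕ, minLast c ω τ = r ∧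
      c.threshold d r < 4 * coefBound d (strictFloor c.βhi) ρlo ρhi c₁ * L *
        bandwidth c d false ^ β) := by
  obtain ⟨m₁, hm₁, k, x, hx, herr⟩ := hbias
  have hfin : ((fun m => (freeBins c ω τ m).last) ''
      (binIndices d c.q (c.level d) : Set (Fin d → ℕ))).Finite :=
    (Finset.finite_toSet _).image _
  have hne : ((fun m => (freeBins c ω τ m).last) ''
      (binIndices d c.q (c.level d) : Set (Fin d → ℕ))).Nonempty :=
    ⟨_, m₁, hm₁, rfl⟩
  constructor
  · refine (csInf_le hfin.bddBelow ⟨m₁, hm₁, rfl⟩).trans ?_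
    have I := binInv_freeBins hq hR ω m₁ τ
    -- The biased bin rejects in round `r₁`, unless it has raised its flag before.
    have hrej : r₁ < (freeBins c ω τ m₁).round → RoundRejects c m₁ r₁ ω τ := fun h =>
      roundRejects_of_error hP hlo hhi hc₁ hco hq hbw hβ hL hH hp hτ hc hm₁ hr₁R
        (I.length r₁ hr₁ h) hthr1 hx herr
    by_cases hf : (freeBins c ω τ m₁).flag = true
    · obtain ⟨r₀, h1, h2, h3, -, h5⟩ := I.flag hf
      show (freeBins c ω τ m₁).last ≤ r₁
      rw [h1]
      by_contra hlt
      have hlt' : r₁ < r₀ := by omega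
      exact h5 r₁ hr₁ hlt' (hrej (hlt'.trans h3))
    · have hround := (hdone m₁ hm₁).resolve_left hf
      have h1 : r₁ < (freeBins c ω τ m₁).round := by omega
      exact absurd (hrej h1) ((I.no_flag (by simpa using hf)).2 r₁ hr₁ h1)
  -- A bin that attains the minimum has either never rejected or did so at the recorded round, and a
  -- rejection on the typical event needs biases that add up to more than half of the threshold.
  · obtain ⟨m, hm, hmeq⟩ := hne.csInf_mem hfin
    have hmeq' : minLast c ω τ = (freeBins c ω τ m).last := hmeq.symm
    have I := binInv_freeBins hq hR ω m τ
    rw [hmeq']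
    by_cases hf : (freeBins c ω τ m).flag = true
    · right
      obtain ⟨r₀, h1, h2, h3, h4, h5⟩ := I.flag hf
      refine ⟨r₀, h1, ?_⟩
      have := I.round_le
      exact threshold_lt_of_rejects hP hlo hhi hc₁ hco hq hbw hβ hL hH hp hτ hc hm (by omega)
        (I.length r₀ h2 h3) h4
    · left
      exact (I.no_flag (by simpa using hf)).1

end Recorded

/-! ### Bias of a self-similar problem -/

section Bias

variable {d : ℕ} {c : Params}

/-- Self-similarity yields a bin, an arm and a point at which the projection has a large error. -/
lemma SelfSimilar.exists_error {P : Problem d} {ρlo ρhi c₁ β b l₀ : ℝ} {q l p : ℕ}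
    (hS : SelfSimilar c.βhi β b l₀ P) (hP : HasBoundedDensity ρlo ρhi P.ctxLaw) (hlo : 0 < ρlo)
    (hhi : ρlo ≤ ρhi) (hc₁ : 0 < c₁)
    (hco : ∀ (σ : Fin d → Bool) (δ : Idx d p → ℝ),
      c₁ * ∑ s, δ s ^ 2 ≤ ∫ v in corner σ, polyVal δ v ^ 2)
    (hb : 0 < b) (hq : 1 < q) (hl : l₀ ≤ l) (hp : strictFloor β ≤ p) (hp' : p ≤ strictFloor c.βhi) :
    ∃ m ∈ binIndices d q l, ∃ k : Fin 2, ∃ x ∈ box (binCorner q l m) (((q : ℝ) ^ l)⁻¹),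
      b / 2 * (((q : ℝ) ^ l)⁻¹) ^ β ≤
        |popVal p (cond P.ctxLaw (box (binCorner q l m) (((q : ℝ) ^ l)⁻¹))) (P.payoff k) x
          (((q : ℝ) ^ l)⁻¹) - P.payoff k x| := by
  have hq0 : (0 : ℝ) < q := by exact_mod_cast (by omega : 0 < q)
  have hpow : (q : ℝ) ^ (-(l * β)) = (((q : ℝ) ^ l)⁻¹) ^ β := by
    rw [Real.rpow_neg hq0.le, Real.rpow_mul hq0.le, Real.rpow_natCast, Real.inv_rpow (by positivity)]
  have h := hS l q p hl hq hp hp'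
  have hlt : ENNReal.ofReal (b / 2 * (q : ℝ) ^ (-(l * β)))
      < ENNReal.ofReal (b * (q : ℝ) ^ (-(l * β))) := by
    have : 0 < (q : ℝ) ^ (-(l * β)) := Real.rpow_pos_of_pos hq0 _
    rw [ENNReal.ofReal_lt_ofReal_iff (by positivity)]
    nlinarith
  have h2 := hlt.trans_le h
  simp only [lt_iSup_iff] at h2
  obtain ⟨m, hm, k, x, hx, h3⟩ := h2
  have S := boxSetting_bin hP hlo hhi hc₁ hco (by omega) hm (l := l)
  have := S.isProbabilityMeasure
  have hxb := hx
  rw [bin_eq_box] at hxb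
  refine ⟨m, hm, k, x, hxb, ?_⟩
  have hf1 : ∀ u, |P.payoff k u| ≤ 1 := fun u =>
    abs_le.2 ⟨by linarith [payoff_nonneg P k u], payoff_le_one P k u⟩
  rw [← proj_eq_popVal (S.window_self hxb) (measurable_payoff P k) hf1, ← bin_eq_box, ← hpow]
  exact ((ENNReal.ofReal_lt_ofReal_iff_of_nonneg
    (by have := Real.rpow_pos_of_pos hq0 (-(l * β)); positivity)).1 h3).le

end Bias

/-! ### The scales of the policy -/

section Scales

/-- The standing assumptions on the inputs of the policy; the last one says that the horizon is not
too small. -/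
structure Params.Valid (c : Params) (d : ℕ) : Prop where
  d_pos : 1 ≤ d
  q_ge : 2 ≤ c.q
  lo_pos : 0 < c.βlo
  lo_lt : c.βlo < c.βhi
  υ_eq : c.υ = d / c.βlo + 4
  γ_pos : 0 < c.γ
  loglog_ge : 1 ≤ c.loglog

variable {c : Params} {d : ℕ} (V : c.Valid d)

namespace Params.Valid

include V

lemma q_pos : (0 : ℝ) < c.q := by
  have := V.q_ge
  exact_mod_cast (by omega : 0 < c.q)

lemma one_lt_q : (1 : ℝ) < c.q := by
  have := V.q_ge
  exact_mod_cast (by omega : 1 < c.q)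

lemma q_pos' : 0 < c.q := by have := V.q_ge; omega

lemma hi_pos : 0 < c.βhi := V.lo_pos.trans V.lo_lt

lemma log_pos : 0 < Real.log c.T := by
  by_contra h
  push Not at h
  have h1 : Real.log c.T = 0 := le_antisymm h (Real.log_natCast_nonneg _)
  have := V.loglog_ge
  rw [Params.loglog, h1, Real.logb_zero] at this
  linarith

lemma rpow_loglog : (c.q : ℝ) ^ c.loglog = Real.log c.T :=
  Real.rpow_logb V.q_pos V.one_lt_q.ne' V.log_pos

lemma q_le_log : (c.q : ℝ) ≤ Real.log c.T := by
  rw [← V.rpow_loglog]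
  calc (c.q : ℝ) = (c.q : ℝ) ^ (1 : ℝ) := (Real.rpow_one _).symm
    _ ≤ _ := Real.rpow_le_rpow_of_exponent_le V.one_lt_q.le V.loglog_ge

lemma one_lt_log : 1 < Real.log c.T := V.one_lt_q.trans_le V.q_le_log

lemma rpow_mul_loglog (a : ℝ) : (c.q : ℝ) ^ (a * c.loglog) = Real.log c.T ^ a := by
  rw [mul_comm, Real.rpow_mul V.q_pos.le, V.rpow_loglog]

lemma horizon_pos : (0 : ℝ) < c.T := by
  rcases Nat.eq_zero_or_pos c.T with h | h
  · have := V.log_pos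
    rw [h, Nat.cast_zero, Real.log_zero] at this
    exact absurd this (lt_irrefl _)
  · exact_mod_cast h

lemma one_lt_horizon : (1 : ℝ) < c.T := by
  by_contra h
  push Not at h
  exact absurd V.log_pos (not_lt.2 (Real.log_nonpos V.horizon_pos.le h))

lemma bandwidth_false_pos : 0 < bandwidth c d false := by
  rw [bandwidth_false]
  have := V.q_pos
  positivity

lemma bandwidth_false_eq : bandwidth c d false = (c.q : ℝ) ^ (-(c.level d : ℝ)) := by
  rw [bandwidth_false, Real.rpow_neg V.q_pos.le, Real.rpow_natCast]

lemma bandwidth_false_rpow (a : ℝ) :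
    bandwidth c d false ^ a = (c.q : ℝ) ^ (-(a * c.level d)) := by
  rw [V.bandwidth_false_eq, ← Real.rpow_mul V.q_pos.le]
  congr 1; ring

lemma bandwidth_false_le_one : bandwidth c d false ≤ 1 := by
  rw [V.bandwidth_false_eq]
  exact Real.rpow_le_one_of_one_le_of_nonpos V.one_lt_q.le (by simp)

lemma bandwidth_true_eq : bandwidth c d true
    = bandwidth c d false * (c.q : ℝ) ^ (-((⌈1 / c.βlo * c.loglog⌉ : ℤ) : ℝ)) := by
  rw [V.bandwidth_false_eq, ← Real.rpow_add V.q_pos]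
  simp only [bandwidth, if_true, Params.bw₂]
  rw [← Real.rpow_intCast]
  congr 1
  push_cast
  ring

lemma bandwidth_true_le : bandwidth c d true
    ≤ bandwidth c d false * Real.log c.T ^ (-(1 / c.βlo)) := by
  rw [V.bandwidth_true_eq, ← V.rpow_mul_loglog]
  refine mul_le_mul_of_nonneg_left (Real.rpow_le_rpow_of_exponent_le V.one_lt_q.le ?_)
    V.bandwidth_false_pos.le
  have := Int.le_ceil (1 / c.βlo * c.loglog)
  linarith

lemma le_bandwidth_true : bandwidth c d false * ((c.q : ℝ)⁻¹ * Real.log c.T ^ (-(1 / c.βlo)))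
    ≤ bandwidth c d true := by
  rw [V.bandwidth_true_eq, ← V.rpow_mul_loglog, ← Real.rpow_neg_one (c.q : ℝ),
    ← Real.rpow_add V.q_pos]
  refine mul_le_mul_of_nonneg_left (Real.rpow_le_rpow_of_exponent_le V.one_lt_q.le ?_)
    V.bandwidth_false_pos.le
  have := Int.ceil_lt_add_one (1 / c.βlo * c.loglog)
  linarith

lemma bandwidth_true_le_false : bandwidth c d true ≤ bandwidth c d false := by
  refine V.bandwidth_true_le.trans (mul_le_of_le_one_right V.bandwidth_false_pos.le ?_)
  have := V.lo_pos
  exact Real.rpow_le_one_of_one_le_of_nonpos V.one_lt_log.le (by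
    rw [neg_nonpos]; positivity)

lemma bandwidth_true_rpow_le {β : ℝ} (hβ : c.βlo ≤ β) :
    bandwidth c d true ^ β ≤ (Real.log c.T)⁻¹ * bandwidth c d false ^ β := by
  have hβ0 := V.lo_pos.trans_le hβ
  have h0 : 0 ≤ bandwidth c d true := by
    unfold bandwidth; rw [if_pos rfl]; exact (zpow_pos V.q_pos _).le
  have hy := V.log_pos
  refine (Real.rpow_le_rpow h0 V.bandwidth_true_le hβ0.le).trans ?_
  rw [Real.mul_rpow V.bandwidth_false_pos.le (by positivity), mul_comm]
  refine mul_le_mul_of_nonneg_right ?_ (Real.rpow_nonneg V.bandwidth_false_pos.le _)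
  rw [← Real.rpow_mul hy.le, ← Real.rpow_neg_one]
  refine Real.rpow_le_rpow_of_exponent_le V.one_lt_log.le ?_
  have : 1 ≤ 1 / c.βlo * β := by
    rw [one_div, inv_mul_eq_div, le_div_iff₀ V.lo_pos, one_mul]; exact hβ
  linarith

lemma threshold_nonneg (r : ℕ) : 0 ≤ c.threshold d r := by
  have h1 := V.γ_pos
  have h2 := V.log_pos
  have h3 := V.q_pos
  unfold Params.threshold; positivity

lemma threshold_sq_mul (r : ℕ) :
    c.threshold d r ^ 2 * (c.q : ℝ) ^ r = c.γ ^ 2 * Real.log c.T ^ ((d : ℝ) / c.βlo + 1) := by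
  have hy := V.log_pos
  have h1 : ((c.q : ℝ) ^ ((r : ℝ) / 2)) ^ 2 = (c.q : ℝ) ^ r := by
    rw [← Real.rpow_natCast, ← Real.rpow_mul V.q_pos.le, ← Real.rpow_natCast]
    congr 1; push_cast; ring
  have h2 : (Real.log c.T ^ ((d : ℝ) / (2 * c.βlo) + 1 / 2)) ^ 2
      = Real.log c.T ^ ((d : ℝ) / c.βlo + 1) := by
    rw [← Real.rpow_natCast, ← Real.rpow_mul hy.le]
    congr 1
    have := V.lo_pos.ne'
    push_cast; field_simp
  have h3 : (c.q : ℝ) ^ r ≠ 0 := (pow_pos V.q_pos r).ne'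
  unfold Params.threshold
  rw [div_pow, mul_pow, h1, h2, div_mul_cancel₀ _ h3]

/-- The threshold makes the exponent of the concentration inequality proportional to `log T`. -/
lemma le_threshold_sq_mul (r : ℕ) : c.γ ^ 2 * ((c.q : ℝ) ^ d)⁻¹ * Real.log c.T ≤
    c.threshold d r ^ 2 * ((bandwidth c d true / bandwidth c d false) ^ d * (c.q : ℝ) ^ r) := by
  have hy := V.log_pos
  have hq := V.q_pos
  have h1 : (c.q : ℝ)⁻¹ * Real.log c.T ^ (-(1 / c.βlo))
      ≤ bandwidth c d true / bandwidth c d false := by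
    rw [le_div_iff₀ V.bandwidth_false_pos, mul_comm]; exact V.le_bandwidth_true
  have h2 := pow_le_pow_left₀ (by positivity) h1 d
  have h3 : ((c.q : ℝ)⁻¹ * Real.log c.T ^ (-(1 / c.βlo))) ^ d
      = ((c.q : ℝ) ^ d)⁻¹ * Real.log c.T ^ (-((d : ℝ) / c.βlo)) := by
    rw [mul_pow, inv_pow, ← Real.rpow_natCast (Real.log c.T ^ _), ← Real.rpow_mul hy.le]
    congr 2; ring
  rw [h3] at h2
  calc c.γ ^ 2 * ((c.q : ℝ) ^ d)⁻¹ * Real.log c.T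
      = ((c.q : ℝ) ^ d)⁻¹ * Real.log c.T ^ (-((d : ℝ) / c.βlo)) *
        (c.γ ^ 2 * Real.log c.T ^ ((d : ℝ) / c.βlo + 1)) := by
        have : Real.log c.T ^ (-((d : ℝ) / c.βlo)) * Real.log c.T ^ ((d : ℝ) / c.βlo + 1)
            = Real.log c.T := by
          rw [← Real.rpow_add hy]; simp
        calc _ = ((c.q : ℝ) ^ d)⁻¹ * c.γ ^ 2 * (Real.log c.T ^ (-((d : ℝ) / c.βlo)) *
              Real.log c.T ^ ((d : ℝ) / c.βlo + 1)) := by rw [this]; ring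
          _ = _ := by ring
    _ ≤ (bandwidth c d true / bandwidth c d false) ^ d *
        (c.γ ^ 2 * Real.log c.T ^ ((d : ℝ) / c.βlo + 1)) :=
        mul_le_mul_of_nonneg_right h2 (by positivity)
    _ = _ := by rw [← V.threshold_sq_mul r]; ring

lemma threshold_eq (r : ℕ) (β κ : ℝ) : c.threshold d r = c.γ *
    Real.log c.T ^ ((d : ℝ) / (2 * c.βlo) + 1 / 2 - κ / 2) * bandwidth c d false ^ β *
    (c.q : ℝ) ^ ((2 * c.level d * β + κ * c.loglog - r) / 2) := by
  have hy := V.log_pos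
  have h1 : (c.q : ℝ) ^ (κ / 2 * c.loglog) ≠ 0 := (Real.rpow_pos_of_pos V.q_pos _).ne'
  have h2 : (c.q : ℝ) ^ ((r : ℝ) / 2) ≠ 0 := (Real.rpow_pos_of_pos V.q_pos _).ne'
  have h3 : (c.q : ℝ) ^ (-(β * c.level d)) * (c.q : ℝ) ^ ((2 * c.level d * β + κ * c.loglog - r) / 2)
      * (c.q : ℝ) ^ ((r : ℝ) / 2) = (c.q : ℝ) ^ (κ / 2 * c.loglog) := by
    rw [← Real.rpow_add V.q_pos, ← Real.rpow_add V.q_pos]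
    congr 1; ring
  rw [V.bandwidth_false_rpow, Params.threshold, Real.rpow_sub hy _ (κ / 2),
    ← V.rpow_mul_loglog (κ / 2), div_eq_iff h2, ← h3]
  have h4 : (c.q : ℝ) ^ (-(β * c.level d)) ≠ 0 := (Real.rpow_pos_of_pos V.q_pos _).ne'
  have h5 : (c.q : ℝ) ^ ((2 * c.level d * β + κ * c.loglog - r) / 2) ≠ 0 :=
    (Real.rpow_pos_of_pos V.q_pos _).ne'
  generalize (c.q : ℝ) ^ (-(β * c.level d)) = a1 at *
  generalize (c.q : ℝ) ^ ((2 * c.level d * β + κ * c.loglog - r) / 2) = a2 at *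
  generalize (c.q : ℝ) ^ ((r : ℝ) / 2) = a3 at *
  field_simp

lemma threshold_le {r : ℕ} {β : ℝ}
    (hr : 2 * c.level d * β + (d / c.βlo + 2) * c.loglog ≤ r) :
    c.threshold d r ≤ c.γ * Real.log c.T ^ (-(1 / 2) : ℝ) * bandwidth c d false ^ β := by
  have hy := V.log_pos
  have hγ := V.γ_pos
  have hb := V.bandwidth_false_pos
  rw [V.threshold_eq r β (d / c.βlo + 2)]
  have : (d : ℝ) / (2 * c.βlo) + 1 / 2 - (d / c.βlo + 2) / 2 = -(1 / 2) := by
    have := V.lo_pos.ne'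
    field_simp; ring
  rw [this]
  refine mul_le_of_le_one_right (by positivity) ?_
  exact Real.rpow_le_one_of_one_le_of_nonpos V.one_lt_q.le (by linarith)

lemma le_threshold {r : ℕ} {β : ℝ}
    (hr : (r : ℝ) ≤ 2 * c.level d * β + (d / c.βlo - 2) * c.loglog) :
    c.γ * Real.log c.T ^ (3 / 2 : ℝ) * bandwidth c d false ^ β ≤ c.threshold d r := by
  have hy := V.log_pos
  have hγ := V.γ_pos
  have hb := V.bandwidth_false_pos
  rw [V.threshold_eq r β (d / c.βlo - 2)]
  have : (d : ℝ) / (2 * c.βlo) + 1 / 2 - (d / c.βlo - 2) / 2 = 3 / 2 := by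
    have := V.lo_pos.ne'
    field_simp; ring
  rw [this]
  refine le_mul_of_one_le_right (by positivity) ?_
  exact Real.one_le_rpow V.one_lt_q.le (by linarith)

/-- The rate at which the level grows with `log_q T`. -/
lemma levelRate_pos : 0 < (c.βlo + d - 1) / (2 * c.βhi + d) ^ 2 := by
  have h1 := V.lo_pos
  have h2 := V.hi_pos
  have h3 : (1 : ℝ) ≤ d := by exact_mod_cast V.d_pos
  have : 0 < c.βlo + d - 1 := by linarith
  positivity

omit V in
lemma le_level : (c.βlo + d - 1) / (2 * c.βhi + d) ^ 2 * Real.logb c.q c.T ≤ c.level d := by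
  unfold Params.level
  refine le_trans (le_of_eq ?_) (Nat.le_ceil _)
  ring

lemma logb_horizon_pos : 0 < Real.logb c.q c.T :=
  Real.logb_pos V.one_lt_q V.one_lt_horizon

lemma level_pos : 0 < (c.level d : ℝ) :=
  (mul_pos V.levelRate_pos V.logb_horizon_pos).trans_le le_level

lemma level_lt : (c.level d : ℝ) <
    (c.βlo + d - 1) / (2 * c.βhi + d) ^ 2 * Real.logb c.q c.T + 1 := by
  have h := (mul_pos V.levelRate_pos V.logb_horizon_pos).le
  unfold Params.level
  refine lt_of_lt_of_eq (Nat.ceil_lt_add_one ?_) ?_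
  · refine h.trans (le_of_eq ?_); ring
  · ring

lemma rpow_level_le : (c.q : ℝ) ^ (c.level d : ℝ) ≤
    c.q * (c.T : ℝ) ^ ((c.βlo + d - 1) / (2 * c.βhi + d) ^ 2) := by
  have h1 : (c.T : ℝ) ^ ((c.βlo + d - 1) / (2 * c.βhi + d) ^ 2)
      = (c.q : ℝ) ^ ((c.βlo + d - 1) / (2 * c.βhi + d) ^ 2 * Real.logb c.q c.T) := by
    rw [mul_comm _ (Real.logb _ _), Real.rpow_mul V.q_pos.le,
      Real.rpow_logb V.q_pos V.one_lt_q.ne' V.horizon_pos]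
  rw [h1, mul_comm, ← Real.rpow_add_one V.q_pos.ne']
  exact Real.rpow_le_rpow_of_exponent_le V.one_lt_q.le V.level_lt.le

omit V in
lemma le_maxRound : 2 * (c.level d : ℝ) * c.βhi + c.υ * c.loglog ≤ (c.maxRound d : ℝ) := Int.le_ceil _

lemma one_le_maxRound : 1 ≤ c.maxRound d := by
  have h1 := le_maxRound (c := c) (d := d)
  have h2 := mul_pos V.level_pos V.hi_pos
  have h3 : 4 ≤ c.υ := by
    rw [V.υ_eq]
    have := V.lo_pos
    have : 0 ≤ (d : ℝ) / c.βlo := by positivity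
    linarith
  have h4 : (0 : ℝ) < c.maxRound d := by nlinarith [V.loglog_ge]
  have : 0 < c.maxRound d := by exact_mod_cast h4
  omega

lemma rpow_maxRound_le : (c.q : ℝ) ^ (c.maxRound d : ℝ) ≤
    c.q * (((c.q : ℝ) ^ (c.level d : ℝ)) ^ (2 * c.βhi) * Real.log c.T ^ c.υ) := by
  rw [← V.rpow_mul_loglog, ← Real.rpow_mul V.q_pos.le, ← Real.rpow_add V.q_pos, mul_comm,
    ← Real.rpow_add_one V.q_pos.ne']
  refine Real.rpow_le_rpow_of_exponent_le V.one_lt_q.le ?_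
  have := (Int.ceil_lt_add_one (2 * (c.level d : ℝ) * c.βhi + c.υ * c.loglog)).le
  refine this.trans (le_of_eq ?_)
  ring

lemma log_rpow_le_rpow_maxRound : Real.log c.T ^ (4 : ℝ) ≤ (c.q : ℝ) ^ (c.maxRound d : ℝ) := by
  rw [← V.rpow_mul_loglog]
  refine Real.rpow_le_rpow_of_exponent_le V.one_lt_q.le ?_
  have h1 := le_maxRound (c := c) (d := d)
  have h2 := mul_pos V.level_pos V.hi_pos
  have h3 : 4 ≤ c.υ := by
    rw [V.υ_eq]
    have := V.lo_pos
    have : 0 ≤ (d : ℝ) / c.βlo := by positivity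
    linarith
  nlinarith [V.loglog_ge]

omit V in
lemma le_meshLevel : (1 + c.βhi) * (c.level d : ℝ) + c.loglog ≤ (c.meshLevel d : ℝ) :=
  (Int.le_ceil _).trans (by exact_mod_cast le_max_right _ _)

lemma exists_meshLevel : ∃ M : ℕ, c.meshLevel d = M ∧ c.level d ≤ M := by
  have h1 := le_meshLevel (c := c) (d := d)
  have h2 := mul_pos V.level_pos V.hi_pos
  have h3 : ((c.level d : ℤ) : ℝ) ≤ (c.meshLevel d : ℝ) := by
    push_cast; nlinarith [V.loglog_ge]
  have h4 : (c.level d : ℤ) ≤ c.meshLevel d := by exact_mod_cast h3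
  obtain ⟨M, hM⟩ := Int.eq_ofNat_of_zero_le (le_trans (by positivity) h4)
  exact ⟨M, hM, by omega⟩

lemma rpow_meshLevel_le : (c.q : ℝ) ^ (c.meshLevel d : ℝ) ≤ c.q *
    (((c.q : ℝ) ^ (c.level d : ℝ)) ^ (c.βhi / c.βlo + (1 + c.βhi)) *
      Real.log c.T ^ (1 / c.βlo + 1)) := by
  rw [← V.rpow_mul_loglog, ← Real.rpow_mul V.q_pos.le, ← Real.rpow_add V.q_pos, mul_comm,
    ← Real.rpow_add_one V.q_pos.ne']
  refine Real.rpow_le_rpow_of_exponent_le V.one_lt_q.le ?_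
  have h1 := (Int.ceil_lt_add_one (c.βhi * (c.level d : ℝ) / c.βlo + c.loglog / c.βlo)).le
  have h2 := (Int.ceil_lt_add_one ((1 + c.βhi) * (c.level d : ℝ) + c.loglog)).le
  have hlo := V.lo_pos
  have hhi := V.hi_pos
  have hl := V.level_pos
  have hΛ := V.loglog_ge
  have h3 : 0 ≤ c.βhi * (c.level d : ℝ) / c.βlo := by positivity
  have h4 : 0 ≤ c.loglog / c.βlo := by positivity
  have h5 : 0 ≤ (1 + c.βhi) * (c.level d : ℝ) := by positivity
  have key : (c.level d : ℝ) * (c.βhi / c.βlo + (1 + c.βhi)) + (1 / c.βlo + 1) * c.loglog + 1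
      = c.βhi * (c.level d : ℝ) / c.βlo + c.loglog / c.βlo + (1 + c.βhi) * (c.level d : ℝ)
        + c.loglog + 1 := by ring
  rw [key, Params.meshLevel, Int.cast_max]
  exact max_le (by linarith) (by linarith)

lemma inv_meshWidth_le {M : ℕ} (hM : c.meshLevel d = M) {β : ℝ} (hβ : β ≤ c.βhi) :
    ((c.q : ℝ) ^ M)⁻¹ / ((c.q : ℝ) ^ c.level d)⁻¹ ≤ (Real.log c.T)⁻¹ * bandwidth c d false ^ β := by
  rw [V.bandwidth_false_rpow, ← V.rpow_loglog, ← Real.rpow_neg V.q_pos.le,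
    ← Real.rpow_add V.q_pos, ← Real.rpow_natCast, ← Real.rpow_natCast,
    ← Real.rpow_neg V.q_pos.le, ← Real.rpow_neg V.q_pos.le, ← Real.rpow_sub V.q_pos]
  refine Real.rpow_le_rpow_of_exponent_le V.one_lt_q.le ?_
  have h := le_meshLevel (c := c) (d := d)
  rw [hM] at h
  push_cast at h
  have := mul_le_mul_of_nonneg_right hβ V.level_pos.le
  linarith

end Params.Valid

end Scales

/-! ### The smoothness estimate on the typical event -/

section Estimate

variable {d : ℕ} {c : Params}

/-- The estimates that do not exceed the smoothness `β` and lie within the accuracy of the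
estimate. -/
def goodEstimates (c : Params) (d : ℕ) (β : ℝ) : Set ℝ :=
  {β₀ | β₀ ∈ Set.Icc c.βlo c.βhi ∧
    clamp c.βlo c.βhi (β - estError d c.q c.βlo c.βhi c.T) ≤ β₀ ∧ β₀ ≤ β ∧ (c.βlo < β → β₀ < β)}

lemma clamp_mono {lo hi a b : ℝ} (h : a ≤ b) : clamp lo hi a ≤ clamp lo hi b :=
  min_le_min_right _ (max_le_max_left _ h)

lemma clamp_mem {lo hi : ℝ} (h : lo ≤ hi) (a : ℝ) : clamp lo hi a ∈ Set.Icc lo hi :=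
  ⟨le_min (le_max_left _ _) h, min_le_right _ _⟩

/-- The least recorded round determines the smoothness up to the accuracy of the estimate. -/
lemma betaOfLast_mem (V : c.Valid d) {β : ℝ} (hβ : β ∈ Set.Icc c.βlo c.βhi) {z : ℤ}
    (hlow : 2 * c.level d * β + (d / c.βlo - 2) * c.loglog ≤ z)
    (hupp : (z : ℝ) ≤ 2 * c.level d * β + (d / c.βlo + 2) * c.loglog + 1) :
    betaOfLast c d z ∈ goodEstimates c d β := by
  have hl := V.level_pos
  have hΛ := V.loglog_ge
  -- With `υ = d / βlo + 4`, the bounds on `z - υ Λ` are `2 l β - 6 Λ` and `2 l β - 2 Λ + 1 < 2 l β`; this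
  -- is where `Λ ≥ 1` enters.
  have hv : β - 3 * c.loglog / c.level d ≤ 1 / (2 * (c.level d : ℝ)) * ((z : ℝ) - c.υ * c.loglog) := by
    rw [V.υ_eq, one_div, inv_mul_eq_div, le_div_iff₀ (by positivity)]
    have : (β - 3 * c.loglog / c.level d) * (2 * c.level d)
        = 2 * c.level d * β - 6 * c.loglog := by field_simp; ring
    rw [this]
    linarith
  have hv' : 1 / (2 * (c.level d : ℝ)) * ((z : ℝ) - c.υ * c.loglog) < β := by
    rw [V.υ_eq, one_div, inv_mul_eq_div, div_lt_iff₀ (by positivity)]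
    linarith
  have herr : 3 * c.loglog / c.level d ≤ estError d c.q c.βlo c.βhi c.T := by
    have h1 := mul_pos V.levelRate_pos V.logb_horizon_pos
    have h2 : estError d c.q c.βlo c.βhi c.T = 3 * c.loglog /
        ((c.βlo + d - 1) / (2 * c.βhi + d) ^ 2 * Real.logb c.q c.T) := by
      unfold estError Params.loglog
      have h3 : (2 * c.βhi + d) ≠ 0 := by
        have := V.hi_pos; positivity
      field_simp
    rw [h2]
    exact div_le_div_of_nonneg_left (by linarith) h1 Params.Valid.le_level
  refine ⟨clamp_mem V.lo_lt.le _, clamp_mono (by linarith), ?_, fun h => ?_⟩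
  · exact (min_le_left _ _).trans (max_le hβ.1 hv'.le)
  · exact (min_le_left _ _).trans_lt (max_lt h hv')

/-- On the typical event the exploration ends in time, with a good estimate. -/
lemma stopsWell_of_typical (V : c.Valid d) {P : Problem d} {ρlo ρhi c₁ β L ε : ℝ}
    (hP : HasBoundedDensity ρlo ρhi P.ctxLaw) (hlo : 0 < ρlo) (hhi : ρlo ≤ ρhi) (hc₁ : 0 < c₁)
    (hco : ∀ (σ : Fin d → Bool) (δ : Idx d (strictFloor c.βhi) → ℝ),
      c₁ * ∑ s, δ s ^ 2 ≤ ∫ v in corner σ, polyVal δ v ^ 2)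
    (hβ : β ∈ Set.Icc c.βlo c.βhi) (hL : 0 ≤ L) (hH : ∀ k, IsHolder β L (P.payoff k))
    (hbias : ∃ m ∈ binIndices d c.q (c.level d), ∃ k : Fin 2,
      ∃ x ∈ box (binCorner c.q (c.level d) m) (((c.q : ℝ) ^ c.level d)⁻¹),
      ε * (((c.q : ℝ) ^ c.level d)⁻¹) ^ β ≤
        |trunc (popVal (strictFloor c.βhi) (cond P.ctxLaw (box (binCorner c.q (c.level d) m)
          (((c.q : ℝ) ^ c.level d)⁻¹))) (P.payoff k) x (((c.q : ℝ) ^ c.level d)⁻¹)) - P.payoff k x|)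
    (hC : 4 * coefBound d (strictFloor c.βhi) ρlo ρhi c₁ * L ≤ c.γ * Real.log c.T ^ (3 / 2 : ℝ))
    (hthr : c.γ * Real.log c.T ^ (-(1 / 2) : ℝ) ≤ 1)
    (hε : 3 / 2 * (c.γ * Real.log c.T ^ (-(1 / 2) : ℝ)) +
      coefBound d (strictFloor c.βhi) ρlo ρhi c₁ * L * (Real.log c.T)⁻¹ < ε / 2)
    (hκ1 : L * (Real.log c.T)⁻¹ ^ β + Fintype.card (Idx d (strictFloor c.βhi)) *
      (coefBound d (strictFloor c.βhi) ρlo ρhi c₁ * L) * (Real.log c.T)⁻¹ ≤ ε / 4)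
    (hκ2 : 2 * (Fintype.card (Idx d (strictFloor c.βhi)) *
      coefBound d (strictFloor c.βhi) ρlo ρhi c₁ * (Real.log c.T)⁻¹) ≤ ε / 4)
    {R N : ℕ} (hR : c.maxRound d = R) (hN : 1 ≤ N) {ω : ℕ → Period d}
    (hconc : Concentrated c P N ω) (hvis : Visited c N (roundStart c.q (R + 1)) ω) :
    ∃ τ ≤ N, StopsWell c (goodEstimates c d β) τ ω := by
  have hβ0 : 0 < β := V.lo_pos.trans_le hβ.1
  have hp : strictFloor β ≤ strictFloor c.βhi := by
    unfold strictFloor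
    exact Nat.sub_le_sub_right (Nat.ceil_mono hβ.2) 1
  have hR1 := V.one_le_maxRound
  have hq := V.q_pos'
  have hl := V.level_pos
  have hΛ := V.loglog_ge
  have hb : 0 < bandwidth c d false ^ β := Real.rpow_pos_of_pos V.bandwidth_false_pos _
  obtain ⟨τ, hτ1, hτ, hended, hdone⟩ := exists_stopTime (n := roundStart c.q (R + 1)) hq hR1 hN
    (fun r hr => roundStart_mono _ (by rw [hR] at hr; omega)) hvis
  refine ⟨τ, hτ, hended, ?_⟩
  -- the round in which a biased bin must reject at the latest
  set r₁ : ℕ := ⌈2 * c.level d * β + (d / c.βlo + 2) * c.loglog⌉₊ with hr₁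
  have hd0 : 0 ≤ (d : ℝ) / c.βlo := by have := V.lo_pos; positivity
  have hpos : 0 < 2 * c.level d * β + (d / c.βlo + 2) * c.loglog := by positivity
  have hr₁lt : (r₁ : ℝ) < 2 * c.level d * β + (d / c.βlo + 2) * c.loglog + 1 :=
    Nat.ceil_lt_add_one hpos.le
  have hr₁1 : 1 ≤ r₁ := Nat.one_le_iff_ne_zero.2 (Nat.ceil_pos.2 hpos).ne'
  have hle1 : (c.level d : ℝ) * β ≤ c.level d * c.βhi := mul_le_mul_of_nonneg_left hβ.2 hl.le
  have hmax := Params.Valid.le_maxRound (c := c) (d := d)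
  rw [V.υ_eq] at hmax
  -- The room between `d / βlo + 2` and `υ` makes this round one of those in which a test takes place.
  have hr₁R : (r₁ : ℤ) ≤ c.maxRound d := by
    have : (r₁ : ℝ) ≤ (c.maxRound d : ℝ) := by linarith
    exact_mod_cast this
  have hthr₁ : c.threshold d r₁ ≤
      c.γ * Real.log c.T ^ (-(1 / 2) : ℝ) * bandwidth c d false ^ β :=
    V.threshold_le (Nat.le_ceil _)
  have hy := V.log_pos
  have hthr1 : c.threshold d r₁ ≤ 1 := by
    refine hthr₁.trans (mul_le_one₀ hthr hb.le ?_)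
    exact Real.rpow_le_one V.bandwidth_false_pos.le V.bandwidth_false_le_one hβ0.le
  have hbias' : ∃ m ∈ binIndices d c.q (c.level d), ∃ k : Fin 2, ∃ x ∈ c.mesh m,
      3 / 2 * c.threshold d r₁ +
      coefBound d (strictFloor c.βhi) ρlo ρhi c₁ * (L * bandwidth c d true ^ β)
      < |trunc (target c P m k x (bandwidth c d false)) - P.payoff k x| := by
    obtain ⟨m, hm, k, x, hx, he⟩ := hbias
    obtain ⟨M, hM, hlM⟩ := V.exists_meshLevel
    have hxb := hx
    rw [← bin_eq_box] at hxb
    obtain ⟨x', hx', hnear⟩ := exists_mesh_near hq hM hlM hm hxb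
    refine ⟨m, hm, k, x', hx', ?_⟩
    have S := boxSetting_bin hP hlo hhi hc₁ hco hq hm (l := c.level d)
    have hx'b := mesh_subset m hx'
    rw [bin_eq_box] at hx'b
    -- The mesh is finer than `q ^ (-(1 + βhi) l) / log T`, so that moving to a mesh point changes the
    -- polynomial by less than the bias.
    have hdist : ‖x' - x‖ / ((c.q : ℝ) ^ c.level d)⁻¹
        ≤ (Real.log c.T)⁻¹ * (((c.q : ℝ) ^ c.level d)⁻¹) ^ β := by
      have h := V.inv_meshWidth_le hM hβ.2
      rw [bandwidth_false] at h
      refine le_trans ?_ h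
      exact div_le_div_of_nonneg_right hnear S.h_pos.le
    have hb1 : (((c.q : ℝ) ^ c.level d)⁻¹) ^ β ≤ 1 := by
      rw [← bandwidth_false]
      exact Real.rpow_le_one V.bandwidth_false_pos.le V.bandwidth_false_le_one hβ0.le
    have hdist' : ‖x' - x‖ / ((c.q : ℝ) ^ c.level d)⁻¹ ≤ (Real.log c.T)⁻¹ :=
      hdist.trans (mul_le_of_le_one_right (inv_nonneg.2 hy.le) hb1)
    have hM0 := S.coefBound_nonneg
    have hb' : 0 < (((c.q : ℝ) ^ c.level d)⁻¹) ^ β := by rw [← bandwidth_false]; exact hb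
    have hmain := S.le_trunc_error_of_near (measurable_payoff P k)
      (fun u => ⟨payoff_nonneg P k u, payoff_le_one P k u⟩) hβ0 hL (hH k) hp hx hx'b he hdist' hκ1
      (by
        refine le_trans (b := 2 * (Fintype.card (Idx d (strictFloor c.βhi)) *
          coefBound d (strictFloor c.βhi) ρlo ρhi c₁ *
            ((Real.log c.T)⁻¹ * (((c.q : ℝ) ^ c.level d)⁻¹) ^ β))) ?_ ?_
        · gcongr
        · have := mul_le_mul_of_nonneg_right hκ2 hb'.le
          linarith)
    rw [← bandwidth_false] at hmain
    have hmain' : ε / 2 * bandwidth c d false ^ β ≤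
        |trunc (target c P m k x' (bandwidth c d false)) - P.payoff k x'| := by
      unfold target
      rw [bin_eq_box, ← bandwidth_false]
      exact hmain
    refine lt_of_lt_of_le ?_ hmain'
    -- The smaller bandwidth has a bias that is smaller by a factor `log T`.
    have h2 := V.bandwidth_true_rpow_le hβ.1
    have h3 : coefBound d (strictFloor c.βhi) ρlo ρhi c₁ * (L * bandwidth c d true ^ β) ≤
        coefBound d (strictFloor c.βhi) ρlo ρhi c₁ * (L * ((Real.log c.T)⁻¹ *
          bandwidth c d false ^ β)) := by gcongr
    have h4 := mul_lt_mul_of_pos_right hε hb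
    linarith
  obtain ⟨hup, hdown⟩ := minLast_spec hP hlo hhi hc₁ hco hq V.bandwidth_true_le_false hβ0 hL hH hp
    hR1 hτ hconc hdone hr₁1 hr₁R hthr1 hbias'
  refine betaOfLast_mem V hβ ?_ ?_
  · rcases hdown with h | ⟨r, h, hlt⟩
    · rw [h]; linarith
    · rw [h]
      by_contra hcon
      push Not at hcon
      push_cast at hcon
      have h1 := V.le_threshold hcon.le
      have h2 := mul_le_mul_of_nonneg_right hC hb.le
      linarith
  · have : (minLast c ω τ : ℝ) ≤ r₁ := by exact_mod_cast hup
    linarith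

end Estimate

/-! ### Length of the exploration and probability of the typical event -/

section Length

lemma roundStart_le {q : ℕ} (hq : 2 ≤ q) (R : ℕ) : roundStart q (R + 1) ≤ 4 * q ^ R := by
  induction R with
  | zero => simp [roundStart_one]
  | succ R ih =>
    rw [roundStart_succ q (by omega), pow_succ]
    have := Nat.mul_le_mul_left (q ^ R) hq
    omega

lemma le_roundStart {q R : ℕ} (hR : 1 ≤ R) : q ^ R ≤ roundStart q (R + 1) := by
  rw [roundStart_succ q hR]; omega

/-- Powers of logarithms are negligible relative to powers. -/
lemma eventually_mul_rpow_log_le (A B : ℝ) {e e' : ℝ} (h : e < e') :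
    ∀ᶠ T : ℕ in atTop, A * (T : ℝ) ^ e * Real.log T ^ B ≤ (T : ℝ) ^ e' := by
  have h1 : (fun x : ℝ => Real.log x ^ B) =o[atTop] fun x : ℝ => x ^ (e' - e) :=
    isLittleO_log_rpow_rpow_atTop B (sub_pos.2 h)
  have h2 := (h1.bound (c := (|A| + 1)⁻¹) (by positivity)).and (eventually_gt_atTop 1)
  have h3 := tendsto_natCast_atTop_atTop (R := ℝ) |>.eventually h2
  filter_upwards [h3] with T hT
  obtain ⟨hT, hT1⟩ := hT
  have hT0 : (0 : ℝ) < T := by linarith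
  have hy : 0 ≤ Real.log (T : ℝ) ^ B := Real.rpow_nonneg (Real.log_nonneg hT1.le) _
  have hx : 0 < (T : ℝ) ^ (e' - e) := Real.rpow_pos_of_pos hT0 _
  rw [Real.norm_of_nonneg hy, Real.norm_of_nonneg hx.le, inv_mul_eq_div,
    le_div_iff₀ (by positivity)] at hT
  have he : 0 < (T : ℝ) ^ e := Real.rpow_pos_of_pos hT0 _
  have h4 : A * Real.log T ^ B ≤ (T : ℝ) ^ (e' - e) := by
    have := mul_le_mul_of_nonneg_right (le_abs_self A) hy
    nlinarith
  calc A * (T : ℝ) ^ e * Real.log T ^ B = (T : ℝ) ^ e * (A * Real.log T ^ B) := by ring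
    _ ≤ (T : ℝ) ^ e * (T : ℝ) ^ (e' - e) := mul_le_mul_of_nonneg_left h4 he.le
    _ = (T : ℝ) ^ e' := by rw [← Real.rpow_add hT0]; congr 1; ring

variable {d : ℕ} {c : Params}

/-- The length of the exploration that suffices on the typical event. -/
def explorationLength (c : Params) (d R : ℕ) (ρlo : ℝ) : ℕ :=
  ⌈4 * (roundStart c.q (R + 1) : ℝ) * ((c.q : ℝ) ^ c.level d) ^ d / ρlo⌉₊

/-- The constant in front of the concentration inequality. -/
def concConst (d p : ℕ) : ℝ := 2 * (Fintype.card (Idx d p) ^ 2 + Fintype.card (Idx d p))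

lemma concConst_nonneg (d p : ℕ) : 0 ≤ concConst d p := by unfold concConst; positivity

lemma concRate_nonneg {d p : ℕ} {K₁ K₂ : ℝ} (h₂ : 0 ≤ K₂) : 0 ≤ concRate d p K₁ K₂ := by
  unfold concRate; positivity

/-- Union bound over the times, bins, rounds, arms, mesh points and bandwidths for the concentration,
and over the bins for the number of visits. -/
lemma law_not_typical_le (V : c.Valid d) {P : Problem d} {ρlo ρhi c₁ : ℝ}
    (hP : HasBoundedDensity ρlo ρhi P.ctxLaw) (hlo : 0 < ρlo) (hhi : ρlo ≤ ρhi) (hc₁ : 0 < c₁)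
    (hco : ∀ (σ : Fin d → Bool) (δ : Idx d (strictFloor c.βhi) → ℝ),
      c₁ * ∑ s, δ s ^ 2 ≤ ∫ v in corner σ, polyVal δ v ^ 2)
    {M R : ℕ} (hM : c.meshLevel d = M) (hR : c.maxRound d = R) :
    P.law {ω | ¬ (Concentrated c P (explorationLength c d R ρlo) ω ∧
      Visited c (explorationLength c d R ρlo) (roundStart c.q (R + 1)) ω)} ≤ ENNReal.ofReal
      ((((explorationLength c d R ρlo : ℝ) + 1) * (((c.q : ℝ) ^ c.level d) ^ d *
        ((R + 1) * (2 * (((c.q : ℝ) ^ M) ^ d * 2))))) * (concConst d (strictFloor c.βhi) *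
        Real.exp (-(concRate d (strictFloor c.βhi) (ρlo / ρhi * c₁) (ρhi / ρlo * 2 ^ d) *
          (c.γ ^ 2 * ((c.q : ℝ) ^ d)⁻¹ * Real.log c.T))))
      + ((c.q : ℝ) ^ c.level d) ^ d * Real.exp (-(roundStart c.q (R + 1) : ℝ))) := by
  set N := explorationLength c d R ρlo with hN
  set n := roundStart c.q (R + 1) with hn
  have hq := V.q_pos
  have hhi0 : 0 < ρhi := hlo.trans_le hhi
  have h1 := law_not_concentrated_le hP hlo hhi hc₁ hco V.q_pos' V.threshold_nonneg hM hR
    V.bandwidth_true_le_false (γ₁ := concRate d (strictFloor c.βhi) (ρlo / ρhi * c₁)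
      (ρhi / ρlo * 2 ^ d) * (c.γ ^ 2 * ((c.q : ℝ) ^ d)⁻¹ * Real.log c.T)) (fun r => by
        rw [mul_assoc (concRate _ _ _ _)]
        exact mul_le_mul_of_nonneg_left (V.le_threshold_sq_mul r)
          (concRate_nonneg (by positivity))) N
  have h2 := law_not_visited_le (c := c) hP hlo V.q_pos' N n
  have h3 : Real.exp (n - N * (ρlo * (((c.q : ℝ) ^ c.level d)⁻¹) ^ d) / 2) ≤ Real.exp (-(n : ℝ)) := by
    refine Real.exp_le_exp.2 ?_
    have hpos : 0 < ((c.q : ℝ) ^ c.level d) ^ d := by positivity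
    have h4 : 4 * (n : ℝ) * ((c.q : ℝ) ^ c.level d) ^ d / ρlo ≤ N := Nat.le_ceil _
    have h5 := mul_le_mul_of_nonneg_right h4
      (by positivity : 0 ≤ ρlo * (((c.q : ℝ) ^ c.level d)⁻¹) ^ d)
    have h6 : 4 * (n : ℝ) * ((c.q : ℝ) ^ c.level d) ^ d / ρlo * (ρlo * (((c.q : ℝ) ^ c.level d)⁻¹) ^ d)
        = 4 * n := by
      rw [inv_pow]; field_simp
    rw [h6] at h5
    linarith
  have hsub : {ω : ℕ → Period d | ¬ (Concentrated c P N ω ∧ Visited c N n ω)} ⊆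
      {ω | ¬ Concentrated c P N ω} ∪ {ω | ¬ Visited c N n ω} := by
    intro ω hω
    exact not_and_or.1 hω
  have hexp := concConst_nonneg d (strictFloor c.βhi)
  rw [ENNReal.ofReal_add (by positivity) (by positivity)]
  refine (measure_mono hsub).trans ((measure_union_le _ _).trans (add_le_add h1 (h2.trans ?_)))
  refine ENNReal.ofReal_le_ofReal (mul_le_mul_of_nonneg_left h3 (by positivity))

/-- For large horizons, the typical event fails with probability at most `1 / T`. -/
lemma failure_bound (V : c.Valid d) {ρlo κ cr : ℝ} {M R : ℕ} (hR1 : 1 ≤ R)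
    (hR : c.maxRound d = R) (hlogd : (d : ℝ) + 2 ≤ Real.log c.T)
    (hQ : (c.q : ℝ) ^ c.level d ≤ c.T) (hR' : (c.q : ℝ) ^ R ≤ c.T) (hM' : (c.q : ℝ) ^ M ≤ (c.T : ℝ) ^ κ)
    (hN : (explorationLength c d R ρlo : ℝ) + 1 ≤ c.T) (hC : 8 * concConst d (strictFloor c.βhi) ≤ c.T)
    (hcr : (d : ℝ) + κ * d + 4 ≤ cr * (c.γ ^ 2 * ((c.q : ℝ) ^ d)⁻¹)) :
      (((explorationLength c d R ρlo : ℝ) + 1) * (((c.q : ℝ) ^ c.level d) ^ d *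
        ((R + 1) * (2 * (((c.q : ℝ) ^ M) ^ d * 2))))) * (concConst d (strictFloor c.βhi) *
        Real.exp (-(cr * (c.γ ^ 2 * ((c.q : ℝ) ^ d)⁻¹ * Real.log c.T))))
      + ((c.q : ℝ) ^ c.level d) ^ d * Real.exp (-(roundStart c.q (R + 1) : ℝ)) ≤ (c.T : ℝ)⁻¹ := by
  have hq := V.q_pos
  have hT := V.horizon_pos
  have hT1 := V.one_lt_horizon
  have hy := V.log_pos
  have hT2 : (2 : ℝ) ≤ c.T := by exact_mod_cast (by exact_mod_cast hT1 : 1 < c.T)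
  have hC0 := concConst_nonneg d (strictFloor c.βhi)
  have hexp : ∀ a : ℝ, Real.exp (-(a * Real.log c.T)) = (c.T : ℝ) ^ (-a) := fun a => by
    rw [Real.rpow_def_of_pos hT]; congr 1; ring
  have h1 : Real.exp (-(cr * (c.γ ^ 2 * ((c.q : ℝ) ^ d)⁻¹ * Real.log c.T)))
      ≤ (c.T : ℝ) ^ (-((d : ℝ) + κ * d + 4)) := by
    rw [← hexp]
    refine Real.exp_le_exp.2 (neg_le_neg ?_)
    have := mul_le_mul_of_nonneg_right hcr hy.le
    linarith
  have h2 : (R : ℝ) + 1 ≤ c.T := by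
    refine le_trans ?_ hR'
    have h3 : R + 1 ≤ c.q ^ R :=
      (Nat.lt_two_pow_self (n := R)).trans_le (Nat.pow_le_pow_left V.q_ge R)
    exact_mod_cast h3
  -- All cardinalities in the union bound are powers of `T`, so a large rate in the exponential wins.
  have hM'' : ((c.q : ℝ) ^ M) ^ d ≤ (c.T : ℝ) ^ (κ * d) := by
    rw [Real.rpow_mul_natCast hT.le]
    exact pow_le_pow_left₀ (by positivity) hM' d
  have hQ' : ((c.q : ℝ) ^ c.level d) ^ d ≤ (c.T : ℝ) ^ (d : ℝ) := by
    rw [Real.rpow_natCast]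
    exact pow_le_pow_left₀ (by positivity) hQ d
  have hfirst : (((explorationLength c d R ρlo : ℝ) + 1) * (((c.q : ℝ) ^ c.level d) ^ d *
        ((R + 1) * (2 * (((c.q : ℝ) ^ M) ^ d * 2))))) * (concConst d (strictFloor c.βhi) *
        Real.exp (-(cr * (c.γ ^ 2 * ((c.q : ℝ) ^ d)⁻¹ * Real.log c.T)))) ≤ (c.T : ℝ)⁻¹ / 2 := by
    calc _ ≤ ((c.T : ℝ) * ((c.T : ℝ) ^ (d : ℝ) * (c.T * (2 * ((c.T : ℝ) ^ (κ * d) * 2))))) *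
          (concConst d (strictFloor c.βhi) * (c.T : ℝ) ^ (-((d : ℝ) + κ * d + 4))) := by gcongr
      _ = 4 * concConst d (strictFloor c.βhi) * ((c.T : ℝ) ^ (1 : ℝ) * (c.T : ℝ) ^ (d : ℝ) *
          (c.T : ℝ) ^ (1 : ℝ) * (c.T : ℝ) ^ (κ * d) * (c.T : ℝ) ^ (-((d : ℝ) + κ * d + 4))) := by
          rw [Real.rpow_one]; ring
      _ = 4 * concConst d (strictFloor c.βhi) * (c.T : ℝ) ^ (-2 : ℝ) := by
          rw [← Real.rpow_add hT, ← Real.rpow_add hT, ← Real.rpow_add hT, ← Real.rpow_add hT]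
          congr 2; ring
      _ ≤ (c.T : ℝ)⁻¹ / 2 := by
          rw [Real.rpow_neg hT.le]
          have : (c.T : ℝ) ^ (2 : ℝ) = c.T * c.T := by
            rw [show (2 : ℝ) = ((2 : ℕ) : ℝ) by norm_num, Real.rpow_natCast]; ring
          rw [this, mul_inv, ← mul_assoc, div_eq_mul_inv, mul_comm]
          refine mul_le_mul_of_nonneg_left ?_ (by positivity)
          rw [← div_eq_mul_inv, div_le_iff₀ hT]
          linarith
  have hsecond : ((c.q : ℝ) ^ c.level d) ^ d * Real.exp (-(roundStart c.q (R + 1) : ℝ))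
      ≤ (c.T : ℝ)⁻¹ / 2 := by
    have h5 : ((d : ℝ) + 2) * Real.log c.T ≤ roundStart c.q (R + 1) := by
      have h6 : (c.q : ℝ) ^ R ≤ roundStart c.q (R + 1) := by exact_mod_cast le_roundStart hR1
      have h7 := V.log_rpow_le_rpow_maxRound
      rw [hR] at h7
      rw [show (4 : ℝ) = ((4 : ℕ) : ℝ) by norm_num, Real.rpow_natCast, Int.cast_natCast,
        Real.rpow_natCast] at h7
      have hy1 := V.one_lt_log
      refine le_trans ?_ (h7.trans h6)
      have h8 : Real.log c.T ^ 4 = Real.log c.T ^ 2 * Real.log c.T * Real.log c.T := by ring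
      rw [h8]
      refine mul_le_mul_of_nonneg_right (hlogd.trans ?_) hy.le
      exact le_mul_of_one_le_left hy.le (one_le_pow₀ hy1.le)
    calc _ ≤ (c.T : ℝ) ^ (d : ℝ) * (c.T : ℝ) ^ (-((d : ℝ) + 2)) := by
          rw [← hexp]
          have := Real.exp_le_exp.2 (neg_le_neg h5)
          gcongr
      _ = (c.T : ℝ) ^ (-2 : ℝ) := by
          rw [← Real.rpow_add hT]; congr 1; ring
      _ ≤ (c.T : ℝ)⁻¹ / 2 := by
          rw [Real.rpow_neg hT.le]
          have : (c.T : ℝ) ^ (2 : ℝ) = c.T * c.T := by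
            rw [show (2 : ℝ) = ((2 : ℕ) : ℝ) by norm_num, Real.rpow_natCast]; ring
          rw [this, mul_inv, div_eq_mul_inv]
          refine mul_le_mul_of_nonneg_left ?_ (by positivity)
          exact inv_anti₀ (by norm_num) hT2
  linarith

lemma pow_level_le (V : c.Valid d) : (c.q : ℝ) ^ c.level d ≤
    c.q * (c.T : ℝ) ^ ((c.βlo + d - 1) / (2 * c.βhi + d) ^ 2) := by
  have := V.rpow_level_le
  rwa [Real.rpow_natCast] at this

lemma pow_maxRound_le (V : c.Valid d) {R : ℕ} (hR : c.maxRound d = R) : (c.q : ℝ) ^ R ≤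
    c.q * (c.q : ℝ) ^ (2 * c.βhi) *
      (c.T : ℝ) ^ ((c.βlo + d - 1) / (2 * c.βhi + d) ^ 2 * (2 * c.βhi)) * Real.log c.T ^ c.υ := by
  have h := V.rpow_maxRound_le
  rw [hR, Int.cast_natCast, Real.rpow_natCast] at h
  refine h.trans ?_
  have hq := V.q_pos
  have hT := V.horizon_pos
  have hy := V.log_pos
  have h1 := Real.rpow_le_rpow (by positivity) V.rpow_level_le (z := 2 * c.βhi)
    (by have := V.hi_pos; positivity)
  rw [Real.mul_rpow hq.le (by positivity), ← Real.rpow_mul hT.le] at h1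
  calc _ ≤ (c.q : ℝ) * ((c.q : ℝ) ^ (2 * c.βhi) *
      (c.T : ℝ) ^ ((c.βlo + d - 1) / (2 * c.βhi + d) ^ 2 * (2 * c.βhi)) * Real.log c.T ^ c.υ) := by
        gcongr
    _ = _ := by ring

lemma pow_meshLevel_le (V : c.Valid d) {M : ℕ} (hM : c.meshLevel d = M) : (c.q : ℝ) ^ M ≤
    c.q * (c.q : ℝ) ^ (c.βhi / c.βlo + (1 + c.βhi)) *
      (c.T : ℝ) ^ ((c.βlo + d - 1) / (2 * c.βhi + d) ^ 2 * (c.βhi / c.βlo + (1 + c.βhi))) *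
      Real.log c.T ^ (1 / c.βlo + 1) := by
  have h := V.rpow_meshLevel_le
  rw [hM, Int.cast_natCast, Real.rpow_natCast] at h
  refine h.trans ?_
  have hq := V.q_pos
  have hT := V.horizon_pos
  have hy := V.log_pos
  have h1 := Real.rpow_le_rpow (by positivity) V.rpow_level_le
    (z := c.βhi / c.βlo + (1 + c.βhi))
    (by have := V.hi_pos; have := V.lo_pos; positivity)
  rw [Real.mul_rpow hq.le (by positivity), ← Real.rpow_mul hT.le] at h1
  calc _ ≤ (c.q : ℝ) * ((c.q : ℝ) ^ (c.βhi / c.βlo + (1 + c.βhi)) *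
      (c.T : ℝ) ^ ((c.βlo + d - 1) / (2 * c.βhi + d) ^ 2 * (c.βhi / c.βlo + (1 + c.βhi))) *
      Real.log c.T ^ (1 / c.βlo + 1)) := by
        gcongr
    _ = _ := by ring

lemma explorationLength_le (V : c.Valid d) {R : ℕ} (hR : c.maxRound d = R) {ρlo : ℝ}
    (hlo : 0 < ρlo) : (explorationLength c d R ρlo : ℝ) ≤
    16 / ρlo * (c.q * (c.q : ℝ) ^ (2 * c.βhi) * (c.q : ℝ) ^ d) *
      (c.T : ℝ) ^ ((c.βlo + d - 1) / (2 * c.βhi + d)) * Real.log c.T ^ c.υ + 1 := by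
  have hq := V.q_pos
  have hT := V.horizon_pos
  have hy := V.log_pos
  unfold explorationLength
  refine (Nat.ceil_lt_add_one (by positivity)).le.trans (add_le_add_left ?_ 1)
  have h1 : (roundStart c.q (R + 1) : ℝ) ≤ 4 * (c.q : ℝ) ^ R := by
    exact_mod_cast roundStart_le V.q_ge R
  have h2 := pow_maxRound_le V hR
  have h3 := pow_le_pow_left₀ (by positivity) (pow_level_le V) d
  have h4 : (c.T : ℝ) ^ ((c.βlo + d - 1) / (2 * c.βhi + d)) =
      (c.T : ℝ) ^ ((c.βlo + d - 1) / (2 * c.βhi + d) ^ 2 * (2 * c.βhi)) *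
      ((c.T : ℝ) ^ ((c.βlo + d - 1) / (2 * c.βhi + d) ^ 2)) ^ d := by
    rw [← Real.rpow_mul_natCast hT.le, ← Real.rpow_add hT]
    congr 1
    have : (2 * c.βhi + d) ≠ 0 := by have := V.hi_pos; positivity
    field_simp
  rw [h4]
  calc 4 * (roundStart c.q (R + 1) : ℝ) * ((c.q : ℝ) ^ c.level d) ^ d / ρlo
      ≤ 4 * (4 * (c.q * (c.q : ℝ) ^ (2 * c.βhi) *
      (c.T : ℝ) ^ ((c.βlo + d - 1) / (2 * c.βhi + d) ^ 2 * (2 * c.βhi)) * Real.log c.T ^ c.υ)) *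
      (c.q * (c.T : ℝ) ^ ((c.βlo + d - 1) / (2 * c.βhi + d) ^ 2)) ^ d / ρlo := by
        have := h1.trans (mul_le_mul_of_nonneg_left h2 (by norm_num : (0 : ℝ) ≤ 4))
        gcongr
    _ = _ := by rw [mul_pow]; ring

end Length

/-! ### The exploration for large horizons -/

section Eventually

/-- The inputs of the policy with the under-smoothing coefficient `d / βlo + 4`. -/
def sacbParams (d q : ℕ) (βlo βhi γ : ℝ) (T : ℕ) : Params where
  βlo := βlo
  βhi := βhi
  γ := γ
  υ := d / βlo + 4
  q := q
  T := T

lemma tendsto_log_natCast : Tendsto (fun T : ℕ => Real.log T) atTop atTop :=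
  Real.tendsto_log_atTop.comp tendsto_natCast_atTop_atTop

lemma eventually_small_terms {B C D L β γ ε : ℝ} (hβ : 0 < β) (hγ : 0 < γ) (hε : 0 < ε) :
    ∀ᶠ y : ℝ in atTop, C ≤ γ * y ^ (3 / 2 : ℝ) ∧ γ * y ^ (-(1 / 2) : ℝ) ≤ 1 ∧
      3 / 2 * (γ * y ^ (-(1 / 2) : ℝ)) + B * L * y⁻¹ < ε / 2 ∧
      L * y⁻¹ ^ β + D * (B * L) * y⁻¹ ≤ ε / 4 ∧ 2 * (D * B * y⁻¹) ≤ ε / 4 := by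
  have h1 : Tendsto (fun y : ℝ => γ * y ^ (3 / 2 : ℝ)) atTop atTop :=
    (tendsto_rpow_atTop (by norm_num)).const_mul_atTop hγ
  have h2 : Tendsto (fun y : ℝ => γ * y ^ (-(1 / 2) : ℝ)) atTop (𝓝 0) := by
    simpa using (tendsto_rpow_neg_atTop (by norm_num : (0 : ℝ) < 1 / 2)).const_mul γ
  have h3 : Tendsto (fun y : ℝ => y⁻¹) atTop (𝓝 0) := tendsto_inv_atTop_zero
  have h4 : Tendsto (fun y : ℝ => 3 / 2 * (γ * y ^ (-(1 / 2) : ℝ)) + B * L * y⁻¹) atTop (𝓝 0) := by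
    simpa using (h2.const_mul (3 / 2)).add (h3.const_mul (B * L))
  have h5 : Tendsto (fun y : ℝ => y⁻¹ ^ β) atTop (𝓝 0) := by
    have := h3.rpow_const (p := β) (Or.inr hβ.le)
    rwa [Real.zero_rpow hβ.ne'] at this
  have h6 : Tendsto (fun y : ℝ => L * y⁻¹ ^ β + D * (B * L) * y⁻¹) atTop (𝓝 0) := by
    simpa using (h5.const_mul L).add (h3.const_mul (D * (B * L)))
  have h7 : Tendsto (fun y : ℝ => 2 * (D * B * y⁻¹)) atTop (𝓝 0) := by
    simpa using (h3.const_mul (D * B)).const_mul 2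
  filter_upwards [h1.eventually_ge_atTop C, h2.eventually (Iic_mem_nhds zero_lt_one),
    h4.eventually (Iio_mem_nhds (by positivity : 0 < ε / 2)),
    h6.eventually (Iic_mem_nhds (by positivity : 0 < ε / 4)),
    h7.eventually (Iic_mem_nhds (by positivity : 0 < ε / 4))] with y a1 a2 a3 a4 a5
  exact ⟨a1, a2, a3, a4, a5⟩

variable {d q : ℕ} (hd : 1 ≤ d) (hq : 2 ≤ q) {βlo βhi L ρlo ρhi : ℝ} (hβlo : 0 < βlo)
  (hβ : βlo < βhi) (hL : 0 < L) (hρlo : 0 < ρlo) (hρ : ρlo ≤ ρhi)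

include hd hq hβlo hβ in
lemma eventually_valid {γ : ℝ} (hγ : 0 < γ) :
    ∀ᶠ T : ℕ in atTop, (sacbParams d q βlo βhi γ T).Valid d := by
  filter_upwards [tendsto_log_natCast.eventually_ge_atTop (q : ℝ)] with T hT
  have hq1 : (1 : ℝ) < q := by exact_mod_cast (by omega : 1 < q)
  refine ⟨hd, hq, hβlo, hβ, rfl, hγ, ?_⟩
  show 1 ≤ Real.logb q (Real.log T)
  rw [Real.le_logb_iff_rpow_le hq1 (by linarith), Real.rpow_one]
  exact hT

include hd hq hβlo hβ hL hρlo hρ in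
/-- For large horizons, the exploration phase is short and, but for an event of probability at most
`1 / T`, it ends with a good estimate of the smoothness. -/
theorem exists_exploration : ∃ γ₀ A : ℝ, 0 < γ₀ ∧ ∀ γ, γ₀ ≤ γ → ∀ β ∈ Set.Icc βlo βhi,
    ∀ b l₀ : ℝ, 0 < b → ∀ᶠ T : ℕ in atTop, ∃ N : ℕ,
      (N : ℝ) ≤ A * (T : ℝ) ^ ((βlo + d - 1) / (2 * βhi + d)) *
        Real.log T ^ ((d : ℝ) / βlo + 4) + 1 ∧
      ∀ P : Problem d, HasBoundedDensity ρlo ρhi P.ctxLaw → (∀ k, IsHolder β L (P.payoff k)) →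
        SelfSimilar βhi β b l₀ P →
        P.law {ω | ¬ ∃ τ ≤ N, StopsWell (sacbParams d q βlo βhi γ T)
          (goodEstimates (sacbParams d q βlo βhi γ T) d β) τ ω} ≤ ENNReal.ofReal (T : ℝ)⁻¹ := by
  set p := strictFloor βhi with hp
  obtain ⟨c₁, hc₁, hco⟩ := exists_coercive_corner d p
  have hρhi : 0 < ρhi := hρlo.trans_le hρ
  have hβhi : 0 < βhi := hβlo.trans hβ
  have hq0 : (0 : ℝ) < q := by exact_mod_cast (by omega : 0 < q)
  have hd1 : (1 : ℝ) ≤ d := by exact_mod_cast hd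
  set cr := concRate d p (ρlo / ρhi * c₁) (ρhi / ρlo * 2 ^ d) with hcr
  have hcr0 : 0 < cr := by
    have : Nonempty (Idx d p) := ⟨idxZero d p⟩
    have h1 : 0 < noiseBound d p (ρlo / ρhi * c₁) (ρhi / ρlo * 2 ^ d) := by
      unfold noiseBound; positivity
    have h2 : (0 : ℝ) < Fintype.card (Idx d p) := by exact_mod_cast Fintype.card_pos
    rw [hcr, concRate]; positivity
  -- There are at most `T ^ κ` mesh points per coordinate, and `γ₀` makes the concentration beat the
  -- union bound over them.
  set κ : ℝ := βhi / βlo + (1 + βhi) + 1 with hκ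
  set γ₀ : ℝ := Real.sqrt (((d : ℝ) + κ * d + 4) * (q : ℝ) ^ d / cr) with hγ₀
  have hκ0 : 0 < κ := by positivity
  have hγ₀0 : 0 < γ₀ := Real.sqrt_pos.2 (by positivity)
  refine ⟨γ₀, 16 / ρlo * (q * (q : ℝ) ^ (2 * βhi) * (q : ℝ) ^ d), hγ₀0, ?_⟩
  intro γ hγ β hβm b l₀ hb
  have hγ0 : 0 < γ := hγ₀0.trans_le hγ
  have hβ0 : 0 < β := hβlo.trans_le hβm.1
  have hpβ : strictFloor β ≤ p := by
    rw [hp]; unfold strictFloor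
    exact Nat.sub_le_sub_right (Nat.ceil_mono hβm.2) 1
  -- `b / 2` and not `b`: the lower bound of the self-similarity condition is a supremum, which need
  -- not be attained.
  obtain ⟨ε, hε, herr⟩ := exists_trunc_error d p hρlo hρ hc₁ hβ0 hL (half_pos hb) hpβ
  have hcrγ : (d : ℝ) + κ * d + 4 ≤ cr * (γ ^ 2 * ((q : ℝ) ^ d)⁻¹) := by
    have h1 : γ₀ ^ 2 ≤ γ ^ 2 := pow_le_pow_left₀ hγ₀0.le hγ 2
    rw [hγ₀, Real.sq_sqrt (by positivity), div_le_iff₀ hcr0] at h1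
    rw [← div_eq_mul_inv, mul_div_assoc', le_div_iff₀ (by positivity)]
    linarith
  set a : ℝ := (βlo + d - 1) / (2 * βhi + d) ^ 2 with ha
  have hnum : 0 < βlo + d - 1 := by linarith
  have hden : 0 < 2 * βhi + d := by positivity
  have ha0 : 0 < a := by positivity
  have ha1 : a < 1 := by
    rw [ha, div_lt_one (by positivity)]
    nlinarith
  have ha2 : a * (2 * βhi) < 1 := by
    rw [ha, div_mul_eq_mul_div, div_lt_one (by positivity)]
    nlinarith
  have he1 : (βlo + d - 1) / (2 * βhi + d) < 1 := by
    rw [div_lt_one hden]; linarith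
  have ha3 : a * (βhi / βlo + (1 + βhi)) < κ := by
    have : 0 < βhi / βlo + (1 + βhi) := by positivity
    nlinarith
  -- How large the horizon has to be does not depend on the problem.
  have E1 := eventually_mul_rpow_log_le q 0 ha1
  have E2 := eventually_mul_rpow_log_le (q * (q : ℝ) ^ (2 * βhi)) ((d : ℝ) / βlo + 4) ha2
  have E3 := eventually_mul_rpow_log_le (q * (q : ℝ) ^ (βhi / βlo + (1 + βhi))) (1 / βlo + 1) ha3
  obtain ⟨e₁, he₁, he₁1⟩ := exists_between he1
  have E4 := eventually_mul_rpow_log_le (16 / ρlo * (q * (q : ℝ) ^ (2 * βhi) * (q : ℝ) ^ d))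
    ((d : ℝ) / βlo + 4) he₁
  have E5 := eventually_mul_rpow_log_le 2 0 he₁1
  have E6 := tendsto_log_natCast.eventually (eventually_small_terms
    (B := coefBound d p ρlo ρhi c₁) (C := 4 * coefBound d p ρlo ρhi c₁ * L)
    (D := Fintype.card (Idx d p)) (L := L) hβ0 hγ0 hε)
  have E7 := tendsto_log_natCast.eventually_ge_atTop ((d : ℝ) + 2)
  have E8 := tendsto_log_natCast.eventually_ge_atTop (l₀ * Real.log q / a)
  have E9 := tendsto_natCast_atTop_atTop (R := ℝ) |>.eventually_ge_atTop
    (max 4 (8 * concConst d p))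
  filter_upwards [eventually_valid hd hq hβlo hβ hγ0, E1, E2, E3, E4, E5, E6, E7, E8, E9]
    with T V e1 e2 e3 e4 e5 e6 e7 e8 e9
  set c := sacbParams d q βlo βhi γ T with hc
  have hlq : 0 < Real.log q := Real.log_pos (by exact_mod_cast (by omega : 1 < q))
  obtain ⟨M, hM, hlM⟩ := V.exists_meshLevel
  obtain ⟨R, hR⟩ := Int.eq_ofNat_of_zero_le (zero_le_one.trans V.one_le_maxRound)
  have hR1 : 1 ≤ R := by have := V.one_le_maxRound; omega
  have hlen := explorationLength_le V hR hρlo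
  refine ⟨explorationLength c d R ρlo, hlen, ?_⟩
  intro P hP hH hS
  have hTT : (2 : ℝ) ≤ T := by linarith [le_max_left (4 : ℝ) (8 * concConst d p)]
  have hT0 : (0 : ℝ) < T := by linarith
  have hQ : (c.q : ℝ) ^ c.level d ≤ c.T := by
    rw [Real.rpow_zero, mul_one, Real.rpow_one] at e1
    exact (pow_level_le V).trans e1
  have hR' : (c.q : ℝ) ^ R ≤ c.T := by
    rw [Real.rpow_one] at e2
    exact (pow_maxRound_le V hR).trans e2
  have hM' : (c.q : ℝ) ^ M ≤ (c.T : ℝ) ^ κ := (pow_meshLevel_le V hM).trans e3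
  have hN : (explorationLength c d R ρlo : ℝ) + 1 ≤ c.T := by
    rw [Real.rpow_zero, mul_one, Real.rpow_one] at e5
    have h1 : (explorationLength c d R ρlo : ℝ) ≤ (T : ℝ) ^ e₁ + 1 :=
      hlen.trans (add_le_add_left e4 1)
    have h2 : (explorationLength c d R ρlo : ℝ) ≤ T / 2 + 1 := by linarith
    have h4 : (4 : ℝ) ≤ T := (le_max_left _ _).trans e9
    show _ ≤ (T : ℝ)
    linarith
  have hNpos : 1 ≤ explorationLength c d R ρlo := by
    unfold explorationLength
    refine Nat.one_le_iff_ne_zero.2 (Nat.ceil_pos.2 ?_).ne'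
    have h1 : 0 < roundStart c.q (R + 1) :=
      (pow_pos V.q_pos' R).trans_le (le_roundStart hR1)
    have := V.q_pos
    positivity
  have hl : l₀ ≤ c.level d := by
    refine le_trans ?_ Params.Valid.le_level
    show l₀ ≤ a * Real.logb q T
    rw [Real.logb, mul_div_assoc', le_div_iff₀ hlq]
    rwa [div_le_iff₀ ha0, mul_comm (Real.log _) a] at e8
  -- a bin in which the estimator has a large bias
  obtain ⟨m, hm, k, x, hx, hbig⟩ := hS.exists_error (c := c) hP hρlo hρ hc₁ hco hb
    (by omega : 1 < q) hl hpβ le_rfl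
  have S := boxSetting_bin hP hρlo hρ hc₁ hco (by omega : 0 < q) hm
  obtain ⟨x', hx', hbig'⟩ := herr _ _ _ _ S (measurable_payoff P k)
    (fun u => ⟨payoff_nonneg P k u, payoff_le_one P k u⟩) (hH k) ⟨x, hx, hbig⟩
  have hsub : {ω : ℕ → Period d | ¬ ∃ τ ≤ explorationLength c d R ρlo,
      StopsWell c (goodEstimates c d β) τ ω} ⊆
      {ω | ¬ (Concentrated c P (explorationLength c d R ρlo) ω ∧
        Visited c (explorationLength c d R ρlo) (roundStart c.q (R + 1)) ω)} := by
    intro ω hω hgood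
    exact hω (stopsWell_of_typical V hP hρlo hρ hc₁ hco hβm hL.le hH ⟨m, hm, k, x', hx', hbig'⟩
      e6.1 e6.2.1 e6.2.2.1 e6.2.2.2.1 e6.2.2.2.2 hR hNpos hgood.1 hgood.2)
  refine (measure_mono hsub).trans ((law_not_typical_le V hP hρlo hρ hc₁ hco hM hR).trans
    (ENNReal.ofReal_le_ofReal ?_))
  exact failure_bound V hR1 hR e7 hQ hR' hM' hN ((le_max_right _ _).trans e9) hcrγ

end Eventually

/-! ### Rates -/

section Rates

variable {d q : ℕ} {βlo βhi β α : ℝ}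

lemma strictFloor_eq_of_lt {β β₀ : ℝ} (h : (strictFloor β : ℝ) < β₀) (hle : β₀ ≤ β) :
    strictFloor β₀ = strictFloor β := by
  unfold strictFloor at *
  have h1 : ⌈β₀⌉₊ ≤ ⌈β⌉₊ := Nat.ceil_mono hle
  have h2 : ⌈β⌉₊ - 1 < ⌈β₀⌉₊ := Nat.lt_ceil.2 h
  omega

lemma strictFloor_lt (hβ : 0 < β) : (strictFloor β : ℝ) < β := by
  have h1 := Nat.ceil_lt_add_one hβ.le
  have h2 := Nat.ceil_pos.2 hβ
  unfold strictFloor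
  rw [Nat.cast_sub h2]
  push_cast
  linarith

lemma IsHolder.of_le {L β₀ : ℝ} {f : Ctx d → ℝ} (h : IsHolder β L f) (hL : 0 ≤ L) (h0 : 0 < β₀)
    (hle : β₀ ≤ β) (hs : strictFloor β₀ = strictFloor β) : IsHolder β₀ L f := by
  unfold IsHolder
  rw [hs]
  refine ⟨h.1, fun x hx x' hx' => (h.2 x hx x' hx').trans (mul_le_mul_of_nonneg_left ?_ hL)⟩
  have h1 : ‖x - x'‖ ≤ 1 := by
    rw [pi_norm_le_iff_of_nonneg zero_le_one]
    intro i
    rw [Pi.sub_apply, Real.norm_eq_abs, abs_le]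
    have a1 := hx.1 i; have a2 := hx.2 i; have a3 := hx'.1 i; have a4 := hx'.2 i
    simp only [Pi.zero_apply, Pi.one_apply] at a1 a2 a3 a4
    constructor <;> linarith
  exact Real.rpow_le_rpow_of_exponent_ge_of_imp (norm_nonneg _) h1 hle fun _ h2 =>
    absurd h2 (h0.trans_le hle).ne'

lemma problemClass_of_le {L C₀ ρlo ρhi β₀ : ℝ} {P : Problem d} (hL : 0 ≤ L) (h0 : 0 < β₀)
    (hle : β₀ ≤ β) (hs : strictFloor β₀ = strictFloor β)
    (h : P ∈ problemClass d β L α C₀ ρlo ρhi) : P ∈ problemClass d β₀ L α C₀ ρlo ρhi :=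
  ⟨fun k => (h.1 k).of_le hL h0 hle hs, h.2⟩

/-- The exploration is shorter than the minimax regret, save in the excluded case. -/
lemma explorationRate_lt_zeta (hd : 1 ≤ d) (hβlo : 0 < βlo) (hβlo1 : βlo ≤ 1) (hβ : βlo < βhi)
    (hβm : β ∈ Set.Icc βlo βhi) (hα1 : α ≤ 1 / min 1 β)
    (hne : ¬ (βlo = 1 ∧ β = βhi ∧ α = 1)) :
    (βlo + d - 1) / (2 * βhi + d) < zeta d β α := by
  have hd1 : (1 : ℝ) ≤ d := by exact_mod_cast hd
  have hβ0 : 0 < β := hβlo.trans_le hβm.1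
  have hz : zeta d β α = (β + d - α * β) / (2 * β + d) := by
    unfold zeta
    have : 2 * β + d ≠ 0 := by positivity
    field_simp; ring
  rw [hz, div_lt_div_iff₀ (by linarith) (by positivity)]
  rcases le_or_gt β 1 with h1 | h1
  · rw [min_eq_right h1, le_div_iff₀ hβ0] at hα1
    have h2 : (β + d - 1) * (2 * βhi + d) ≤ (β + d - α * β) * (2 * βhi + d) :=
      mul_le_mul_of_nonneg_right (by linarith) (by linarith)
    refine lt_of_lt_of_le ?_ h2
    rcases hβm.2.lt_or_eq with h3 | h3
    · calc (βlo + d - 1) * (2 * β + d) < (βlo + d - 1) * (2 * βhi + d) :=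
            mul_lt_mul_of_pos_left (by linarith) (by linarith)
        _ ≤ _ := mul_le_mul_of_nonneg_right (by linarith [hβm.1]) (by linarith)
    · rw [h3]
      exact mul_lt_mul_of_pos_right (by linarith) (by linarith)
  · rw [min_eq_left h1.le, div_one] at hα1
    have h4 : (βlo + d - 1) * (2 * β + d) ≤ d * (2 * β + d) :=
      mul_le_mul_of_nonneg_right (by linarith) (by linarith)
    have h5 : (d : ℝ) * (2 * β + d) ≤ d * (2 * βhi + d) :=
      mul_le_mul_of_nonneg_left (by linarith [hβm.2]) (by linarith)
    have h6 : d * (2 * βhi + d) ≤ (β + d - α * β) * (2 * βhi + d) :=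
      mul_le_mul_of_nonneg_right (by nlinarith) (by linarith)
    by_contra hcon
    push Not at hcon
    refine hne ⟨?_, ?_, ?_⟩
    · have h7 : (1 - βlo) * (2 * β + d) ≤ 0 := by linarith
      by_contra h8
      have h9 : 0 < 1 - βlo := by
        rcases hβlo1.lt_or_eq with h | h
        · linarith
        · exact absurd h h8
      have : 0 < (1 - βlo) * (2 * β + d) := by positivity
      linarith
    · by_contra h8
      have h9 : β < βhi := lt_of_le_of_ne hβm.2 h8
      have : 0 < (d : ℝ) * (βhi - β) := mul_pos (by linarith) (by linarith)
      linarith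
    · by_contra h8
      have h9 : α < 1 := lt_of_le_of_ne hα1 h8
      have h10 : 0 < (1 - α) * β * (2 * βhi + d) :=
        mul_pos (mul_pos (by linarith) hβ0) (by linarith)
      linarith

lemma estError_eq (hq : 2 ≤ q) (T : ℕ) : estError d q βlo βhi T =
    3 * (2 * βhi + d) ^ 2 / (βlo + d - 1) * (Real.log (Real.log T) / Real.log T) := by
  have hlq : Real.log q ≠ 0 := (Real.log_pos (by exact_mod_cast (by omega : 1 < q))).ne'
  unfold estError Real.logb
  rw [div_mul_div_comm, mul_div_assoc', mul_div_assoc', div_div_div_cancel_right₀ hlq]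

lemma tendsto_estError (hq : 2 ≤ q) :
    Tendsto (fun T : ℕ => estError d q βlo βhi T) atTop (𝓝 0) := by
  simp_rw [estError_eq hq]
  have h1 : Tendsto (fun x : ℝ => Real.log x / x) atTop (𝓝 0) :=
    Real.isLittleO_log_id_atTop.tendsto_div_nhds_zero
  simpa using (h1.comp tendsto_log_natCast).const_mul (3 * (2 * βhi + d) ^ 2 / (βlo + d - 1))

lemma estError_nonneg (hd : 1 ≤ d) (hq : 2 ≤ q) (hβlo : 0 < βlo) {T : ℕ}
    (hT : 1 ≤ Real.log T) : 0 ≤ estError d q βlo βhi T := by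
  have hd1 : (1 : ℝ) ≤ d := by exact_mod_cast hd
  have h1 : 0 ≤ Real.log (Real.log T) := Real.log_nonneg hT
  have h2 : 0 < βlo + d - 1 := by linarith
  rw [estError_eq hq]
  positivity

lemma rpow_mul_estError (hq : 2 ≤ q) {T : ℕ} (hT : 0 < (T : ℝ)) (hy : 0 < Real.log T) (s : ℝ) :
    (T : ℝ) ^ (s * estError d q βlo βhi T)
      = Real.log T ^ (s * (3 * (2 * βhi + d) ^ 2 / (βlo + d - 1))) := by
  rw [Real.rpow_def_of_pos hT, Real.rpow_def_of_pos hy, estError_eq hq]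
  congr 1
  field_simp

lemma zeta_sub_zeta {β₀ : ℝ} (h : 0 < 2 * β + d) (h₀ : 0 < 2 * β₀ + d) :
    zeta d β₀ α - zeta d β α = (1 + α) * d * (β - β₀) / ((2 * β + d) * (2 * β₀ + d)) := by
  have h1 := h.ne'
  have h2 := h₀.ne'
  unfold zeta
  rw [sub_sub_sub_cancel_left, div_sub_div _ _ h1 h2]
  congr 1
  ring

lemma clamp_sub_of_eq (hβ : βlo ≤ βhi) {e : ℝ} (he : 0 ≤ e) : clamp βlo βhi (βlo - e) = βlo := by
  unfold clamp
  rw [max_eq_left (by linarith), min_eq_left hβ]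

/-- A good estimate costs at most the stated logarithmic factor. The factor is not sharp: the slack
absorbs the oscillation of `ι₀` near its left limit. -/
lemma eventually_rate_le (hd : 1 ≤ d) (hq : 2 ≤ q) (hβlo : 0 < βlo) (hβ : βlo < βhi) (hα : 0 < α)
    (hβm : β ∈ Set.Icc βlo βhi) {ι₀ : ℝ → ℝ}
    (hι : βlo < β → ∃ ℓ : ℝ, Tendsto ι₀ (𝓝[<] β) (𝓝 ℓ)) (γ : ℝ) :
    ∃ M : ℝ, ∀ᶠ T : ℕ in atTop,
      M ≤ adaptCost d βlo βhi β α + ι₀ (clamp βlo βhi (β - estError d q βlo βhi T)) ∧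
      ∀ β₀ ∈ goodEstimates (sacbParams d q βlo βhi γ T) d β, strictFloor β₀ = strictFloor β ∧
        Real.log T ^ ι₀ β₀ * (T : ℝ) ^ zeta d β₀ α ≤
        Real.log T ^ (adaptCost d βlo βhi β α +
          ι₀ (clamp βlo βhi (β - estError d q βlo βhi T))) * (T : ℝ) ^ zeta d β α := by
  have hd1 : (1 : ℝ) ≤ d := by exact_mod_cast hd
  have hβ0 : 0 < β := hβlo.trans_le hβm.1
  have hn : 0 < βlo + d - 1 := by linarith
  have hhi : 0 < βhi := hβlo.trans hβ
  have hcost : 0 < adaptCost d βlo βhi β α := by unfold adaptCost; positivity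
  have E1 := tendsto_log_natCast.eventually_ge_atTop 1
  have E2 := eventually_gt_atTop 1
  rcases hβm.1.eq_or_lt with heq | hlt
  -- At the lower end of the range the clamped estimate is exact.
  · subst heq
    refine ⟨adaptCost d βlo βhi βlo α + ι₀ βlo, ?_⟩
    filter_upwards [E1, E2] with T hy hT
    have hT0 : (0 : ℝ) < T := by exact_mod_cast (by omega : 0 < T)
    rw [clamp_sub_of_eq hβ.le (estError_nonneg hd hq hβlo hy)]
    refine ⟨le_rfl, fun β₀ hβ₀ => ?_⟩
    have : β₀ = βlo := le_antisymm hβ₀.2.2.1 hβ₀.1.1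
    subst this
    refine ⟨rfl, mul_le_mul_of_nonneg_right ?_ (Real.rpow_nonneg hT0.le _)⟩
    exact Real.rpow_le_rpow_of_exponent_le hy (by linarith)
  · obtain ⟨ℓ, hℓ⟩ := hι hlt
    -- For `β₀ ≥ 3 β / 4`, the loss in the exponent of `T` takes only the fraction `ρ` of `adaptCost`; the
    -- remaining `2 η` are left for the oscillation of `ι₀`.
    set ρ : ℝ := (β + d) / (3 / 2 * β + d) with hρ
    have hρ1 : ρ < 1 := by rw [hρ, div_lt_one (by positivity)]; linarith
    set η : ℝ := adaptCost d βlo βhi β α * (1 - ρ) / 2 with hη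
    have hη0 : 0 < η := by
      rw [hη]; exact div_pos (mul_pos hcost (by linarith)) two_pos
    have hev : ∀ᶠ x in 𝓝[<] β, |ι₀ x - ℓ| < η := by
      have := hℓ.eventually (Metric.ball_mem_nhds ℓ hη0)
      filter_upwards [this] with x hx
      rwa [Real.dist_eq] at hx
    obtain ⟨δ, hδ, hδβ⟩ := mem_nhdsLT_iff_exists_Ioo_subset.1 hev
    have hδ' : δ < β := hδ
    have hs := strictFloor_lt hβ0
    refine ⟨adaptCost d βlo βhi β α + (ℓ - η), ?_⟩
    have hmin : 0 < min (β - δ) (min (β / 4) (β - strictFloor β)) := by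
      refine lt_min (by linarith) (lt_min (by linarith) (by linarith))
    have E3 := (tendsto_estError (d := d) (βlo := βlo) (βhi := βhi) hq).eventually
      (Iio_mem_nhds hmin)
    have E4 := tendsto_log_natCast.eventually_gt_atTop 1
    filter_upwards [E4, E2, E3] with T hy hT herr
    have hT0 : (0 : ℝ) < T := by exact_mod_cast (by omega : 0 < T)
    have hT1 : (1 : ℝ) ≤ T := by exact_mod_cast (by omega : 1 ≤ T)
    set e := estError d q βlo βhi T with he
    have he0 : 0 < e := by
      have h1 : 0 < Real.log (Real.log T) := Real.log_pos hy
      rw [he, estError_eq hq]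
      positivity
    have herr' : e < min (β - δ) (min (β / 4) (β - strictFloor β)) := herr
    rw [lt_min_iff, lt_min_iff] at herr'
    obtain ⟨he1, he2, he3⟩ := herr'
    set bT := clamp βlo βhi (β - e) with hbT
    have hbT1 : β - e ≤ bT := le_min (le_max_right _ _) (by linarith [hβm.2])
    have hbT2 : bT < β := (min_le_left _ _).trans_lt (max_lt hlt (by linarith))
    have hclose : ∀ x, bT ≤ x → x < β → |ι₀ x - ℓ| < η := fun x h1 h2 =>
      hδβ ⟨by linarith, h2⟩
    have hbTι := abs_lt.1 (hclose bT le_rfl hbT2)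
    refine ⟨by linarith [hbTι.1], fun β₀ hβ₀ => ?_⟩
    have hb1 : bT ≤ β₀ := hβ₀.2.1
    have hb2 : β₀ < β := hβ₀.2.2.2 hlt
    have hb3 : β - e ≤ β₀ := hbT1.trans hb1
    -- Close to `β` the degree of the Taylor polynomials is the same, so the classes are nested.
    refine ⟨strictFloor_eq_of_lt (by linarith) hb2.le, ?_⟩
    have hι₀ := abs_lt.1 (hclose β₀ hb1 hb2)
    have hβ₀0 : 0 < β₀ := by linarith
    have hz : zeta d β₀ α ≤ zeta d β α +
        (1 + α) * d / ((2 * β + d) * (3 / 2 * β + d)) * e := by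
      have h1 := zeta_sub_zeta (d := d) (α := α) (β := β) (β₀ := β₀) (by positivity) (by positivity)
      have h2 : (1 + α) * d * (β - β₀) / ((2 * β + d) * (2 * β₀ + d)) ≤
          (1 + α) * d * e / ((2 * β + d) * (3 / 2 * β + d)) := by
        refine div_le_div₀ (by positivity) ?_ (by positivity) ?_
        · exact mul_le_mul_of_nonneg_left (by linarith) (by positivity)
        · exact mul_le_mul_of_nonneg_left (by linarith) (by positivity)
      rw [div_mul_eq_mul_div]
      linarith
    have hpow : (T : ℝ) ^ zeta d β₀ α ≤
        Real.log T ^ (adaptCost d βlo βhi β α * ρ) * (T : ℝ) ^ zeta d β α := by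
      refine (Real.rpow_le_rpow_of_exponent_le hT1 hz).trans (le_of_eq ?_)
      rw [Real.rpow_add hT0, he, rpow_mul_estError hq hT0 (by linarith), mul_comm]
      congr 2
      rw [hρ, adaptCost]
      field_simp
      ring
    calc Real.log T ^ ι₀ β₀ * (T : ℝ) ^ zeta d β₀ α
        ≤ Real.log T ^ (ι₀ bT + 2 * η) *
          (Real.log T ^ (adaptCost d βlo βhi β α * ρ) * (T : ℝ) ^ zeta d β α) := by
          refine mul_le_mul (Real.rpow_le_rpow_of_exponent_le hy.le (by linarith)) hpow
            (by positivity) (by positivity)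
      _ = Real.log T ^ (adaptCost d βlo βhi β α + ι₀ bT) * (T : ℝ) ^ zeta d β α := by
          rw [← mul_assoc, ← Real.rpow_add (by linarith)]
          congr 2
          rw [hη]; ring

lemma adaptCost_le_uniformCost (hd : 1 ≤ d) (hβlo : 0 < βlo) (hβlo1 : βlo ≤ 1)
    (hβm : β ∈ Set.Icc βlo βhi) (hα : 0 < α) :
    adaptCost d βlo βhi β α ≤ uniformCost βlo βhi β α := by
  have hd1 : (1 : ℝ) ≤ d := by exact_mod_cast hd
  have hβ0 : 0 < β := hβlo.trans_le hβm.1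
  have hhi : 0 < βhi := hβ0.trans_le hβm.2
  have hn : 0 < βlo + d - 1 := by linarith
  have h1 : (2 * βhi + d) / (2 * β + d) ≤ (2 * βhi + 1) / (2 * β + 1) := by
    rw [div_le_div_iff₀ (by positivity) (by positivity)]
    nlinarith [mul_nonneg (sub_nonneg.2 hβm.2) (sub_nonneg.2 hd1)]
  have h2 : (2 * βhi + d) / (β + d) ≤ (2 * βhi + 1) / (β + 1) := by
    rw [div_le_div_iff₀ (by positivity) (by positivity)]
    nlinarith [mul_nonneg (sub_nonneg.2 hβm.2) (sub_nonneg.2 hd1), mul_nonneg hhi.le (sub_nonneg.2 hd1)]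
  have h3 : d / (βlo + d - 1) ≤ 1 / βlo := by
    rw [div_le_div_iff₀ hn hβlo]
    nlinarith [mul_nonneg (sub_nonneg.2 hβlo1) (sub_nonneg.2 hd1)]
  calc adaptCost d βlo βhi β α = 3 * (α + 1) * ((2 * βhi + d) / (2 * β + d) *
        ((2 * βhi + d) / (β + d)) * (d / (βlo + d - 1))) := by
        unfold adaptCost; field_simp
    _ ≤ 3 * (α + 1) * ((2 * βhi + 1) / (2 * β + 1) * ((2 * βhi + 1) / (β + 1)) * (1 / βlo)) := by
        gcongr
    _ = uniformCost βlo βhi β α := by unfold uniformCost; field_simp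

/-- Finitely many horizons only affect the constant. -/
lemma exists_const_of_eventually {f : ℕ → ℝ} (hf : ∀ T, 2 ≤ T → 0 < f T) {S : Type*}
    {R : S → ℕ → ℝ} (hR : ∀ P T, R P T ≤ T) {C : ℝ}
    (h : ∀ᶠ T : ℕ in atTop, ∀ P, R P T ≤ C * f T) :
    ∃ C' : ℝ, 0 < C' ∧ ∀ P T, 2 ≤ T → R P T ≤ C' * f T := by
  obtain ⟨T₀, hT₀⟩ := eventually_atTop.1 h
  have hs : 0 ≤ ∑ T ∈ Finset.range T₀, |(T : ℝ) / f T| := Finset.sum_nonneg fun _ _ => abs_nonneg _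
  refine ⟨|C| + 1 + ∑ T ∈ Finset.range T₀, |(T : ℝ) / f T|, by positivity, fun P T hT => ?_⟩
  have hfT := hf T hT
  rcases le_or_gt T₀ T with h1 | h1
  · refine (hT₀ T h1 P).trans (mul_le_mul_of_nonneg_right ?_ hfT.le)
    linarith [le_abs_self C]
  · have h2 : |(T : ℝ) / f T| ≤ ∑ T ∈ Finset.range T₀, |(T : ℝ) / f T| :=
      Finset.single_le_sum (f := fun T : ℕ => |(T : ℝ) / f T|) (fun _ _ => abs_nonneg _)
        (Finset.mem_range.2 h1)
    have h3 : (T : ℝ) / f T ≤ |C| + 1 + ∑ T ∈ Finset.range T₀, |(T : ℝ) / f T| := by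
      linarith [le_abs_self ((T : ℝ) / f T), abs_nonneg C]
    rw [div_le_iff₀ hfT] at h3
    exact (hR P T).trans h3

end Rates

end

end SACB

theorem theorem4
    (d q : ℕ) (hd : 1 ≤ d) (hq : 2 ≤ q)
    (βlo βhi : ℝ) (hβlo : 0 < βlo) (hβlo1 : βlo ≤ 1) (hβ : βlo < βhi)
    (L C₀ ρlo ρhi : ℝ) (hL : 0 < L) (hC₀ : 0 < C₀) (hρlo : 0 < ρlo) (hρ : ρlo ≤ ρhi)
    {U : Type*} [MeasurableSpace U] (μU : MeasureTheory.Measure U)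
    [MeasureTheory.IsProbabilityMeasure μU]
    (π₀ : ℝ → ℕ → SACB.Policy d U) (ι₀ : ℝ → ℝ → ℝ)
    (hι₀ : ∀ α, 0 < α → ∀ β ∈ Set.Ioc βlo βhi, α ≤ 1 / min 1 β →
      ∃ ℓ : ℝ, Filter.Tendsto (fun β₀ => ι₀ β₀ α) (nhdsWithin β (Set.Iio β)) (nhds ℓ))
    (hπ₀ : ∀ α, 0 < α → ∃ Cbar₀ : ℝ, 0 < Cbar₀ ∧
      ∀ β₀ ∈ Set.Icc βlo βhi, α ≤ 1 / min 1 β₀ → ∀ T : ℕ, 2 ≤ T →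
        ∀ P ∈ SACB.problemClass d β₀ L α C₀ ρlo ρhi,
          SACB.regret μU (π₀ β₀ T).act P T ≤
            Cbar₀ * Real.log T ^ ι₀ β₀ α * (T : ℝ) ^ SACB.zeta d β₀ α) :
    let sacb : ℝ → ℕ → SACB.Rule d U := fun γ T =>
      SACB.sacb { βlo := βlo, βhi := βhi, γ := γ, υ := d / βlo + 4, q := q, T := T } π₀
    (∀ (γ : ℝ) (T : ℕ), 2 ≤ T → SACB.IsAdmissible (sacb γ T)) ∧
    ∃ γ₀ : ℝ, 0 < γ₀ ∧
      ∀ β ∈ Set.Icc βlo βhi, ∀ α, 0 < α → α ≤ 1 / min 1 β →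
      ¬ (βlo = 1 ∧ β = βhi ∧ α = 1) →
      ∀ b l₀ : ℝ, 0 < b → 0 ≤ l₀ → ∀ γ, γ₀ ≤ γ →
        (∃ Cbar : ℝ, 0 < Cbar ∧
          ∀ P ∈ SACB.selfSimilarClass d βhi β L α C₀ ρlo ρhi b l₀, ∀ T : ℕ, 2 ≤ T →
            SACB.regret μU (sacb γ T) P T ≤
              Cbar * Real.log T ^ (SACB.adaptCost d βlo βhi β α +
                ι₀ (SACB.clamp βlo βhi (β - SACB.estError d q βlo βhi T)) α) *
              (T : ℝ) ^ SACB.zeta d β α) ∧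
        ((∀ β₀ ∈ Set.Icc βlo βhi, α ≤ 1 / min 1 β₀ → ι₀ β₀ α = 0) →
          0 < SACB.uniformCost βlo βhi β α ∧
          ∃ Cbar : ℝ, 0 < Cbar ∧
            ∀ P ∈ SACB.selfSimilarClass d βhi β L α C₀ ρlo ρhi b l₀, ∀ T : ℕ, 2 ≤ T →
              SACB.regret μU (sacb γ T) P T ≤
                Cbar * Real.log T ^ SACB.uniformCost βlo βhi β α *
                (T : ℝ) ^ SACB.zeta d β α) := by
  intro sacb
  have hq0 : 0 < q := by omega
  have hadm : ∀ (γ : ℝ) (T : ℕ), SACB.IsAdmissible (sacb γ T) := fun γ T =>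
    SACB.isAdmissible_sacb (c := SACB.sacbParams d q βlo βhi γ T) hq0 π₀
  refine ⟨fun γ T _ => hadm γ T, ?_⟩
  obtain ⟨γ₀, A, hγ₀, hexp⟩ := SACB.exists_exploration hd hq hβlo hβ hL hρlo hρ
  refine ⟨γ₀, hγ₀, ?_⟩
  intro β hβm α hα hα1 hne b l₀ hb _ γ hγ
  have hβ0 : 0 < β := hβlo.trans_le hβm.1
  have hmin : 0 < min 1 β := lt_min one_pos hβ0
  have hαle : ∀ β₀, 0 < β₀ → β₀ ≤ β → α ≤ 1 / min 1 β₀ := fun β₀ h1 h2 =>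
    hα1.trans (one_div_le_one_div_of_le (lt_min one_pos h1) (min_le_min_left _ h2))
  have hlogpos : ∀ T : ℕ, 2 ≤ T → 0 < Real.log T := fun T hT =>
    Real.log_pos (by exact_mod_cast (by omega : 1 < T))
  have hTpos : ∀ T : ℕ, 2 ≤ T → (0 : ℝ) < T := fun T hT => by
    exact_mod_cast (by omega : 0 < T)
  -- For large horizons, the exploration, the estimate and the input policy are compared with the
  -- rate; the finitely many other horizons are absorbed in the constant, as the regret is at most
  -- the horizon.
  have hfirst : ∃ Cbar : ℝ, 0 < Cbar ∧
      ∀ P ∈ SACB.selfSimilarClass d βhi β L α C₀ ρlo ρhi b l₀, ∀ T : ℕ, 2 ≤ T →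
        SACB.regret μU (sacb γ T) P T ≤
          Cbar * (Real.log T ^ (SACB.adaptCost d βlo βhi β α +
            ι₀ (SACB.clamp βlo βhi (β - SACB.estError d q βlo βhi T)) α) *
          (T : ℝ) ^ SACB.zeta d β α) := by
    obtain ⟨Cbar₀, hC₀', hinput⟩ := hπ₀ α hα
    obtain ⟨M, hM⟩ := SACB.eventually_rate_le (ι₀ := fun x => ι₀ x α) hd hq hβlo hβ hα hβm
      (fun h => hι₀ α hα β ⟨h, hβm.2⟩ hα1) γ
    -- The only use of the exclusion of `(βlo, β, α) = (1, βhi, 1)`: there the exploration alone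
    -- could cost as much as `T ^ zeta`, up to logarithms.
    have hζ := SACB.explorationRate_lt_zeta hd hβlo hβlo1 hβ hβm hα1 hne
    have hd1 : (1 : ℝ) ≤ d := by exact_mod_cast hd
    have he0 : 0 ≤ (βlo + d - 1) / (2 * βhi + d) :=
      div_nonneg (by linarith) (by linarith)
    have hsmall := SACB.eventually_mul_rpow_log_le (|A| + 2) ((d : ℝ) / βlo + 4 - M) hζ
    have hυ : 0 ≤ (d : ℝ) / βlo + 4 := by positivity
    obtain ⟨C', hC', hreg⟩ := SACB.exists_const_of_eventually
      (S := {P // P ∈ SACB.selfSimilarClass d βhi β L α C₀ ρlo ρhi b l₀})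
      (R := fun P T => SACB.regret μU (sacb γ T) P.1 T)
      (f := fun T => Real.log T ^ (SACB.adaptCost d βlo βhi β α +
            ι₀ (SACB.clamp βlo βhi (β - SACB.estError d q βlo βhi T)) α) *
          (T : ℝ) ^ SACB.zeta d β α) (C := 1 + Cbar₀)
      (fun T hT => mul_pos (Real.rpow_pos_of_pos (hlogpos T hT) _)
        (Real.rpow_pos_of_pos (hTpos T hT) _))
      (fun P T => SACB.regret_le_horizon μU (hadm γ T) P.1 T) (by
        filter_upwards [hexp γ hγ β hβm b l₀ hb, hM, hsmall,
          SACB.tendsto_log_natCast.eventually_ge_atTop 1, Filter.eventually_ge_atTop 2]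
          with T hT hMT hsm hy hT2
        rintro ⟨P, hP, hself⟩
        obtain ⟨N, hN, hbad⟩ := hT
        have hT0 := hTpos T hT2
        have hy0 : 0 < Real.log T := hlogpos T hT2
        set bT := SACB.clamp βlo βhi (β - SACB.estError d q βlo βhi T) with hbT
        set F := Real.log T ^ (SACB.adaptCost d βlo βhi β α + ι₀ bT α) *
          (T : ℝ) ^ SACB.zeta d β α with hF
        have hF0 : 0 < F := mul_pos (Real.rpow_pos_of_pos hy0 _) (Real.rpow_pos_of_pos hT0 _)
        -- An estimate below `β` still describes a class that contains `P`, and it is close enough to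
        -- `β` for the rate of the input policy to exceed the target by a power of `log T` only.
        have hgood : ∀ β₀ ∈ SACB.goodEstimates (SACB.sacbParams d q βlo βhi γ T) d β,
            SACB.regret μU (π₀ β₀ T).act P T ≤ Cbar₀ * F := by
          intro β₀ hβ₀
          have h0 : 0 < β₀ := hβlo.trans_le hβ₀.1.1
          obtain ⟨h1, h2⟩ := hMT.2 β₀ hβ₀
          refine (hinput β₀ hβ₀.1 (hαle β₀ h0 hβ₀.2.2.1) T hT2 P
            (SACB.problemClass_of_le hL.le h0 hβ₀.2.2.1 h1 hP)).trans ?_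
          rw [mul_assoc]
          exact mul_le_mul_of_nonneg_left h2 hC₀'.le
        have hmain := SACB.regret_sacb_le μU (c := SACB.sacbParams d q βlo βhi γ T) π₀ hq0 P
          (SACB.goodEstimates (SACB.sacbParams d q βlo βhi γ T) d β) T N
          (mul_nonneg hC₀'.le hF0.le) (inv_nonneg.2 hT0.le) hgood
          (hbad P hP.2.1 hP.1 hself)
        -- Exploration is polynomially shorter than the target, so that even a negative power of
        -- `log T` in the target does no harm.
        have hNF : (N : ℝ) + 1 ≤ F := by
          have hT1 : (1 : ℝ) ≤ T := by exact_mod_cast (by omega : 1 ≤ T)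
          have h1 : 1 ≤ (T : ℝ) ^ ((βlo + d - 1) / (2 * βhi + d)) *
              Real.log T ^ ((d : ℝ) / βlo + 4) :=
            one_le_mul_of_one_le_of_one_le (Real.one_le_rpow hT1 he0) (Real.one_le_rpow hy hυ)
          have h2 : (N : ℝ) + 1 ≤ (|A| + 2) * ((T : ℝ) ^ ((βlo + d - 1) / (2 * βhi + d)) *
              Real.log T ^ ((d : ℝ) / βlo + 4)) := by
            have h3 := mul_le_mul_of_nonneg_right (le_abs_self A) (zero_le_one.trans h1)
            linarith
          refine h2.trans ?_
          have h4 : Real.log T ^ ((d : ℝ) / βlo + 4)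
              = Real.log T ^ M * Real.log T ^ ((d : ℝ) / βlo + 4 - M) := by
            rw [← Real.rpow_add hy0]; congr 1; ring
          have h5 : Real.log T ^ M ≤ Real.log T ^ (SACB.adaptCost d βlo βhi β α + ι₀ bT α) :=
            Real.rpow_le_rpow_of_exponent_le hy hMT.1
          calc (|A| + 2) * ((T : ℝ) ^ ((βlo + d - 1) / (2 * βhi + d)) *
              Real.log T ^ ((d : ℝ) / βlo + 4))
              = Real.log T ^ M * ((|A| + 2) * (T : ℝ) ^ ((βlo + d - 1) / (2 * βhi + d)) *
                Real.log T ^ ((d : ℝ) / βlo + 4 - M)) := by rw [h4]; ring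
            _ ≤ F := mul_le_mul h5 hsm (by positivity) (by positivity)
        -- The atypical event has probability at most `T⁻¹` and costs at most `T`.
        have hTT : (T : ℝ) * (T : ℝ)⁻¹ = 1 := mul_inv_cancel₀ hT0.ne'
        rw [hTT] at hmain
        calc SACB.regret μU (sacb γ T) P T ≤ N + Cbar₀ * F + 1 := hmain
          _ ≤ (1 + Cbar₀) * F := by linarith)
    exact ⟨C', hC', fun P hP T hT => hreg ⟨P, hP⟩ T hT⟩
  obtain ⟨Cbar, hCbar, hreg⟩ := hfirst
  refine ⟨⟨Cbar, hCbar, fun P hP T hT => ?_⟩, fun hzero => ?_⟩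
  · rw [mul_assoc]
    exact hreg P hP T hT
  · -- The exponents are compared for `log T ≥ 1` only: for `T = 2` larger exponents give smaller
    -- powers, so the small horizons are absorbed in the constant here too.
    have hhi : 0 < βhi := hβlo.trans hβ
    refine ⟨by unfold SACB.uniformCost; positivity, ?_⟩
    obtain ⟨C', hC', hreg'⟩ := SACB.exists_const_of_eventually
      (S := {P // P ∈ SACB.selfSimilarClass d βhi β L α C₀ ρlo ρhi b l₀})
      (R := fun P T => SACB.regret μU (sacb γ T) P.1 T)
      (f := fun T => Real.log T ^ SACB.uniformCost βlo βhi β α * (T : ℝ) ^ SACB.zeta d β α)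
      (C := Cbar)
      (fun T hT => mul_pos (Real.rpow_pos_of_pos (hlogpos T hT) _)
        (Real.rpow_pos_of_pos (hTpos T hT) _))
      (fun P T => SACB.regret_le_horizon μU (hadm γ T) P.1 T) (by
        filter_upwards [SACB.tendsto_log_natCast.eventually_ge_atTop 1,
          Filter.eventually_ge_atTop 2] with T hy hT2
        rintro ⟨P, hP⟩
        refine (hreg P hP T hT2).trans (mul_le_mul_of_nonneg_left
          (mul_le_mul_of_nonneg_right ?_ (Real.rpow_nonneg (hTpos T hT2).le _)) hCbar.le)
        have herr : 0 ≤ SACB.estError d q βlo βhi T := SACB.estError_nonneg hd hq hβlo hy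
        have hmem := SACB.clamp_mem hβ.le (β - SACB.estError d q βlo βhi T)
        have hle : SACB.clamp βlo βhi (β - SACB.estError d q βlo βhi T) ≤ β :=
          (min_le_left _ _).trans (max_le hβm.1 (by linarith))
        rw [hzero _ hmem (hαle _ (hβlo.trans_le hmem.1) hle), add_zero]
        exact Real.rpow_le_rpow_of_exponent_le hy
          (SACB.adaptCost_le_uniformCost hd hβlo hβlo1 hβm hα))
    refine ⟨C', hC', fun P hP T hT => ?_⟩
    rw [mul_assoc]
    exact hreg' ⟨P, hP⟩ T hT
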